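/- Consider in $\mathbb{R}^3$ the Boussinesq system $$\partial_t\theta+u\cdot\nabla\theta=\Delta\theta,\qquad \partial_t u+u\cdot\nabla u+\nabla p=\Delta u+\theta e_3,\qquad \nabla\cdot u=0,\qquad u|_{t=0}=u_0,\ \theta|_{t=0}=\theta_0,$$ and its mild solutions, i.e. the solutions of $$\theta(t)=e^{t\Delta}\theta_0-\int_0^t e^{(t-s)\Delta}\nabla\cdot(\theta u)(s)\,ds,$$ $$u(t)=e^{t\Delta}u_0-\int_0^t e^{(t-s)\Delta}\mathbb{P}\nabla\cdot(u\otimes u)(s)\,ds+\int_0^t e^{(t-s)\Delta}\mathbb{P}\,\theta(s)e_3\,ds,$$ where $\mathbb{P}$ is the Leray projector. Let $$\|u\|_{\mathcal X}=\operatorname*{ess\,sup}_{x\in\mathbb{R}^3,\,t>0}(\sqrt t+|x|)\,|u(x,t)|,\qquad \|\theta\|_{\mathcal Y}=\operatorname*{ess\,sup}_{t>0}\|\theta(t)\|_{1}+\operatorname*{ess\,sup}_{x\in\mathbb{R}^3,\,t>0}(\sqrt t+|x|)^3|\theta(x,t)|.$$ Let $\mathcal X$ be the space of measurable divergence-free vector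 fields $u$ with $\|u\|_{\mathcal X}<\infty$ such that $u(t)\to u(0)$ in the sense of distributions as $t\to0^+$ and $\operatorname{ess\,sup}_x|x|\,|u(x,t)-u(x,t')|\to0$ as $t\to t'$ for every $t'>0$. Let $\mathcal Y$ be the space of measurable scalar functions $\theta$ with $\|\theta\|_{\mathcal Y}<\infty$ such that $\theta(t)\to\theta(0)$ in the sense of distributions as $t\to0^+$, and $\operatorname{ess\,sup}_x|x|^3|\theta(x,t)-\theta(x,t')|\to0$ and $\|\theta(t)-\theta(t')\|_1\to0$ as $t\to t'$ for every $t'>0$. There are absolute constants $\epsilon>0$ and $K>0$ such that the following holds. Let $u_0$ be a divergence-free vector field and $\theta_0$ a scalar function with $$\|\theta_0\|_1<\epsilon,\qquad \operatorname*{ess\,sup}_x|x|^3|\theta_0(x)|<\epsilon,\qquad \operatorname*{ess\,sup}_x|x|\,|u_0(x)|<\epsilon .$$ Then there is a unique mild solution $(u,\theta)\in\mathcal X\times\mathcal Y$ with $\|u\|_{\mathcal X}\le K\epsilon$ and $\|\theta\|_{\mathcal Y}\le K\epsilon$, and it has the following properties. (a) Let $1\le a<3$ and $b\ge3$, and suppose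 that for some constant $C_0>0$ and almost every $x$ $$|u_0(x)|\le C_0(1+|x|)^{-a},\qquad |\theta_0(x)|\le C_0(1+|x|)^{-b}. \tag{1}$$ Then there is a constant $C>0$, independent of $x$ and $t$, such that for all $t\ge0$ and almost every $x\in\mathbb{R}^3$ $$|u(x,t)|\le C\inf_{0\le\eta\le a}|x|^{-\eta}(1+t)^{(\eta-1)/2},\qquad |\theta(x,t)|\le C\inf_{0\le\eta\le b}|x|^{-\eta}(1+t)^{(\eta-3)/2}.$$ (b) Let $2\le a<4$, $a\neq3$, and $b\ge4$, and suppose that (1) holds for these $a$, $b$ and some constant $C_0>0$. If in addition $\int\theta_0=0$ and $\int(1+|x|)\,|\theta_0(x)|\,dx<\infty$, then there is a constant $C>0$, independent of $x$ and $t$, such that for all $t\ge0$ and almost every $x\in\mathbb{R}^3$ $$|u(x,t)|\le C\inf_{0\le\eta\le a}(1+|x|)^{-\eta}(1+t)^{(\eta-2)/2},\qquad |\theta(x,t)|\le C\inf_{0\le\eta\le b}(1+|x|)^{-\eta}(1+t)^{(\eta-4)/2}.$$ -/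

import Mathlib

open MeasureTheory Set Filter Topology
open scoped ENNReal ContDiff

namespace Boussinesq

noncomputable section

/-- The physical space, with its Euclidean norm and Lebesgue measure. -/
abbrev E3 : Type := EuclideanSpace ℝ (Fin 3)

/-- The partial derivative of a scalar function in the direction of the `i`-th basis vector. -/
def pd (i : Fin 3) (f : E3 → ℝ) (x : E3) : ℝ :=
  fderiv ℝ f x (EuclideanSpace.single i (1 : ℝ))

/-- The heat kernel: the convolution kernel of `exp (t Δ)`, for `t > 0`. -/
def heatKernel (t : ℝ) (x : E3) : ℝ :=
  (4 * Real.pi * t) ^ (-(3 / 2) : ℝ) * Real.exp (-‖x‖ ^ 2 / (4 * t))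

/-- The matrix kernel of `exp (t Δ) ℙ`, where `ℙ` is the Leray projector, for `t > 0`.
Since `ℙ = Id + ∇ (-Δ)⁻¹ div` and `exp (t Δ) (-Δ)⁻¹` is the integral of `exp (s Δ)` over
`s > t`, its entries are those of `g_t Id` plus the integral of `∂_j ∂_k g_s` over `s > t`. -/
def oseenKernel (t : ℝ) (j k : Fin 3) (x : E3) : ℝ :=
  (if j = k then heatKernel t x else 0)
    + ∫ s in Ioi t, pd j (pd k (heatKernel s)) x

/-- The kernel of `exp (t Δ) ℙ ∇`, for `t > 0`: the entry `(j, k, l)` is the kernel of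
`exp (t Δ) ℙ_{jk} ∂_l`, that is, the `l`-th partial derivative of the previous kernel. -/
def oseenGradKernel (t : ℝ) (j k l : Fin 3) (x : E3) : ℝ :=
  (if j = k then pd l (heatKernel t) x else 0)
    + ∫ s in Ioi t, pd l (pd j (pd k (heatKernel s))) x

/-- A (locally integrable) vector field is divergence-free in the sense of distributions. -/
def IsDivFree (v : E3 → E3) : Prop :=
  ∀ φ : E3 → ℝ, ContDiff ℝ ∞ φ → HasCompactSupport φ →
    ∫ x, ∑ i, v x i * pd i φ x = 0

/-- Lebesgue measure on `(0, ∞) × ℝ³`. -/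
def spaceTime : Measure (ℝ × E3) :=
  (volume.restrict (Ioi (0 : ℝ))).prod volume

/-- `ess sup_{x, t > 0} (√t + |x|) |u(x, t)|`. -/
def normX (u : ℝ → E3 → E3) : ℝ≥0∞ :=
  essSup (fun p : ℝ × E3 => ENNReal.ofReal (√p.1 + ‖p.2‖) * ‖u p.1 p.2‖ₑ) spaceTime

/-- `ess sup_{t > 0} ‖θ(t)‖_{L¹} + ess sup_{x, t > 0} (√t + |x|)³ |θ(x, t)|`. -/
def normY (θ : ℝ → E3 → ℝ) : ℝ≥0∞ :=
  essSup (fun t => eLpNorm (θ t) 1 volume) (volume.restrict (Ioi (0 : ℝ)))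
    + essSup (fun p : ℝ × E3 => ENNReal.ofReal (√p.1 + ‖p.2‖) ^ 3 * ‖θ p.1 p.2‖ₑ) spaceTime

/-- The space of velocities. -/
structure MemX (u : ℝ → E3 → E3) : Prop where
  aestronglyMeasurable : AEStronglyMeasurable (fun p : ℝ × E3 => u p.1 p.2) spaceTime
  aestronglyMeasurable_slice : ∀ t, 0 ≤ t → AEStronglyMeasurable (u t) volume
  norm_lt_top : normX u < ⊤
  divFree : ∀ t, 0 < t → IsDivFree (u t)
  tendsto_zero : ∀ φ : E3 → ℝ, ContDiff ℝ ∞ φ → HasCompactSupport φ →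
    Tendsto (fun t => ∫ x, φ x • u t x) (𝓝[>] 0) (𝓝 (∫ x, φ x • u 0 x))
  continuous : ∀ t', 0 < t' →
    Tendsto (fun t => essSup (fun x => ‖x‖ₑ * ‖u t x - u t' x‖ₑ) volume) (𝓝 t') (𝓝 0)

/-- The space of temperatures. -/
structure MemY (θ : ℝ → E3 → ℝ) : Prop where
  aestronglyMeasurable : AEStronglyMeasurable (fun p : ℝ × E3 => θ p.1 p.2) spaceTime
  aestronglyMeasurable_slice : ∀ t, 0 ≤ t → AEStronglyMeasurable (θ t) volume
  norm_lt_top : normY θ < ⊤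
  tendsto_zero : ∀ φ : E3 → ℝ, ContDiff ℝ ∞ φ → HasCompactSupport φ →
    Tendsto (fun t => ∫ x, φ x * θ t x) (𝓝[>] 0) (𝓝 (∫ x, φ x * θ 0 x))
  continuous : ∀ t', 0 < t' →
    Tendsto (fun t => essSup (fun x => ‖x‖ₑ ^ 3 * ‖θ t x - θ t' x‖ₑ) volume) (𝓝 t') (𝓝 0)
  continuous_L1 : ∀ t', 0 < t' →
    Tendsto (fun t => eLpNorm (fun x => θ t x - θ t' x) 1 volume) (𝓝 t') (𝓝 0)

/-- Mild solutions of the Boussinesq system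
`∂ₜθ + u·∇θ = Δθ`, `∂ₜu + u·∇u + ∇p = Δu + θ e₃`, `∇·u = 0`,
with data `u₀`, `θ₀`: the integral formulation
`θ(t) = exp(tΔ)θ₀ - ∫₀ᵗ exp((t-s)Δ) ∇·(θu)(s) ds`,
`u(t) = exp(tΔ)u₀ - ∫₀ᵗ exp((t-s)Δ) ℙ∇·(u⊗u)(s) ds + ∫₀ᵗ exp((t-s)Δ) ℙ θ(s)e₃ ds`.
For `u` and `θ` in the spaces above all the integrals converge absolutely. The index `2` is
the third coordinate. -/
structure IsMildSolution (u₀ : E3 → E3) (θ₀ : E3 → ℝ)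
    (u : ℝ → E3 → E3) (θ : ℝ → E3 → ℝ) : Prop where
  initial_velocity : u 0 =ᵐ[volume] u₀
  initial_temperature : θ 0 =ᵐ[volume] θ₀
  temperature : ∀ t, 0 < t → ∀ᵐ x : E3,
    θ t x = (∫ y, heatKernel t (x - y) * θ₀ y)
      - ∫ s in Ioo 0 t, ∫ y, ∑ l, pd l (heatKernel (t - s)) (x - y) * (θ s y * u s y l)
  velocity : ∀ t, 0 < t → ∀ᵐ x : E3, ∀ j,
    u t x j = (∫ y, heatKernel t (x - y) * u₀ y j)
      - (∫ s in Ioo 0 t, ∫ y, ∑ k, ∑ l,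
          oseenGradKernel (t - s) j k l (x - y) * (u s y k * u s y l))
      + ∫ s in Ioo 0 t, ∫ y, oseenKernel (t - s) j 2 (x - y) * θ s y

/-- Measurable data of size less than `ε` in the scale-invariant norms, with divergence-free
velocity. -/
structure SmallData (ε : ℝ) (u₀ : E3 → E3) (θ₀ : E3 → ℝ) : Prop where
  aestronglyMeasurable_velocity : AEStronglyMeasurable u₀ volume
  aestronglyMeasurable_temperature : AEStronglyMeasurable θ₀ volume
  divFree : IsDivFree u₀
  temperature_L1 : eLpNorm θ₀ 1 volume < ENNReal.ofReal ε
  temperature_sup : essSup (fun x => ‖x‖ₑ ^ 3 * ‖θ₀ x‖ₑ) volume < ENNReal.ofReal ε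
  velocity_sup : essSup (fun x => ‖x‖ₑ * ‖u₀ x‖ₑ) volume < ENNReal.ofReal ε

/-- Mild solutions in the two spaces above whose norms are at most `r`. -/
structure IsStrongSolution (r : ℝ) (u₀ : E3 → E3) (θ₀ : E3 → ℝ)
    (u : ℝ → E3 → E3) (θ : ℝ → E3 → ℝ) : Prop where
  memX : MemX u
  memY : MemY θ
  mild : IsMildSolution u₀ θ₀ u θ
  normX_le : normX u ≤ ENNReal.ofReal r
  normY_le : normY θ ≤ ENNReal.ofReal r

/-- `|u₀(x)| ≤ C (1 + |x|)^{-a}` and `|θ₀(x)| ≤ C (1 + |x|)^{-b}` for some constant `C`. -/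
def DataDecay (a b : ℝ) (u₀ : E3 → E3) (θ₀ : E3 → ℝ) : Prop :=
  ∃ C > 0, ∀ᵐ x : E3, ‖u₀ x‖ ≤ C * (1 + ‖x‖) ^ (-a) ∧ |θ₀ x| ≤ C * (1 + ‖x‖) ^ (-b)

end

end Boussinesq

open Boussinesq

open MeasureTheory Set Filter Topology
open scoped ENNReal ContDiff

namespace Boussinesq

noncomputable section

/-! Everything is measured with the parabolic distance `rho t x` = √t + |x|. The velocity is sought
in the class M ρ^(-1), the temperature in the class M ρ^(-3). The gradient of the heat kernel and
the kernel of exp(tΔ)ℙ∇ are O(ρ^(-4)), and the kernel of exp(tΔ)ℙ is O(ρ^(-3)) (`ker_heat1`,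
`ker_oseenGradKernel`, `ker_oseenKernel`). Space-time has parabolic dimension 5, so convolving
ρ^(-p) with ρ^(-q) over (0,t) × ℝ³ gives at most a multiple of ρ^(-(p+q-5)) when 0 < p, q < 5 ≤ p +
q (`dom_crit`). The pairs (4,4), (4,2), (3,3) give the orders 3, 1, 1, which is the scale invariance
of the three Duhamel terms (`exists_duhBound`).

Existence and uniqueness follow by Picard iteration. The bilinear terms are small because M is. The
buoyancy term is linear in θ and carries no small factor, but θ does not depend linearly on u:
measuring the velocity difference on a scale 12C times that of the temperature difference makes the
map a contraction with ratio 1/2 (`next_sub_le_half`). Uniqueness comes from halving the difference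
of two small solutions again and again. Hölder continuity of the kernels in time gives continuity
for t > 0, and testing the integral equations against smooth functions gives the initial limits and
the divergence condition.

For the decay, the weights `wt c e` = (1+t)^c (√(1+t)+|x|)^(-e) replace the infimum over η: the
weight with e = a and c = (a-p)/2 is below every interpolated expression at once (`wt_le_one_add`).
First, the heat flow of the data decays at the expected rate. Splitting the convolution at |y| = ρ/2
loses no more than the mass of the datum, or its first moment if the mean vanishes. Secondly, a
bilinear term in which one factor is only known to be M ρ^(-1) maps the weight `wt c e` into itself
with a constant that is uniform for 1 ≤ e ≤ 15/4 and c ≥ 0 (`dom_contract`), so one smallness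
threshold serves all these exponents. Iterating the resulting inequality (`le_of_halving`) transfers
the decay of the linear terms to the solution without assuming any weighted norm finite. Thirdly,
the buoyancy term is estimated from the mass of θ (`source_le_of_mass`), or, when θ has mean zero
for all times, by subtracting the value of the kernel at x (`source_le_of_mean_zero`). The mean of θ
is conserved since the gradient of the heat kernel has integral zero.

In case (a) this yields θ at exponent 3, then u at exponent a. Since θu decays one power faster than
θ, the exponent of θ can then be raised to b in steps of length one. In case (b) the exponents are
reached in the order θ: 15/4, u: 7/4, θ: 4, u: 2, then u: a and θ: b. The extra decay of u makes the
nonlinear contributions integrable in time, so they cause no loss. -/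

/-- The parabolic distance to the origin of space-time. -/
def rho (t : ℝ) (x : E3) : ℝ := √t + ‖x‖

/-- Lebesgue measure on `(0, t) × ℝ³`. -/
def nu (t : ℝ) : Measure (ℝ × E3) := (volume.restrict (Ioo 0 t)).prod volume

instance (t : ℝ) : SFinite (nu t) := by unfold nu; infer_instance

/-! ### The parabolic distance and negative powers -/

lemma rho_pos {t : ℝ} (ht : 0 < t) (x : E3) : 0 < rho t x :=
  add_pos_of_pos_of_nonneg (Real.sqrt_pos.2 ht) (norm_nonneg x)

lemma rho_nonneg (t : ℝ) (x : E3) : 0 ≤ rho t x := by unfold rho; positivity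

lemma sqrt_le_rho (t : ℝ) (x : E3) : √t ≤ rho t x := by unfold rho; linarith [norm_nonneg x]

lemma norm_le_rho (t : ℝ) (x : E3) : ‖x‖ ≤ rho t x := by unfold rho; linarith [Real.sqrt_nonneg t]

lemma rho_mono {s t : ℝ} (h : s ≤ t) (x : E3) : rho s x ≤ rho t x := by
  unfold rho; linarith [Real.sqrt_le_sqrt h]

@[fun_prop]
lemma measurable_rho {α : Type*} [MeasurableSpace α] {f : α → ℝ} {g : α → E3}
    (hf : Measurable f) (hg : Measurable g) : Measurable (fun a => rho (f a) (g a)) := by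
  unfold rho; fun_prop

lemma sqrt_add_le (a b : ℝ) : √(a + b) ≤ √a + √b := by
  rcases le_total 0 a with ha | ha
  · rcases le_total 0 b with hb | hb
    · rw [Real.sqrt_le_left (by positivity)]
      nlinarith [Real.sq_sqrt ha, Real.sq_sqrt hb, Real.sqrt_nonneg a, Real.sqrt_nonneg b,
        mul_nonneg (Real.sqrt_nonneg a) (Real.sqrt_nonneg b)]
    · have := Real.sqrt_le_sqrt (show a + b ≤ a by linarith)
      linarith [Real.sqrt_nonneg b]
  · have := Real.sqrt_le_sqrt (show a + b ≤ b by linarith)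
    linarith [Real.sqrt_nonneg a]

/-- The triangle inequality for the parabolic distance. -/
lemma rho_le_add (s t : ℝ) (x y : E3) : rho (s + t) (x + y) ≤ rho s x + rho t y := by
  unfold rho
  linarith [sqrt_add_le s t, norm_add_le x y]

lemma rho_le_sub (s t : ℝ) (x y : E3) : rho t x ≤ rho (t - s) (x - y) + rho s y := by
  simpa using rho_le_add (t - s) s (x - y) y

lemma rpow_neg_le {a b : ℝ} (ha : 0 < a) (hab : a ≤ b) {e : ℝ} (he : 0 ≤ e) :
    b ^ (-e) ≤ a ^ (-e) :=
  Real.rpow_le_rpow_of_nonpos ha hab (by linarith)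

lemma one_le_two_rpow {e : ℝ} (he : 0 ≤ e) : (1 : ℝ) ≤ 2 ^ e :=
  Real.one_le_rpow (by norm_num) he

/-- A factor `A ^ (-p)` with `R ≤ 2 A` yields `R ^ (-e)`. -/
lemma rpow_neg_pull {A R : ℝ} (hA : 0 < A) (hR : 0 < R) (h : R ≤ 2 * A) {e : ℝ} (he : 0 ≤ e)
    (p : ℝ) : A ^ (-p) ≤ 2 ^ e * (R ^ (-e) * A ^ (-(p - e))) := by
  have h1 : A ^ (-p) = A ^ (-e) * A ^ (-(p - e)) := by
    rw [← Real.rpow_add hA]; congr 1; ring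
  have h2 : A ^ (-e) ≤ 2 ^ e * R ^ (-e) := by
    have := rpow_neg_le (show 0 < R / 2 by positivity) (show R / 2 ≤ A by linarith) he
    rw [Real.div_rpow hR.le (by norm_num), Real.rpow_neg (show (0 : ℝ) ≤ 2 by norm_num)] at this
    simpa [div_eq_mul_inv, mul_comm] using this
  rw [h1, ← mul_assoc]
  exact mul_le_mul_of_nonneg_right h2 (Real.rpow_nonneg hA.le _)

/-- If `R ≤ A + B`, a power of `R` can be pulled out of one of the two factors. -/
lemma rpow_neg_split {A B R : ℝ} (hA : 0 < A) (hB : 0 < B) (hR : 0 < R) (h : R ≤ A + B) {e : ℝ}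
    (he : 0 ≤ e) (p q : ℝ) :
    A ^ (-p) * B ^ (-q) ≤
      2 ^ e * (R ^ (-e) * (A ^ (-(p - e)) * B ^ (-q) + A ^ (-p) * B ^ (-(q - e)))) := by
  have hn : ∀ {a : ℝ} (b : ℝ), 0 < a → 0 ≤ a ^ b := fun b h => Real.rpow_nonneg h.le b
  rcases le_total B A with hBA | hAB
  · have := mul_le_mul_of_nonneg_right (rpow_neg_pull hA hR (by linarith) he p) (hn (-q) hB)
    refine this.trans ?_
    have : 0 ≤ 2 ^ e * (R ^ (-e) * (A ^ (-p) * B ^ (-(q - e)))) :=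
      mul_nonneg (by positivity) (mul_nonneg (hn _ hR) (mul_nonneg (hn _ hA) (hn _ hB)))
    nlinarith
  · have := mul_le_mul_of_nonneg_left (rpow_neg_pull hB hR (by linarith) he q) (hn (-p) hA)
    refine this.trans ?_
    have : 0 ≤ 2 ^ e * (R ^ (-e) * (A ^ (-(p - e)) * B ^ (-q))) :=
      mul_nonneg (by positivity) (mul_nonneg (hn _ hR) (mul_nonneg (hn _ hA) (hn _ hB)))
    nlinarith

/-- Replacing both bases by the smaller one only increases the product. This decouples the two
factors of a convolution integrand, so that each can be integrated alone. -/
lemma rpow_neg_mul_le_add {A B : ℝ} (hA : 0 < A) (hB : 0 < B) {p q : ℝ} (hp : 0 ≤ p)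
    (hq : 0 ≤ q) : A ^ (-p) * B ^ (-q) ≤ A ^ (-(p + q)) + B ^ (-(p + q)) := by
  have e1 : ∀ {a : ℝ}, 0 < a → a ^ (-(p + q)) = a ^ (-p) * a ^ (-q) := fun h => by
    rw [← Real.rpow_add h]; congr 1; ring
  have hn : ∀ {a : ℝ} (b : ℝ), 0 < a → 0 ≤ a ^ b := fun b h => Real.rpow_nonneg h.le b
  rcases le_total A B with h | h
  · rw [e1 hA]
    have := mul_le_mul_of_nonneg_left (rpow_neg_le hA h hq) (hn (-p) hA)
    linarith [hn (-(p + q)) hB]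
  · rw [e1 hB]
    have := mul_le_mul_of_nonneg_right (rpow_neg_le hB h hp) (hn (-q) hB)
    linarith [hn (-(p + q)) hA]

lemma rho_rpow_le_sqrt {t : ℝ} (ht : 0 < t) (x : E3) {e : ℝ} (he : 0 ≤ e) :
    rho t x ^ (-e) ≤ t ^ (-(e / 2)) := by
  refine (rpow_neg_le (Real.sqrt_pos.2 ht) (sqrt_le_rho t x) he).trans_eq ?_
  rw [Real.sqrt_eq_rpow, ← Real.rpow_mul ht.le]; congr 1; ring

/-! ### Integrals of powers in space and in time -/

lemma finrank_E3 : Module.finrank ℝ E3 = 3 := by simp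

lemma integrable_rho_rpow {N : ℝ} (hN : 3 < N) {σ : ℝ} (hσ : 0 < σ) :
    Integrable (fun y : E3 => rho σ y ^ (-N)) := by
  have h := integrable_one_add_norm (E := E3) (μ := volume) (r := N) (by rw [finrank_E3]; exact_mod_cast hN)
  have hs := Real.sqrt_pos.2 hσ
  have h2 := (h.comp_smul (R := (√σ)⁻¹) (inv_ne_zero hs.ne')).const_mul ((√σ) ^ (-N))
  refine h2.congr (Eventually.of_forall fun y => ?_)
  simp only
  rw [norm_smul, norm_inv, Real.norm_of_nonneg hs.le, ← Real.mul_rpow hs.le (by positivity)]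
  unfold rho
  congr 1
  field_simp

lemma integral_rho_rpow {N : ℝ} {σ : ℝ} (hσ : 0 < σ) :
    ∫ y : E3, rho σ y ^ (-N) = (∫ y : E3, (1 + ‖y‖) ^ (-N)) * σ ^ ((3 - N) / 2) := by
  have hs := Real.sqrt_pos.2 hσ
  have h2 := Measure.integral_comp_inv_smul (volume : Measure E3) (fun y => (1 + ‖y‖) ^ (-N)) (√σ)
  have : (fun y : E3 => rho σ y ^ (-N)) =
      fun y => (√σ) ^ (-N) * (1 + ‖(√σ)⁻¹ • y‖) ^ (-N) := by
    ext y
    rw [norm_smul, norm_inv, Real.norm_of_nonneg hs.le, ← Real.mul_rpow hs.le (by positivity)]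
    unfold rho
    congr 1
    field_simp
  rw [this, integral_const_mul, h2, finrank_E3, abs_of_pos (by positivity), smul_eq_mul,
    ← mul_assoc, mul_comm]
  congr 1
  rw [← Real.rpow_natCast, ← Real.rpow_add hs, Real.sqrt_eq_rpow, ← Real.rpow_mul hσ.le]
  congr 1; push_cast; ring

/-- Scaling by √σ reduces to σ = 1, where N > 3 is integrability at infinity. The summand 1 in the
constant only secures positivity. -/
lemma lintegral_rho_rpow (N : ℝ) (hN : 3 < N) : ∃ C > 0, ∀ σ : ℝ, 0 < σ → ∀ x : E3,
    ∫⁻ y, ENNReal.ofReal (rho σ (x - y) ^ (-N)) ≤ ENNReal.ofReal (C * σ ^ ((3 - N) / 2)) := by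
  refine ⟨(∫ y : E3, (1 + ‖y‖) ^ (-N)) + 1, ?_, fun σ hσ x => ?_⟩
  · have : 0 ≤ ∫ y : E3, (1 + ‖y‖) ^ (-N) := integral_nonneg fun y => by positivity
    linarith
  · rw [lintegral_sub_left_eq_self (fun y => ENNReal.ofReal (rho σ y ^ (-N))) x,
      ← ofReal_integral_eq_lintegral_ofReal (integrable_rho_rpow hN hσ)
        (Eventually.of_forall fun y => Real.rpow_nonneg (rho_nonneg _ _) _),
      integral_rho_rpow hσ]
    refine ENNReal.ofReal_le_ofReal ?_
    have : 0 ≤ σ ^ ((3 - N) / 2) := by positivity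
    nlinarith

lemma lintegral_Ioo_rpow {b : ℝ} (hb : b < 1) {t : ℝ} (ht : 0 < t) :
    ∫⁻ s in Ioo 0 t, ENNReal.ofReal (s ^ (-b)) = ENNReal.ofReal (t ^ (1 - b) / (1 - b)) := by
  have hi := intervalIntegral.intervalIntegrable_rpow' (a := 0) (b := t) (r := -b) (by linarith)
  rw [intervalIntegrable_iff_integrableOn_Ioo_of_le ht.le] at hi
  rw [← ofReal_integral_eq_lintegral_ofReal hi ((ae_restrict_iff' measurableSet_Ioo).2
    (Eventually.of_forall fun s hs => Real.rpow_nonneg hs.1.le _)),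
    ← integral_Ioc_eq_integral_Ioo, ← intervalIntegral.integral_of_le ht.le,
    integral_rpow (Or.inl (by linarith)), Real.zero_rpow (by linarith)]
  congr 1
  rw [sub_zero, show -b + 1 = 1 - b by ring]

lemma lintegral_Ioo_sub_rpow {b : ℝ} (hb : b < 1) {t : ℝ} (ht : 0 < t) :
    ∫⁻ s in Ioo 0 t, ENNReal.ofReal ((t - s) ^ (-b)) = ENNReal.ofReal (t ^ (1 - b) / (1 - b)) := by
  rw [← lintegral_Ioo_rpow hb ht, ← lintegral_indicator measurableSet_Ioo,
    ← lintegral_indicator measurableSet_Ioo,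
    ← lintegral_sub_left_eq_self (fun s => (Ioo 0 t).indicator (fun s => ENNReal.ofReal (s ^ (-b))) s) t]
  congr 1
  ext s
  simp only [indicator, mem_Ioo]
  congr 1
  ext; constructor <;> rintro ⟨h1, h2⟩ <;> constructor <;> linarith

lemma rpow_neg_le_of_half {t s : ℝ} (ht : 0 < t) (h1 : t / 2 ≤ s) (h2 : s ≤ t) (a : ℝ) :
    s ^ (-a) ≤ 2 ^ |a| * t ^ (-a) := by
  have hs : 0 < s := by linarith
  rcases le_total 0 a with ha | ha
  · rw [abs_of_nonneg ha]
    have := rpow_neg_pull hs ht (by linarith) ha a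
    simpa using this
  · have h3 : s ^ (-a) ≤ t ^ (-a) := Real.rpow_le_rpow hs.le h2 (by linarith)
    have h4 := one_le_two_rpow (abs_nonneg a)
    have : 0 ≤ t ^ (-a) := by positivity
    nlinarith

/-- A Beta integral. On each half of (0,t) one of the two factors is comparable with a power of t
and the other is integrable. The absolute values in the constants allow negative exponents. -/
lemma lintegral_beta {a b : ℝ} (ha : a < 1) (hb : b < 1) : ∃ C > 0, ∀ t : ℝ, 0 < t →
    ∫⁻ s in Ioo 0 t, ENNReal.ofReal ((t - s) ^ (-a) * s ^ (-b)) ≤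
      ENNReal.ofReal (C * t ^ (1 - a - b)) := by
  have ha' : 0 < 1 - a := by linarith
  have hb' : 0 < 1 - b := by linarith
  refine ⟨2 ^ |a| / (1 - b) + 2 ^ |b| / (1 - a), by positivity, fun t ht => ?_⟩
  have key : ∀ s ∈ Ioo 0 t, ENNReal.ofReal ((t - s) ^ (-a) * s ^ (-b)) ≤
      ENNReal.ofReal (2 ^ |a| * t ^ (-a)) * ENNReal.ofReal (s ^ (-b)) +
      ENNReal.ofReal (2 ^ |b| * t ^ (-b)) * ENNReal.ofReal ((t - s) ^ (-a)) := by
    rintro s ⟨h0, h1⟩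
    have h2 : 0 ≤ (t - s) ^ (-a) := Real.rpow_nonneg (by linarith) _
    have h3 : 0 ≤ s ^ (-b) := Real.rpow_nonneg h0.le _
    rw [← ENNReal.ofReal_mul (by positivity), ← ENNReal.ofReal_mul (by positivity),
      ← ENNReal.ofReal_add (by positivity) (by positivity)]
    refine ENNReal.ofReal_le_ofReal ?_
    have p1 : 0 ≤ 2 ^ |a| * t ^ (-a) * s ^ (-b) := by positivity
    have p2 : 0 ≤ 2 ^ |b| * t ^ (-b) * (t - s) ^ (-a) := by positivity
    rcases le_total s (t / 2) with h | h
    · have := mul_le_mul_of_nonneg_right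
        (rpow_neg_le_of_half ht (show t / 2 ≤ t - s by linarith) (by linarith) a) h3
      linarith
    · have := mul_le_mul_of_nonneg_right (rpow_neg_le_of_half ht h h1.le b) h2
      linarith
  refine (setLIntegral_mono (by fun_prop) key).trans ?_
  rw [lintegral_add_left (by fun_prop), lintegral_const_mul _ (by fun_prop),
    lintegral_const_mul _ (by fun_prop), lintegral_Ioo_rpow hb ht, lintegral_Ioo_sub_rpow ha ht,
    ← ENNReal.ofReal_mul (by positivity), ← ENNReal.ofReal_mul (by positivity),
    ← ENNReal.ofReal_add (by positivity) (by positivity)]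
  refine ENNReal.ofReal_le_ofReal (le_of_eq ?_)
  have e1 : t ^ (1 - a - b) = t ^ (-a) * t ^ (1 - b) := by
    rw [← Real.rpow_add ht]; congr 1; ring
  have e2 : t ^ (1 - a - b) = t ^ (-b) * t ^ (1 - a) := by
    rw [← Real.rpow_add ht]; congr 1; ring
  rw [add_mul]
  nth_rw 1 [e1]
  rw [e2]
  ring

/-! ### Space-time convolution of parabolic powers -/

/-- `h` is integrable over `(0, t) × ℝ³`, with integral at most `c`. -/
structure Dom (t : ℝ) (h : ℝ × E3 → ℝ) (c : ℝ) : Prop where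
  integrable : Integrable h (nu t)
  integral_le : ∫ z, h z ∂nu t ≤ c

lemma nu_eq (t : ℝ) : nu t = ((volume : Measure ℝ).prod (volume : Measure E3)).restrict
    (Ioo 0 t ×ˢ univ) := by
  rw [nu, ← Measure.prod_restrict, Measure.restrict_univ]

lemma spaceTime_eq : spaceTime = ((volume : Measure ℝ).prod (volume : Measure E3)).restrict
    (Ioi 0 ×ˢ univ) := by
  rw [spaceTime, ← Measure.prod_restrict, Measure.restrict_univ]

lemma ae_nu_of_forall {t : ℝ} {P : ℝ × E3 → Prop} (h : ∀ s ∈ Ioo 0 t, ∀ y, P (s, y)) :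
    ∀ᵐ z ∂nu t, P z := by
  rw [nu_eq]
  exact ae_restrict_of_forall_mem (measurableSet_Ioo.prod MeasurableSet.univ)
    fun z hz => h z.1 hz.1 z.2

lemma ae_spaceTime_of_forall {P : ℝ × E3 → Prop} (h : ∀ s, 0 < s → ∀ y, P (s, y)) :
    ∀ᵐ z ∂spaceTime, P z := by
  rw [spaceTime_eq]
  exact ae_restrict_of_forall_mem (measurableSet_Ioi.prod MeasurableSet.univ)
    fun z hz => h z.1 hz.1 z.2

lemma nu_le_spaceTime (t : ℝ) : nu t ≤ spaceTime := by
  rw [nu_eq, spaceTime_eq]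
  exact Measure.restrict_mono (Set.prod_mono Ioo_subset_Ioi_self le_rfl) le_rfl

lemma ae_nu_of_spaceTime {t : ℝ} {P : ℝ × E3 → Prop} (h : ∀ᵐ z ∂spaceTime, P z) :
    ∀ᵐ z ∂nu t, P z := ae_mono (nu_le_spaceTime t) h

lemma ae_nu_mem (t : ℝ) : ∀ᵐ z ∂nu t, z.1 ∈ Ioo 0 t := ae_nu_of_forall fun _ hs _ => hs

lemma Dom.mono {t : ℝ} {h h' : ℝ × E3 → ℝ} {c c' : ℝ} (H : Dom t h c)
    (hm : AEStronglyMeasurable h' (nu t)) (h0 : ∀ s ∈ Ioo 0 t, ∀ y, 0 ≤ h' (s, y))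
    (hle : ∀ s ∈ Ioo 0 t, ∀ y, h' (s, y) ≤ h (s, y)) (hc : c ≤ c') : Dom t h' c' := by
  have hi : Integrable h' (nu t) := H.integrable.mono' hm (by
    filter_upwards [ae_nu_of_forall (P := fun z => 0 ≤ h' z) h0,
      ae_nu_of_forall (P := fun z => h' z ≤ h z) hle] with z h1 h2
    rwa [Real.norm_of_nonneg h1])
  exact ⟨hi, (integral_mono_ae hi H.integrable (ae_nu_of_forall (P := fun z => h' z ≤ h z) hle)).trans
    (H.integral_le.trans hc)⟩

lemma Dom.add {t : ℝ} {h h' : ℝ × E3 → ℝ} {c c' : ℝ} (H : Dom t h c) (H' : Dom t h' c') :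
    Dom t (fun z => h z + h' z) (c + c') :=
  ⟨H.integrable.add H'.integrable, by
    rw [integral_add H.integrable H'.integrable]; exact add_le_add H.integral_le H'.integral_le⟩

lemma Dom.const_mul {t : ℝ} {h : ℝ × E3 → ℝ} {c : ℝ} (H : Dom t h c) {a : ℝ} (ha : 0 ≤ a) :
    Dom t (fun z => a * h z) (a * c) :=
  ⟨H.integrable.const_mul a, by
    rw [integral_const_mul]; exact mul_le_mul_of_nonneg_left H.integral_le ha⟩

lemma Dom.norm_integral_le {t : ℝ} {h f : ℝ × E3 → ℝ} {c : ℝ} (H : Dom t h c)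
    (hf : ∀ᵐ z ∂nu t, |f z| ≤ h z) : |∫ z, f z ∂nu t| ≤ c :=
  (Real.norm_eq_abs _).symm.trans_le
    ((norm_integral_le_of_norm_le H.integrable hf).trans H.integral_le)

lemma dom_of_lintegral {t : ℝ} {h : ℝ × E3 → ℝ} {c : ℝ} (hc : 0 ≤ c) (hm : Measurable h)
    (h0 : ∀ s ∈ Ioo 0 t, ∀ y, 0 ≤ h (s, y))
    (hl : ∫⁻ z, ENNReal.ofReal (h z) ∂nu t ≤ ENNReal.ofReal c) : Dom t h c := by
  have hi : Integrable h (nu t) := by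
    refine ⟨hm.aestronglyMeasurable, ?_⟩
    rw [hasFiniteIntegral_iff_ofReal (ae_nu_of_forall h0)]
    exact hl.trans_lt ENNReal.ofReal_lt_top
  refine ⟨hi, ?_⟩
  rw [← ofReal_integral_eq_lintegral_ofReal hi (ae_nu_of_forall h0)] at hl
  exact (ENNReal.ofReal_le_ofReal_iff hc).1 hl

/-- Iterated integration of a product whose first factor depends on time only. -/
lemma dom_mul {t : ℝ} {a e : ℝ → ℝ} {d : ℝ × E3 → ℝ} {c : ℝ} (hc : 0 ≤ c) (ha : Measurable a)
    (hd : Measurable d) (ha0 : ∀ s ∈ Ioo 0 t, 0 ≤ a s) (hd0 : ∀ s ∈ Ioo 0 t, ∀ y, 0 ≤ d (s, y))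
    (hde : ∀ s ∈ Ioo 0 t, ∫⁻ y, ENNReal.ofReal (d (s, y)) ≤ ENNReal.ofReal (e s))
    (hl : ∫⁻ s in Ioo 0 t, ENNReal.ofReal (a s * e s) ≤ ENNReal.ofReal c) :
    Dom t (fun z => a z.1 * d z) c := by
  refine dom_of_lintegral hc (by fun_prop) (fun s hs y => mul_nonneg (ha0 s hs) (hd0 s hs y)) ?_
  rw [nu, lintegral_prod _ (by fun_prop)]
  refine le_trans (setLIntegral_mono' measurableSet_Ioo fun s hs => ?_) hl
  simp only
  simp_rw [ENNReal.ofReal_mul (ha0 s hs)]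
  rw [lintegral_const_mul _ (by fun_prop)]
  gcongr
  exact hde s hs

/-- Integrating in y first costs (t-s)^(-(N-3)/2), and a Beta integral in s remains. In `dom_right`
the cost falls on s instead. -/
lemma dom_left {N a b : ℝ} (hN : 3 < N) (ha : a + (N - 3) / 2 < 1) (hb : b < 1) :
    ∃ C > 0, ∀ t : ℝ, 0 < t → ∀ x : E3,
      Dom t (fun z => ((t - z.1) ^ (-a) * z.1 ^ (-b)) * rho (t - z.1) (x - z.2) ^ (-N))
        (C * t ^ ((5 - N) / 2 - a - b)) := by
  obtain ⟨C₁, h₁, H₁⟩ := lintegral_rho_rpow N hN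
  obtain ⟨C₂, h₂, H₂⟩ := lintegral_beta ha hb
  refine ⟨C₁ * C₂, by positivity, fun t ht x => ?_⟩
  refine dom_mul (a := fun s => (t - s) ^ (-a) * s ^ (-b))
    (e := fun s => C₁ * (t - s) ^ ((3 - N) / 2)) (by positivity) (by fun_prop) (by fun_prop)
    (fun s hs => mul_nonneg (Real.rpow_nonneg (by linarith [hs.2]) _)
      (Real.rpow_nonneg hs.1.le _)) (fun s hs y => Real.rpow_nonneg (rho_nonneg _ _) _)
    (fun s hs => H₁ _ (by linarith [hs.2]) x) ?_
  have : ∀ s ∈ Ioo 0 t, ENNReal.ofReal ((t - s) ^ (-a) * s ^ (-b) * (C₁ * (t - s) ^ ((3 - N) / 2)))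
      = ENNReal.ofReal C₁ * ENNReal.ofReal ((t - s) ^ (-(a + (N - 3) / 2)) * s ^ (-b)) := by
    intro s hs
    rw [← ENNReal.ofReal_mul h₁.le, show -(a + (N - 3) / 2) = -a + (3 - N) / 2 by ring,
      Real.rpow_add (by linarith [hs.2])]
    congr 1; ring
  rw [setLIntegral_congr_fun measurableSet_Ioo this, lintegral_const_mul _ (by fun_prop), mul_assoc,
    ENNReal.ofReal_mul h₁.le]
  gcongr
  rw [show (5 - N) / 2 - a - b = 1 - (a + (N - 3) / 2) - b by ring]
  exact H₂ t ht

lemma dom_right {N a b : ℝ} (hN : 3 < N) (ha : a < 1) (hb : b + (N - 3) / 2 < 1) :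
    ∃ C > 0, ∀ t : ℝ, 0 < t →
      Dom t (fun z => ((t - z.1) ^ (-a) * z.1 ^ (-b)) * rho z.1 z.2 ^ (-N))
        (C * t ^ ((5 - N) / 2 - a - b)) := by
  obtain ⟨C₁, h₁, H₁⟩ := lintegral_rho_rpow N hN
  obtain ⟨C₂, h₂, H₂⟩ := lintegral_beta ha hb
  refine ⟨C₁ * C₂, by positivity, fun t ht => ?_⟩
  refine dom_mul (a := fun s => (t - s) ^ (-a) * s ^ (-b))
    (e := fun s => C₁ * s ^ ((3 - N) / 2)) (by positivity) (by fun_prop) (by fun_prop)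
    (fun s hs => mul_nonneg (Real.rpow_nonneg (by linarith [hs.2]) _)
      (Real.rpow_nonneg hs.1.le _)) (fun s hs y => Real.rpow_nonneg (rho_nonneg _ _) _)
    (fun s hs => ?_) ?_
  · have := H₁ s hs.1 0
    simp only [zero_sub] at this
    refine le_of_eq_of_le ?_ this
    simp [rho]
  have : ∀ s ∈ Ioo 0 t, ENNReal.ofReal ((t - s) ^ (-a) * s ^ (-b) * (C₁ * s ^ ((3 - N) / 2)))
      = ENNReal.ofReal C₁ * ENNReal.ofReal ((t - s) ^ (-a) * s ^ (-(b + (N - 3) / 2))) := by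
    intro s hs
    rw [← ENNReal.ofReal_mul h₁.le, show -(b + (N - 3) / 2) = -b + (3 - N) / 2 by ring,
      Real.rpow_add hs.1]
    congr 1; ring
  rw [setLIntegral_congr_fun measurableSet_Ioo this, lintegral_const_mul _ (by fun_prop), mul_assoc,
    ENNReal.ofReal_mul h₁.le]
  gcongr
  rw [show (5 - N) / 2 - a - b = 1 - a - (b + (N - 3) / 2) by ring]
  exact H₂ t ht

/-- The basic space-time convolution estimate for parabolic power weights. -/
lemma dom_power {p q g : ℝ} (hp : 0 ≤ p) (hq : 0 ≤ q) (h3 : 3 < p + q)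
    (h1 : g + (p + q - 3) / 4 * (1 + p / (p + q)) < 1)
    (h2 : (p + q - 3) / 4 * (1 + q / (p + q)) < 1) :
    ∃ C > 0, ∀ t : ℝ, 0 < t → ∀ x : E3,
      Dom t (fun z => (t - z.1) ^ (-g) * (rho (t - z.1) (x - z.2) ^ (-p) * rho z.1 z.2 ^ (-q)))
        (C * t ^ ((5 - (p + q)) / 2 - g)) := by
  set N := p + q with hN
  have hN0 : 0 < N := by linarith
  have hpN : 0 ≤ p / N := by positivity
  have hqN : 0 ≤ q / N := by positivity
  have hpq : p / N + q / N = 1 := by rw [← add_div, ← hN, div_self hN0.ne']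
  have ep : p = p / N * N := by field_simp
  have eq : q = q / N * N := by field_simp
  have k1 : 0 ≤ (N - 3) / 2 := by linarith
  -- The exponent (N+3)/2 lies halfway between 3, the threshold for integrability in y, and N. The
  -- surplus (N-3)/2 is shared between the two factors in the proportion p : q and turned into
  -- powers of t-s and s; what is left has total (N+3)/2 and is decoupled by `rpow_neg_mul_le_add`.
  obtain ⟨C₁, c₁, H₁⟩ := dom_left (N := (N + 3) / 2) (a := g + p / N * ((N - 3) / 2) / 2)
    (b := q / N * ((N - 3) / 2) / 2) (by linarith) (by linarith) (by nlinarith)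
  obtain ⟨C₂, c₂, H₂⟩ := dom_right (N := (N + 3) / 2) (a := g + p / N * ((N - 3) / 2) / 2)
    (b := q / N * ((N - 3) / 2) / 2) (by linarith) (by nlinarith) (by linarith)
  refine ⟨C₁ + C₂, by positivity, fun t ht x => ?_⟩
  refine ((H₁ t ht x).add (H₂ t ht)).mono (by fun_prop) ?_ ?_ (le_of_eq ?_)
  · intro s hs y
    have := hs.2
    exact mul_nonneg (Real.rpow_nonneg (by linarith) _) (mul_nonneg
      (Real.rpow_nonneg (rho_nonneg _ _) _) (Real.rpow_nonneg (rho_nonneg _ _) _))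
  · intro s hs y
    simp only
    have hts : 0 < t - s := by linarith [hs.2]
    have hA := rho_pos hts (x - y)
    have hB := rho_pos hs.1 y
    have e1 : rho (t - s) (x - y) ^ (-p) = rho (t - s) (x - y) ^ (-(p / N * ((N - 3) / 2))) *
        rho (t - s) (x - y) ^ (-(p / N * ((N + 3) / 2))) := by
      rw [← Real.rpow_add hA]; congr 1; nlinarith
    have e2 : rho s y ^ (-q) = rho s y ^ (-(q / N * ((N - 3) / 2))) *
        rho s y ^ (-(q / N * ((N + 3) / 2))) := by
      rw [← Real.rpow_add hB]; congr 1; nlinarith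
    have i1 := rho_rpow_le_sqrt hts (x - y) (show 0 ≤ p / N * ((N - 3) / 2) by positivity)
    have i2 := rho_rpow_le_sqrt hs.1 y (show 0 ≤ q / N * ((N - 3) / 2) by positivity)
    have i3 := rpow_neg_mul_le_add hA hB (show 0 ≤ p / N * ((N + 3) / 2) by positivity)
      (show 0 ≤ q / N * ((N + 3) / 2) by positivity)
    rw [← add_mul, hpq, one_mul] at i3
    have e3 : (t - s) ^ (-(g + p / N * ((N - 3) / 2) / 2)) =
        (t - s) ^ (-g) * (t - s) ^ (-(p / N * ((N - 3) / 2) / 2)) := by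
      rw [← Real.rpow_add hts]; congr 1; ring
    have n1 := Real.rpow_nonneg hts.le (-g)
    have n2 := Real.rpow_nonneg hA.le (-(p / N * ((N - 3) / 2)))
    have n3 := Real.rpow_nonneg hB.le (-(q / N * ((N - 3) / 2)))
    have n4 := Real.rpow_nonneg hA.le (-(p / N * ((N + 3) / 2)))
    have n5 := Real.rpow_nonneg hB.le (-(q / N * ((N + 3) / 2)))
    have n6 := Real.rpow_nonneg hts.le (-(p / N * ((N - 3) / 2) / 2))
    have n7 := Real.rpow_nonneg hs.1.le (-(q / N * ((N - 3) / 2) / 2))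
    rw [e1, e2, e3, ← mul_add]
    calc _ = (t - s) ^ (-g) * (rho (t - s) (x - y) ^ (-(p / N * ((N - 3) / 2))) *
          rho s y ^ (-(q / N * ((N - 3) / 2)))) *
          (rho (t - s) (x - y) ^ (-(p / N * ((N + 3) / 2))) *
            rho s y ^ (-(q / N * ((N + 3) / 2)))) := by ring
      _ ≤ (t - s) ^ (-g) * ((t - s) ^ (-(p / N * ((N - 3) / 2) / 2)) *
          s ^ (-(q / N * ((N - 3) / 2) / 2))) * _ := by gcongr
      _ ≤ (t - s) ^ (-g) * ((t - s) ^ (-(p / N * ((N - 3) / 2) / 2)) *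
          s ^ (-(q / N * ((N - 3) / 2) / 2))) *
          (rho (t - s) (x - y) ^ (-((N + 3) / 2)) + rho s y ^ (-((N + 3) / 2))) := by gcongr
      _ = _ := by ring
  · rw [← add_mul]
    have e : (5 - (N + 3) / 2) / 2 - (g + p / N * ((N - 3) / 2) / 2) - q / N * ((N - 3) / 2) / 2
      = (5 - N) / 2 - g - (p / N + q / N - 1) * ((N - 3) / 2) / 2 := by ring
    rw [e, hpq]
    congr 2; ring

lemma dom_power_lt {p q : ℝ} (hp : 0 ≤ p) (hq : 0 ≤ q) (h3 : 3 < p + q) (h5 : p + q < 5) :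
    ∃ C > 0, ∀ t : ℝ, 0 < t → ∀ x : E3,
      Dom t (fun z => rho (t - z.1) (x - z.2) ^ (-p) * rho z.1 z.2 ^ (-q))
        (C * t ^ ((5 - (p + q)) / 2)) := by
  have h1 : p / (p + q) ≤ 1 := (div_le_one (by linarith)).2 (by linarith)
  have h2 : q / (p + q) ≤ 1 := (div_le_one (by linarith)).2 (by linarith)
  simpa using dom_power (g := 0) hp hq h3 (by nlinarith) (by nlinarith)

lemma dom_power_five {p q g : ℝ} (hp : 0 < p) (hq : 0 < q) (h5 : p + q = 5) (hg : g < q / 10) :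
    ∃ C > 0, ∀ t : ℝ, 0 < t → ∀ x : E3,
      Dom t (fun z => (t - z.1) ^ (-g) * (rho (t - z.1) (x - z.2) ^ (-p) * rho z.1 z.2 ^ (-q)))
        (C * t ^ (-g)) := by
  simpa [h5] using dom_power (g := g) hp.le hq.le (by linarith) (by rw [h5]; linarith)
    (by rw [h5]; linarith)

lemma mul_rpow_nonneg {a b p q : ℝ} (ha : 0 ≤ a) (hb : 0 ≤ b) : 0 ≤ a ^ p * b ^ q :=
  mul_nonneg (Real.rpow_nonneg ha _) (Real.rpow_nonneg hb _)

/-- The scale-invariant convolution estimate. -/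
lemma dom_crit {p q g : ℝ} (hp : 0 < p) (hq : 0 < q) (hp5 : p < 5) (hq5 : q < 5)
    (hpq : 5 ≤ p + q) (hg : g < q / 10) (hg' : g < (5 - p) / 10) :
    ∃ C > 0, ∀ t : ℝ, 0 < t → ∀ x : E3,
      Dom t (fun z => (t - z.1) ^ (-g) * (rho (t - z.1) (x - z.2) ^ (-p) * rho z.1 z.2 ^ (-q)))
        (C * (t ^ (-g) * rho t x ^ (-(p + q - 5)))) := by
  -- Pulling ρ(t,x)^(-(p+q-5)) out of one factor or the other leaves the pairs (5-q, q) and (p,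
  -- 5-p), both of critical total 5.
  obtain ⟨C₁, c₁, H₁⟩ := dom_power_five (p := 5 - q) (q := q) (by linarith) hq (by ring) hg
  obtain ⟨C₂, c₂, H₂⟩ := dom_power_five (p := p) (q := 5 - p) hp (by linarith) (by ring) hg'
  refine ⟨2 ^ (p + q - 5) * (C₁ + C₂), by positivity, fun t ht x => ?_⟩
  have hR := rho_pos ht x
  refine (((H₁ t ht x).add (H₂ t ht x)).const_mul (a := 2 ^ (p + q - 5) * rho t x ^ (-(p + q - 5)))
    (by positivity)).mono (by fun_prop) ?_ ?_ (le_of_eq (by ring))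
  · intro s hs y
    exact mul_nonneg (Real.rpow_nonneg (by linarith [hs.2]) _)
      (mul_rpow_nonneg (rho_nonneg _ _) (rho_nonneg _ _))
  · intro s hs y
    have hts : 0 < t - s := by linarith [hs.2]
    have := rpow_neg_split (rho_pos hts (x - y)) (rho_pos hs.1 y) hR (rho_le_sub s t x y)
      (show 0 ≤ p + q - 5 by linarith) p q
    rw [show p - (p + q - 5) = 5 - q by ring, show q - (p + q - 5) = 5 - p by ring] at this
    have := mul_le_mul_of_nonneg_left this (Real.rpow_nonneg hts.le (-g))
    simp only
    linarith

/-- The convolution estimate with a gain of a power of the time. -/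
lemma dom_sub {p q e : ℝ} (he : 0 ≤ e) (hp : e ≤ p) (hq : e ≤ q) (h3 : 3 < p + q - e)
    (h5 : p + q - e < 5) :
    ∃ C > 0, ∀ t : ℝ, 0 < t → ∀ x : E3,
      Dom t (fun z => rho (t - z.1) (x - z.2) ^ (-p) * rho z.1 z.2 ^ (-q))
        (C * (t ^ ((5 - (p + q - e)) / 2) * rho t x ^ (-e))) := by
  obtain ⟨C₁, c₁, H₁⟩ := dom_power_lt (p := p - e) (q := q) (by linarith) (by linarith)
    (by linarith) (by linarith)
  obtain ⟨C₂, c₂, H₂⟩ := dom_power_lt (p := p) (q := q - e) (by linarith) (by linarith)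
    (by linarith) (by linarith)
  refine ⟨2 ^ e * (C₁ + C₂), by positivity, fun t ht x => ?_⟩
  have hR := rho_pos ht x
  refine (((H₁ t ht x).add (H₂ t ht x)).const_mul (a := 2 ^ e * rho t x ^ (-e))
    (by positivity)).mono (by fun_prop) ?_ ?_ (le_of_eq ?_)
  · intro s hs y
    exact mul_rpow_nonneg (rho_nonneg _ _) (rho_nonneg _ _)
  · intro s hs y
    have hts : 0 < t - s := by linarith [hs.2]
    have := rpow_neg_split (rho_pos hts (x - y)) (rho_pos hs.1 y) hR (rho_le_sub s t x y) he p q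
    simp only
    linarith
  · rw [show p - e + q = p + q - e by ring, show p + (q - e) = p + q - e by ring]
    ring

/-! ### The heat kernel and its derivatives -/

lemma heatKernel_nonneg {σ : ℝ} (hσ : 0 < σ) (x : E3) : 0 ≤ heatKernel σ x := by
  unfold heatKernel; positivity

/-- With y = |x|/√σ, one has (1+y)^M ≤ e^(My) and My - y²/4 ≤ M², so the Gaussian beats every power.
The free exponent M trades decay in x against powers of σ. -/
lemma heatKernel_le {M : ℝ} (hM : 0 ≤ M) : ∃ C > 0, ∀ σ : ℝ, 0 < σ → ∀ x : E3,
    heatKernel σ x ≤ C * (σ ^ ((M - 3) / 2) * rho σ x ^ (-M)) := by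
  refine ⟨(4 * Real.pi) ^ (-(3 / 2) : ℝ) * Real.exp (M ^ 2), by positivity, fun σ hσ x => ?_⟩
  have hs := Real.sqrt_pos.2 hσ
  have hr := rho_pos hσ x
  set y := ‖x‖ / √σ with hy
  have hy0 : 0 ≤ y := by positivity
  have e1 : rho σ x = √σ * (1 + y) := by unfold rho; rw [hy]; field_simp
  have e2 : ‖x‖ ^ 2 / (4 * σ) = y ^ 2 / 4 := by
    rw [hy, div_pow, Real.sq_sqrt hσ.le]; field_simp
  have e3 : Real.exp (-‖x‖ ^ 2 / (4 * σ)) ≤ Real.exp (M ^ 2) * (1 + y) ^ (-M) := by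
    have h1 : (1 + y) ^ M ≤ Real.exp (M * y) := by
      rw [mul_comm, Real.exp_mul]
      exact Real.rpow_le_rpow (by positivity) (by linarith [Real.add_one_le_exp y]) hM
    rw [Real.rpow_neg (by positivity), neg_div, e2, ← div_eq_mul_inv, le_div_iff₀ (by positivity)]
    calc _ ≤ Real.exp (-(y ^ 2 / 4)) * Real.exp (M * y) := by gcongr
      _ = Real.exp (-(y ^ 2 / 4) + M * y) := (Real.exp_add _ _).symm
      _ ≤ _ := Real.exp_le_exp.2 (by nlinarith [sq_nonneg (y / 2 - M)])
  have e4 : σ ^ (-(3 / 2) : ℝ) * (1 + y) ^ (-M) = σ ^ ((M - 3) / 2) * rho σ x ^ (-M) := by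
    rw [e1, Real.mul_rpow hs.le (by positivity), ← mul_assoc, Real.sqrt_eq_rpow,
      ← Real.rpow_mul hσ.le, ← Real.rpow_add hσ]
    congr 2; ring
  unfold heatKernel
  rw [Real.mul_rpow (by positivity) hσ.le]
  calc _ ≤ (4 * Real.pi) ^ (-(3 / 2) : ℝ) * σ ^ (-(3 / 2) : ℝ) *
        (Real.exp (M ^ 2) * (1 + y) ^ (-M)) := by gcongr
    _ = (4 * Real.pi) ^ (-(3 / 2) : ℝ) * Real.exp (M ^ 2) *
        (σ ^ (-(3 / 2) : ℝ) * (1 + y) ^ (-M)) := by ring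
    _ = _ := by rw [e4]

/-- The polynomial factor is absorbed by asking the Gaussian for decay of order m + i. All
derivatives of the heat kernel are sums of such terms. -/
lemma norm_pow_mul_heatKernel_le {m : ℝ} (hm : 0 ≤ m) (i n : ℕ) :
    ∃ C > 0, ∀ σ : ℝ, 0 < σ → ∀ x : E3,
      ‖x‖ ^ i / σ ^ n * heatKernel σ x ≤ C * (σ ^ ((m + i - 2 * n - 3) / 2) * rho σ x ^ (-m)) := by
  obtain ⟨C, hC, H⟩ := heatKernel_le (M := m + i) (by positivity)
  refine ⟨C, hC, fun σ hσ x => ?_⟩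
  have hr := rho_pos hσ x
  calc _ ≤ rho σ x ^ i / σ ^ n * (C * (σ ^ ((m + i - 3) / 2) * rho σ x ^ (-(m + i)))) := by
        gcongr
        · exact heatKernel_nonneg hσ x
        · exact norm_le_rho σ x
        · exact H σ hσ x
    _ = C * (σ ^ ((m + i - 3) / 2) / σ ^ n * (rho σ x ^ (-(m + i)) * rho σ x ^ i)) := by ring
    _ = _ := by
        rw [← Real.rpow_sub_natCast hσ.ne', ← Real.rpow_add_natCast hr.ne']
        congr 3 <;> ring

lemma pd_eq_of_hasFDerivAt {f : E3 → ℝ} {f' : E3 →L[ℝ] ℝ} {x : E3} (h : HasFDerivAt f f' x)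
    (i : Fin 3) : pd i f x = f' (EuclideanSpace.single i 1) := by
  rw [pd, h.fderiv]

lemma hasFDerivAt_heatKernel (σ : ℝ) (x : E3) :
    HasFDerivAt (heatKernel σ) (-(heatKernel σ x / (2 * σ)) • innerSL ℝ x) x := by
  have h := (((hasStrictFDerivAt_norm_sq x).hasFDerivAt.const_mul (-(4 * σ)⁻¹)).exp).const_mul
    ((4 * Real.pi * σ) ^ (-(3 / 2) : ℝ))
  have e : (fun x : E3 => (4 * Real.pi * σ) ^ (-(3 / 2) : ℝ) * Real.exp (-(4 * σ)⁻¹ * ‖x‖ ^ 2)) =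
      heatKernel σ := by
    ext y; unfold heatKernel; congr 2; rw [neg_div, div_eq_mul_inv]; ring
  rw [e] at h
  convert! h using 1
  ext y
  have e' := congrFun e x
  rw [← e']
  simp only [smul_apply, smul_eq_mul, innerSL_apply_apply, nsmul_eq_mul]
  push_cast
  rw [mul_inv]
  ring

lemma differentiable_heatKernel (σ : ℝ) : Differentiable ℝ (heatKernel σ) :=
  fun x => (hasFDerivAt_heatKernel σ x).differentiableAt

lemma hasFDerivAt_coord (k : Fin 3) (x : E3) :
    HasFDerivAt (fun x : E3 => x k) (EuclideanSpace.proj k : E3 →L[ℝ] ℝ) x :=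
  (EuclideanSpace.proj k : E3 →L[ℝ] ℝ).hasFDerivAt

lemma pd_mul_heatKernel (l : Fin 3) {P : E3 → ℝ} {σ : ℝ} {x : E3} (hP : DifferentiableAt ℝ P x) :
    pd l (fun x => P x * heatKernel σ x) x =
      (pd l P x - P x * (x l / (2 * σ))) * heatKernel σ x := by
  have h : HasFDerivAt (fun x => P x * heatKernel σ x) _ x :=
    hP.hasFDerivAt.mul (hasFDerivAt_heatKernel σ x)
  rw [pd_eq_of_hasFDerivAt h]
  simp only [add_apply, smul_apply, smul_eq_mul,
    innerSL_apply_apply, EuclideanSpace.inner_single_right, pd]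
  simp
  ring

/-- The first derivatives of the heat kernel. -/
def heat1 (k : Fin 3) (σ : ℝ) (x : E3) : ℝ := -(x k / (2 * σ)) * heatKernel σ x

/-- The second derivatives of the heat kernel. -/
def heat2 (j k : Fin 3) (σ : ℝ) (x : E3) : ℝ :=
  (x j * x k / (4 * σ ^ 2) - (if k = j then 1 else 0) / (2 * σ)) * heatKernel σ x

/-- The third derivatives of the heat kernel. -/
def heat3 (l j k : Fin 3) (σ : ℝ) (x : E3) : ℝ :=
  (-(x l * x j * x k / (8 * σ ^ 3)) + ((if k = j then 1 else 0) * x l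
    + (if j = l then 1 else 0) * x k + (if k = l then 1 else 0) * x j) / (4 * σ ^ 2))
    * heatKernel σ x

lemma pd_heatKernel (k : Fin 3) (σ : ℝ) : pd k (heatKernel σ) = heat1 k σ := by
  ext x
  rw [pd_eq_of_hasFDerivAt (hasFDerivAt_heatKernel σ x), heat1]
  simp [EuclideanSpace.inner_single_right]
  ring

@[fun_prop]
lemma differentiable_coord (k : Fin 3) : Differentiable ℝ (fun x : E3 => x k) :=
  fun x => (hasFDerivAt_coord k x).differentiableAt

lemma pd_heat1 (j k : Fin 3) (σ : ℝ) : pd j (heat1 k σ) = heat2 j k σ := by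
  ext x
  have h : HasFDerivAt (fun x : E3 => -(x k / (2 * σ)))
      (-((2 * σ)⁻¹ • (EuclideanSpace.proj k : E3 →L[ℝ] ℝ))) x :=
    ((hasFDerivAt_coord k x).mul_const (2 * σ)⁻¹).neg
  have e : heat1 k σ = fun x => -(x k / (2 * σ)) * heatKernel σ x := rfl
  rw [e, pd_mul_heatKernel j h.differentiableAt, pd_eq_of_hasFDerivAt h, heat2]
  simp only [neg_apply, smul_apply, smul_eq_mul, PiLp.proj_apply]
  rw [PiLp.single_apply]
  split_ifs <;> ring

lemma pd_heat2 (l j k : Fin 3) (σ : ℝ) : pd l (heat2 j k σ) = heat3 l j k σ := by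
  ext x
  have h : HasFDerivAt (fun x : E3 => x j * x k / (4 * σ ^ 2) - (if k = j then 1 else 0) / (2 * σ))
      ((4 * σ ^ 2)⁻¹ • (x j • (EuclideanSpace.proj k : E3 →L[ℝ] ℝ) +
        x k • (EuclideanSpace.proj j : E3 →L[ℝ] ℝ))) x :=
    (((hasFDerivAt_coord j x).mul (hasFDerivAt_coord k x)).mul_const (4 * σ ^ 2)⁻¹).sub_const _
  have e : heat2 j k σ = fun x => (x j * x k / (4 * σ ^ 2) - (if k = j then 1 else 0) / (2 * σ)) *
    heatKernel σ x := rfl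
  rw [e, pd_mul_heatKernel l h.differentiableAt, pd_eq_of_hasFDerivAt h, heat3]
  simp only [add_apply, smul_apply, smul_eq_mul, PiLp.proj_apply]
  rw [PiLp.single_apply, PiLp.single_apply]
  split_ifs <;> ring

lemma differentiable_heat2 (j k : Fin 3) (σ : ℝ) : Differentiable ℝ (heat2 j k σ) := by
  have := differentiable_heatKernel σ
  unfold heat2; fun_prop

lemma abs_coord_le (x : E3) (k : Fin 3) : |x k| ≤ ‖x‖ := by
  simpa using PiLp.norm_apply_le x k

lemma abs_heat1_le {m : ℝ} (hm : 0 ≤ m) : ∃ C > 0, ∀ (k : Fin 3) (σ : ℝ), 0 < σ → ∀ x : E3,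
    |heat1 k σ x| ≤ C * (σ ^ ((m - 4) / 2) * rho σ x ^ (-m)) := by
  obtain ⟨C, hC, H⟩ := norm_pow_mul_heatKernel_le hm 1 1
  refine ⟨C, hC, fun k σ hσ x => ?_⟩
  have h := H σ hσ x
  rw [show (m + (1 : ℕ) - 2 * (1 : ℕ) - 3) / 2 = (m - 4) / 2 by push_cast; ring] at h
  refine le_trans ?_ h
  have hg := heatKernel_nonneg hσ x
  rw [heat1, abs_mul, abs_neg, abs_of_nonneg hg, abs_div, abs_of_pos (show 0 < 2 * σ by positivity),
    pow_one, pow_one]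
  gcongr
  · exact abs_coord_le x k
  · linarith

lemma abs_heat2_le {m : ℝ} (hm : 0 ≤ m) : ∃ C > 0, ∀ (j k : Fin 3) (σ : ℝ), 0 < σ → ∀ x : E3,
    |heat2 j k σ x| ≤ C * (σ ^ ((m - 5) / 2) * rho σ x ^ (-m)) := by
  obtain ⟨C, hC, H⟩ := norm_pow_mul_heatKernel_le hm 2 2
  obtain ⟨C', hC', H'⟩ := norm_pow_mul_heatKernel_le hm 0 1
  refine ⟨C + C', by positivity, fun j k σ hσ x => ?_⟩
  have h := H σ hσ x
  have h' := H' σ hσ x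
  rw [show (m + (2 : ℕ) - 2 * (2 : ℕ) - 3) / 2 = (m - 5) / 2 by push_cast; ring] at h
  rw [show (m + (0 : ℕ) - 2 * (1 : ℕ) - 3) / 2 = (m - 5) / 2 by push_cast; ring] at h'
  have hg := heatKernel_nonneg hσ x
  rw [add_mul]
  refine le_trans ?_ (add_le_add h h')
  rw [heat2, abs_mul, abs_of_nonneg hg, ← add_mul]
  gcongr
  refine (abs_sub _ _).trans (add_le_add ?_ ?_)
  · rw [abs_div, abs_mul, abs_of_pos (show 0 < 4 * σ ^ 2 by positivity), pow_two ‖x‖]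
    gcongr
    · exact abs_coord_le x j
    · exact abs_coord_le x k
    · linarith [sq_nonneg σ]
  · rw [abs_div, abs_of_pos (show 0 < 2 * σ by positivity), pow_zero, pow_one]
    gcongr
    · split_ifs <;> simp
    · linarith

lemma abs_heat3_le {m : ℝ} (hm : 0 ≤ m) : ∃ C > 0, ∀ (l j k : Fin 3) (σ : ℝ), 0 < σ → ∀ x : E3,
    |heat3 l j k σ x| ≤ C * (σ ^ ((m - 6) / 2) * rho σ x ^ (-m)) := by
  obtain ⟨C, hC, H⟩ := norm_pow_mul_heatKernel_le hm 3 3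
  obtain ⟨C', hC', H'⟩ := norm_pow_mul_heatKernel_le hm 1 2
  refine ⟨C + C', by positivity, fun l j k σ hσ x => ?_⟩
  have h := H σ hσ x
  have h' := H' σ hσ x
  rw [show (m + (3 : ℕ) - 2 * (3 : ℕ) - 3) / 2 = (m - 6) / 2 by push_cast; ring] at h
  rw [show (m + (1 : ℕ) - 2 * (2 : ℕ) - 3) / 2 = (m - 6) / 2 by push_cast; ring] at h'
  have hg := heatKernel_nonneg hσ x
  rw [add_mul]
  refine le_trans ?_ (add_le_add h h')
  rw [heat3, abs_mul, abs_of_nonneg hg, ← add_mul]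
  gcongr
  refine (abs_add_le _ _).trans (add_le_add ?_ ?_)
  · rw [abs_neg, abs_div, abs_mul, abs_mul, abs_of_pos (show 0 < 8 * σ ^ 3 by positivity),
      show ‖x‖ ^ 3 = ‖x‖ * ‖x‖ * ‖x‖ by ring]
    gcongr
    · exact abs_coord_le x l
    · exact abs_coord_le x j
    · exact abs_coord_le x k
    · have : 0 < σ ^ 3 := by positivity
      linarith
  · have hd : ∀ (p : Prop) [Decidable p] (i : Fin 3), |(if p then (1 : ℝ) else 0) * x i| ≤ ‖x‖ := by
      intro p _ i
      split_ifs
      · simpa using abs_coord_le x i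
      · simp
    rw [abs_div, abs_of_pos (show 0 < 4 * σ ^ 2 by positivity), pow_one,
      div_le_div_iff₀ (by positivity) (by positivity)]
    have h3 : |(if k = j then (1 : ℝ) else 0) * x l + (if j = l then 1 else 0) * x k +
        (if k = l then 1 else 0) * x j| ≤ 4 * ‖x‖ := by
      refine (abs_add_le _ _).trans ?_
      have := abs_add_le ((if k = j then (1 : ℝ) else 0) * x l) ((if j = l then 1 else 0) * x k)
      linarith [hd (k = j) l, hd (j = l) k, hd (k = l) j, norm_nonneg x]
    have := mul_le_mul_of_nonneg_right h3 (sq_nonneg σ)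
    linarith

lemma sum_coord_sq (x : E3) : ∑ j, x j ^ 2 = ‖x‖ ^ 2 := by
  rw [EuclideanSpace.norm_sq_eq]; simp

/-- The heat equation for the heat kernel. -/
lemma hasDerivAt_heatKernel {σ : ℝ} (hσ : 0 < σ) (x : E3) :
    HasDerivAt (fun s => heatKernel s x) (∑ j, heat2 j j σ x) σ := by
  have h1 : HasDerivAt (fun s : ℝ => (4 * Real.pi * s) ^ (-(3 / 2) : ℝ))
      (4 * Real.pi * (-(3 / 2)) * (4 * Real.pi * σ) ^ (-(3 / 2) - 1 : ℝ)) σ := by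
    have := ((hasDerivAt_id σ).const_mul (4 * Real.pi)).rpow_const (p := (-(3 / 2) : ℝ))
      (Or.inl (by simp; positivity))
    simpa using this
  have h2 : HasDerivAt (fun s : ℝ => Real.exp (-‖x‖ ^ 2 / (4 * s)))
      (Real.exp (-‖x‖ ^ 2 / (4 * σ)) * (‖x‖ ^ 2 / (4 * σ ^ 2))) σ := by
    have := (((hasDerivAt_id σ).const_mul 4).fun_inv (by simp; positivity)).const_mul (-‖x‖ ^ 2)
    have := this.exp
    simp only [id, ← div_eq_mul_inv] at this
    convert! this using 1
    congr 1
    field_simp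
  have h := h1.mul h2
  have e : (fun s => heatKernel s x) = (fun s : ℝ => (4 * Real.pi * s) ^ (-(3 / 2) : ℝ)) *
    (fun s : ℝ => Real.exp (-‖x‖ ^ 2 / (4 * s))) := rfl
  rw [e]
  convert! h using 1
  simp only [heat2, ← Finset.sum_mul, if_true, Finset.sum_sub_distrib, ← pow_two,
    ← Finset.sum_div, sum_coord_sq, heatKernel]
  rw [Real.rpow_sub (by positivity), Real.rpow_one]
  simp
  field_simp
  ring

/-- The heat equation differentiated in the k-th variable, checked on the closed forms. It gives the
time regularity of the gradient kernels and the divergence of the Oseen kernel. -/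
lemma hasDerivAt_heat1 (k : Fin 3) {σ : ℝ} (hσ : 0 < σ) (x : E3) :
    HasDerivAt (fun s => heat1 k s x) (∑ j, heat3 j j k σ x) σ := by
  have h1 : HasDerivAt (fun s : ℝ => -(x k / (2 * s))) (x k / (2 * σ ^ 2)) σ := by
    have := (((hasDerivAt_id σ).const_mul 2).fun_inv (by simp; positivity)).const_mul (-(x k))
    convert! this using 1
    · ext s; simp [div_eq_mul_inv]
    · simp; field_simp
  have h := h1.mul (hasDerivAt_heatKernel hσ x)
  have e : (fun s => heat1 k s x) = (fun s : ℝ => -(x k / (2 * s))) *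
    (fun s => heatKernel s x) := rfl
  rw [e]
  convert! h using 1
  simp only [heat2, heat3, ← Finset.sum_mul]
  rw [← mul_assoc, ← add_mul]
  congr 1
  have hs := sum_coord_sq x
  simp only [Fin.sum_univ_three] at hs ⊢
  fin_cases k <;> simp <;> rw [← sub_eq_zero] <;> field_simp <;> ring

/-! ### Kernels of parabolic order -/

/-- A kernel of parabolic order `-p`: it is bounded by `C (√t + |x|) ^ (-p)` and Hölder continuous
in time in the corresponding scale-invariant sense. -/
structure Ker (p C : ℝ) (k : ℝ → E3 → ℝ) : Prop where
  measurable : Measurable (fun z : ℝ × E3 => k z.1 z.2)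
  bound : ∀ σ, 0 < σ → ∀ z, |k σ z| ≤ C * rho σ z ^ (-p)
  holder : ∀ σ τ, 0 < σ → σ ≤ τ → ∀ z,
    |k τ z - k σ z| ≤ C * ((τ - σ) ^ (1 / 20 : ℝ) * (σ ^ (-(1 / 20 : ℝ)) * rho σ z ^ (-p)))

/-- Let r = (τ-σ)/σ. For r ≤ 1, r ≤ r^(1/20); for r ≥ 1 the triangle inequality is enough. A small
Hölder exponent is wanted: the singularity (t-s)^(-1/20) it costs must be admissible in `dom_crit`,
that is 1/20 < q/10 and 1/20 < (5-p)/10, for the pairs (4,4), (4,2), (3,3). -/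
lemma Ker.of_lipschitz {p C : ℝ} (hp : 0 ≤ p) (hC : 0 ≤ C) {k : ℝ → E3 → ℝ}
    (hm : Measurable (fun z : ℝ × E3 => k z.1 z.2))
    (hb : ∀ σ, 0 < σ → ∀ z, |k σ z| ≤ C * rho σ z ^ (-p))
    (hl : ∀ σ τ, 0 < σ → σ ≤ τ → ∀ z, |k τ z - k σ z| ≤ C * ((τ - σ) / σ * rho σ z ^ (-p))) :
    Ker p (2 * C) k := by
  have hn : ∀ σ z, 0 ≤ rho σ z ^ (-p) := fun σ z => Real.rpow_nonneg (rho_nonneg _ _) _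
  refine ⟨hm, fun σ hσ z => (hb σ hσ z).trans ?_, fun σ τ hσ hστ z => ?_⟩
  · have := mul_nonneg hC (hn σ z)
    linarith
  · have h0 : 0 ≤ (τ - σ) / σ := div_nonneg (by linarith) hσ.le
    have e : (τ - σ) ^ (1 / 20 : ℝ) * (σ ^ (-(1 / 20 : ℝ)) * rho σ z ^ (-p)) =
        ((τ - σ) / σ) ^ (1 / 20 : ℝ) * rho σ z ^ (-p) := by
      rw [Real.div_rpow (by linarith) hσ.le, Real.rpow_neg hσ.le]; ring
    rw [e]
    rcases le_total ((τ - σ) / σ) 1 with h | h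
    · refine (hl σ τ hσ hστ z).trans ?_
      have h1 : (τ - σ) / σ ≤ ((τ - σ) / σ) ^ (1 / 20 : ℝ) := by
        simpa using Real.rpow_le_rpow_of_exponent_ge_of_imp h0 h (show (1 / 20 : ℝ) ≤ 1 by norm_num)
          (by norm_num)
      have := mul_le_mul_of_nonneg_left (mul_le_mul_of_nonneg_right h1 (hn σ z)) hC
      have := mul_nonneg hC (mul_nonneg h0 (hn σ z))
      linarith
    · have h1 : (1 : ℝ) ≤ ((τ - σ) / σ) ^ (1 / 20 : ℝ) := Real.one_le_rpow h (by norm_num)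
      have h2 := hb σ hσ z
      have h3 := hb τ (hσ.trans_le hστ) z
      have h4 := mul_le_mul_of_nonneg_left (rpow_neg_le (rho_pos hσ z) (rho_mono hστ z) hp) hC
      have h5 := mul_le_mul_of_nonneg_left (mul_le_mul_of_nonneg_right h1 (hn σ z)) hC
      have := abs_sub (k τ z) (k σ z)
      linarith

@[fun_prop]
lemma measurable_heatKernel {α : Type*} [MeasurableSpace α] {f : α → ℝ} {g : α → E3}
    (hf : Measurable f) (hg : Measurable g) : Measurable (fun a => heatKernel (f a) (g a)) := by
  unfold heatKernel; fun_prop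

@[fun_prop]
lemma measurable_coord {α : Type*} [MeasurableSpace α] {g : α → E3} (hg : Measurable g)
    (k : Fin 3) : Measurable (fun a => g a k) :=
  (EuclideanSpace.proj k : E3 →L[ℝ] ℝ).measurable.comp hg

@[fun_prop]
lemma measurable_heat1 {α : Type*} [MeasurableSpace α] {f : α → ℝ} {g : α → E3} (k : Fin 3)
    (hf : Measurable f) (hg : Measurable g) : Measurable (fun a => heat1 k (f a) (g a)) := by
  unfold heat1; fun_prop

@[fun_prop]
lemma measurable_heat2 {α : Type*} [MeasurableSpace α] {f : α → ℝ} {g : α → E3} (j k : Fin 3)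
    (hf : Measurable f) (hg : Measurable g) : Measurable (fun a => heat2 j k (f a) (g a)) := by
  unfold heat2; fun_prop

@[fun_prop]
lemma measurable_heat3 {α : Type*} [MeasurableSpace α] {f : α → ℝ} {g : α → E3} (l j k : Fin 3)
    (hf : Measurable f) (hg : Measurable g) : Measurable (fun a => heat3 l j k (f a) (g a)) := by
  unfold heat3; fun_prop

/-- The mean value inequality in time for functions with derivative bounded by a multiple of
`s⁻¹ (√s + |x|) ^ (-p)`. -/
lemma abs_sub_le_of_hasDerivAt {f f' : ℝ → ℝ} {σ τ B : ℝ} (hστ : σ ≤ τ)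
    (hf : ∀ s, σ ≤ s → HasDerivAt f (f' s) s) (hB : ∀ s, σ ≤ s → |f' s| ≤ B) :
    |f τ - f σ| ≤ B * (τ - σ) := by
  have := Convex.norm_image_sub_le_of_norm_hasDerivWithin_le (s := Ici σ) (f := f) (f' := f')
    (fun s hs => (hf s hs).hasDerivWithinAt) hB (convex_Ici σ) self_mem_Ici (y := τ) hστ
  rwa [Real.norm_eq_abs, Real.norm_eq_abs, abs_of_nonneg (show 0 ≤ τ - σ by linarith)] at this

lemma ker_heat1 : ∃ C > 0, ∀ l, Ker 4 C (heat1 l) := by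
  obtain ⟨C₁, c₁, H₁⟩ := abs_heat1_le (m := 4) (by norm_num)
  obtain ⟨C₃, c₃, H₃⟩ := abs_heat3_le (m := 4) (by norm_num)
  refine ⟨2 * (C₁ + 3 * C₃), by positivity, fun l => Ker.of_lipschitz (by norm_num) (by positivity)
    (by fun_prop) (fun σ hσ z => ?_) fun σ τ hσ hστ z => ?_⟩
  · have := H₁ l σ hσ z
    have h0 : 0 ≤ rho σ z ^ (-4 : ℝ) := Real.rpow_nonneg (rho_nonneg _ _) _
    rw [sub_self, zero_div, Real.rpow_zero, one_mul] at this
    nlinarith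
  · have h0 : 0 ≤ (τ - σ) / σ * rho σ z ^ (-4 : ℝ) :=
      mul_nonneg (div_nonneg (by linarith) hσ.le) (Real.rpow_nonneg (rho_nonneg _ _) _)
    refine (abs_sub_le_of_hasDerivAt (f := fun s => heat1 l s z)
      (B := 3 * (C₃ * (σ⁻¹ * rho σ z ^ (-4 : ℝ)))) hστ
      (fun s hs => hasDerivAt_heat1 l (hσ.trans_le hs) z) fun s hs => ?_).trans ?_
    · have hs0 := hσ.trans_le hs
      refine (Finset.abs_sum_le_sum_abs _ _).trans ?_
      have : ∀ j ∈ Finset.univ, |heat3 j j l s z| ≤ C₃ * (σ⁻¹ * rho σ z ^ (-4 : ℝ)) := by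
        intro j _
        refine (H₃ j j l s hs0 z).trans ?_
        rw [show ((4 : ℝ) - 6) / 2 = -1 by norm_num, Real.rpow_neg_one]
        have := rpow_neg_le (rho_pos hσ z) (rho_mono hs z) (show (0 : ℝ) ≤ 4 by norm_num)
        have h2 : 0 ≤ rho s z ^ (-4 : ℝ) := Real.rpow_nonneg (rho_nonneg _ _) _
        gcongr
      simpa using Finset.sum_le_sum this
    · have : 3 * (C₃ * (σ⁻¹ * rho σ z ^ (-4 : ℝ))) * (τ - σ) =
        3 * C₃ * ((τ - σ) / σ * rho σ z ^ (-4 : ℝ)) := by ring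
      rw [this]
      nlinarith

/-- The heat kernel with its natural bounds, and its Lipschitz continuity in time. -/
lemma abs_heatKernel_sub_le : ∃ C > 0, ∀ σ τ : ℝ, 0 < σ → σ ≤ τ → ∀ z : E3,
    |heatKernel τ z - heatKernel σ z| ≤
      C * ((τ - σ) / σ) * (σ ^ (1 / 2 : ℝ) * rho σ z ^ (-4 : ℝ)) := by
  obtain ⟨C₂, c₂, H₂⟩ := abs_heat2_le (m := 4) (by norm_num)
  refine ⟨3 * C₂, by positivity, fun σ τ hσ hστ z => ?_⟩
  refine (abs_sub_le_of_hasDerivAt (f := fun s => heatKernel s z)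
      (B := 3 * (C₂ * (σ ^ (-(1 / 2) : ℝ) * rho σ z ^ (-4 : ℝ)))) hστ
      (fun s hs => hasDerivAt_heatKernel (hσ.trans_le hs) z) fun s hs => ?_).trans ?_
  · have hs0 := hσ.trans_le hs
    refine (Finset.abs_sum_le_sum_abs _ _).trans ?_
    have : ∀ j ∈ Finset.univ, |heat2 j j s z| ≤ C₂ * (σ ^ (-(1 / 2) : ℝ) * rho σ z ^ (-4 : ℝ)) := by
      intro j _
      refine (H₂ j j s hs0 z).trans ?_
      rw [show ((4 : ℝ) - 5) / 2 = -(1 / 2) by norm_num]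
      have h1 := rpow_neg_le (rho_pos hσ z) (rho_mono hs z) (show (0 : ℝ) ≤ 4 by norm_num)
      have h2 : 0 ≤ rho s z ^ (-4 : ℝ) := Real.rpow_nonneg (rho_nonneg _ _) _
      have h3 := rpow_neg_le hσ hs (show (0 : ℝ) ≤ 1 / 2 by norm_num)
      gcongr
    simpa using Finset.sum_le_sum this
  · have : σ ^ (-(1 / 2) : ℝ) = σ ^ (1 / 2 : ℝ) / σ := by
      rw [← Real.rpow_sub_one hσ.ne']; norm_num
    rw [this]
    exact le_of_eq (by ring)

lemma integral_heatKernel {σ : ℝ} (hσ : 0 < σ) : ∫ x, heatKernel σ x = 1 := by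
  have h := GaussianFourier.integral_rexp_neg_mul_sq_norm (V := E3) (b := (4 * σ)⁻¹) (by positivity)
  unfold heatKernel
  have e : ∀ x : E3, -‖x‖ ^ 2 / (4 * σ) = -(4 * σ)⁻¹ * ‖x‖ ^ 2 := fun x => by ring
  simp_rw [e]
  rw [integral_const_mul, h, finrank_E3, div_inv_eq_mul, show Real.pi * (4 * σ) = 4 * Real.pi * σ by ring,
    ← Real.rpow_add (by positivity)]
  norm_num

lemma integrable_heatKernel {σ : ℝ} (hσ : 0 < σ) : Integrable (heatKernel σ) := by
  -- The integral of a nonintegrable function is 0 by convention, which contradicts total mass 1.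
  by_contra h
  have := integral_heatKernel hσ
  rw [integral_undef h] at this
  norm_num at this

lemma integrable_heat1 (l : Fin 3) {σ : ℝ} (hσ : 0 < σ) : Integrable (heat1 l σ) := by
  obtain ⟨C, hC, H⟩ := ker_heat1
  exact ((integrable_rho_rpow (show (3 : ℝ) < 4 by norm_num) hσ).const_mul C).mono'
    (by fun_prop) (Eventually.of_forall fun z => (H l).bound σ hσ z)

lemma heatKernel_neg (σ : ℝ) (x : E3) : heatKernel σ (-x) = heatKernel σ x := by
  simp [heatKernel]

lemma integral_heat1 (l : Fin 3) (σ : ℝ) : ∫ x, heat1 l σ x = 0 := by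
  have h := integral_neg_eq_self (heat1 l σ) volume
  have e : ∀ x, heat1 l σ (-x) = -heat1 l σ x := fun x => by
    simp [heat1, heatKernel_neg]; ring
  simp_rw [e, integral_neg] at h
  linarith

/-! ### The Oseen kernels -/

lemma tendsto_rho_atTop (x : E3) : Tendsto (fun s => rho s x) atTop atTop := by
  unfold rho
  exact tendsto_atTop_add_const_right _ _ Real.tendsto_sqrt_atTop

/-- Since √s ≤ ρ, the integrand is at most 2/b times the function -d/ds ρ(s,x)^(-b) = (b/(2√s))
ρ^(-b-1), whose integral telescopes. This is how two orders are gained from the integral over s > t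
in the Oseen kernels. -/
lemma tail_rho {b : ℝ} (hb : 0 < b) {σ : ℝ} (hσ : 0 < σ) (x : E3) :
    IntegrableOn (fun s => rho s x ^ (-(b + 2))) (Ioi σ) ∧
      ∫ s in Ioi σ, rho s x ^ (-(b + 2)) ≤ 2 / b * rho σ x ^ (-b) := by
  have hd : ∀ s ∈ Ici σ, HasDerivAt (fun s => rho s x ^ (-b))
      (1 / (2 * √s) * (-b) * rho s x ^ (-b - 1)) s := by
    intro s hs
    have hs0 : 0 < s := hσ.trans_le hs
    exact ((Real.hasDerivAt_sqrt hs0.ne').add_const ‖x‖).rpow_const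
      (Or.inl (rho_pos hs0 x).ne')
  have hneg : ∀ s ∈ Ioi σ, 1 / (2 * √s) * (-b) * rho s x ^ (-b - 1) ≤ 0 := by
    intro s _
    have : 0 ≤ rho s x ^ (-b - 1) := Real.rpow_nonneg (rho_nonneg _ _) _
    have : 0 ≤ 1 / (2 * √s) * b * rho s x ^ (-b - 1) := by positivity
    linarith
  have ht : Tendsto (fun s => rho s x ^ (-b)) atTop (𝓝 0) :=
    (tendsto_rpow_neg_atTop hb).comp (tendsto_rho_atTop x)
  have hi := (integrableOn_Ioi_deriv_of_nonpos' hd hneg ht).const_mul (-(2 / b))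
  have hv := integral_Ioi_of_hasDerivAt_of_nonpos' hd hneg ht
  have hle : ∀ s ∈ Ioi σ, rho s x ^ (-(b + 2)) ≤
      -(2 / b) * (1 / (2 * √s) * (-b) * rho s x ^ (-b - 1)) := by
    intro s hs
    have hs0 : 0 < s := hσ.trans hs
    have hr := rho_pos hs0 x
    have e1 : -(2 / b) * (1 / (2 * √s) * (-b) * rho s x ^ (-b - 1)) =
        (√s)⁻¹ * rho s x ^ (-b - 1) := by field_simp
    have e2 : rho s x ^ (-(b + 2)) = (rho s x)⁻¹ * rho s x ^ (-b - 1) := by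
      rw [← Real.rpow_neg_one, ← Real.rpow_add hr]; congr 1; ring
    rw [e1, e2]
    gcongr
    exact sqrt_le_rho s x
  have hm : AEStronglyMeasurable (fun s => rho s x ^ (-(b + 2))) (volume.restrict (Ioi σ)) :=
    ((measurable_rho measurable_id measurable_const).pow_const _).aestronglyMeasurable
  have hint : IntegrableOn (fun s => rho s x ^ (-(b + 2))) (Ioi σ) := by
    refine hi.mono' hm ((ae_restrict_iff' measurableSet_Ioi).2 (Eventually.of_forall fun s hs => ?_))
    rw [Real.norm_of_nonneg (Real.rpow_nonneg (rho_nonneg _ _) _)]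
    exact hle s hs
  refine ⟨hint, (setIntegral_mono_on hint hi measurableSet_Ioi hle).trans (le_of_eq ?_)⟩
  rw [integral_const_mul, hv]
  ring

lemma oseenKernel_eq (σ : ℝ) (j k : Fin 3) (x : E3) :
    oseenKernel σ j k x = (if j = k then heatKernel σ x else 0) + ∫ s in Ioi σ, heat2 j k s x := by
  simp only [oseenKernel, pd_heatKernel, pd_heat1]

lemma oseenGradKernel_eq (σ : ℝ) (j k l : Fin 3) (x : E3) :
    oseenGradKernel σ j k l x =
      (if j = k then heat1 l σ x else 0) + ∫ s in Ioi σ, heat3 l j k s x := by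
  simp only [oseenGradKernel, pd_heatKernel, pd_heat1, pd_heat2]

lemma integrableOn_heat2 (j k : Fin 3) {σ : ℝ} (hσ : 0 < σ) (x : E3) :
    IntegrableOn (fun s => heat2 j k s x) (Ioi σ) := by
  obtain ⟨C, hC, H⟩ := abs_heat2_le (m := 5) (by norm_num)
  have := (tail_rho (b := 3) (by norm_num) hσ x).1.const_mul C
  refine this.mono' (by fun_prop) ((ae_restrict_iff' measurableSet_Ioi).2
    (Eventually.of_forall fun s hs => ?_))
  have := H j k s (hσ.trans hs) x
  norm_num at this ⊢
  exact this

lemma integrableOn_heat3 (l j k : Fin 3) {σ : ℝ} (hσ : 0 < σ) (x : E3) :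
    IntegrableOn (fun s => heat3 l j k s x) (Ioi σ) := by
  obtain ⟨C, hC, H⟩ := abs_heat3_le (m := 6) (by norm_num)
  have := (tail_rho (b := 4) (by norm_num) hσ x).1.const_mul C
  refine this.mono' (by fun_prop) ((ae_restrict_iff' measurableSet_Ioi).2
    (Eventually.of_forall fun s hs => ?_))
  have := H l j k s (hσ.trans hs) x
  norm_num at this ⊢
  exact this

lemma measurable_integral_Ioi {f : ℝ → E3 → ℝ} (hf : Measurable (fun z : ℝ × E3 => f z.1 z.2)) :
    Measurable (fun z : ℝ × E3 => ∫ s in Ioi z.1, f s z.2) := by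
  have h : StronglyMeasurable (fun p : (ℝ × E3) × ℝ =>
      (if p.1.1 < p.2 then f p.2 p.1.2 else 0)) := by
    refine (Measurable.ite (measurableSet_lt (by fun_prop) (by fun_prop)) ?_ (by fun_prop)).stronglyMeasurable
    exact hf.comp (f := fun p : (ℝ × E3) × ℝ => (p.2, p.1.2)) (by fun_prop)
  convert! (h.integral_prod_right' (ν := volume)).measurable using 2 with z
  rw [← integral_indicator measurableSet_Ioi]
  rfl

lemma measurable_oseenKernel (j k : Fin 3) :
    Measurable (fun z : ℝ × E3 => oseenKernel z.1 j k z.2) := by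
  simp_rw [oseenKernel_eq]
  refine Measurable.add ?_ (measurable_integral_Ioi (by fun_prop))
  split_ifs <;> fun_prop

lemma measurable_oseenGradKernel (j k l : Fin 3) :
    Measurable (fun z : ℝ × E3 => oseenGradKernel z.1 j k l z.2) := by
  simp_rw [oseenGradKernel_eq]
  refine Measurable.add ?_ (measurable_integral_Ioi (by fun_prop))
  split_ifs <;> fun_prop

lemma integral_Ioi_sub {f : ℝ → ℝ} {σ τ : ℝ} (h : σ ≤ τ) (hf : IntegrableOn f (Ioi σ)) :
    ∫ s in Ioi τ, f s = (∫ s in Ioi σ, f s) - ∫ s in Ioc σ τ, f s := by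
  rw [← Ioc_union_Ioi_eq_Ioi h, setIntegral_union Ioc_disjoint_Ioi_same measurableSet_Ioi
    (hf.mono_set Ioc_subset_Ioi_self) (hf.mono_set (Ioi_subset_Ioi h))]
  ring

lemma abs_setIntegral_Ioc_le {f : ℝ → ℝ} {σ τ B : ℝ} (h : σ ≤ τ) (hB : ∀ s ∈ Ioc σ τ, |f s| ≤ B) :
    |∫ s in Ioc σ τ, f s| ≤ B * (τ - σ) := by
  have := norm_setIntegral_le_of_norm_le_const (μ := volume) (s := Ioc σ τ) (f := f) (by simp) hB
  simpa [h] using this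

/-- The second derivatives of the heat kernel are O(ρ^(-5)), so their tail integral is O(ρ^(-3)). A
time increment of the tail is an integral over (σ, τ], where ρ^(-5) ≤ σ⁻¹ ρ^(-3) at time σ. -/
lemma ker_oseenKernel : ∃ C > 0, ∀ j k, Ker 3 C (fun σ => oseenKernel σ j k) := by
  obtain ⟨C₀, c₀, H₀⟩ := heatKernel_le (M := 3) (by norm_num)
  obtain ⟨C₁, c₁, H₁⟩ := abs_heatKernel_sub_le
  obtain ⟨C₂, c₂, H₂⟩ := abs_heat2_le (m := 5) (by norm_num)
  refine ⟨2 * (C₀ + C₁ + C₂), by positivity, fun j k => Ker.of_lipschitz (by norm_num)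
    (by positivity) (measurable_oseenKernel j k) (fun σ hσ z => ?_) fun σ τ hσ hστ z => ?_⟩
  · have h0 : 0 ≤ rho σ z ^ (-3 : ℝ) := Real.rpow_nonneg (rho_nonneg _ _) _
    have i1 : |if j = k then heatKernel σ z else 0| ≤ C₀ * rho σ z ^ (-3 : ℝ) := by
      split_ifs
      · rw [abs_of_nonneg (heatKernel_nonneg hσ z)]
        simpa using H₀ σ hσ z
      · rw [abs_zero]; exact mul_nonneg c₀.le h0
    have i2 : |∫ s in Ioi σ, heat2 j k s z| ≤ C₂ * rho σ z ^ (-3 : ℝ) := by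
      obtain ⟨ti, tb⟩ := tail_rho (b := 3) (by norm_num) hσ z
      have := norm_integral_le_of_norm_le (ti.const_mul C₂) (f := fun s => heat2 j k s z)
        ((ae_restrict_iff' measurableSet_Ioi).2 (Eventually.of_forall fun s hs => by
          have := H₂ j k s (hσ.trans hs) z
          norm_num at this ⊢
          exact this))
      rw [integral_const_mul, Real.norm_eq_abs] at this
      refine this.trans ?_
      gcongr
      exact tb.trans (by linarith)
    rw [oseenKernel_eq]
    refine (abs_add_le _ _).trans ?_
    nlinarith
  · have h0 : 0 ≤ (τ - σ) / σ * rho σ z ^ (-3 : ℝ) :=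
      mul_nonneg (div_nonneg (by linarith) hσ.le) (Real.rpow_nonneg (rho_nonneg _ _) _)
    have hr := rho_pos hσ z
    have i1 : |(if j = k then heatKernel τ z else 0) - (if j = k then heatKernel σ z else 0)| ≤
        C₁ * ((τ - σ) / σ * rho σ z ^ (-3 : ℝ)) := by
      split_ifs
      · refine (H₁ σ τ hσ hστ z).trans ?_
        have : σ ^ (1 / 2 : ℝ) * rho σ z ^ (-4 : ℝ) ≤ rho σ z ^ (-3 : ℝ) := by
          rw [show (-3 : ℝ) = 1 + -4 by norm_num, Real.rpow_add hr, Real.rpow_one,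
            ← Real.sqrt_eq_rpow]
          have := sqrt_le_rho σ z
          gcongr
        have h1 : 0 ≤ C₁ * ((τ - σ) / σ) := mul_nonneg c₁.le (div_nonneg (by linarith) hσ.le)
        nlinarith [mul_le_mul_of_nonneg_left this h1]
      · simp; positivity
    have i2 : |∫ s in Ioc σ τ, heat2 j k s z| ≤ C₂ * ((τ - σ) / σ * rho σ z ^ (-3 : ℝ)) := by
      refine (abs_setIntegral_Ioc_le (B := C₂ * (σ⁻¹ * rho σ z ^ (-3 : ℝ))) hστ
        fun s hs => ?_).trans (le_of_eq (by ring))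
      refine (H₂ j k s (hσ.trans hs.1) z).trans ?_
      have h1 := rpow_neg_le hr (rho_mono hs.1.le z) (show (0 : ℝ) ≤ 5 by norm_num)
      have h2 := rho_rpow_le_sqrt hσ z (show (0 : ℝ) ≤ 2 by norm_num)
      rw [show -((2 : ℝ) / 2) = -1 by norm_num, Real.rpow_neg_one] at h2
      have h3 : rho σ z ^ (-5 : ℝ) = rho σ z ^ (-2 : ℝ) * rho σ z ^ (-3 : ℝ) := by
        rw [← Real.rpow_add hr]; norm_num
      rw [show ((5 : ℝ) - 5) / 2 = 0 by norm_num, Real.rpow_zero, one_mul]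
      have h4 : 0 ≤ rho σ z ^ (-3 : ℝ) := Real.rpow_nonneg (rho_nonneg _ _) _
      gcongr
      refine h1.trans ?_
      rw [h3]
      gcongr
    rw [oseenKernel_eq, oseenKernel_eq, integral_Ioi_sub hστ (integrableOn_heat2 j k hσ z)]
    have := abs_sub ((if j = k then heatKernel τ z else 0) - (if j = k then heatKernel σ z else 0))
      (∫ s in Ioc σ τ, heat2 j k s z)
    refine le_trans (le_of_eq ?_) (this.trans ?_)
    · congr 1; ring
    · nlinarith

/-- As for `ker_oseenKernel`, one order higher: third derivatives are O(ρ^(-6)) and their tail is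
O(ρ^(-4)). -/
lemma ker_oseenGradKernel : ∃ C > 0, ∀ j k l, Ker 4 C (fun σ => oseenGradKernel σ j k l) := by
  obtain ⟨C₁, c₁, H₁⟩ := abs_heat1_le (m := 4) (by norm_num)
  obtain ⟨C₂, c₂, H₂⟩ := abs_heat3_le (m := 4) (by norm_num)
  obtain ⟨C₃, c₃, H₃⟩ := abs_heat3_le (m := 6) (by norm_num)
  have hsum : ∀ (l : Fin 3) (σ τ : ℝ), 0 < σ → σ ≤ τ → ∀ z,
      |heat1 l τ z - heat1 l σ z| ≤ 3 * (C₂ * ((τ - σ) / σ * rho σ z ^ (-4 : ℝ))) := by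
    intro l σ τ hσ hστ z
    refine (abs_sub_le_of_hasDerivAt (f := fun s => heat1 l s z)
      (B := 3 * (C₂ * (σ⁻¹ * rho σ z ^ (-4 : ℝ)))) hστ
      (fun s hs => hasDerivAt_heat1 l (hσ.trans_le hs) z) fun s hs => ?_).trans
        (le_of_eq (by ring))
    have hs0 := hσ.trans_le hs
    refine (Finset.abs_sum_le_sum_abs _ _).trans ?_
    have : ∀ j ∈ Finset.univ, |heat3 j j l s z| ≤ C₂ * (σ⁻¹ * rho σ z ^ (-4 : ℝ)) := by
      intro j _
      refine (H₂ j j l s hs0 z).trans ?_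
      rw [show ((4 : ℝ) - 6) / 2 = -1 by norm_num, Real.rpow_neg_one]
      have := rpow_neg_le (rho_pos hσ z) (rho_mono hs z) (show (0 : ℝ) ≤ 4 by norm_num)
      have h2 : 0 ≤ rho s z ^ (-4 : ℝ) := Real.rpow_nonneg (rho_nonneg _ _) _
      gcongr
    simpa using Finset.sum_le_sum this
  refine ⟨2 * (C₁ + 3 * C₂ + C₃), by positivity, fun j k l => Ker.of_lipschitz (by norm_num)
    (by positivity) (measurable_oseenGradKernel j k l) (fun σ hσ z => ?_) fun σ τ hσ hστ z => ?_⟩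
  · have h0 : 0 ≤ rho σ z ^ (-4 : ℝ) := Real.rpow_nonneg (rho_nonneg _ _) _
    have i1 : |if j = k then heat1 l σ z else 0| ≤ C₁ * rho σ z ^ (-4 : ℝ) := by
      split_ifs
      · simpa using H₁ l σ hσ z
      · rw [abs_zero]; exact mul_nonneg c₁.le h0
    have i2 : |∫ s in Ioi σ, heat3 l j k s z| ≤ C₃ * rho σ z ^ (-4 : ℝ) := by
      obtain ⟨ti, tb⟩ := tail_rho (b := 4) (by norm_num) hσ z
      have := norm_integral_le_of_norm_le (ti.const_mul C₃) (f := fun s => heat3 l j k s z)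
        ((ae_restrict_iff' measurableSet_Ioi).2 (Eventually.of_forall fun s hs => by
          have := H₃ l j k s (hσ.trans hs) z
          norm_num at this ⊢
          exact this))
      rw [integral_const_mul, Real.norm_eq_abs] at this
      refine this.trans ?_
      gcongr
      exact tb.trans (by linarith)
    rw [oseenGradKernel_eq]
    refine (abs_add_le _ _).trans ?_
    nlinarith
  · have h0 : 0 ≤ (τ - σ) / σ * rho σ z ^ (-4 : ℝ) :=
      mul_nonneg (div_nonneg (by linarith) hσ.le) (Real.rpow_nonneg (rho_nonneg _ _) _)
    have hr := rho_pos hσ z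
    have i1 : |(if j = k then heat1 l τ z else 0) - (if j = k then heat1 l σ z else 0)| ≤
        3 * (C₂ * ((τ - σ) / σ * rho σ z ^ (-4 : ℝ))) := by
      split_ifs
      · exact hsum l σ τ hσ hστ z
      · simp; positivity
    have i2 : |∫ s in Ioc σ τ, heat3 l j k s z| ≤ C₃ * ((τ - σ) / σ * rho σ z ^ (-4 : ℝ)) := by
      refine (abs_setIntegral_Ioc_le (B := C₃ * (σ⁻¹ * rho σ z ^ (-4 : ℝ))) hστ
        fun s hs => ?_).trans (le_of_eq (by ring))
      refine (H₃ l j k s (hσ.trans hs.1) z).trans ?_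
      have h1 := rpow_neg_le hr (rho_mono hs.1.le z) (show (0 : ℝ) ≤ 6 by norm_num)
      have h2 := rho_rpow_le_sqrt hσ z (show (0 : ℝ) ≤ 2 by norm_num)
      rw [show -((2 : ℝ) / 2) = -1 by norm_num, Real.rpow_neg_one] at h2
      have h3 : rho σ z ^ (-6 : ℝ) = rho σ z ^ (-2 : ℝ) * rho σ z ^ (-4 : ℝ) := by
        rw [← Real.rpow_add hr]; norm_num
      rw [show ((6 : ℝ) - 6) / 2 = 0 by norm_num, Real.rpow_zero, one_mul]
      have h4 : 0 ≤ rho σ z ^ (-4 : ℝ) := Real.rpow_nonneg (rho_nonneg _ _) _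
      gcongr
      refine h1.trans ?_
      rw [h3]
      gcongr
    rw [oseenGradKernel_eq, oseenGradKernel_eq, integral_Ioi_sub hστ (integrableOn_heat3 l j k hσ z)]
    have := abs_sub ((if j = k then heat1 l τ z else 0) - (if j = k then heat1 l σ z else 0))
      (∫ s in Ioc σ τ, heat3 l j k s z)
    refine le_trans (le_of_eq ?_) (this.trans ?_)
    · congr 1; ring
    · nlinarith

/-! ### Spatial increments of the kernels -/

lemma norm_fderiv_le_of_pd {f : E3 → ℝ} {x : E3} {B : ℝ} (h : ∀ l, |pd l f x| ≤ B) :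
    ‖fderiv ℝ f x‖ ≤ 3 * B := by
  have hB : 0 ≤ B := (abs_nonneg _).trans (h 0)
  refine ContinuousLinearMap.opNorm_le_bound _ (by positivity) fun v => ?_
  have hv : v = ∑ l, v l • EuclideanSpace.single l (1 : ℝ) := by
    ext i
    simp [Fin.sum_univ_three]
    fin_cases i <;> simp
  have : fderiv ℝ f x v = ∑ l, v l * pd l f x := by
    conv_lhs => rw [hv]
    simp [map_sum, pd]
  rw [this, Real.norm_eq_abs]
  refine (Finset.abs_sum_le_sum_abs _ _).trans ?_
  have : ∀ l ∈ Finset.univ, |v l * pd l f x| ≤ ‖v‖ * B := fun l _ => by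
    rw [abs_mul]; gcongr
    · exact abs_coord_le v l
    · exact h l
  refine (Finset.sum_le_sum this).trans (le_of_eq ?_)
  simp
  ring

/-- Spatial increments of a function whose partial derivatives are bounded on a ball. -/
lemma abs_sub_le_of_pd {f : E3 → ℝ} (hf : Differentiable ℝ f) {x y : E3} {B : ℝ}
    (h : ∀ z, ‖z - x‖ ≤ ‖y‖ → ∀ l, |pd l f z| ≤ B) : |f (x - y) - f x| ≤ 3 * B * ‖y‖ := by
  have := Convex.norm_image_sub_le_of_norm_fderiv_le (𝕜 := ℝ) (s := Metric.closedBall x ‖y‖)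
    (f := f) (C := 3 * B) (x := x) (y := x - y) (fun z _ => hf z)
    (fun z hz => norm_fderiv_le_of_pd (h z (by simpa [dist_eq_norm] using hz)))
    (convex_closedBall _ _) (by simp) (by simp)
  simpa using this

lemma rho_le_two_mul {σ s : ℝ} (h : σ ≤ s) {x y z : E3} (hy : ‖y‖ ≤ rho σ x / 2)
    (hz : ‖z - x‖ ≤ ‖y‖) : rho s x ≤ 2 * rho s z := by
  have h1 := rho_mono h x
  have h2 : ‖x‖ ≤ ‖z‖ + ‖z - x‖ := by
    have := norm_add_le z (x - z)
    rw [norm_sub_rev] at this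
    rw [add_sub_cancel] at this
    rwa [norm_sub_rev z x, norm_sub_rev x z]
  unfold rho at *
  linarith [Real.sqrt_nonneg s]

lemma abs_heatKernel_sub_space_le {m : ℝ} (hm : 0 ≤ m) : ∃ C > 0, ∀ σ : ℝ, 0 < σ → ∀ x y : E3,
    ‖y‖ ≤ rho σ x / 2 → |heatKernel σ (x - y) - heatKernel σ x| ≤
      C * ‖y‖ * (σ ^ ((m - 4) / 2) * rho σ x ^ (-m)) := by
  obtain ⟨C, hC, H⟩ := abs_heat1_le hm
  refine ⟨3 * C * 2 ^ m, by positivity, fun σ hσ x y hy => ?_⟩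
  refine (abs_sub_le_of_pd (differentiable_heatKernel σ)
    (B := C * (σ ^ ((m - 4) / 2) * (2 ^ m * rho σ x ^ (-m)))) fun z hz l => ?_).trans
      (le_of_eq (by ring))
  rw [pd_heatKernel]
  refine (H l σ hσ z).trans ?_
  have := rpow_neg_pull (rho_pos hσ z) (rho_pos hσ x) (rho_le_two_mul le_rfl hy hz) hm m
  simp only [sub_self, neg_zero, Real.rpow_zero, mul_one] at this
  gcongr

/-- On the ball of radius |y| ≤ ρ(σ,x)/2 around x the parabolic distance, at time σ and at all later
times, is at least half its value at x. The mean value inequality therefore gains one order, also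
under the tail integral. This gain is what cancellation in a temperature of mean zero exploits. -/
lemma abs_oseenKernel_sub_space_le : ∃ C > 0, ∀ (j k : Fin 3) (σ : ℝ), 0 < σ → ∀ x y : E3,
    ‖y‖ ≤ rho σ x / 2 → |oseenKernel σ j k (x - y) - oseenKernel σ j k x| ≤
      C * ‖y‖ * rho σ x ^ (-4 : ℝ) := by
  obtain ⟨C₁, c₁, H₁⟩ := abs_heatKernel_sub_space_le (m := 4) (by norm_num)
  obtain ⟨C₃, c₃, H₃⟩ := abs_heat3_le (m := 6) (by norm_num)
  refine ⟨C₁ + 3 * C₃ * 2 ^ (6 : ℝ), by positivity, fun j k σ hσ x y hy => ?_⟩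
  have h0 : 0 ≤ rho σ x ^ (-4 : ℝ) := Real.rpow_nonneg (rho_nonneg _ _) _
  have hy0 := norm_nonneg y
  have i1 : |(if j = k then heatKernel σ (x - y) else 0) - (if j = k then heatKernel σ x else 0)| ≤
      C₁ * ‖y‖ * rho σ x ^ (-4 : ℝ) := by
    split_ifs
    · simpa using H₁ σ hσ x y hy
    · simp; positivity
  have i2 : |∫ s in Ioi σ, (heat2 j k s (x - y) - heat2 j k s x)| ≤
      3 * C₃ * 2 ^ (6 : ℝ) * ‖y‖ * rho σ x ^ (-4 : ℝ) := by
    obtain ⟨ti, tb⟩ := tail_rho (b := 4) (by norm_num) hσ x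
    have := norm_integral_le_of_norm_le (ti.const_mul (3 * C₃ * 2 ^ (6 : ℝ) * ‖y‖))
      (f := fun s => heat2 j k s (x - y) - heat2 j k s x)
      ((ae_restrict_iff' measurableSet_Ioi).2 (Eventually.of_forall fun s hs => by
        have hs0 : 0 < s := hσ.trans hs
        rw [Real.norm_eq_abs]
        refine (abs_sub_le_of_pd (differentiable_heat2 j k s)
          (B := C₃ * (2 ^ (6 : ℝ) * rho s x ^ (-(6 : ℝ)))) fun z hz l => ?_).trans
            (le_of_eq (by norm_num; ring))
        rw [pd_heat2]
        refine (H₃ l j k s hs0 z).trans ?_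
        have := rpow_neg_pull (rho_pos hs0 z) (rho_pos hs0 x)
          (rho_le_two_mul (le_of_lt hs) hy hz) (show (0 : ℝ) ≤ 6 by norm_num) 6
        simp only [sub_self, neg_zero, Real.rpow_zero, mul_one, zero_div, one_mul] at this ⊢
        gcongr))
    rw [integral_const_mul, Real.norm_eq_abs] at this
    refine this.trans ?_
    gcongr
    exact tb.trans (by linarith)
  rw [integral_sub (integrableOn_heat2 j k hσ _) (integrableOn_heat2 j k hσ _)] at i2
  rw [oseenKernel_eq, oseenKernel_eq]
  have e : ∀ a b c d : ℝ, a + b - (c + d) = (a - c) + (b - d) := fun a b c d => by ring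
  rw [e]
  refine (abs_add_le _ _).trans ((add_le_add i1 i2).trans (le_of_eq (by ring)))

/-! ### Integration by parts and divergence of the Oseen kernels -/

lemma hasLineDerivAt_of_pd {f : E3 → ℝ} (hf : Differentiable ℝ f) (l : Fin 3) (x : E3) :
    HasLineDerivAt ℝ f (pd l f x) x (EuclideanSpace.single l 1) :=
  (hf x).hasFDerivAt.hasLineDerivAt _

/-- Differentiation under the tail integral: third derivatives of the heat kernel are O(s^(-3))
uniformly in x, which is integrable over s > σ. -/
lemma hasLineDerivAt_oseenKernel (j k l : Fin 3) {σ : ℝ} (hσ : 0 < σ) (x : E3) :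
    HasLineDerivAt ℝ (oseenKernel σ j k) (oseenGradKernel σ j k l x) x
      (EuclideanSpace.single l 1) := by
  obtain ⟨C₃, c₃, H₃⟩ := abs_heat3_le (m := 0) le_rfl
  set v : E3 := EuclideanSpace.single l 1 with hv
  have hd : ∀ s r, HasDerivAt (fun r : ℝ => heat2 j k s (x + r • v)) (heat3 l j k s (x + r • v)) r := by
    intro s r
    have := (hasLineDerivAt_of_pd (differentiable_heat2 j k s) l (x + r • v))
    rw [pd_heat2] at this
    have h2 : HasDerivAt (fun q : ℝ => heat2 j k s (x + r • v + q • v))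
        (heat3 l j k s (x + r • v)) (r - r) := by rw [sub_self]; exact this
    have h3 := h2.comp_sub_const r r
    simp only [sub_smul] at h3
    convert! h3 using 2 with q
    abel_nf
  have hb : IntegrableOn (fun s : ℝ => C₃ * s ^ (-3 : ℝ)) (Ioi σ) :=
    (integrableOn_Ioi_rpow_of_lt (by norm_num) hσ).const_mul C₃
  have h2 := (hasDerivAt_integral_of_dominated_loc_of_deriv_le (μ := volume.restrict (Ioi σ))
    (F := fun (r : ℝ) s => heat2 j k s (x + r • v)) (F' := fun r s => heat3 l j k s (x + r • v))
    (x₀ := (0 : ℝ)) (s := univ) (bound := fun s => C₃ * s ^ (-3 : ℝ)) univ_mem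
    (Eventually.of_forall fun r => by fun_prop)
    (integrableOn_heat2 j k hσ _) (by fun_prop)
    ((ae_restrict_iff' measurableSet_Ioi).2 (Eventually.of_forall fun s hs r _ => by
      have := H₃ l j k s (hσ.trans hs) (x + r • v)
      rw [neg_zero, Real.rpow_zero, mul_one, show ((0 : ℝ) - 6) / 2 = -3 by norm_num] at this
      exact this))
    hb (Eventually.of_forall fun s r _ => hd s r)).2
  have h1 : HasDerivAt (fun r : ℝ => if j = k then heatKernel σ (x + r • v) else 0)
      (if j = k then heat1 l σ x else 0) 0 := by
    split_ifs
    · have := hasLineDerivAt_of_pd (differentiable_heatKernel σ) l x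
      rwa [pd_heatKernel] at this
    · exact hasDerivAt_const _ _
  have h := h1.add h2
  unfold HasLineDerivAt
  simp_rw [oseenKernel_eq, oseenGradKernel_eq]
  simp only [zero_smul, add_zero] at h
  exact h

/-- The Oseen kernel is divergence-free. -/
lemma sum_oseenGradKernel (k : Fin 3) {σ : ℝ} (hσ : 0 < σ) (x : E3) :
    ∑ j, oseenGradKernel σ j k j x = 0 := by
  obtain ⟨C₁, c₁, H₁⟩ := abs_heat1_le (m := 0) le_rfl
  have ht : Tendsto (fun s => heat1 k s x) atTop (𝓝 0) := by
    have h0 : Tendsto (fun s : ℝ => C₁ * s ^ (-2 : ℝ)) atTop (𝓝 0) := by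
      simpa using (tendsto_rpow_neg_atTop (show (0 : ℝ) < 2 by norm_num)).const_mul C₁
    refine squeeze_zero_norm' ?_ h0
    filter_upwards [eventually_gt_atTop 0] with s hs
    have := H₁ k s hs x
    rw [neg_zero, Real.rpow_zero, mul_one, show ((0 : ℝ) - 4) / 2 = -2 by norm_num] at this
    exact this
  have hint : ∀ j ∈ Finset.univ, Integrable (fun s => heat3 j j k s x) (volume.restrict (Ioi σ)) :=
    fun j _ => integrableOn_heat3 j j k hσ x
  -- The sum of ∂_j∂_j∂_k g_s over j is d/ds of ∂_k g_s, so its tail integral is -∂_k g_σ. This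
  -- cancels the diagonal term.
  have h := integral_Ioi_of_hasDerivAt_of_tendsto' (a := σ)
    (fun s hs => hasDerivAt_heat1 k (hσ.trans_le hs) x) (integrable_finsetSum _ hint) ht
  rw [integral_finsetSum _ hint] at h
  simp_rw [oseenGradKernel_eq]
  rw [Finset.sum_add_distrib, h]
  simp

lemma hasLineDerivAt_comp_sub_right {f : E3 → ℝ} {f' : ℝ} {x y v : E3}
    (h : HasLineDerivAt ℝ f f' (x - y) v) : HasLineDerivAt ℝ (fun x => f (x - y)) f' x v := by
  unfold HasLineDerivAt at *
  simpa only [add_sub_right_comm] using h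

lemma hasCompactSupport_pd {φ : E3 → ℝ} (hc : HasCompactSupport φ) (l : Fin 3) :
    HasCompactSupport (pd l φ) := hc.fderiv_apply ℝ _

lemma contDiff_pd {φ : E3 → ℝ} (hφ : ContDiff ℝ ∞ φ) (l : Fin 3) : ContDiff ℝ ∞ (pd l φ) :=
  (hφ.fderiv_right (m := ∞) (by norm_num)).clm_apply contDiff_const

lemma integrable_test {φ : E3 → ℝ} (hφ : ContDiff ℝ ∞ φ) (hc : HasCompactSupport φ) :
    Integrable φ := hφ.continuous.integrable_of_hasCompactSupport hc

lemma integrable_bdd_mul_test {φ f : E3 → ℝ} (hφ : ContDiff ℝ ∞ φ) (hc : HasCompactSupport φ)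
    (hf : Measurable f) {B : ℝ} (hB : ∀ x, |f x| ≤ B) : Integrable (fun x => f x * φ x) :=
  (integrable_test hφ hc).bdd_mul (c := B) hf.aestronglyMeasurable (Eventually.of_forall hB)

lemma Ker.abs_le {p C : ℝ} {k : ℝ → E3 → ℝ} (hk : Ker p C k) (hC : 0 ≤ C) (hp : 0 ≤ p) {σ : ℝ}
    (hσ : 0 < σ) (z : E3) : |k σ z| ≤ C * σ ^ (-(p / 2)) :=
  (hk.bound σ hσ z).trans (mul_le_mul_of_nonneg_left (rho_rpow_le_sqrt hσ z hp) hC)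

lemma integral_oseenKernel_mul_pd (j k l : Fin 3) {σ : ℝ} (hσ : 0 < σ) {φ : E3 → ℝ}
    (hφ : ContDiff ℝ ∞ φ) (hc : HasCompactSupport φ) (y : E3) :
    ∫ x, oseenKernel σ j k (x - y) * pd l φ x = -∫ x, oseenGradKernel σ j k l (x - y) * φ x := by
  obtain ⟨C, hC, H⟩ := ker_oseenKernel
  obtain ⟨C', hC', H'⟩ := ker_oseenGradKernel
  have m1 : Measurable (fun x => oseenKernel σ j k (x - y)) :=
    (measurable_oseenKernel j k).comp (f := fun x => (σ, x - y)) (by fun_prop)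
  have m2 : Measurable (fun x => oseenGradKernel σ j k l (x - y)) :=
    (measurable_oseenGradKernel j k l).comp (f := fun x => (σ, x - y)) (by fun_prop)
  have b1 := fun x => (H j k).abs_le hC.le (by norm_num) hσ (x - y)
  have b2 := fun x => (H' j k l).abs_le hC'.le (by norm_num) hσ (x - y)
  exact integral_bilinear_hasLineDerivAt_right_eq_neg_left_of_integrable
    (B := ContinuousLinearMap.mul ℝ ℝ) (f := fun x => oseenKernel σ j k (x - y))
    (f' := fun x => oseenGradKernel σ j k l (x - y)) (g := φ) (g' := pd l φ)
    (v := EuclideanSpace.single l 1)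
    (integrable_bdd_mul_test hφ hc m2 b2)
    (integrable_bdd_mul_test (contDiff_pd hφ l) (hasCompactSupport_pd hc l) m1 b1)
    (integrable_bdd_mul_test hφ hc m1 b1)
    (fun x _ => hasLineDerivAt_comp_sub_right (hasLineDerivAt_oseenKernel j k l hσ (x - y)))
    (fun x _ => hasLineDerivAt_of_pd (hφ.differentiable (by simp)) l x)

/-- The columns of the Oseen kernel are divergence-free in the sense of distributions. -/
lemma sum_integral_oseenKernel_mul_pd (k : Fin 3) {σ : ℝ} (hσ : 0 < σ) {φ : E3 → ℝ}
    (hφ : ContDiff ℝ ∞ φ) (hc : HasCompactSupport φ) (y : E3) :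
    ∑ j, ∫ x, oseenKernel σ j k (x - y) * pd j φ x = 0 := by
  obtain ⟨C', hC', H'⟩ := ker_oseenGradKernel
  simp_rw [fun j => integral_oseenKernel_mul_pd j k j hσ hφ hc y]
  rw [Finset.sum_neg_distrib, ← integral_finsetSum]
  · simp_rw [← Finset.sum_mul, sum_oseenGradKernel k hσ]
    simp
  · intro j _
    exact integrable_bdd_mul_test hφ hc
      ((measurable_oseenGradKernel j k j).comp (f := fun x => (σ, x - y)) (by fun_prop))
      (fun x => (H' j k j).abs_le hC'.le (by norm_num) hσ (x - y))

lemma pd_comm {φ : E3 → ℝ} (hφ : ContDiff ℝ ∞ φ) (j l : Fin 3) : pd j (pd l φ) = pd l (pd j φ) := by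
  ext x
  have hd : DifferentiableAt ℝ (fderiv ℝ φ) x :=
    ((hφ.fderiv_right (m := 1) (by norm_cast)).differentiable (by simp)) x
  have h : ∀ i k : Fin 3, pd i (pd k φ) x =
      fderiv ℝ (fderiv ℝ φ) x (EuclideanSpace.single i 1) (EuclideanSpace.single k 1) := by
    intro i k
    have e : pd k φ = fun y => fderiv ℝ φ y (EuclideanSpace.single k 1) := rfl
    rw [e, pd, fderiv_clm_apply hd (differentiableAt_const _)]
    simp
  rw [h, h]
  exact (hφ.contDiffAt.isSymmSndFDerivAt (by simp; exact WithTop.coe_le_coe.2 (le_top (a := (2 : ℕ∞))))) _ _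

/-- Moving the l-th derivative onto the test function and commuting partial derivatives reduces this
to the Oseen kernel tested against the gradient of ∂_l φ. -/
lemma sum_integral_oseenGradKernel_mul_pd (k l : Fin 3) {σ : ℝ} (hσ : 0 < σ) {φ : E3 → ℝ}
    (hφ : ContDiff ℝ ∞ φ) (hc : HasCompactSupport φ) (y : E3) :
    ∑ j, ∫ x, oseenGradKernel σ j k l (x - y) * pd j φ x = 0 := by
  have : ∀ j, ∫ x, oseenGradKernel σ j k l (x - y) * pd j φ x =
      -∫ x, oseenKernel σ j k (x - y) * pd j (pd l φ) x := fun j => by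
    rw [pd_comm hφ, integral_oseenKernel_mul_pd j k l hσ (contDiff_pd hφ j)
      (hasCompactSupport_pd hc j), neg_neg]
  simp_rw [this]
  rw [Finset.sum_neg_distrib, sum_integral_oseenKernel_mul_pd k hσ (contDiff_pd hφ l)
    (hasCompactSupport_pd hc l), neg_zero]

lemma exists_lipschitz_test {φ : E3 → ℝ} (hφ : ContDiff ℝ ∞ φ) (hc : HasCompactSupport φ) :
    ∃ L ≥ 0, ∀ x y, |φ x - φ y| ≤ L * ‖x - y‖ := by
  obtain ⟨K, hK⟩ := hφ.lipschitzWith_of_hasCompactSupport hc (by simp)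
  exact ⟨K, K.2, fun x y => by simpa [dist_eq_norm] using hK.dist_le_mul x y⟩

/-- Averages of test functions against first derivatives of the heat kernel stay bounded. -/
lemma abs_integral_heat1_mul_test_le : ∃ C > 0, ∀ (φ : E3 → ℝ) (L : ℝ), 0 ≤ L →
    (∀ x y, |φ x - φ y| ≤ L * ‖x - y‖) → Measurable φ → (∃ B, ∀ x, |φ x| ≤ B) →
    ∀ (l : Fin 3) (σ : ℝ), 0 < σ → ∀ y : E3,
      |∫ x, heat1 l σ (x - y) * φ x| ≤ C * L := by
  obtain ⟨C, hC, H⟩ := abs_heat1_le (m := 5) (by norm_num)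
  have hI : 0 ≤ ∫ y : E3, (1 + ‖y‖) ^ (-(4 : ℝ)) := integral_nonneg fun y => by positivity
  refine ⟨C * ((∫ y : E3, (1 + ‖y‖) ^ (-(4 : ℝ))) + 1), by positivity,
    fun φ L hL hφ hm ⟨B, hB⟩ l σ hσ y => ?_⟩
  -- The kernel has integral zero, so φ y may be subtracted. The Lipschitz bound then supplies a
  -- factor ρ, which offsets the derivative.
  have e : ∫ x, heat1 l σ (x - y) * φ x = ∫ x, heat1 l σ (x - y) * (φ x - φ y) := by
    have i1 : Integrable (fun x => heat1 l σ (x - y)) := (integrable_heat1 l hσ).comp_sub_right y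
    simp_rw [mul_sub]
    rw [integral_sub (i1.mul_bdd (c := B) hm.aestronglyMeasurable (Eventually.of_forall hB))
      (i1.mul_const _), integral_mul_const,
      integral_sub_right_eq_self (fun x => heat1 l σ x) y, integral_heat1]
    ring
  have i2 := ((integrable_rho_rpow (show (3 : ℝ) < 4 by norm_num) hσ).comp_sub_right y).const_mul
    (C * L * σ ^ (1 / 2 : ℝ))
  rw [e]
  refine (norm_integral_le_of_norm_le (f := fun x => heat1 l σ (x - y) * (φ x - φ y)) i2 (Eventually.of_forall fun x => ?_)).trans ?_
  · rw [Real.norm_eq_abs, abs_mul]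
    have h1 := H l σ hσ (x - y)
    have h2 : |φ x - φ y| ≤ L * rho σ (x - y) :=
      (hφ x y).trans (mul_le_mul_of_nonneg_left (norm_le_rho _ _) hL)
    have hr := rho_pos hσ (x - y)
    refine (mul_le_mul h1 h2 (abs_nonneg _) (by positivity)).trans (le_of_eq ?_)
    rw [show (-(4 : ℝ)) = -5 + 1 by norm_num, Real.rpow_add hr, Real.rpow_one,
      show ((5 : ℝ) - 4) / 2 = 1 / 2 by norm_num]
    ring
  · rw [integral_const_mul, integral_sub_right_eq_self (fun x => rho σ x ^ (-(4 : ℝ))) y,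
      integral_rho_rpow hσ, show ((3 : ℝ) - 4) / 2 = -(1 / 2) by norm_num]
    have : σ ^ (1 / 2 : ℝ) * σ ^ (-(1 / 2) : ℝ) = 1 := by
      rw [← Real.rpow_add hσ]; norm_num
    calc _ = C * L * (∫ y : E3, (1 + ‖y‖) ^ (-(4 : ℝ))) *
          (σ ^ (1 / 2 : ℝ) * σ ^ (-(1 / 2) : ℝ)) := by ring
      _ ≤ _ := by rw [this]; nlinarith [mul_nonneg hC.le hL]

/-! ### Estimates for the heat flow of the data -/

/-- In polar coordinates the radial integrand is at most r^(2-a) near 0 and at most r^(-2) at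
infinity. -/
lemma integrable_one_add_rpow_mul_rpow {a : ℝ} (ha : a < 3) :
    Integrable (fun y : E3 => (1 + ‖y‖) ^ (-(4 - a)) * ‖y‖ ^ (-a)) := by
  rw [integrable_fun_norm_addHaar volume (f := fun r => (1 + r) ^ (-(4 - a)) * r ^ (-a)), finrank_E3,
    ← Ioc_union_Ioi_eq_Ioi zero_le_one]
  have hm : Measurable (fun r : ℝ => r ^ (3 - 1) • ((1 + r) ^ (-(4 - a)) * r ^ (-a))) := by
    fun_prop
  have e : ∀ r : ℝ, 0 < r → r ^ (3 - 1) • ((1 + r) ^ (-(4 - a)) * r ^ (-a)) =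
      (1 + r) ^ (-(4 - a)) * r ^ (2 - a) := by
    intro r hr
    have : r ^ (2 - a) = r ^ (-a) * r ^ 2 := by
      rw [← Real.rpow_add_natCast hr.ne']; congr 1; push_cast; ring
    rw [this, smul_eq_mul]; ring
  refine IntegrableOn.union ?_ ?_
  · have hi := intervalIntegral.intervalIntegrable_rpow' (a := 0) (b := 1) (r := 2 - a) (by linarith)
    rw [intervalIntegrable_iff_integrableOn_Ioc_of_le zero_le_one] at hi
    refine hi.mono' hm.aestronglyMeasurable ((ae_restrict_iff' measurableSet_Ioc).2
      (Eventually.of_forall fun r hr => ?_))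
    have h1 : (1 + r) ^ (-(4 - a)) ≤ 1 :=
      Real.rpow_le_one_of_one_le_of_nonpos (by linarith [hr.1]) (by linarith)
    have h2 : 0 ≤ r ^ (2 - a) := Real.rpow_nonneg hr.1.le _
    have h3 : 0 ≤ (1 + r) ^ (-(4 - a)) := Real.rpow_nonneg (by linarith [hr.1]) _
    rw [e r hr.1, Real.norm_of_nonneg (by positivity)]
    nlinarith
  · refine (integrableOn_Ioi_rpow_of_lt (show (-2 : ℝ) < -1 by norm_num) zero_lt_one).mono'
      hm.aestronglyMeasurable ((ae_restrict_iff' measurableSet_Ioi).2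
      (Eventually.of_forall fun r hr => ?_))
    have hr0 : (0 : ℝ) < r := zero_lt_one.trans hr
    have h1 : (1 + r) ^ (-(4 - a)) ≤ r ^ (-(4 - a)) :=
      rpow_neg_le hr0 (by linarith) (by linarith)
    have h2 : 0 ≤ r ^ (2 - a) := Real.rpow_nonneg hr0.le _
    have h3 : 0 ≤ (1 + r) ^ (-(4 - a)) := Real.rpow_nonneg (by linarith) _
    rw [e r hr0, Real.norm_of_nonneg (by positivity)]
    refine (mul_le_mul_of_nonneg_right h1 h2).trans (le_of_eq ?_)
    rw [← Real.rpow_add hr0]; congr 1; ring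

lemma integrable_rho_rpow_mul_rpow {a : ℝ} (ha : a < 3) {σ : ℝ} (hσ : 0 < σ) :
    Integrable (fun y : E3 => rho σ y ^ (-(4 - a)) * ‖y‖ ^ (-a)) ∧
      ∫ y : E3, rho σ y ^ (-(4 - a)) * ‖y‖ ^ (-a) =
        (∫ y : E3, (1 + ‖y‖) ^ (-(4 - a)) * ‖y‖ ^ (-a)) * σ ^ (-(1 / 2) : ℝ) := by
  have hs := Real.sqrt_pos.2 hσ
  have e : (fun y : E3 => rho σ y ^ (-(4 - a)) * ‖y‖ ^ (-a)) = fun y =>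
      (√σ) ^ (-4 : ℝ) * ((1 + ‖(√σ)⁻¹ • y‖) ^ (-(4 - a)) * ‖(√σ)⁻¹ • y‖ ^ (-a)) := by
    ext y
    have h4 : (√σ) ^ (-4 : ℝ) = (√σ) ^ (-(4 - a)) * (√σ) ^ (-a) := by
      rw [← Real.rpow_add hs]; congr 1; ring
    have h5 : ∀ p q r s : ℝ, p * q * (r * s) = (p * r) * (q * s) := fun p q r s => by ring
    rw [norm_smul, norm_inv, Real.norm_of_nonneg hs.le, h4, h5, ← Real.mul_rpow hs.le (by positivity),
      ← Real.mul_rpow hs.le (by positivity)]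
    unfold rho
    congr 2 <;> field_simp
  have h := integrable_one_add_rpow_mul_rpow ha
  rw [e]
  refine ⟨(h.comp_smul (R := (√σ)⁻¹) (inv_ne_zero hs.ne')).const_mul _, ?_⟩
  rw [integral_const_mul, Measure.integral_comp_inv_smul volume
    (fun y : E3 => (1 + ‖y‖) ^ (-(4 - a)) * ‖y‖ ^ (-a)), finrank_E3, abs_of_pos (by positivity),
    smul_eq_mul, ← mul_assoc, mul_comm]
  congr 1
  rw [← Real.rpow_natCast, ← Real.rpow_add hs, Real.sqrt_eq_rpow, ← Real.rpow_mul hσ.le]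
  congr 1; norm_num

lemma ae_ne_zero : ∀ᵐ y : E3, y ≠ 0 := by
  simp [ae_iff, measure_singleton]

lemma norm_le_add_rho (t : ℝ) (x y : E3) : rho t x ≤ rho t (x - y) + ‖y‖ := by
  have := norm_add_le (x - y) y
  rw [sub_add_cancel] at this
  unfold rho; linarith

/-- Convolution of a heat-like majorant with a homogeneous singularity. -/
lemma integrable_heat_majorant {a : ℝ} (ha0 : 0 < a) (ha : a < 3) : ∃ C > 0, ∀ t : ℝ, 0 < t →
    ∀ x : E3, Integrable (fun y => t ^ (1 / 2 : ℝ) * rho t (x - y) ^ (-4 : ℝ) * ‖y‖ ^ (-a)) ∧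
      ∫ y, t ^ (1 / 2 : ℝ) * rho t (x - y) ^ (-4 : ℝ) * ‖y‖ ^ (-a) ≤ C * rho t x ^ (-a) := by
  have hI : 0 ≤ ∫ y : E3, (1 + ‖y‖) ^ (-(4 : ℝ)) := integral_nonneg fun y => by positivity
  have hJ : 0 ≤ ∫ y : E3, (1 + ‖y‖) ^ (-(4 - a)) * ‖y‖ ^ (-a) :=
    integral_nonneg fun y => by positivity
  set I := ∫ y : E3, (1 + ‖y‖) ^ (-(4 : ℝ)) with hIdef
  set J := ∫ y : E3, (1 + ‖y‖) ^ (-(4 - a)) * ‖y‖ ^ (-a) with hJdef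
  refine ⟨2 ^ a * (2 * I + 2 ^ (4 : ℝ) * J) + 1, by positivity, fun t ht x => ?_⟩
  have hs := Real.sqrt_pos.2 ht
  have hR := rho_pos ht x
  have i1 := (integrable_rho_rpow (show (3 : ℝ) < 4 by norm_num) ht).comp_sub_left x
  have v1 : ∫ y, rho t (x - y) ^ (-4 : ℝ) = I * t ^ (-(1 / 2) : ℝ) := by
    rw [integral_sub_left_eq_self (fun y => rho t y ^ (-4 : ℝ)), integral_rho_rpow ht, hIdef,
      show ((3 : ℝ) - 4) / 2 = -(1 / 2) by norm_num]
  obtain ⟨i2, v2⟩ := integrable_rho_rpow_mul_rpow ha ht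
  have i3 := ((i1.const_mul 2).add (i2.const_mul (2 ^ (4 : ℝ)))).const_mul
    (t ^ (1 / 2 : ℝ) * (2 ^ a * rho t x ^ (-a)))
  have hle : ∀ᵐ y : E3, ‖t ^ (1 / 2 : ℝ) * rho t (x - y) ^ (-4 : ℝ) * ‖y‖ ^ (-a)‖ ≤
      t ^ (1 / 2 : ℝ) * (2 ^ a * rho t x ^ (-a)) *
        (2 * rho t (x - y) ^ (-4 : ℝ) + 2 ^ (4 : ℝ) * (rho t y ^ (-(4 - a)) * ‖y‖ ^ (-a))) := by
    filter_upwards [ae_ne_zero] with y hy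
    have hy0 : 0 < ‖y‖ := norm_pos_iff.2 hy
    have hA := rho_pos ht (x - y)
    have hB := rho_pos ht y
    have n1 : 0 ≤ rho t (x - y) ^ (-4 : ℝ) := Real.rpow_nonneg hA.le _
    have n2 : 0 ≤ ‖y‖ ^ (-a) := by positivity
    have n3 : 0 ≤ rho t y ^ (-(4 - a)) := Real.rpow_nonneg hB.le _
    rw [Real.norm_of_nonneg (by positivity), mul_assoc, mul_assoc]
    refine mul_le_mul_of_nonneg_left ?_ (by positivity)
    refine (rpow_neg_split hA hy0 hR (norm_le_add_rho t x y) ha0.le 4 a).trans ?_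
    rw [sub_self, neg_zero, Real.rpow_zero, mul_one, ← mul_assoc]
    refine mul_le_mul_of_nonneg_left ?_ (by positivity)
    suffices h : rho t (x - y) ^ (-(4 - a)) * ‖y‖ ^ (-a) ≤
        rho t (x - y) ^ (-4 : ℝ) + 2 ^ (4 : ℝ) * (rho t y ^ (-(4 - a)) * ‖y‖ ^ (-a)) by linarith
    have h24 : (2 : ℝ) ^ (4 - a) ≤ 2 ^ (4 : ℝ) :=
      Real.rpow_le_rpow_of_exponent_le (by norm_num) (by linarith)
    -- The aim is to move the mixed product to one centred at y = 0, whose integral is known by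
    -- scaling. For |y| ≤ √t, both ρ(t,x-y) and ρ(t,y) can be compared with √t. For |y| ≥ √t the
    -- product is decoupled into ρ(t,x-y)^(-4) and |y|^(-4), and |y| is comparable with ρ(t,y).
    rcases le_total ‖y‖ (√t) with h | h
    · have h1 : rho t (x - y) ^ (-(4 - a)) ≤ (√t) ^ (-(4 - a)) :=
        rpow_neg_le hs (sqrt_le_rho _ _) (by linarith)
      have h2 := rpow_neg_pull hs hB (show rho t y ≤ 2 * √t by unfold rho; linarith)
        (show 0 ≤ 4 - a by linarith) (4 - a)
      rw [sub_self, neg_zero, Real.rpow_zero, mul_one] at h2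
      have h3 : (√t) ^ (-(4 - a)) ≤ 2 ^ (4 : ℝ) * rho t y ^ (-(4 - a)) :=
        h2.trans (mul_le_mul_of_nonneg_right h24 n3)
      have := mul_le_mul_of_nonneg_right (h1.trans h3) n2
      linarith
    · have h1 := rpow_neg_mul_le_add hA hy0 (show 0 ≤ 4 - a by linarith) ha0.le
      rw [sub_add_cancel] at h1
      have h2 : ‖y‖ ^ (-4 : ℝ) ≤ 2 ^ (4 : ℝ) * (rho t y ^ (-(4 - a)) * ‖y‖ ^ (-a)) := by
        have h2 := rpow_neg_pull hy0 hB (show rho t y ≤ 2 * ‖y‖ by unfold rho; linarith)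
          (show 0 ≤ 4 - a by linarith) 4
        rw [show (4 : ℝ) - (4 - a) = a by ring] at h2
        exact h2.trans (mul_le_mul_of_nonneg_right h24 (by positivity))
      linarith
  have hm : Measurable (fun y => t ^ (1 / 2 : ℝ) * rho t (x - y) ^ (-4 : ℝ) * ‖y‖ ^ (-a)) := by
    fun_prop
  refine ⟨i3.mono' hm.aestronglyMeasurable hle, ?_⟩
  refine (le_abs_self _).trans ((norm_integral_le_of_norm_le i3 hle).trans ?_)
  rw [integral_const_mul, integral_add' (i1.const_mul 2) (i2.const_mul (2 ^ (4 : ℝ))),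
    integral_const_mul, integral_const_mul, v1, v2]
  have : t ^ (1 / 2 : ℝ) * t ^ (-(1 / 2) : ℝ) = 1 := by rw [← Real.rpow_add ht]; norm_num
  calc _ = (2 ^ a * (2 * I + 2 ^ (4 : ℝ) * J)) * rho t x ^ (-a) *
        (t ^ (1 / 2 : ℝ) * t ^ (-(1 / 2) : ℝ)) := by ring
    _ ≤ _ := by rw [this]; nlinarith [Real.rpow_nonneg hR.le (-a)]

/-- Convolution of a heat-like kernel with a function bounded by a homogeneous one. -/
lemma conv_le_of_rpow {a : ℝ} (ha0 : 0 < a) (ha : a < 3) : ∃ C > 0, ∀ (t κ D : ℝ) (k f : E3 → ℝ),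
    0 < t → 0 ≤ κ → 0 ≤ D → (∀ z, |k z| ≤ κ * (t ^ (1 / 2 : ℝ) * rho t z ^ (-4 : ℝ))) →
    (∀ᵐ y, |f y| ≤ D * ‖y‖ ^ (-a)) → Measurable k → AEStronglyMeasurable f volume → ∀ x,
    Integrable (fun y => k (x - y) * f y) ∧
      |∫ y, k (x - y) * f y| ≤ C * (κ * D) * rho t x ^ (-a) := by
  obtain ⟨C, hC, H⟩ := integrable_heat_majorant ha0 ha
  refine ⟨C, hC, fun t κ D k f ht hκ hD hk hf hkm hfm x => ?_⟩
  obtain ⟨hi, hv⟩ := H t ht x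
  have hle : ∀ᵐ y, ‖k (x - y) * f y‖ ≤
      κ * D * (t ^ (1 / 2 : ℝ) * rho t (x - y) ^ (-4 : ℝ) * ‖y‖ ^ (-a)) := by
    filter_upwards [hf] with y hy
    rw [norm_mul, Real.norm_eq_abs, Real.norm_eq_abs]
    refine (mul_le_mul (hk (x - y)) hy (abs_nonneg _) ?_).trans (le_of_eq (by ring))
    exact (abs_nonneg _).trans (hk (x - y))
  refine ⟨(hi.const_mul (κ * D)).mono' ?_ hle, ?_⟩
  · exact (hkm.comp (by fun_prop : Measurable fun y => x - y)).aestronglyMeasurable.mul hfm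
  · refine (norm_integral_le_of_norm_le (hi.const_mul (κ * D)) hle).trans ?_
    rw [integral_const_mul]
    calc _ ≤ κ * D * (C * rho t x ^ (-a)) := by gcongr
      _ = _ := by ring

lemma sqrt_mul_rho_rpow_le {t : ℝ} (ht : 0 < t) (z : E3) :
    t ^ (1 / 2 : ℝ) * rho t z ^ (-4 : ℝ) ≤ rho t z ^ (-3 : ℝ) := by
  have hr := rho_pos ht z
  rw [show (-3 : ℝ) = 1 + -4 by norm_num, Real.rpow_add hr, Real.rpow_one, ← Real.sqrt_eq_rpow]
  have := sqrt_le_rho t z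
  have := Real.rpow_nonneg hr.le (-4)
  gcongr

/-- Convolution of a heat-like kernel with an integrable function of size `|y| ^ (-3)`. -/
lemma conv_le_of_integrable : ∃ C > 0, ∀ (t κ D : ℝ) (k f : E3 → ℝ),
    0 < t → 0 ≤ κ → 0 ≤ D → (∀ z, |k z| ≤ κ * (t ^ (1 / 2 : ℝ) * rho t z ^ (-4 : ℝ))) →
    (∀ᵐ y, |f y| ≤ D * ‖y‖ ^ (-3 : ℝ)) → Measurable k → Integrable f → ∫ y, |f y| ≤ D → ∀ x,
    Integrable (fun y => k (x - y) * f y) ∧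
      |∫ y, k (x - y) * f y| ≤ C * (κ * D) * rho t x ^ (-3 : ℝ) := by
  have hI : 0 ≤ ∫ y : E3, (1 + ‖y‖) ^ (-(4 : ℝ)) := integral_nonneg fun y => by positivity
  set I := ∫ y : E3, (1 + ‖y‖) ^ (-(4 : ℝ)) with hIdef
  refine ⟨2 ^ (3 : ℝ) * (1 + I), by positivity, fun t κ D k f ht hκ hD hk hf hkm hfi hfD x => ?_⟩
  have hR := rho_pos ht x
  have i1 := (integrable_rho_rpow (show (3 : ℝ) < 4 by norm_num) ht).comp_sub_left x
  have v1 : ∫ y, rho t (x - y) ^ (-4 : ℝ) = I * t ^ (-(1 / 2) : ℝ) := by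
    rw [integral_sub_left_eq_self (fun y => rho t y ^ (-4 : ℝ)), integral_rho_rpow ht, hIdef,
      show ((3 : ℝ) - 4) / 2 = -(1 / 2) by norm_num]
  have i3 := (hfi.abs.add (i1.const_mul (D * t ^ (1 / 2 : ℝ)))).const_mul
    (2 ^ (3 : ℝ) * κ * rho t x ^ (-3 : ℝ))
  have hle : ∀ᵐ y : E3, ‖k (x - y) * f y‖ ≤ 2 ^ (3 : ℝ) * κ * rho t x ^ (-3 : ℝ) *
        (|f y| + D * t ^ (1 / 2 : ℝ) * rho t (x - y) ^ (-4 : ℝ)) := by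
    filter_upwards [ae_ne_zero, hf] with y hy hfy
    have hy0 : 0 < ‖y‖ := norm_pos_iff.2 hy
    have hA := rho_pos ht (x - y)
    have n1 : 0 ≤ rho t (x - y) ^ (-4 : ℝ) := Real.rpow_nonneg hA.le _
    have n2 : 0 ≤ rho t x ^ (-3 : ℝ) := Real.rpow_nonneg hR.le _
    have n3 := abs_nonneg (f y)
    have n4 : 0 ≤ t ^ (1 / 2 : ℝ) := by positivity
    rw [norm_mul, Real.norm_eq_abs, Real.norm_eq_abs]
    refine (mul_le_mul_of_nonneg_right (hk (x - y)) n3).trans ?_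
    have h3 := norm_le_add_rho t x y
    -- One of |y| and ρ(t,x-y) is at least ρ(t,x)/2. In the first case the kernel gives ρ(t,x)^(-3)
    -- and f is integrated; in the second the pointwise bound on f gives it and the kernel is
    -- integrated.
    rcases le_total ‖y‖ (rho t (x - y)) with h | h
    · have h1 := rpow_neg_pull hA hR (by linarith) (show (0 : ℝ) ≤ 3 by norm_num) 3
      rw [sub_self, neg_zero, Real.rpow_zero, mul_one] at h1
      have h2 := (sqrt_mul_rho_rpow_le ht (x - y)).trans h1
      have h4 : κ * (t ^ (1 / 2 : ℝ) * rho t (x - y) ^ (-4 : ℝ)) * |f y| ≤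
        κ * (2 ^ (3 : ℝ) * rho t x ^ (-3 : ℝ)) * |f y| := by gcongr
      have h5 : 0 ≤ 2 ^ (3 : ℝ) * κ * rho t x ^ (-3 : ℝ) *
        (D * t ^ (1 / 2 : ℝ) * rho t (x - y) ^ (-4 : ℝ)) := by positivity
      linarith
    · have h1 := rpow_neg_pull hy0 hR (by linarith) (show (0 : ℝ) ≤ 3 by norm_num) 3
      rw [sub_self, neg_zero, Real.rpow_zero, mul_one] at h1
      have h2 : |f y| ≤ D * (2 ^ (3 : ℝ) * rho t x ^ (-3 : ℝ)) := hfy.trans (by gcongr)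
      have h4 : κ * (t ^ (1 / 2 : ℝ) * rho t (x - y) ^ (-4 : ℝ)) * |f y| ≤
        κ * (t ^ (1 / 2 : ℝ) * rho t (x - y) ^ (-4 : ℝ)) *
          (D * (2 ^ (3 : ℝ) * rho t x ^ (-3 : ℝ))) := by gcongr
      have h5 : 0 ≤ 2 ^ (3 : ℝ) * κ * rho t x ^ (-3 : ℝ) * |f y| := by positivity
      linarith
  refine ⟨i3.mono' ?_ hle, ?_⟩
  · exact (hkm.comp (by fun_prop : Measurable fun y => x - y)).aestronglyMeasurable.mul hfi.1
  · refine (norm_integral_le_of_norm_le i3 hle).trans ?_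
    rw [integral_const_mul, integral_add' hfi.abs (i1.const_mul _), integral_const_mul, v1]
    have : t ^ (1 / 2 : ℝ) * t ^ (-(1 / 2) : ℝ) = 1 := by rw [← Real.rpow_add ht]; norm_num
    have n2 : 0 ≤ rho t x ^ (-3 : ℝ) := Real.rpow_nonneg hR.le _
    calc _ = 2 ^ (3 : ℝ) * κ * rho t x ^ (-3 : ℝ) *
          ((∫ y, |f y|) + D * I * (t ^ (1 / 2 : ℝ) * t ^ (-(1 / 2) : ℝ))) := by ring
      _ ≤ 2 ^ (3 : ℝ) * κ * rho t x ^ (-3 : ℝ) * (D + D * I) := by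
        rw [this, mul_one]; gcongr
      _ = _ := by ring

lemma heatKernel_bound : ∃ C > 0, ∀ t : ℝ, 0 < t → ∀ z : E3,
    |heatKernel t z| ≤ C * (t ^ (1 / 2 : ℝ) * rho t z ^ (-4 : ℝ)) := by
  obtain ⟨C, hC, H⟩ := heatKernel_le (M := 4) (by norm_num)
  refine ⟨C, hC, fun t ht z => ?_⟩
  rw [abs_of_nonneg (heatKernel_nonneg ht z)]
  have := H t ht z
  rwa [show ((4 : ℝ) - 3) / 2 = 1 / 2 by norm_num] at this

/-! ### Duhamel integrals -/

/-- The Duhamel integral of `f` with kernel `k`. -/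
def duh (k : ℝ → E3 → ℝ) (f : ℝ × E3 → ℝ) (t : ℝ) (x : E3) : ℝ :=
  ∫ z, k (t - z.1) (x - z.2) * f z ∂nu t

/-- The integral of power weights which dominates Duhamel integrals. -/
def powInt (g p q t : ℝ) (x : E3) : ℝ :=
  ∫ z, (t - z.1) ^ (-g) * (rho (t - z.1) (x - z.2) ^ (-p) * rho z.1 z.2 ^ (-q)) ∂nu t

lemma measurable_kernel_comp {k : ℝ → E3 → ℝ} (hk : Measurable (fun z : ℝ × E3 => k z.1 z.2))
    {α : Type*} [MeasurableSpace α] {f : α → ℝ} {g : α → E3} (hf : Measurable f)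
    (hg : Measurable g) : Measurable (fun a => k (f a) (g a)) :=
  hk.comp (hf.prodMk hg)

lemma Ker.integrand_integrable {p C : ℝ} {k : ℝ → E3 → ℝ} (hk : Ker p C k) (hC : 0 ≤ C)
    {f w : ℝ × E3 → ℝ} {t c : ℝ} {x : E3} (hfm : AEStronglyMeasurable f (nu t))
    (hf : ∀ᵐ z ∂nu t, |f z| ≤ w z)
    (H : Dom t (fun z => rho (t - z.1) (x - z.2) ^ (-p) * w z) c) :
    Integrable (fun z => k (t - z.1) (x - z.2) * f z) (nu t) ∧ |duh k f t x| ≤ C * c := by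
  have hle : ∀ᵐ z ∂nu t, ‖k (t - z.1) (x - z.2) * f z‖ ≤
      C * (rho (t - z.1) (x - z.2) ^ (-p) * w z) := by
    filter_upwards [hf, ae_nu_mem t] with z hz hs
    rw [norm_mul, Real.norm_eq_abs, Real.norm_eq_abs, ← mul_assoc]
    have h1 := hk.bound (t - z.1) (by linarith [hs.2]) (x - z.2)
    exact mul_le_mul h1 hz (abs_nonneg _) ((abs_nonneg _).trans h1)
  refine ⟨(H.integrable.const_mul C).mono' ?_ hle, (H.const_mul hC).norm_integral_le hle⟩
  exact (measurable_kernel_comp hk.measurable (by fun_prop) (by fun_prop)).aestronglyMeasurable.mul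
    hfm

lemma duh_congr {k : ℝ → E3 → ℝ} {f f' : ℝ × E3 → ℝ} (h : f =ᵐ[spaceTime] f') (t : ℝ) (x : E3) :
    duh k f t x = duh k f' t x :=
  integral_congr_ae (by filter_upwards [ae_nu_of_spaceTime h] with z hz; rw [hz])

lemma stronglyMeasurable_duh {k : ℝ → E3 → ℝ} (hk : Measurable (fun z : ℝ × E3 => k z.1 z.2))
    {f : ℝ × E3 → ℝ} (hf : AEStronglyMeasurable f spaceTime) :
    StronglyMeasurable (fun z : ℝ × E3 => duh k f z.1 z.2) := by
  have e : ∀ z : ℝ × E3, duh k f z.1 z.2 = ∫ w : ℝ × E3,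
      (if 0 < w.1 ∧ w.1 < z.1 then k (z.1 - w.1) (z.2 - w.2) * hf.mk f w else 0) := by
    intro z
    rw [duh_congr hf.ae_eq_mk, duh, nu_eq, ← integral_indicator
      (measurableSet_Ioo.prod MeasurableSet.univ), ← Measure.volume_eq_prod]
    congr 1
    ext w
    simp [indicator]
  simp_rw [e]
  have h : StronglyMeasurable (fun p : (ℝ × E3) × (ℝ × E3) =>
      (if 0 < p.2.1 ∧ p.2.1 < p.1.1 then k (p.1.1 - p.2.1) (p.1.2 - p.2.2) * hf.mk f p.2
        else 0)) := by
    refine (Measurable.ite ?_ ?_ measurable_const).stronglyMeasurable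
    · exact (measurableSet_lt measurable_const (measurable_fst.comp measurable_snd)).inter
        (measurableSet_lt (measurable_fst.comp measurable_snd) (measurable_fst.comp measurable_fst))
    · exact (measurable_kernel_comp hk (by fun_prop) (by fun_prop)).mul
        (hf.stronglyMeasurable_mk.measurable.comp measurable_snd)
  exact h.integral_prod_right' (ν := volume)

lemma aestronglyMeasurable_nu {f : ℝ × E3 → ℝ} (hf : AEStronglyMeasurable f spaceTime) (t : ℝ) :
    AEStronglyMeasurable f (nu t) := hf.mono_measure (nu_le_spaceTime t)

lemma nu_restrict {s t : ℝ} (h : s ≤ t) : nu s = (nu t).restrict {z | z.1 < s} := by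
  rw [nu_eq, nu_eq, Measure.restrict_restrict (measurableSet_lt measurable_fst measurable_const)]
  congr 1
  ext z
  simp only [mem_prod, mem_Ioo, mem_univ, and_true, mem_inter_iff, mem_ofPred_eq]
  constructor
  · rintro ⟨h1, h2⟩; exact ⟨h2, h1, h2.trans_le h⟩
  · rintro ⟨h1, h2, -⟩; exact ⟨h2, h1⟩

lemma integrable_powInt {g p q : ℝ} (hp : 0 < p) (hq : 0 < q) (hp5 : p < 5) (hq5 : q < 5)
    (hpq : 5 ≤ p + q) (hg : g < q / 10) (hg' : g < (5 - p) / 10) {t : ℝ} (ht : 0 < t) (x : E3) :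
    Integrable (fun z => (t - z.1) ^ (-g) *
      (rho (t - z.1) (x - z.2) ^ (-p) * rho z.1 z.2 ^ (-q))) (nu t) := by
  obtain ⟨C, -, H⟩ := dom_crit hp hq hp5 hq5 hpq hg hg'
  exact (H t ht x).integrable

/-- Duhamel integrals are Hölder continuous in time, with a bound by integrals of powers. -/
lemma Ker.abs_duh_sub_le {p C : ℝ} {k : ℝ → E3 → ℝ} (hk : Ker p C k) (hC : 0 ≤ C) {q M : ℝ}
    (hM : 0 ≤ M) (hp : 0 < p) (hq : 0 < q) (hp5 : p < 5) (hq5 : q < 5) (hpq : 5 ≤ p + q)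
    (hg : 1 / 20 < q / 10) (hg' : 1 / 20 < (5 - p) / 10)
    {f : ℝ × E3 → ℝ} (hfm : AEStronglyMeasurable f spaceTime)
    (hf : ∀ᵐ z ∂spaceTime, |f z| ≤ M * rho z.1 z.2 ^ (-q)) {s t : ℝ} (hs : 0 < s) (hst : s ≤ t)
    (x : E3) : |duh k f t x - duh k f s x| ≤
      C * M * (t - s) ^ (1 / 20 : ℝ) * (powInt (1 / 20) p q t x + powInt (1 / 20) p q s x) := by
  have ht := hs.trans_le hst
  have hmS : MeasurableSet {z : ℝ × E3 | z.1 < s} :=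
    measurableSet_lt measurable_fst measurable_const
  have hint : ∀ r, 0 < r → Integrable (fun z => k (r - z.1) (x - z.2) * f z) (nu r) := by
    intro r hr
    obtain ⟨C₀, -, H₀⟩ := dom_crit (g := 0) hp hq hp5 hq5 hpq (by linarith) (by linarith)
    have := (H₀ r hr x).const_mul hM
    simp only [neg_zero, Real.rpow_zero, one_mul] at this
    refine (hk.integrand_integrable hC (w := fun z => M * rho z.1 z.2 ^ (-q))
      (aestronglyMeasurable_nu hfm r)
      (ae_nu_of_spaceTime hf) (c := M * (C₀ * rho r x ^ (-(p + q - 5)))) ?_).1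
    convert! this using 2
    ring
  have hP : ∀ r, 0 < r → Integrable (fun z => (r - z.1) ^ (-(1 / 20 : ℝ)) *
      (rho (r - z.1) (x - z.2) ^ (-p) * rho z.1 z.2 ^ (-q))) (nu r) := fun r hr =>
    integrable_powInt hp hq hp5 hq5 hpq hg hg' hr x
  have hi1 := hint s hs
  have hP1 := hP s hs
  rw [nu_restrict hst] at hi1 hP1
  have e1 : duh k f s x = ∫ z, {z : ℝ × E3 | z.1 < s}.indicator
      (fun z => k (s - z.1) (x - z.2) * f z) z ∂nu t := by
    rw [integral_indicator hmS, ← nu_restrict hst, duh]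
  have e2 : powInt (1 / 20) p q s x = ∫ z, {z : ℝ × E3 | z.1 < s}.indicator
      (fun z => (s - z.1) ^ (-(1 / 20 : ℝ)) *
        (rho (s - z.1) (x - z.2) ^ (-p) * rho z.1 z.2 ^ (-q))) z ∂nu t := by
    rw [integral_indicator hmS, ← nu_restrict hst, powInt]
  rw [e1, e2, duh, powInt, ← integral_sub (hint t ht) ((integrable_indicator_iff hmS).2 hi1),
    ← integral_add (hP t ht) ((integrable_indicator_iff hmS).2 hP1), ← integral_const_mul]
  rw [← Real.norm_eq_abs]
  refine norm_integral_le_of_norm_le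
    (((hP t ht).add ((integrable_indicator_iff hmS).2 hP1)).const_mul _) ?_
  filter_upwards [ae_nu_of_spaceTime hf, ae_nu_mem t] with z hz hzt
  have hzt' : 0 < t - z.1 := by linarith [hzt.2]
  have n1 : 0 ≤ (t - s) ^ (1 / 20 : ℝ) := Real.rpow_nonneg (by linarith) _
  have n2 : ∀ r : ℝ, 0 ≤ rho r (x - z.2) ^ (-p) := fun r => Real.rpow_nonneg (rho_nonneg _ _) _
  have n3 : 0 ≤ rho z.1 z.2 ^ (-q) := Real.rpow_nonneg (rho_nonneg _ _) _
  have n4 : 0 ≤ (t - z.1) ^ (-(1 / 20) : ℝ) := Real.rpow_nonneg hzt'.le _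
  have n5 := abs_nonneg (f z)
  rw [Real.norm_eq_abs]
  by_cases hzs : z.1 < s
  · have hzs' : 0 < s - z.1 := by linarith
    rw [indicator_of_mem (by exact hzs), indicator_of_mem (by exact hzs), ← sub_mul, abs_mul]
    have h1 := hk.holder (s - z.1) (t - z.1) hzs' (by linarith) (x - z.2)
    rw [show t - z.1 - (s - z.1) = t - s by ring] at h1
    have n6 : 0 ≤ (s - z.1) ^ (-(1 / 20) : ℝ) := Real.rpow_nonneg hzs'.le _
    have h2 := mul_le_mul h1 hz n5 ((abs_nonneg _).trans h1)
    refine h2.trans ?_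
    have h3 : 0 ≤ C * M * (t - s) ^ (1 / 20 : ℝ) * ((t - z.1) ^ (-(1 / 20) : ℝ) *
      (rho (t - z.1) (x - z.2) ^ (-p) * rho z.1 z.2 ^ (-q))) := by
        have := n2 (t - z.1)
        positivity
    linarith
  · rw [indicator_of_notMem (by exact hzs), indicator_of_notMem (by exact hzs), sub_zero, add_zero,
      abs_mul]
    have h1 := mul_le_mul (hk.bound (t - z.1) hzt' (x - z.2)) hz n5
      ((abs_nonneg _).trans (hk.bound (t - z.1) hzt' (x - z.2)))
    refine h1.trans ?_
    -- For times in [s, t) there is no earlier integrand to compare with, but 0 < t - z.1 ≤ t - s,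
    -- so the Hölder factor can be inserted for free.
    have h2 : 1 ≤ (t - s) ^ (1 / 20 : ℝ) * (t - z.1) ^ (-(1 / 20) : ℝ) := by
      rw [Real.rpow_neg hzt'.le, ← div_eq_mul_inv, one_le_div (by positivity)]
      exact Real.rpow_le_rpow hzt'.le (by linarith [not_lt.1 hzs]) (by norm_num)
    have h3 : 0 ≤ C * M * (rho (t - z.1) (x - z.2) ^ (-p) * rho z.1 z.2 ^ (-q)) := by
      have := n2 (t - z.1)
      positivity
    have := mul_le_mul_of_nonneg_left h2 h3
    linarith

lemma powInt_nonneg (g p q t : ℝ) (x : E3) : 0 ≤ powInt g p q t x := by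
  refine integral_nonneg_of_ae ?_
  filter_upwards [ae_nu_mem t] with z hz
  exact mul_nonneg (Real.rpow_nonneg (by linarith [hz.2]) _)
    (mul_rpow_nonneg (rho_nonneg _ _) (rho_nonneg _ _))

lemma measurable_powInt (g p q t : ℝ) : Measurable (fun x => powInt g p q t x) := by
  have h : StronglyMeasurable (fun w : E3 × (ℝ × E3) => (t - w.2.1) ^ (-g) *
      (rho (t - w.2.1) (w.1 - w.2.2) ^ (-p) * rho w.2.1 w.2.2 ^ (-q))) :=
    Measurable.stronglyMeasurable (by fun_prop)
  exact (h.integral_prod_right' (ν := nu t)).measurable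

/-- The Duhamel integrals of order `-4` with data of order `-4` are bounded in `L¹`. -/
lemma lintegral_powInt_le {g : ℝ} (hg : g < 1 / 2) : ∃ C > 0, ∀ t : ℝ, 0 < t →
    ∫⁻ x, ENNReal.ofReal (powInt g 4 4 t x) ≤ ENNReal.ofReal (C * t ^ (-g)) := by
  obtain ⟨C₁, c₁, H₁⟩ := lintegral_rho_rpow 4 (by norm_num)
  obtain ⟨C₂, c₂, H₂⟩ := dom_right (N := 4) (a := g + 1 / 2) (b := 0) (by norm_num) (by linarith)
    (by norm_num)
  refine ⟨C₁ * C₂, by positivity, fun t ht => ?_⟩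
  have hA : ∀ (x : E3) (z : ℝ × E3), 0 ≤ rho (t - z.1) (x - z.2) ^ (-(4 : ℝ)) * rho z.1 z.2 ^ (-(4 : ℝ)) :=
    fun x z => mul_rpow_nonneg (rho_nonneg _ _) (rho_nonneg _ _)
  calc ∫⁻ x, ENNReal.ofReal (powInt g 4 4 t x)
      ≤ ∫⁻ x : E3, ∫⁻ z : ℝ × E3, ENNReal.ofReal ((t - z.1) ^ (-g) * (rho (t - z.1) (x - z.2) ^ (-(4 : ℝ)) *
          rho z.1 z.2 ^ (-(4 : ℝ)))) ∂nu t := by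
        refine lintegral_mono fun x => ?_
        refine ENNReal.ofReal_le_of_le_toReal ?_
        rw [powInt, integral_eq_lintegral_of_nonneg_ae]
        · filter_upwards [ae_nu_mem t] with z hz
          exact mul_nonneg (Real.rpow_nonneg (by linarith [hz.2]) _) (hA x z)
        · exact Measurable.aestronglyMeasurable (by fun_prop)
    _ = ∫⁻ z : ℝ × E3, (∫⁻ x : E3, ENNReal.ofReal ((t - z.1) ^ (-g) *
          (rho (t - z.1) (x - z.2) ^ (-(4 : ℝ)) * rho z.1 z.2 ^ (-(4 : ℝ))))) ∂nu t := by
        rw [lintegral_lintegral_swap]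
        exact Measurable.aemeasurable (by fun_prop)
    _ ≤ ∫⁻ z : ℝ × E3, ENNReal.ofReal C₁ * ENNReal.ofReal (((t - z.1) ^ (-(g + 1 / 2)) * z.1 ^ (-(0 : ℝ))) *
          rho z.1 z.2 ^ (-(4 : ℝ))) ∂nu t := by
        refine lintegral_mono_ae ?_
        filter_upwards [ae_nu_mem t] with z hz
        have hz' : 0 < t - z.1 := by linarith [hz.2]
        have n1 := Real.rpow_nonneg hz'.le (-g)
        have n2 := Real.rpow_nonneg (rho_nonneg z.1 z.2) (-4)
        have e : ∀ x : E3, ENNReal.ofReal ((t - z.1) ^ (-g) *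
            (rho (t - z.1) (x - z.2) ^ (-(4 : ℝ)) * rho z.1 z.2 ^ (-(4 : ℝ)))) =
            ENNReal.ofReal ((t - z.1) ^ (-g) * rho z.1 z.2 ^ (-(4 : ℝ))) *
            ENNReal.ofReal (rho (t - z.1) (0 - (z.2 - x)) ^ (-(4 : ℝ))) := by
          intro x
          rw [← ENNReal.ofReal_mul (by positivity), zero_sub, neg_sub]
          congr 1; ring
        simp_rw [e]
        rw [lintegral_const_mul _ (by fun_prop),
          lintegral_sub_left_eq_self (fun y => ENNReal.ofReal (rho (t - z.1) (0 - y) ^ (-(4 : ℝ)))),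
          ← ENNReal.ofReal_mul c₁.le]
        refine (mul_le_mul_right (H₁ (t - z.1) hz' 0) _).trans ?_
        rw [← ENNReal.ofReal_mul (by positivity)]
        refine ENNReal.ofReal_le_ofReal (le_of_eq ?_)
        rw [neg_zero, Real.rpow_zero, mul_one, show -(g + 1 / 2) = -g + (3 - 4) / 2 by ring,
          Real.rpow_add hz']
        ring
    _ ≤ _ := by
        have hn : 0 ≤ᵐ[nu t] fun z => ((t - z.1) ^ (-(g + 1 / 2)) * z.1 ^ (-(0 : ℝ))) *
          rho z.1 z.2 ^ (-(4 : ℝ)) := by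
          filter_upwards [ae_nu_mem t] with z hz
          exact mul_nonneg (mul_rpow_nonneg (by linarith [hz.2]) hz.1.le)
            (Real.rpow_nonneg (rho_nonneg _ _) _)
        rw [lintegral_const_mul _ (by fun_prop),
          ← ofReal_integral_eq_lintegral_ofReal (H₂ t ht).integrable hn, mul_assoc,
          ENNReal.ofReal_mul c₁.le]
        gcongr
        refine (H₂ t ht).integral_le.trans (le_of_eq ?_)
        congr 2; ring

/-- The hypothesis of Fubini's theorem for pairing a Duhamel integral with ψ. The majorant b of the
inner integrals is in practice a multiple of `powInt`. -/
lemma integrable_prod_of_left {k : ℝ → E3 → ℝ} (hk : Measurable (fun z : ℝ × E3 => k z.1 z.2))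
    {f : ℝ × E3 → ℝ} {ψ b : E3 → ℝ} {t : ℝ} (hf : AEStronglyMeasurable f (nu t))
    (hψ : AEStronglyMeasurable ψ volume)
    (hi : ∀ᵐ x, Integrable (fun z => k (t - z.1) (x - z.2) * f z) (nu t))
    (hb : ∀ᵐ x, ∫ z, |k (t - z.1) (x - z.2) * f z| ∂nu t ≤ b x)
    (hib : Integrable (fun x => ψ x * b x)) :
    Integrable (fun w : E3 × (ℝ × E3) => ψ w.1 * (k (t - w.2.1) (w.1 - w.2.2) * f w.2))
      ((volume : Measure E3).prod (nu t)) := by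
  have hm : AEStronglyMeasurable (fun w : E3 × (ℝ × E3) =>
      ψ w.1 * (k (t - w.2.1) (w.1 - w.2.2) * f w.2)) ((volume : Measure E3).prod (nu t)) :=
    hψ.comp_fst.mul ((measurable_kernel_comp hk (by fun_prop) (by fun_prop)).aestronglyMeasurable.mul
      hf.comp_snd)
  rw [integrable_prod_iff hm]
  refine ⟨hi.mono fun x hx => hx.const_mul (ψ x), hib.norm.mono' hm.norm.integral_prod_right' ?_⟩
  filter_upwards [hb] with x hx
  have h0 : 0 ≤ ∫ z, |k (t - z.1) (x - z.2) * f z| ∂nu t := integral_nonneg fun z => abs_nonneg _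
  simp only [norm_mul, Real.norm_eq_abs, integral_const_mul]
  simp only [abs_mul] at hx h0
  rw [abs_of_nonneg h0, abs_abs]
  exact mul_le_mul_of_nonneg_left (hx.trans (le_abs_self _)) (abs_nonneg _)

lemma integral_mul_duh {k : ℝ → E3 → ℝ} {f : ℝ × E3 → ℝ} {ψ : E3 → ℝ} {t : ℝ}
    (h : Integrable (fun w : E3 × (ℝ × E3) => ψ w.1 * (k (t - w.2.1) (w.1 - w.2.2) * f w.2))
      ((volume : Measure E3).prod (nu t))) :
    ∫ x, ψ x * duh k f t x = ∫ z, (∫ x, k (t - z.1) (x - z.2) * ψ x) * f z ∂nu t := by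
  unfold duh
  simp_rw [← integral_const_mul]
  rw [integral_integral_swap h]
  congr 1
  ext z
  rw [← integral_mul_const]
  congr 1
  ext x
  ring

/-! ### The integral equations as a fixed point problem -/

/-- The heat flow of `f`. -/
def lin (f : E3 → ℝ) (t : ℝ) (x : E3) : ℝ := ∫ y, heatKernel t (x - y) * f y

/-- The right-hand side of the integral equation for the temperature. -/
def nextT (θ₀ : E3 → ℝ) (u : ℝ → E3 → E3) (θ : ℝ → E3 → ℝ) (t : ℝ) (x : E3) : ℝ :=
  lin θ₀ t x - ∑ l, duh (heat1 l) (fun z => θ z.1 z.2 * u z.1 z.2 l) t x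

/-- The right-hand side of the integral equation for the velocity. -/
def nextU (u₀ : E3 → E3) (u : ℝ → E3 → E3) (θ : ℝ → E3 → ℝ) (t : ℝ) (x : E3) : E3 :=
  WithLp.toLp 2 fun j => lin (fun y => u₀ y j) t x
    - (∑ k, ∑ l, duh (fun σ => oseenGradKernel σ j k l)
        (fun z => u z.1 z.2 k * u z.1 z.2 l) t x)
    + duh (fun σ => oseenKernel σ j 2) (fun z => θ z.1 z.2) t x

/-- Data of size `ε`. -/
structure Data (ε : ℝ) (u₀ : E3 → E3) (θ₀ : E3 → ℝ) : Prop where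
  mu : AEStronglyMeasurable u₀ volume
  bu : ∀ᵐ y, ‖u₀ y‖ ≤ ε * ‖y‖ ^ (-1 : ℝ)
  bθ : ∀ᵐ y, |θ₀ y| ≤ ε * ‖y‖ ^ (-3 : ℝ)
  iθ : Integrable θ₀
  nθ : ∫ y, |θ₀ y| ≤ ε

/-- Pairs of size `M` in the critical weighted spaces. -/
structure Adm (M N : ℝ) (u : ℝ → E3 → E3) (θ : ℝ → E3 → ℝ) : Prop where
  mu : AEStronglyMeasurable (fun z : ℝ × E3 => u z.1 z.2) spaceTime
  mθ : AEStronglyMeasurable (fun z : ℝ × E3 => θ z.1 z.2) spaceTime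
  bu : ∀ᵐ z ∂spaceTime, ‖u z.1 z.2‖ ≤ M * rho z.1 z.2 ^ (-1 : ℝ)
  bθ : ∀ᵐ z ∂spaceTime, |θ z.1 z.2| ≤ N * rho z.1 z.2 ^ (-3 : ℝ)

lemma aesm_coord {α : Type*} [MeasurableSpace α] {μ : Measure α} {v : α → E3}
    (hv : AEStronglyMeasurable v μ) (k : Fin 3) : AEStronglyMeasurable (fun a => v a k) μ :=
  (EuclideanSpace.proj k : E3 →L[ℝ] ℝ).continuous.comp_aestronglyMeasurable hv

lemma norm_le_sum_coord (v : E3) : ‖v‖ ≤ ∑ j, |v j| := by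
  have hv : v = ∑ l, v l • EuclideanSpace.single l (1 : ℝ) := by
    ext i
    simp [Fin.sum_univ_three]
    fin_cases i <;> simp
  conv_lhs => rw [hv]
  refine (norm_sum_le _ _).trans (Finset.sum_le_sum fun l _ => ?_)
  simp [norm_smul]

/-- Scale-invariant bounds for Duhamel integrals. -/
lemma duh_crit_le {p q : ℝ} (hp : 0 < p) (hq : 0 < q) (hp5 : p < 5) (hq5 : q < 5)
    (hpq : 5 ≤ p + q) : ∃ C₀ > 0, ∀ (C A : ℝ) (k : ℝ → E3 → ℝ) (f : ℝ × E3 → ℝ), Ker p C k →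
    0 ≤ C → 0 ≤ A → AEStronglyMeasurable f spaceTime →
    (∀ᵐ z ∂spaceTime, |f z| ≤ A * rho z.1 z.2 ^ (-q)) → ∀ t, 0 < t → ∀ x,
    Integrable (fun z => k (t - z.1) (x - z.2) * f z) (nu t) ∧
      |duh k f t x| ≤ C₀ * (C * A) * rho t x ^ (-(p + q - 5)) := by
  obtain ⟨C₀, h₀, H₀⟩ := dom_crit (g := 0) hp hq hp5 hq5 hpq (by linarith) (by linarith)
  refine ⟨C₀, h₀, fun C A k f hk hC hA hfm hf t ht x => ?_⟩
  have := (H₀ t ht x).const_mul hA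
  simp only [neg_zero, Real.rpow_zero, one_mul] at this
  have h := hk.integrand_integrable hC (w := fun z => A * rho z.1 z.2 ^ (-q))
    (aestronglyMeasurable_nu hfm t) (ae_nu_of_spaceTime hf) (x := x)
    (c := A * (C₀ * rho t x ^ (-(p + q - 5)))) (by
      convert! this using 2
      ring)
  exact ⟨h.1, h.2.trans (le_of_eq (by ring))⟩

lemma lin_le : ∃ C > 0, ∀ (ε : ℝ) (u₀ : E3 → E3) (θ₀ : E3 → ℝ), 0 ≤ ε → Data ε u₀ θ₀ →
    ∀ t, 0 < t → ∀ x, (∀ j, |lin (fun y => u₀ y j) t x| ≤ C * ε * rho t x ^ (-1 : ℝ)) ∧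
      |lin θ₀ t x| ≤ C * ε * rho t x ^ (-3 : ℝ) := by
  obtain ⟨C₁, c₁, H₁⟩ := conv_le_of_rpow (a := 1) (by norm_num) (by norm_num)
  obtain ⟨C₂, c₂, H₂⟩ := conv_le_of_integrable
  obtain ⟨C₃, c₃, H₃⟩ := heatKernel_bound
  refine ⟨(C₁ + C₂) * C₃, by positivity, fun ε u₀ θ₀ hε hD t ht x => ⟨fun j => ?_, ?_⟩⟩
  · have hb : ∀ᵐ y, |u₀ y j| ≤ ε * ‖y‖ ^ (-1 : ℝ) := by
      filter_upwards [hD.bu] with y hy using (abs_coord_le _ _).trans hy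
    refine (H₁ t C₃ ε _ _ ht c₃.le hε (H₃ t ht) hb (by fun_prop) (aesm_coord hD.mu j) x).2.trans ?_
    have : 0 ≤ rho t x ^ (-1 : ℝ) := Real.rpow_nonneg (rho_nonneg _ _) _
    have : 0 ≤ C₂ * C₃ * ε * rho t x ^ (-1 : ℝ) := by positivity
    linarith
  · refine (H₂ t C₃ ε _ _ ht c₃.le hε (H₃ t ht) hD.bθ (by fun_prop) hD.iθ hD.nθ x).2.trans ?_
    have : 0 ≤ rho t x ^ (-3 : ℝ) := Real.rpow_nonneg (rho_nonneg _ _) _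
    have : 0 ≤ C₁ * C₃ * ε * rho t x ^ (-3 : ℝ) := by positivity
    linarith

/-- The constant `C` bounds the three Duhamel operators between the critical weighted spaces. -/
structure DuhBound (C : ℝ) : Prop where
  heat : ∀ (l : Fin 3) (A : ℝ) (f : ℝ × E3 → ℝ), 0 ≤ A → AEStronglyMeasurable f spaceTime →
    (∀ᵐ z ∂spaceTime, |f z| ≤ A * rho z.1 z.2 ^ (-4 : ℝ)) → ∀ t, 0 < t → ∀ x,
    Integrable (fun z => heat1 l (t - z.1) (x - z.2) * f z) (nu t) ∧
      |duh (heat1 l) f t x| ≤ C * A * rho t x ^ (-3 : ℝ)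
  grad : ∀ (j k l : Fin 3) (A : ℝ) (f : ℝ × E3 → ℝ), 0 ≤ A → AEStronglyMeasurable f spaceTime →
    (∀ᵐ z ∂spaceTime, |f z| ≤ A * rho z.1 z.2 ^ (-2 : ℝ)) → ∀ t, 0 < t → ∀ x,
    Integrable (fun z => oseenGradKernel (t - z.1) j k l (x - z.2) * f z) (nu t) ∧
      |duh (fun σ => oseenGradKernel σ j k l) f t x| ≤ C * A * rho t x ^ (-1 : ℝ)
  oseen : ∀ (j k : Fin 3) (A : ℝ) (f : ℝ × E3 → ℝ), 0 ≤ A → AEStronglyMeasurable f spaceTime →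
    (∀ᵐ z ∂spaceTime, |f z| ≤ A * rho z.1 z.2 ^ (-3 : ℝ)) → ∀ t, 0 < t → ∀ x,
    Integrable (fun z => oseenKernel (t - z.1) j k (x - z.2) * f z) (nu t) ∧
      |duh (fun σ => oseenKernel σ j k) f t x| ≤ C * A * rho t x ^ (-1 : ℝ)

/-- The arithmetic of the scaling: 4 + 4 - 5 = 3 for θu, 4 + 2 - 5 = 1 for u ⊗ u, and 3 + 3 - 5 = 1
for the buoyancy term. -/
lemma exists_duhBound : ∃ C > 0, DuhBound C := by
  obtain ⟨C₁, c₁, H₁⟩ := duh_crit_le (p := 4) (q := 4) (by norm_num) (by norm_num) (by norm_num)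
    (by norm_num) (by norm_num)
  obtain ⟨C₂, c₂, H₂⟩ := duh_crit_le (p := 4) (q := 2) (by norm_num) (by norm_num) (by norm_num)
    (by norm_num) (by norm_num)
  obtain ⟨C₃, c₃, H₃⟩ := duh_crit_le (p := 3) (q := 3) (by norm_num) (by norm_num) (by norm_num)
    (by norm_num) (by norm_num)
  obtain ⟨K₁, k₁, L₁⟩ := ker_heat1
  obtain ⟨K₂, k₂, L₂⟩ := ker_oseenGradKernel
  obtain ⟨K₃, k₃, L₃⟩ := ker_oseenKernel
  have n : ∀ (t : ℝ) (x : E3) (e : ℝ), 0 ≤ rho t x ^ e := fun t x e =>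
    Real.rpow_nonneg (rho_nonneg _ _) _
  refine ⟨C₁ * K₁ + C₂ * K₂ + C₃ * K₃, by positivity, ⟨fun l A f hA hm hf t ht x => ?_,
    fun j k l A f hA hm hf t ht x => ?_, fun j k A f hA hm hf t ht x => ?_⟩⟩
  · obtain ⟨h, h'⟩ := H₁ K₁ A _ f (L₁ l) k₁.le hA hm hf t ht x
    refine ⟨h, h'.trans ?_⟩
    rw [show -((4 : ℝ) + 4 - 5) = -3 by norm_num]
    have := mul_nonneg (mul_nonneg (mul_nonneg c₂.le k₂.le) hA) (n t x (-3))
    have := mul_nonneg (mul_nonneg (mul_nonneg c₃.le k₃.le) hA) (n t x (-3))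
    linarith
  · obtain ⟨h, h'⟩ := H₂ K₂ A _ f (L₂ j k l) k₂.le hA hm hf t ht x
    refine ⟨h, h'.trans ?_⟩
    rw [show -((4 : ℝ) + 2 - 5) = -1 by norm_num]
    have := mul_nonneg (mul_nonneg (mul_nonneg c₁.le k₁.le) hA) (n t x (-1))
    have := mul_nonneg (mul_nonneg (mul_nonneg c₃.le k₃.le) hA) (n t x (-1))
    linarith
  · obtain ⟨h, h'⟩ := H₃ K₃ A _ f (L₃ j k) k₃.le hA hm hf t ht x
    refine ⟨h, h'.trans ?_⟩
    rw [show -((3 : ℝ) + 3 - 5) = -1 by norm_num]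
    have := mul_nonneg (mul_nonneg (mul_nonneg c₁.le k₁.le) hA) (n t x (-1))
    have := mul_nonneg (mul_nonneg (mul_nonneg c₂.le k₂.le) hA) (n t x (-1))
    linarith

lemma rho_rpow_mul (t : ℝ) (ht : 0 < t) (x : E3) (a b : ℝ) :
    rho t x ^ a * rho t x ^ b = rho t x ^ (a + b) := (Real.rpow_add (rho_pos ht x) a b).symm

lemma ae_spaceTime_pos : ∀ᵐ z ∂spaceTime, 0 < z.1 := ae_spaceTime_of_forall fun _ hs _ => hs

namespace Adm

variable {M N : ℝ} {u : ℝ → E3 → E3} {θ : ℝ → E3 → ℝ}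

lemma mθu (h : Adm M N u θ) (l : Fin 3) :
    AEStronglyMeasurable (fun z : ℝ × E3 => θ z.1 z.2 * u z.1 z.2 l) spaceTime :=
  h.mθ.mul (aesm_coord h.mu l)

lemma muu (h : Adm M N u θ) (k l : Fin 3) :
    AEStronglyMeasurable (fun z : ℝ × E3 => u z.1 z.2 k * u z.1 z.2 l) spaceTime :=
  (aesm_coord h.mu k).mul (aesm_coord h.mu l)

lemma bθu (h : Adm M N u θ) (l : Fin 3) :
    ∀ᵐ z ∂spaceTime, |θ z.1 z.2 * u z.1 z.2 l| ≤ N * M * rho z.1 z.2 ^ (-4 : ℝ) := by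
  filter_upwards [h.bu, h.bθ, ae_spaceTime_pos] with z h1 h2 hz
  rw [abs_mul]
  refine (mul_le_mul h2 ((abs_coord_le _ l).trans h1) (abs_nonneg _)
    ((abs_nonneg _).trans h2)).trans (le_of_eq ?_)
  rw [mul_mul_mul_comm, rho_rpow_mul _ hz]
  norm_num

lemma buu (h : Adm M N u θ) (k l : Fin 3) :
    ∀ᵐ z ∂spaceTime, |u z.1 z.2 k * u z.1 z.2 l| ≤ M * M * rho z.1 z.2 ^ (-2 : ℝ) := by
  filter_upwards [h.bu, ae_spaceTime_pos] with z h1 hz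
  rw [abs_mul]
  refine (mul_le_mul ((abs_coord_le _ k).trans h1) ((abs_coord_le _ l).trans h1) (abs_nonneg _)
    ((norm_nonneg _).trans h1)).trans (le_of_eq ?_)
  rw [mul_mul_mul_comm, rho_rpow_mul _ hz]
  norm_num

end Adm

lemma abs_sum_le_of_le {f : Fin 3 → ℝ} {B : ℝ} (h : ∀ l, |f l| ≤ B) : |∑ l, f l| ≤ 3 * B := by
  refine (Finset.abs_sum_le_sum_abs _ _).trans ((Finset.sum_le_sum fun l _ => h l).trans ?_)
  simp

lemma sum_le_of_le {f : Fin 3 → ℝ} {B : ℝ} (h : ∀ l, f l ≤ B) : ∑ l, f l ≤ 3 * B := by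
  refine (Finset.sum_le_sum fun l _ => h l).trans ?_
  simp

section Estimates

variable {C M N ε : ℝ} {u u' : ℝ → E3 → E3} {θ θ' : ℝ → E3 → ℝ}

lemma nextT_le (hC : DuhBound C) (hM : 0 ≤ M) (hN : 0 ≤ N) (h : Adm M N u θ) {θ₀ : E3 → ℝ} {t : ℝ}
    (ht : 0 < t) (x : E3) {L : ℝ} (hl : |lin θ₀ t x| ≤ L * rho t x ^ (-3 : ℝ)) :
    |nextT θ₀ u θ t x| ≤ (L + 3 * (C * (N * M))) * rho t x ^ (-3 : ℝ) := by
  refine (abs_sub _ _).trans ?_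
  have := abs_sum_le_of_le fun l => (hC.heat l (N * M) _ (by positivity) (h.mθu l) (h.bθu l) t ht x).2
  linarith

lemma nextU_le (hC : DuhBound C) (hM : 0 ≤ M) (hN : 0 ≤ N) (h : Adm M N u θ) {u₀ : E3 → E3} {t : ℝ}
    (ht : 0 < t) (x : E3) {L : ℝ} (hl : ∀ j, |lin (fun y => u₀ y j) t x| ≤ L * rho t x ^ (-1 : ℝ)) :
    ‖nextU u₀ u θ t x‖ ≤ 3 * (L + 9 * (C * (M * M)) + C * N) * rho t x ^ (-1 : ℝ) := by
  refine (norm_le_sum_coord _).trans ?_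
  rw [mul_assoc]
  refine sum_le_of_le fun j => ?_
  refine (abs_add_le _ _).trans ?_
  have h1 := abs_sub (lin (fun y => u₀ y j) t x) (∑ k, ∑ l, duh (fun σ => oseenGradKernel σ j k l)
        (fun z => u z.1 z.2 k * u z.1 z.2 l) t x)
  have h2 := abs_sum_le_of_le fun k => abs_sum_le_of_le fun l =>
    (hC.grad j k l (M * M) _ (by positivity) (h.muu k l) (h.buu k l) t ht x).2
  have h3 := (hC.oseen j 2 N _ hN h.mθ h.bθ t ht x).2
  have := hl j
  linarith

lemma duh_sub {k : ℝ → E3 → ℝ} {f g : ℝ × E3 → ℝ} {t : ℝ} {x : E3}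
    (hf : Integrable (fun z => k (t - z.1) (x - z.2) * f z) (nu t))
    (hg : Integrable (fun z => k (t - z.1) (x - z.2) * g z) (nu t)) :
    duh k f t x - duh k g t x = duh k (fun z => f z - g z) t x := by
  unfold duh
  rw [← integral_sub hf hg]
  congr 1
  ext z
  ring

/-- Difference estimates for the fixed point map. -/
lemma next_sub_le (hC : DuhBound C) (hM : 0 ≤ M) (h : Adm M M u θ) (h' : Adm M M u' θ')
    {D E : ℝ} (hD : 0 ≤ D) (hE : 0 ≤ E)
    (hu : ∀ᵐ z ∂spaceTime, ‖u z.1 z.2 - u' z.1 z.2‖ ≤ D * rho z.1 z.2 ^ (-1 : ℝ))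
    (hθ : ∀ᵐ z ∂spaceTime, |θ z.1 z.2 - θ' z.1 z.2| ≤ E * rho z.1 z.2 ^ (-3 : ℝ))
    (u₀ : E3 → E3) (θ₀ : E3 → ℝ) {t : ℝ} (ht : 0 < t) (x : E3) :
    |nextT θ₀ u θ t x - nextT θ₀ u' θ' t x| ≤ 3 * (C * (M * (D + E))) * rho t x ^ (-3 : ℝ) ∧
    ‖nextU u₀ u θ t x - nextU u₀ u' θ' t x‖ ≤
      3 * (9 * (C * (M * (D + D))) + C * E) * rho t x ^ (-1 : ℝ) := by
  have b1 : ∀ l, ∀ᵐ z ∂spaceTime, |θ z.1 z.2 * u z.1 z.2 l - θ' z.1 z.2 * u' z.1 z.2 l| ≤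
      M * (D + E) * rho z.1 z.2 ^ (-4 : ℝ) := by
    intro l
    filter_upwards [h.bu, h'.bθ, hu, hθ, ae_spaceTime_pos] with z h1 h2 h3 h4 hz
    have e : θ z.1 z.2 * u z.1 z.2 l - θ' z.1 z.2 * u' z.1 z.2 l =
        (θ z.1 z.2 - θ' z.1 z.2) * u z.1 z.2 l + θ' z.1 z.2 * (u z.1 z.2 - u' z.1 z.2) l := by
      simp; ring
    rw [e]
    refine (abs_add_le _ _).trans ?_
    rw [abs_mul, abs_mul]
    have i1 := mul_le_mul h4 ((abs_coord_le _ l).trans h1) (abs_nonneg _)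
      ((abs_nonneg _).trans h4)
    have i2 := mul_le_mul h2 ((abs_coord_le _ l).trans h3) (abs_nonneg _)
      ((abs_nonneg _).trans h2)
    refine (add_le_add i1 i2).trans (le_of_eq ?_)
    rw [show (-4 : ℝ) = -3 + -1 by norm_num, ← rho_rpow_mul _ hz]
    ring
  have b2 : ∀ k l, ∀ᵐ z ∂spaceTime, |u z.1 z.2 k * u z.1 z.2 l - u' z.1 z.2 k * u' z.1 z.2 l| ≤
      M * (D + D) * rho z.1 z.2 ^ (-2 : ℝ) := by
    intro k l
    filter_upwards [h.bu, h'.bu, hu, ae_spaceTime_pos] with z h1 h2 h3 hz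
    have e : u z.1 z.2 k * u z.1 z.2 l - u' z.1 z.2 k * u' z.1 z.2 l =
        (u z.1 z.2 - u' z.1 z.2) k * u z.1 z.2 l + u' z.1 z.2 k * (u z.1 z.2 - u' z.1 z.2) l := by
      simp; ring
    rw [e]
    refine (abs_add_le _ _).trans ?_
    rw [abs_mul, abs_mul]
    have i1 := mul_le_mul ((abs_coord_le _ k).trans h3) ((abs_coord_le _ l).trans h1) (abs_nonneg _)
      ((norm_nonneg _).trans h3)
    have i2 := mul_le_mul ((abs_coord_le _ k).trans h2) ((abs_coord_le _ l).trans h3) (abs_nonneg _)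
      ((norm_nonneg _).trans h2)
    refine (add_le_add i1 i2).trans (le_of_eq ?_)
    rw [show (-2 : ℝ) = -1 + -1 by norm_num, ← rho_rpow_mul _ hz]
    ring
  constructor
  · have e : nextT θ₀ u θ t x - nextT θ₀ u' θ' t x =
        -∑ l, duh (heat1 l) (fun z => θ z.1 z.2 * u z.1 z.2 l - θ' z.1 z.2 * u' z.1 z.2 l) t x := by
      have : ∀ l, duh (heat1 l) (fun z => θ z.1 z.2 * u z.1 z.2 l - θ' z.1 z.2 * u' z.1 z.2 l) t x
          = duh (heat1 l) (fun z => θ z.1 z.2 * u z.1 z.2 l) t x -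
            duh (heat1 l) (fun z => θ' z.1 z.2 * u' z.1 z.2 l) t x := fun l =>
        (duh_sub (hC.heat l (M * M) _ (by positivity) (h.mθu l) (h.bθu l) t ht x).1
          (hC.heat l (M * M) _ (by positivity) (h'.mθu l) (h'.bθu l) t ht x).1).symm
      simp_rw [this, Finset.sum_sub_distrib]
      unfold nextT
      ring
    rw [e, abs_neg, mul_assoc]
    exact abs_sum_le_of_le fun l => (hC.heat l (M * (D + E)) _ (by positivity)
      ((h.mθu l).sub (h'.mθu l)) (b1 l) t ht x).2
  · refine (norm_le_sum_coord _).trans ?_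
    rw [mul_assoc]
    refine sum_le_of_le fun j => ?_
    have e : (nextU u₀ u θ t x - nextU u₀ u' θ' t x) j =
        -(∑ k, ∑ l, duh (fun σ => oseenGradKernel σ j k l) (fun z => u z.1 z.2 k * u z.1 z.2 l
            - u' z.1 z.2 k * u' z.1 z.2 l) t x)
          + duh (fun σ => oseenKernel σ j 2) (fun z => θ z.1 z.2 - θ' z.1 z.2) t x := by
      have e1 : ∀ k l, duh (fun σ => oseenGradKernel σ j k l) (fun z => u z.1 z.2 k * u z.1 z.2 l
            - u' z.1 z.2 k * u' z.1 z.2 l) t x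
          = duh (fun σ => oseenGradKernel σ j k l) (fun z => u z.1 z.2 k * u z.1 z.2 l) t x -
            duh (fun σ => oseenGradKernel σ j k l) (fun z => u' z.1 z.2 k * u' z.1 z.2 l) t x :=
        fun k l => (duh_sub (hC.grad j k l (M * M) _ (by positivity) (h.muu k l) (h.buu k l) t ht x).1
          (hC.grad j k l (M * M) _ (by positivity) (h'.muu k l) (h'.buu k l) t ht x).1).symm
      have e2 : duh (fun σ => oseenKernel σ j 2) (fun z => θ z.1 z.2 - θ' z.1 z.2) t x =
          duh (fun σ => oseenKernel σ j 2) (fun z => θ z.1 z.2) t x -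
          duh (fun σ => oseenKernel σ j 2) (fun z => θ' z.1 z.2) t x :=
        (duh_sub (hC.oseen j 2 M _ hM h.mθ h.bθ t ht x).1
          (hC.oseen j 2 M _ hM h'.mθ h'.bθ t ht x).1).symm
      simp_rw [e1, e2, Finset.sum_sub_distrib]
      simp only [nextU, PiLp.sub_apply]
      ring
    rw [e]
    refine (abs_add_le _ _).trans ?_
    rw [abs_neg]
    have i1 := abs_sum_le_of_le fun k => abs_sum_le_of_le fun l =>
      (hC.grad j k l (M * (D + D)) (fun z => u z.1 z.2 k * u z.1 z.2 l
        - u' z.1 z.2 k * u' z.1 z.2 l) (by positivity) ((h.muu k l).sub (h'.muu k l))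
        (b2 k l) t ht x).2
    have i2 := (hC.oseen j 2 E (fun z => θ z.1 z.2 - θ' z.1 z.2) hE (h.mθ.sub h'.mθ) hθ t ht x).2
    linarith

end Estimates

lemma stronglyMeasurable_lin {f : E3 → ℝ} (hf : AEStronglyMeasurable f volume) :
    StronglyMeasurable (fun z : ℝ × E3 => lin f z.1 z.2) := by
  have e : ∀ z : ℝ × E3, lin f z.1 z.2 = ∫ y, heatKernel z.1 (z.2 - y) * hf.mk f y := fun z =>
    integral_congr_ae (by filter_upwards [hf.ae_eq_mk] with y hy; rw [hy])
  simp_rw [e]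
  have h : StronglyMeasurable (fun p : (ℝ × E3) × E3 =>
      heatKernel p.1.1 (p.1.2 - p.2) * hf.mk f p.2) := by
    have := hf.stronglyMeasurable_mk.measurable
    exact Measurable.stronglyMeasurable (by fun_prop)
  exact h.integral_prod_right' (ν := volume)

lemma stronglyMeasurable_nextT {M N : ℝ} {u : ℝ → E3 → E3} {θ : ℝ → E3 → ℝ} (h : Adm M N u θ)
    {θ₀ : E3 → ℝ} (h₀ : AEStronglyMeasurable θ₀ volume) :
    StronglyMeasurable (fun z : ℝ × E3 => nextT θ₀ u θ z.1 z.2) := by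
  unfold nextT
  refine (stronglyMeasurable_lin h₀).sub (Finset.stronglyMeasurable_fun_sum _ fun l _ => ?_)
  exact stronglyMeasurable_duh (by fun_prop) (h.mθu l)

lemma stronglyMeasurable_nextU {M N : ℝ} {u : ℝ → E3 → E3} {θ : ℝ → E3 → ℝ} (h : Adm M N u θ)
    {u₀ : E3 → E3} (h₀ : AEStronglyMeasurable u₀ volume) :
    StronglyMeasurable (fun z : ℝ × E3 => nextU u₀ u θ z.1 z.2) := by
  unfold nextU
  refine (PiLp.continuous_toLp 2 _).comp_stronglyMeasurable
    (Measurable.stronglyMeasurable (measurable_pi_lambda _ fun j => StronglyMeasurable.measurable ?_))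
  refine ((stronglyMeasurable_lin (aesm_coord h₀ j)).sub (Finset.stronglyMeasurable_fun_sum _ fun k _ =>
    Finset.stronglyMeasurable_fun_sum _ fun l _ => ?_)).add ?_
  · exact stronglyMeasurable_duh (measurable_oseenGradKernel j k l) (h.muu k l)
  · exact stronglyMeasurable_duh (measurable_oseenKernel j 2) h.mθ

/-! ### Existence and uniqueness -/

lemma DuhBound.mono {C C' : ℝ} (h : DuhBound C) (hC : C ≤ C') : DuhBound C' := by
  have n : ∀ (t : ℝ) (x : E3) (e A : ℝ), 0 ≤ A → C * A * rho t x ^ e ≤ C' * A * rho t x ^ e :=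
    fun t x e A hA => mul_le_mul_of_nonneg_right (mul_le_mul_of_nonneg_right hC hA)
      (Real.rpow_nonneg (rho_nonneg _ _) _)
  exact ⟨fun l A f hA hm hf t ht x => ⟨(h.heat l A f hA hm hf t ht x).1,
      (h.heat l A f hA hm hf t ht x).2.trans (n t x _ A hA)⟩,
    fun j k l A f hA hm hf t ht x => ⟨(h.grad j k l A f hA hm hf t ht x).1,
      (h.grad j k l A f hA hm hf t ht x).2.trans (n t x _ A hA)⟩,
    fun j k A f hA hm hf t ht x => ⟨(h.oseen j k A f hA hm hf t ht x).1,
      (h.oseen j k A f hA hm hf t ht x).2.trans (n t x _ A hA)⟩⟩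

lemma Adm.mono {M N M' N' : ℝ} {u : ℝ → E3 → E3} {θ : ℝ → E3 → ℝ} (h : Adm M N u θ)
    (hM : M ≤ M') (hN : N ≤ N') : Adm M' N' u θ where
  mu := h.mu
  mθ := h.mθ
  bu := by
    filter_upwards [h.bu] with z hz using hz.trans
      (mul_le_mul_of_nonneg_right hM (Real.rpow_nonneg (rho_nonneg _ _) _))
  bθ := by
    filter_upwards [h.bθ] with z hz using hz.trans
      (mul_le_mul_of_nonneg_right hN (Real.rpow_nonneg (rho_nonneg _ _) _))

/-- Solutions of the integral equations, everywhere in `t > 0`, in the critical weighted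
spaces. -/
structure Sol (M N : ℝ) (u₀ : E3 → E3) (θ₀ : E3 → ℝ) (u : ℝ → E3 → E3) (θ : ℝ → E3 → ℝ) :
    Prop where
  adm : Adm M N u θ
  bu : ∀ t, 0 < t → ∀ x, ‖u t x‖ ≤ M * rho t x ^ (-1 : ℝ)
  bθ : ∀ t, 0 < t → ∀ x, |θ t x| ≤ N * rho t x ^ (-3 : ℝ)
  eu : ∀ t, 0 < t → ∀ x, u t x = nextU u₀ u θ t x
  eθ : ∀ t, 0 < t → ∀ x, θ t x = nextT θ₀ u θ t x
  zu : u 0 = u₀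
  zθ : θ 0 = θ₀

/-- The Picard iterates. -/
def picard (u₀ : E3 → E3) (θ₀ : E3 → ℝ) : ℕ → (ℝ → E3 → E3) × (ℝ → E3 → ℝ)
  | 0 => (fun _ _ => 0, fun _ _ => 0)
  | n + 1 => (nextU u₀ (picard u₀ θ₀ n).1 (picard u₀ θ₀ n).2,
      nextT θ₀ (picard u₀ θ₀ n).1 (picard u₀ θ₀ n).2)

section

variable {C M N ε : ℝ} {u u' : ℝ → E3 → E3} {θ θ' : ℝ → E3 → ℝ} {u₀ : E3 → E3} {θ₀ : E3 → ℝ}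

/-- The constant `C` bounds the linear flow of data of size `ε`. -/
def LinBound (C ε : ℝ) (u₀ : E3 → E3) (θ₀ : E3 → ℝ) : Prop :=
  ∀ t, 0 < t → ∀ x, (∀ j, |lin (fun y => u₀ y j) t x| ≤ C * ε * rho t x ^ (-1 : ℝ)) ∧
    |lin θ₀ t x| ≤ C * ε * rho t x ^ (-3 : ℝ)

/-- The temperature acts on the velocity linearly, with no small factor, so the velocity difference
is measured on the scale D = 12CE. Then the buoyancy contributes 3CE = D/4 and the quadratic term
54CM·D ≤ D/4, while the temperature difference is at most (36C²M + 3CM)E ≤ E/2. Both scales are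
halved. -/
lemma next_sub_le_half (hC : DuhBound C) (hC1 : 1 ≤ C) (hM : 0 ≤ M) (hM' : 216 * C ^ 2 * M ≤ 1)
    (h : Adm M M u θ) (h' : Adm M M u' θ') {E : ℝ} (hE : 0 ≤ E)
    (hu : ∀ᵐ z ∂spaceTime, ‖u z.1 z.2 - u' z.1 z.2‖ ≤ 12 * C * E * rho z.1 z.2 ^ (-1 : ℝ))
    (hθ : ∀ᵐ z ∂spaceTime, |θ z.1 z.2 - θ' z.1 z.2| ≤ E * rho z.1 z.2 ^ (-3 : ℝ))
    (u₀ : E3 → E3) (θ₀ : E3 → ℝ) {t : ℝ} (ht : 0 < t) (x : E3) :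
    |nextT θ₀ u θ t x - nextT θ₀ u' θ' t x| ≤ E / 2 * rho t x ^ (-3 : ℝ) ∧
    ‖nextU u₀ u θ t x - nextU u₀ u' θ' t x‖ ≤ 12 * C * (E / 2) * rho t x ^ (-1 : ℝ) := by
  have hCM : C * M ≤ C ^ 2 * M := mul_le_mul_of_nonneg_right (by nlinarith) hM
  obtain ⟨h1, h2⟩ := next_sub_le hC hM h h' (by positivity) hE hu hθ u₀ θ₀ ht x
  refine ⟨h1.trans (mul_le_mul_of_nonneg_right ?_ (Real.rpow_nonneg (rho_nonneg _ _) _)),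
    h2.trans (mul_le_mul_of_nonneg_right ?_ (Real.rpow_nonneg (rho_nonneg _ _) _))⟩
  · have : (36 * (C ^ 2 * M) + 3 * (C * M)) * E ≤ 1 / 2 * E :=
      mul_le_mul_of_nonneg_right (by linarith) hE
    linarith
  · have : (54 * (C * M)) * (12 * C * E) ≤ 1 / 4 * (12 * C * E) :=
      mul_le_mul_of_nonneg_right (by linarith) (by positivity)
    linarith

/-- The two radii are unequal because of buoyancy: N = 2Cε is twice the linear flow of the
temperature, and M must then absorb 3Cε + 3CN ≤ 9C²ε = M/2. The bilinear terms contribute at most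
M/8 and N/72. -/
lemma next_le (hC : DuhBound C) (hC1 : 1 ≤ C) (hε : 0 ≤ ε)
    (hM : M = 18 * C ^ 2 * ε) (hN : N = 2 * C * ε) (hM' : 216 * C ^ 2 * M ≤ 1)
    (hl : LinBound C ε u₀ θ₀) (h : Adm M N u θ) {t : ℝ} (ht : 0 < t) (x : E3) :
    ‖nextU u₀ u θ t x‖ ≤ M * rho t x ^ (-1 : ℝ) ∧ |nextT θ₀ u θ t x| ≤ N * rho t x ^ (-3 : ℝ) := by
  have hM0 : 0 ≤ M := by rw [hM]; positivity
  have hN0 : 0 ≤ N := by rw [hN]; positivity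
  have hCM : C * M ≤ C ^ 2 * M := mul_le_mul_of_nonneg_right (by nlinarith) hM0
  refine ⟨(nextU_le hC hM0 hN0 h ht x (hl t ht x).1).trans (mul_le_mul_of_nonneg_right ?_
      (Real.rpow_nonneg (rho_nonneg _ _) _)),
    (nextT_le hC hM0 hN0 h ht x (hl t ht x).2).trans (mul_le_mul_of_nonneg_right ?_
      (Real.rpow_nonneg (rho_nonneg _ _) _))⟩
  · have h1 : C * ε ≤ C ^ 2 * ε := by nlinarith
    have h2 : C * M * M ≤ 1 / 216 * M := mul_le_mul_of_nonneg_right (by linarith) hM0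
    have h3 : C * N = 2 * (C ^ 2 * ε) := by rw [hN]; ring
    have h4 : M = 18 * (C ^ 2 * ε) := by rw [hM]; ring
    linarith
  · have h2 : C * M * N ≤ 1 / 216 * N := mul_le_mul_of_nonneg_right (by linarith) hN0
    linarith

lemma adm_picard (hC : DuhBound C) (hC1 : 1 ≤ C) (hε : 0 ≤ ε)
    (hM : M = 18 * C ^ 2 * ε) (hN : N = 2 * C * ε) (hM' : 216 * C ^ 2 * M ≤ 1)
    (hl : LinBound C ε u₀ θ₀) (hD : Data ε u₀ θ₀) (n : ℕ) :
    Adm M N (picard u₀ θ₀ n).1 (picard u₀ θ₀ n).2 ∧ ∀ t, 0 < t → ∀ x,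
      ‖(picard u₀ θ₀ n).1 t x‖ ≤ M * rho t x ^ (-1 : ℝ) ∧
      |(picard u₀ θ₀ n).2 t x| ≤ N * rho t x ^ (-3 : ℝ) := by
  have hM0 : 0 ≤ M := by rw [hM]; positivity
  have hN0 : 0 ≤ N := by rw [hN]; positivity
  have key : ∀ {v : ℝ → E3 → E3} {τ : ℝ → E3 → ℝ},
      AEStronglyMeasurable (fun z : ℝ × E3 => v z.1 z.2) spaceTime →
      AEStronglyMeasurable (fun z : ℝ × E3 => τ z.1 z.2) spaceTime →
      (∀ t, 0 < t → ∀ x, ‖v t x‖ ≤ M * rho t x ^ (-1 : ℝ) ∧ |τ t x| ≤ N * rho t x ^ (-3 : ℝ)) →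
      Adm M N v τ := fun h1 h2 h3 => ⟨h1, h2, ae_spaceTime_of_forall fun s hs y => (h3 s hs y).1,
        ae_spaceTime_of_forall fun s hs y => (h3 s hs y).2⟩
  induction n with
  | zero =>
    have : ∀ t, 0 < t → ∀ x, ‖(picard u₀ θ₀ 0).1 t x‖ ≤ M * rho t x ^ (-1 : ℝ) ∧
        |(picard u₀ θ₀ 0).2 t x| ≤ N * rho t x ^ (-3 : ℝ) := by
      intro t _ x
      simp only [picard, norm_zero, abs_zero]
      exact ⟨mul_nonneg hM0 (Real.rpow_nonneg (rho_nonneg _ _) _),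
        mul_nonneg hN0 (Real.rpow_nonneg (rho_nonneg _ _) _)⟩
    exact ⟨key aestronglyMeasurable_const aestronglyMeasurable_const this, this⟩
  | succ n ih =>
    have : ∀ t, 0 < t → ∀ x, ‖(picard u₀ θ₀ (n + 1)).1 t x‖ ≤ M * rho t x ^ (-1 : ℝ) ∧
        |(picard u₀ θ₀ (n + 1)).2 t x| ≤ N * rho t x ^ (-3 : ℝ) :=
      fun t ht x => next_le hC hC1 hε hM hN hM' hl ih.1 ht x
    exact ⟨key (stronglyMeasurable_nextU ih.1 hD.mu).aestronglyMeasurable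
      (stronglyMeasurable_nextT ih.1 hD.iθ.aestronglyMeasurable).aestronglyMeasurable this, this⟩

lemma picard_sub_le (hC : DuhBound C) (hC1 : 1 ≤ C) (hε : 0 ≤ ε)
    (hM : M = 18 * C ^ 2 * ε) (hN : N = 2 * C * ε) (hM' : 216 * C ^ 2 * M ≤ 1)
    (hl : LinBound C ε u₀ θ₀) (hD : Data ε u₀ θ₀) (n : ℕ) : ∀ t, 0 < t → ∀ x,
      ‖(picard u₀ θ₀ (n + 1)).1 t x - (picard u₀ θ₀ n).1 t x‖ ≤
        12 * C * (M * (1 / 2) ^ n) * rho t x ^ (-1 : ℝ) ∧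
      |(picard u₀ θ₀ (n + 1)).2 t x - (picard u₀ θ₀ n).2 t x| ≤
        M * (1 / 2) ^ n * rho t x ^ (-3 : ℝ) := by
  have hM0 : 0 ≤ M := by rw [hM]; positivity
  have hNM : N ≤ M := by
    have h1 : C * ε ≤ C ^ 2 * ε := by nlinarith
    have : 0 ≤ C ^ 2 * ε := by positivity
    rw [hM, hN]; linarith
  have hA := fun n => (adm_picard hC hC1 hε hM hN hM' hl hD n).1.mono le_rfl hNM
  induction n with
  | zero =>
    intro t ht x
    have := (adm_picard hC hC1 hε hM hN hM' hl hD 1).2 t ht x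
    have e1 : (picard u₀ θ₀ 0).1 t x = 0 := rfl
    have e2 : (picard u₀ θ₀ 0).2 t x = 0 := rfl
    rw [e1, e2, sub_zero, sub_zero, pow_zero, mul_one]
    refine ⟨this.1.trans ?_, this.2.trans ?_⟩
    · exact mul_le_mul_of_nonneg_right (by nlinarith) (Real.rpow_nonneg (rho_nonneg _ _) _)
    · exact mul_le_mul_of_nonneg_right hNM (Real.rpow_nonneg (rho_nonneg _ _) _)
  | succ n ih =>
    intro t ht x
    have := next_sub_le_half hC hC1 hM0 hM' (hA (n + 1)) (hA n) (E := M * (1 / 2) ^ n)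
      (by positivity) (ae_spaceTime_of_forall fun s hs y => (ih s hs y).1)
      (ae_spaceTime_of_forall fun s hs y => (ih s hs y).2) u₀ θ₀ ht x
    have e : M * (1 / 2 : ℝ) ^ (n + 1) = M * (1 / 2) ^ n / 2 := by ring
    rw [e]
    exact ⟨this.2, this.1⟩

lemma exists_sol (hC : DuhBound C) (hC1 : 1 ≤ C) (hε : 0 ≤ ε)
    (hM : M = 18 * C ^ 2 * ε) (hN : N = 2 * C * ε) (hM' : 216 * C ^ 2 * M ≤ 1)
    (hl : LinBound C ε u₀ θ₀) (hD : Data ε u₀ θ₀) :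
    ∃ u θ, Sol M N u₀ θ₀ u θ := by
  have hM0 : 0 ≤ M := by rw [hM]; positivity
  have hNM : N ≤ M := by
    have h1 : C * ε ≤ C ^ 2 * ε := by nlinarith
    have : 0 ≤ C ^ 2 * ε := by positivity
    rw [hM, hN]; linarith
  have hA := fun n => adm_picard hC hC1 hε hM hN hM' hl hD n
  have hd := fun n => picard_sub_le hC hC1 hε hM hN hM' hl hD n
  have du : ∀ t, 0 < t → ∀ x n, dist ((picard u₀ θ₀ n).1 t x) ((picard u₀ θ₀ (n + 1)).1 t x) ≤
      (12 * C * M * rho t x ^ (-1 : ℝ)) * (1 / 2) ^ n := fun t ht x n => by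
    rw [dist_comm, dist_eq_norm]
    exact (hd n t ht x).1.trans (le_of_eq (by ring))
  have dθ : ∀ t, 0 < t → ∀ x n, dist ((picard u₀ θ₀ n).2 t x) ((picard u₀ θ₀ (n + 1)).2 t x) ≤
      (M * rho t x ^ (-3 : ℝ)) * (1 / 2) ^ n := fun t ht x n => by
    rw [dist_comm, Real.dist_eq]
    exact (hd n t ht x).2.trans (le_of_eq (by ring))
  have hh : (1 / 2 : ℝ) < 1 := by norm_num
  -- The estimates hold at every point of t > 0, so the limit is pointwise. For t ≤ 0 any value will
  -- do; 0 is chosen.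
  have lu : ∀ t x, ∃ v, 0 < t → Tendsto (fun n => (picard u₀ θ₀ n).1 t x) atTop (𝓝 v) := by
    intro t x
    by_cases ht : 0 < t
    · obtain ⟨v, hv⟩ := cauchySeq_tendsto_of_complete
        (cauchySeq_of_le_geometric _ _ hh (du t ht x))
      exact ⟨v, fun _ => hv⟩
    · exact ⟨0, fun h => absurd h ht⟩
  have lθ : ∀ t x, ∃ v, 0 < t → Tendsto (fun n => (picard u₀ θ₀ n).2 t x) atTop (𝓝 v) := by
    intro t x
    by_cases ht : 0 < t
    · obtain ⟨v, hv⟩ := cauchySeq_tendsto_of_complete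
        (cauchySeq_of_le_geometric _ _ hh (dθ t ht x))
      exact ⟨v, fun _ => hv⟩
    · exact ⟨0, fun h => absurd h ht⟩
  choose v hv using lu
  choose τ hτ using lθ
  -- The slice at time 0 is put in by hand. The integral equations only see times in (0, t).
  set u : ℝ → E3 → E3 := fun t => if t = 0 then u₀ else v t with hu
  set θ : ℝ → E3 → ℝ := fun t => if t = 0 then θ₀ else τ t with hθ
  have ue : ∀ t, 0 < t → u t = v t := fun t ht => if_neg ht.ne'
  have θe : ∀ t, 0 < t → θ t = τ t := fun t ht => if_neg ht.ne'
  have tu : ∀ t, 0 < t → ∀ x, Tendsto (fun n => (picard u₀ θ₀ n).1 t x) atTop (𝓝 (u t x)) :=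
    fun t ht x => by rw [ue t ht]; exact hv t x ht
  have tθ : ∀ t, 0 < t → ∀ x, Tendsto (fun n => (picard u₀ θ₀ n).2 t x) atTop (𝓝 (θ t x)) :=
    fun t ht x => by rw [θe t ht]; exact hτ t x ht
  have bu : ∀ t, 0 < t → ∀ x, ‖u t x‖ ≤ M * rho t x ^ (-1 : ℝ) := fun t ht x =>
    le_of_tendsto' (tu t ht x).norm fun n => ((hA n).2 t ht x).1
  have bθ : ∀ t, 0 < t → ∀ x, |θ t x| ≤ N * rho t x ^ (-3 : ℝ) := fun t ht x =>
    le_of_tendsto' (tθ t ht x).abs fun n => ((hA n).2 t ht x).2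
  have adm : Adm M N u θ :=
    ⟨aestronglyMeasurable_of_tendsto_ae atTop (fun n => (hA n).1.mu)
        (ae_spaceTime_of_forall fun s hs y => tu s hs y),
      aestronglyMeasurable_of_tendsto_ae atTop (fun n => (hA n).1.mθ)
        (ae_spaceTime_of_forall fun s hs y => tθ s hs y),
      ae_spaceTime_of_forall bu, ae_spaceTime_of_forall bθ⟩
  -- The distance from the n-th iterate to the limit is at most twice the n-th term of the geometric
  -- series, so the fixed point map applied to the iterates converges to its value at the limit.
  have cl : ∀ n, ∀ t, 0 < t → ∀ x,
      |nextT θ₀ (picard u₀ θ₀ n).1 (picard u₀ θ₀ n).2 t x - nextT θ₀ u θ t x| ≤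
        2 * M * (1 / 2) ^ n / 2 * rho t x ^ (-3 : ℝ) ∧
      ‖nextU u₀ (picard u₀ θ₀ n).1 (picard u₀ θ₀ n).2 t x - nextU u₀ u θ t x‖ ≤
        12 * C * (2 * M * (1 / 2) ^ n / 2) * rho t x ^ (-1 : ℝ) := by
    intro n t ht x
    refine next_sub_le_half hC hC1 hM0 hM' ((hA n).1.mono le_rfl hNM) (adm.mono le_rfl hNM)
      (E := 2 * M * (1 / 2) ^ n) (by positivity) (ae_spaceTime_of_forall fun s hs y => ?_)
      (ae_spaceTime_of_forall fun s hs y => ?_) u₀ θ₀ ht x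
    · rw [← dist_eq_norm]
      refine (dist_le_of_le_geometric_of_tendsto _ _ hh (du s hs y) (tu s hs y) n).trans
        (le_of_eq ?_)
      ring
    · rw [← Real.dist_eq]
      refine (dist_le_of_le_geometric_of_tendsto _ _ hh (dθ s hs y) (tθ s hs y) n).trans
        (le_of_eq ?_)
      ring
  have hz : Tendsto (fun n : ℕ => (1 / 2 : ℝ) ^ n) atTop (𝓝 0) :=
    tendsto_pow_atTop_nhds_zero_of_lt_one (by norm_num) hh
  refine ⟨u, θ, adm, bu, bθ, fun t ht x => ?_, fun t ht x => ?_, by simp [hu], by simp [hθ]⟩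
  · refine tendsto_nhds_unique ((tendsto_add_atTop_iff_nat 1).2 (tu t ht x)) ?_
    refine tendsto_iff_norm_sub_tendsto_zero.2 (squeeze_zero (fun _ => norm_nonneg _)
      (fun n => (cl n t ht x).2) ?_)
    have := hz.const_mul (12 * C * M * rho t x ^ (-1 : ℝ))
    rw [mul_zero] at this
    refine this.congr fun n => ?_
    ring
  · refine tendsto_nhds_unique ((tendsto_add_atTop_iff_nat 1).2 (tθ t ht x)) ?_
    refine tendsto_iff_norm_sub_tendsto_zero.2 (squeeze_zero (fun _ => norm_nonneg _)
      (fun n => (cl n t ht x).1) ?_)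
    have := hz.const_mul (M * rho t x ^ (-3 : ℝ))
    rw [mul_zero] at this
    refine this.congr fun n => ?_
    ring

/-- Uniqueness among small pairs in the critical weighted spaces. -/
lemma ae_eq_of_next (hC : DuhBound C) (hC1 : 1 ≤ C) (hM0 : 0 ≤ M) (hM' : 216 * C ^ 2 * M ≤ 1)
    (h : Adm M M u θ) (h' : Adm M M u' θ')
    (eu : ∀ᵐ z ∂spaceTime, u z.1 z.2 = nextU u₀ u θ z.1 z.2)
    (eθ : ∀ᵐ z ∂spaceTime, θ z.1 z.2 = nextT θ₀ u θ z.1 z.2)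
    (eu' : ∀ᵐ z ∂spaceTime, u' z.1 z.2 = nextU u₀ u' θ' z.1 z.2)
    (eθ' : ∀ᵐ z ∂spaceTime, θ' z.1 z.2 = nextT θ₀ u' θ' z.1 z.2) :
    ∀ᵐ z ∂spaceTime, u z.1 z.2 = u' z.1 z.2 ∧ θ z.1 z.2 = θ' z.1 z.2 := by
  have key : ∀ n : ℕ, (∀ᵐ z ∂spaceTime, ‖u z.1 z.2 - u' z.1 z.2‖ ≤
      12 * C * (2 * M * (1 / 2) ^ n) * rho z.1 z.2 ^ (-1 : ℝ)) ∧
      (∀ᵐ z ∂spaceTime, |θ z.1 z.2 - θ' z.1 z.2| ≤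
        2 * M * (1 / 2) ^ n * rho z.1 z.2 ^ (-3 : ℝ)) := by
    intro n
    induction n with
    | zero =>
      constructor
      · filter_upwards [h.bu, h'.bu] with z h1 h2
        refine (norm_sub_le _ _).trans ((add_le_add h1 h2).trans ?_)
        rw [← add_mul]
        exact mul_le_mul_of_nonneg_right (by nlinarith) (Real.rpow_nonneg (rho_nonneg _ _) _)
      · filter_upwards [h.bθ, h'.bθ] with z h1 h2
        refine (abs_sub _ _).trans ((add_le_add h1 h2).trans (le_of_eq (by ring)))
    | succ n ih =>
      have := fun t (ht : 0 < t) x => next_sub_le_half hC hC1 hM0 hM' h h'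
        (E := 2 * M * (1 / 2) ^ n) (by positivity) ih.1 ih.2 u₀ θ₀ ht x
      have e : 2 * M * (1 / 2 : ℝ) ^ (n + 1) = 2 * M * (1 / 2) ^ n / 2 := by ring
      rw [e]
      constructor
      · filter_upwards [eu, eu', ae_spaceTime_pos] with z h1 h2 hz
        rw [h1, h2]
        exact (this z.1 hz z.2).2
      · filter_upwards [eθ, eθ', ae_spaceTime_pos] with z h1 h2 hz
        rw [h1, h2]
        exact (this z.1 hz z.2).1
  have hz : Tendsto (fun n : ℕ => (1 / 2 : ℝ) ^ n) atTop (𝓝 0) :=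
    tendsto_pow_atTop_nhds_zero_of_lt_one (by norm_num) (by norm_num)
  filter_upwards [ae_all_iff.2 fun n => (key n).1, ae_all_iff.2 fun n => (key n).2] with z h1 h2
  constructor
  · have : Tendsto (fun n : ℕ => 12 * C * (2 * M * (1 / 2) ^ n) * rho z.1 z.2 ^ (-1 : ℝ)) atTop
        (𝓝 0) := by
      have := hz.const_mul (12 * C * (2 * M) * rho z.1 z.2 ^ (-1 : ℝ))
      rw [mul_zero] at this
      exact this.congr fun n => by ring
    have := ge_of_tendsto' this h1
    exact sub_eq_zero.1 (norm_le_zero_iff.1 this)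
  · have : Tendsto (fun n : ℕ => 2 * M * (1 / 2) ^ n * rho z.1 z.2 ^ (-3 : ℝ)) atTop (𝓝 0) := by
      have := hz.const_mul (2 * M * rho z.1 z.2 ^ (-3 : ℝ))
      rw [mul_zero] at this
      exact this.congr fun n => by ring
    have := ge_of_tendsto' this h2
    exact sub_eq_zero.1 (abs_nonpos_iff.1 this)

lemma nextT_congr (hu : ∀ᵐ z ∂spaceTime, u z.1 z.2 = u' z.1 z.2)
    (hθ : ∀ᵐ z ∂spaceTime, θ z.1 z.2 = θ' z.1 z.2) (t : ℝ) (x : E3) :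
    nextT θ₀ u θ t x = nextT θ₀ u' θ' t x := by
  unfold nextT
  congr 1
  refine Finset.sum_congr rfl fun l _ => duh_congr ?_ t x
  filter_upwards [hu, hθ] with z h1 h2
  rw [h1, h2]

lemma nextU_congr (hu : ∀ᵐ z ∂spaceTime, u z.1 z.2 = u' z.1 z.2)
    (hθ : ∀ᵐ z ∂spaceTime, θ z.1 z.2 = θ' z.1 z.2) (t : ℝ) (x : E3) :
    nextU u₀ u θ t x = nextU u₀ u' θ' t x := by
  unfold nextU
  congr 1
  ext j
  congr 1
  · congr 1
    refine Finset.sum_congr rfl fun k _ => Finset.sum_congr rfl fun l _ => duh_congr ?_ t x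
    filter_upwards [hu] with z h1
    rw [h1]
  · exact duh_congr hθ t x

end

/-! ### Comparison with the norms and the equations of the statement -/

lemma ofReal_pow_mul_enorm {F : Type*} [SeminormedAddGroup F] {a : ℝ} (ha : 0 ≤ a) (m : ℕ) (v : F) :
    ENNReal.ofReal a ^ m * ‖v‖ₑ = ENNReal.ofReal (a ^ m * ‖v‖) := by
  rw [← ofReal_norm v, ← ENNReal.ofReal_pow ha, ENNReal.ofReal_mul (pow_nonneg ha m)]

lemma le_mul_rpow_neg {a b c : ℝ} (ha : 0 < a) (m : ℕ) (h : a ^ m * b ≤ c) :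
    b ≤ c * a ^ (-(m : ℝ)) := by
  rw [Real.rpow_neg ha.le, Real.rpow_natCast, ← div_eq_mul_inv, le_div_iff₀ (pow_pos ha m)]
  linarith

lemma mul_le_of_le_rpow_neg {a b c : ℝ} (ha : 0 < a) (m : ℕ) (h : b ≤ c * a ^ (-(m : ℝ))) :
    a ^ m * b ≤ c := by
  rw [Real.rpow_neg ha.le, Real.rpow_natCast, ← div_eq_mul_inv, le_div_iff₀ (pow_pos ha m)] at h
  linarith

lemma SmallData.data {ε : ℝ} (hε : 0 < ε) {u₀ : E3 → E3} {θ₀ : E3 → ℝ} (h : SmallData ε u₀ θ₀) :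
    Data ε u₀ θ₀ := by
  have hi : Integrable θ₀ := memLp_one_iff_integrable.1
    ⟨h.aestronglyMeasurable_temperature, h.temperature_L1.trans_le le_top⟩
  refine ⟨h.aestronglyMeasurable_velocity, ?_, ?_, hi, ?_⟩
  · filter_upwards [ENNReal.ae_le_essSup (fun x => ‖x‖ₑ * ‖u₀ x‖ₑ), ae_ne_zero] with y hy h0
    have h1 := hy.trans h.velocity_sup.le
    have e := ofReal_pow_mul_enorm (norm_nonneg y) 1 (u₀ y)
    rw [pow_one, ofReal_norm] at e
    rw [e, ENNReal.ofReal_le_ofReal_iff hε.le] at h1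
    have := le_mul_rpow_neg (norm_pos_iff.2 h0) 1 h1
    simpa only [Nat.cast_one] using this
  · filter_upwards [ENNReal.ae_le_essSup (fun x => ‖x‖ₑ ^ 3 * ‖θ₀ x‖ₑ), ae_ne_zero] with y hy h0
    have h1 := hy.trans h.temperature_sup.le
    have e := ofReal_pow_mul_enorm (norm_nonneg y) 3 (θ₀ y)
    rw [ofReal_norm] at e
    rw [e, ENNReal.ofReal_le_ofReal_iff hε.le] at h1
    have := le_mul_rpow_neg (norm_pos_iff.2 h0) 3 h1
    simpa only [Nat.cast_ofNat, Real.norm_eq_abs] using this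
  · have h1 := h.temperature_L1.le
    rw [eLpNorm_one_eq_lintegral_enorm, ← ofReal_integral_norm_eq_lintegral_enorm hi,
      ENNReal.ofReal_le_ofReal_iff hε.le] at h1
    simpa only [Real.norm_eq_abs] using h1

lemma ae_le_of_normX {r : ℝ} (hr : 0 ≤ r) {u : ℝ → E3 → E3} (h : normX u ≤ ENNReal.ofReal r) :
    ∀ᵐ z ∂spaceTime, ‖u z.1 z.2‖ ≤ r * rho z.1 z.2 ^ (-1 : ℝ) := by
  filter_upwards [ENNReal.ae_le_essSup (fun p : ℝ × E3 =>
    ENNReal.ofReal (√p.1 + ‖p.2‖) * ‖u p.1 p.2‖ₑ), ae_spaceTime_pos] with z hz h0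
  have h1 := hz.trans h
  have e := ofReal_pow_mul_enorm (rho_nonneg z.1 z.2) 1 (u z.1 z.2)
  rw [pow_one, rho] at e
  rw [e, ENNReal.ofReal_le_ofReal_iff hr] at h1
  have := le_mul_rpow_neg (rho_pos h0 z.2) 1 h1
  simpa only [Nat.cast_one] using this

lemma ae_le_of_normY {r : ℝ} (hr : 0 ≤ r) {θ : ℝ → E3 → ℝ} (h : normY θ ≤ ENNReal.ofReal r) :
    ∀ᵐ z ∂spaceTime, |θ z.1 z.2| ≤ r * rho z.1 z.2 ^ (-3 : ℝ) := by
  filter_upwards [ENNReal.ae_le_essSup (fun p : ℝ × E3 =>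
    ENNReal.ofReal (√p.1 + ‖p.2‖) ^ 3 * ‖θ p.1 p.2‖ₑ), ae_spaceTime_pos] with z hz h0
  have h1 := hz.trans (le_add_self.trans h)
  have e := ofReal_pow_mul_enorm (rho_nonneg z.1 z.2) 3 (θ z.1 z.2)
  rw [rho] at e
  rw [e, ENNReal.ofReal_le_ofReal_iff hr] at h1
  have := le_mul_rpow_neg (rho_pos h0 z.2) 3 h1
  simpa only [Nat.cast_ofNat, Real.norm_eq_abs] using this

lemma normX_le {r : ℝ} {u : ℝ → E3 → E3}
    (h : ∀ t, 0 < t → ∀ x, ‖u t x‖ ≤ r * rho t x ^ (-1 : ℝ)) : normX u ≤ ENNReal.ofReal r := by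
  refine essSup_le_of_ae_le _ (ae_spaceTime_of_forall fun s hs y => ?_)
  have e := ofReal_pow_mul_enorm (rho_nonneg s y) 1 (u s y)
  rw [pow_one, pow_one, rho] at e
  refine e.trans_le (ENNReal.ofReal_le_ofReal ?_)
  have := mul_le_of_le_rpow_neg (rho_pos hs y) 1 (by simpa only [Nat.cast_one] using h s hs y)
  rwa [pow_one] at this

lemma normY_le {r r' : ℝ} (hr : 0 ≤ r) (hr' : 0 ≤ r') {θ : ℝ → E3 → ℝ}
    (h : ∀ t, 0 < t → ∀ x, |θ t x| ≤ r * rho t x ^ (-3 : ℝ))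
    (h1 : ∀ t, 0 < t → eLpNorm (θ t) 1 volume ≤ ENNReal.ofReal r') :
    normY θ ≤ ENNReal.ofReal (r' + r) := by
  rw [ENNReal.ofReal_add hr' hr]
  refine add_le_add (essSup_le_of_ae_le _ ?_)
    (essSup_le_of_ae_le _ (ae_spaceTime_of_forall fun s hs y => ?_))
  · filter_upwards [ae_restrict_mem measurableSet_Ioi] with t ht using h1 t ht
  have e := ofReal_pow_mul_enorm (rho_nonneg s y) 3 (θ s y)
  rw [rho] at e
  refine e.trans_le (ENNReal.ofReal_le_ofReal ?_)
  exact mul_le_of_le_rpow_neg (rho_pos hs y) 3 (by simpa only [Nat.cast_ofNat, Real.norm_eq_abs] using h s hs y)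

/-- Passing from almost every slice to almost every point of the product needs a measurable set;
hence the detour through a strongly measurable representative of f. -/
lemma ae_spaceTime_of_slices {F : Type*} [NormedAddCommGroup F] [MeasurableSpace F] [BorelSpace F]
    {f g : ℝ × E3 → F}
    (hf : AEStronglyMeasurable f spaceTime) (hg : StronglyMeasurable g)
    (h : ∀ t, 0 < t → ∀ᵐ x, f (t, x) = g (t, x)) : ∀ᵐ z ∂spaceTime, f z = g z := by
  have h1 : ∀ᵐ z ∂spaceTime, hf.mk f z = g z := by
    have h2 := Measure.ae_ae_of_ae_prod hf.ae_eq_mk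
    have hms : MeasurableSet {z : ℝ × E3 | hf.mk f z = g z} :=
      hf.stronglyMeasurable_mk.measurableSet_eq_fun hg
    refine (Measure.ae_prod_iff_ae_ae hms).2 ?_
    filter_upwards [h2, ae_restrict_mem measurableSet_Ioi] with t ht ht0
    filter_upwards [ht, h t ht0] with x hx hx'
    rw [← hx, hx']
  filter_upwards [h1, hf.ae_eq_mk] with z hz hz'
  rw [hz', hz]

lemma integral_Ioo_sum {ι : Type*} [Fintype ι] {t : ℝ} {F : ι → ℝ × E3 → ℝ}
    (hF : ∀ i, Integrable (F i) (nu t)) :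
    ∫ s in Ioo 0 t, ∫ y, ∑ i, F i (s, y) = ∑ i, ∫ z, F i z ∂nu t := by
  rw [← integral_finsetSum _ fun i _ => hF i]
  exact (integral_prod (fun z => ∑ i, F i z) (integrable_finsetSum _ fun i _ => hF i)).symm

section

variable {C M N : ℝ} {u : ℝ → E3 → E3} {θ : ℝ → E3 → ℝ}

lemma nextT_eq (hC : DuhBound C) (hM : 0 ≤ M) (hN : 0 ≤ N) (h : Adm M N u θ) (θ₀ : E3 → ℝ) {t : ℝ}
    (ht : 0 < t) (x : E3) : (∫ y, heatKernel t (x - y) * θ₀ y)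
      - ∫ s in Ioo 0 t, ∫ y, ∑ l, pd l (heatKernel (t - s)) (x - y) * (θ s y * u s y l) =
      nextT θ₀ u θ t x := by
  simp_rw [pd_heatKernel]
  exact congrArg _ (integral_Ioo_sum fun l =>
    (hC.heat l (N * M) _ (by positivity) (h.mθu l) (h.bθu l) t ht x).1)

lemma nextU_eq (hC : DuhBound C) (hM : 0 ≤ M) (hN : 0 ≤ N) (h : Adm M N u θ) (u₀ : E3 → E3) {t : ℝ}
    (ht : 0 < t) (x : E3) (j : Fin 3) : (∫ y, heatKernel t (x - y) * u₀ y j)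
      - (∫ s in Ioo 0 t, ∫ y, ∑ k, ∑ l,
          oseenGradKernel (t - s) j k l (x - y) * (u s y k * u s y l))
      + ∫ s in Ioo 0 t, ∫ y, oseenKernel (t - s) j 2 (x - y) * θ s y = nextU u₀ u θ t x j := by
  have hi := fun k l => (hC.grad j k l (M * M) _ (by positivity) (h.muu k l) (h.buu k l) t ht x).1
  have e1 : ∫ s in Ioo 0 t, ∫ y, ∑ k, ∑ l,
      oseenGradKernel (t - s) j k l (x - y) * (u s y k * u s y l) =
      ∑ k, ∑ l, duh (fun σ => oseenGradKernel σ j k l)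
        (fun z => u z.1 z.2 k * u z.1 z.2 l) t x := by
    have := integral_Ioo_sum (fun k => integrable_finsetSum Finset.univ fun l _ => hi k l)
    refine this.trans (Finset.sum_congr rfl fun k _ => ?_)
    rw [integral_finsetSum _ fun l _ => hi k l]
    rfl
  have e2 : ∫ s in Ioo 0 t, ∫ y, oseenKernel (t - s) j 2 (x - y) * θ s y =
      duh (fun σ => oseenKernel σ j 2) (fun z => θ z.1 z.2) t x :=
    (integral_prod _ (hC.oseen j 2 N _ hN h.mθ h.bθ t ht x).1).symm
  rw [e1, e2]
  rfl

end

lemma Sol.isMildSolution {C M N : ℝ} {u₀ : E3 → E3} {θ₀ : E3 → ℝ} {u : ℝ → E3 → E3}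
    {θ : ℝ → E3 → ℝ} (hC : DuhBound C) (hM : 0 ≤ M) (hN : 0 ≤ N) (h : Sol M N u₀ θ₀ u θ) :
    IsMildSolution u₀ θ₀ u θ where
  initial_velocity := by rw [h.zu]
  initial_temperature := by rw [h.zθ]
  temperature t ht := ae_of_all _ fun x => by
    rw [nextT_eq hC hM hN h.adm θ₀ ht x, ← h.eθ t ht x]
  velocity t ht := ae_of_all _ fun x j => by
    rw [nextU_eq hC hM hN h.adm u₀ ht x j, ← h.eu t ht x]

/-- The competitor satisfies the fixed point equation almost everywhere in space-time, hence agrees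
there with the constructed pair by `ae_eq_of_next`. Duhamel integrals depend only on the space-time
class, so the integral equation upgrades this to agreement on every time slice. -/
lemma Sol.unique {C M N : ℝ} {u₀ : E3 → E3} {θ₀ : E3 → ℝ} {u u' : ℝ → E3 → E3}
    {θ θ' : ℝ → E3 → ℝ} (hC : DuhBound C) (hC1 : 1 ≤ C) (hM0 : 0 ≤ M) (hNM : N ≤ M)
    (hM' : 216 * C ^ 2 * M ≤ 1) (hu₀ : AEStronglyMeasurable u₀ volume)
    (hθ₀ : AEStronglyMeasurable θ₀ volume)
    (h : Sol M N u₀ θ₀ u θ) (h' : IsStrongSolution M u₀ θ₀ u' θ') {t : ℝ} (ht : 0 ≤ t) :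
    u' t =ᵐ[volume] u t ∧ θ' t =ᵐ[volume] θ t := by
  have hA : Adm M M u θ := h.adm.mono le_rfl hNM
  have hA' : Adm M M u' θ' := ⟨h'.memX.aestronglyMeasurable, h'.memY.aestronglyMeasurable,
    ae_le_of_normX hM0 h'.normX_le, ae_le_of_normY hM0 h'.normY_le⟩
  have eU : ∀ t, 0 < t → ∀ᵐ x, u' t x = nextU u₀ u' θ' t x := fun t ht => by
    filter_upwards [h'.mild.velocity t ht] with x hx
    ext j
    rw [← nextU_eq hC hM0 hM0 hA' u₀ ht x j]
    exact hx j
  have eT : ∀ t, 0 < t → ∀ᵐ x, θ' t x = nextT θ₀ u' θ' t x := fun t ht => by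
    filter_upwards [h'.mild.temperature t ht] with x hx
    rw [← nextT_eq hC hM0 hM0 hA' θ₀ ht x]
    exact hx
  have key := ae_eq_of_next hC hC1 hM0 hM' hA' hA (u₀ := u₀) (θ₀ := θ₀)
    (ae_spaceTime_of_slices hA'.mu (stronglyMeasurable_nextU hA' hu₀) eU)
    (ae_spaceTime_of_slices hA'.mθ (stronglyMeasurable_nextT hA' hθ₀) eT)
    (ae_spaceTime_of_forall h.eu) (ae_spaceTime_of_forall h.eθ)
  rcases ht.eq_or_lt with rfl | ht
  · rw [h.zu, h.zθ]
    exact ⟨h'.mild.initial_velocity, h'.mild.initial_temperature⟩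
  · constructor
    · filter_upwards [eU t ht] with x hx
      rw [hx, h.eu t ht x]
      exact nextU_congr (key.mono fun _ h => h.1) (key.mono fun _ h => h.2) t x
    · filter_upwards [eT t ht] with x hx
      rw [hx, h.eθ t ht x]
      exact nextT_congr (key.mono fun _ h => h.1) (key.mono fun _ h => h.2) t x

/-! ### Duhamel integrals against test functions -/

lemma powInt_le {g p q : ℝ} (hp : 0 < p) (hq : 0 < q) (hp5 : p < 5) (hq5 : q < 5)
    (hpq : 5 ≤ p + q) (hg : g < q / 10) (hg' : g < (5 - p) / 10) :
    ∃ C > 0, ∀ t : ℝ, 0 < t → ∀ x : E3,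
      powInt g p q t x ≤ C * (t ^ (-g) * rho t x ^ (-(p + q - 5))) := by
  obtain ⟨C, hC, H⟩ := dom_crit hp hq hp5 hq5 hpq hg hg'
  exact ⟨C, hC, fun t ht x => (H t ht x).integral_le⟩

lemma Ker.integral_abs_le {p C : ℝ} {k : ℝ → E3 → ℝ} (hk : Ker p C k) {q A : ℝ}
    (hp : 0 < p) (hq : 0 < q) (hp5 : p < 5) (hq5 : q < 5) (hpq : 5 ≤ p + q)
    {f : ℝ × E3 → ℝ} (hfm : AEStronglyMeasurable f spaceTime)
    (hf : ∀ᵐ z ∂spaceTime, |f z| ≤ A * rho z.1 z.2 ^ (-q)) {t : ℝ} (ht : 0 < t) (x : E3) :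
    Integrable (fun z => k (t - z.1) (x - z.2) * f z) (nu t) ∧
      ∫ z, |k (t - z.1) (x - z.2) * f z| ∂nu t ≤ C * A * powInt 0 p q t x := by
  have hi := integrable_powInt hp hq hp5 hq5 hpq (g := 0) (by linarith) (by linarith) ht x
  have hle : ∀ᵐ z ∂nu t, |k (t - z.1) (x - z.2) * f z| ≤ C * A * ((t - z.1) ^ (-0 : ℝ) *
      (rho (t - z.1) (x - z.2) ^ (-p) * rho z.1 z.2 ^ (-q))) := by
    filter_upwards [ae_nu_of_spaceTime hf, ae_nu_mem t] with z hz hs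
    rw [abs_mul, neg_zero, Real.rpow_zero, one_mul]
    have h1 := hk.bound (t - z.1) (by linarith [hs.2]) (x - z.2)
    refine (mul_le_mul h1 hz (abs_nonneg _) ((abs_nonneg _).trans h1)).trans (le_of_eq (by ring))
  have hi' : Integrable (fun z => k (t - z.1) (x - z.2) * f z) (nu t) := by
    refine (hi.const_mul (C * A)).mono' ?_ hle
    exact (measurable_kernel_comp hk.measurable (by fun_prop)
      (by fun_prop)).aestronglyMeasurable.mul (aestronglyMeasurable_nu hfm t)
  refine ⟨hi', ?_⟩
  unfold powInt
  rw [← integral_const_mul]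
  exact integral_mono_ae hi'.abs (hi.const_mul _) hle

lemma Ker.integrable_prod_test {p C : ℝ} {k : ℝ → E3 → ℝ} (hk : Ker p C k) {q A : ℝ}
    (hp : 0 < p) (hq : 0 < q) (hp5 : p < 5) (hq5 : q < 5) (hpq : 5 ≤ p + q)
    {f : ℝ × E3 → ℝ} (hfm : AEStronglyMeasurable f spaceTime)
    (hf : ∀ᵐ z ∂spaceTime, |f z| ≤ A * rho z.1 z.2 ^ (-q)) {t : ℝ} (ht : 0 < t)
    {ψ : E3 → ℝ} (hψ : Continuous ψ) (hc : HasCompactSupport ψ) :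
    Integrable (fun w : E3 × (ℝ × E3) => ψ w.1 * (k (t - w.2.1) (w.1 - w.2.2) * f w.2))
      ((volume : Measure E3).prod (nu t)) := by
  refine integrable_prod_of_left (b := fun x => C * A * powInt 0 p q t x) hk.measurable
    (aestronglyMeasurable_nu hfm t) hψ.aestronglyMeasurable
    (ae_of_all _ fun x => (hk.integral_abs_le hp hq hp5 hq5 hpq hfm hf ht x).1)
    (ae_of_all _ fun x => (hk.integral_abs_le hp hq hp5 hq5 hpq hfm hf ht x).2) ?_
  obtain ⟨C₀, h₀, H⟩ := powInt_le (g := 0) hp hq hp5 hq5 hpq (by linarith) (by linarith)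
  refine (hψ.integrable_of_hasCompactSupport hc).mul_bdd (c := |C * A| *
      (C₀ * (t ^ (-0 : ℝ) * t ^ (-((p + q - 5) / 2)))))
    ((measurable_powInt 0 p q t).const_mul (C * A)).aestronglyMeasurable (ae_of_all _ fun x => ?_)
  rw [Real.norm_eq_abs, abs_mul, abs_of_nonneg (powInt_nonneg _ _ _ _ _)]
  refine mul_le_mul_of_nonneg_left ((H t ht x).trans ?_) (abs_nonneg _)
  have := rho_rpow_le_sqrt ht x (e := p + q - 5) (by linarith)
  have : 0 ≤ t ^ (-0 : ℝ) := Real.rpow_nonneg ht.le _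
  gcongr

lemma integrable_mul_duh {k : ℝ → E3 → ℝ} {f : ℝ × E3 → ℝ} {ψ : E3 → ℝ} {t : ℝ}
    (h : Integrable (fun w : E3 × (ℝ × E3) => ψ w.1 * (k (t - w.2.1) (w.1 - w.2.2) * f w.2))
      ((volume : Measure E3).prod (nu t))) : Integrable (fun x => ψ x * duh k f t x) := by
  have := h.integral_prod_left
  unfold duh
  simp_rw [← integral_const_mul]
  exact this

/-- Duhamel integrals against kernels which are divergence-free in the sense of distributions. -/
lemma sum_integral_mul_duh_eq_zero {k : Fin 3 → ℝ → E3 → ℝ} {f : ℝ × E3 → ℝ} {ψ : Fin 3 → E3 → ℝ}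
    {t : ℝ} (h : ∀ j, Integrable (fun w : E3 × (ℝ × E3) =>
      ψ j w.1 * (k j (t - w.2.1) (w.1 - w.2.2) * f w.2)) ((volume : Measure E3).prod (nu t)))
    (h0 : ∀ s ∈ Ioo 0 t, ∀ y, ∑ j, ∫ x, k j (t - s) (x - y) * ψ j x = 0) :
    ∑ j, ∫ x, ψ j x * duh (k j) f t x = 0 := by
  simp_rw [integral_mul_duh (h _)]
  have hi : ∀ j, Integrable (fun z : ℝ × E3 => (∫ x, k j (t - z.1) (x - z.2) * ψ j x) * f z)
      (nu t) := fun j => by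
    have := (h j).integral_prod_right
    refine this.congr (ae_of_all _ fun z => ?_)
    dsimp only
    rw [← integral_mul_const]
    congr 1
    ext x
    ring
  rw [← integral_finsetSum _ fun j _ => hi j]
  refine integral_eq_zero_of_ae ?_
  filter_upwards [ae_nu_mem t] with z hz
  rw [← Finset.sum_mul, h0 z.1 hz z.2, zero_mul, Pi.zero_apply]

/-! ### The linear flow against test functions -/

/-- Heat averages of a test function are bounded by its supremum for |y| ≤ 1 and by ρ(t,y)^(-3) ≤
|y|^(-3) beyond, uniformly in t. The bound (1+|y|)^(-3) is integrable against both u₀ and θ₀, and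
serves for Fubini and for dominated convergence as t → 0. -/
lemma integrable_lin_slice {ψ : E3 → ℝ} (hψ : Continuous ψ) (hc : HasCompactSupport ψ) :
    ∃ C > 0, ∀ t, 0 < t → ∀ y, Integrable (fun x => heatKernel t (x - y) * ψ x) ∧
      ∫ x, |heatKernel t (x - y) * ψ x| ≤ C * (1 + ‖y‖) ^ (-3 : ℝ) := by
  obtain ⟨C, hC, H⟩ := conv_le_of_integrable
  obtain ⟨κ, hκ, Hκ⟩ := heatKernel_bound
  have hi := hψ.integrable_of_hasCompactSupport (μ := volume) hc
  obtain ⟨D₁, hD₁⟩ := (hψ.norm.mul (continuous_norm.pow 3)).bounded_above_of_compact_support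
    (hc.norm.mul_right)
  obtain ⟨B, hB⟩ := hψ.bounded_above_of_compact_support hc
  set D := |D₁| + ∫ y, |ψ y| with hD
  have hD0 : 0 ≤ D := by positivity
  have hDb : ∀ᵐ y, |(|ψ y|)| ≤ D * ‖y‖ ^ (-3 : ℝ) := by
    filter_upwards [ae_ne_zero] with y hy
    have h1 : ‖‖ψ y‖ * ‖y‖ ^ 3‖ ≤ D₁ := hD₁ y
    have h2 : ‖y‖ ^ 3 * |ψ y| ≤ D := by
      have : ‖‖ψ y‖ * ‖y‖ ^ 3‖ = ‖y‖ ^ 3 * |ψ y| := by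
        rw [Real.norm_of_nonneg (by positivity), Real.norm_eq_abs, mul_comm]
      rw [this] at h1
      have : 0 ≤ ∫ y, |ψ y| := integral_nonneg fun _ => abs_nonneg _
      linarith [le_abs_self D₁]
    rw [abs_abs]
    have := le_mul_rpow_neg (norm_pos_iff.2 hy) 3 h2
    simpa only [Nat.cast_ofNat] using this
  refine ⟨8 * (C * (κ * D) + |B| + 1), by positivity, fun t ht y => ?_⟩
  have hg : ∀ x, heatKernel t (x - y) = heatKernel t (y - x) := fun x => by
    rw [← heatKernel_neg, neg_sub]
  have hH := H t κ D (heatKernel t) (fun y => |ψ y|) ht hκ.le hD0 (Hκ t ht) hDb (by fun_prop)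
    hi.abs (by simp only [abs_abs]; linarith [abs_nonneg D₁]) y
  have e : ∀ x, |heatKernel t (x - y) * ψ x| = heatKernel t (y - x) * |ψ x| := fun x => by
    rw [hg, abs_mul, abs_of_nonneg (heatKernel_nonneg ht _)]
  have hint : Integrable (fun x => heatKernel t (x - y) * ψ x) := by
    refine hH.1.mono' ?_ (ae_of_all _ fun x => ?_)
    · exact (Measurable.aestronglyMeasurable (by fun_prop)).mul hψ.aestronglyMeasurable
    · rw [Real.norm_eq_abs, e]
  refine ⟨hint, ?_⟩
  simp_rw [e]
  have hpos : 0 < (1 + ‖y‖) := by positivity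
  have b1 : ∫ x, heatKernel t (y - x) * |ψ x| ≤ |B| := by
    have : ∫ x, heatKernel t (y - x) * |ψ x| ≤ ∫ x, heatKernel t (y - x) * |B| := by
      refine integral_mono hH.1 (((integrable_heatKernel ht).comp_sub_left y).mul_const _) fun x => ?_
      exact mul_le_mul_of_nonneg_left ((hB x).trans (le_abs_self _)) (heatKernel_nonneg ht _)
    rwa [integral_mul_const, integral_sub_left_eq_self (heatKernel t) volume y,
      integral_heatKernel ht, one_mul] at this
  have b2 : ∫ x, heatKernel t (y - x) * |ψ x| ≤ C * (κ * D) * rho t y ^ (-3 : ℝ) :=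
    (le_abs_self _).trans hH.2
  rcases le_total ‖y‖ 1 with hy | hy
  · have h2 : (8 : ℝ)⁻¹ ≤ (1 + ‖y‖) ^ (-3 : ℝ) := by
      rw [show (8 : ℝ)⁻¹ = 2 ^ (-3 : ℝ) by norm_num [Real.rpow_neg]]
      exact rpow_neg_le hpos (by linarith) (by norm_num)
    have : 8 * (C * (κ * D) + |B| + 1) * 8⁻¹ ≤
      8 * (C * (κ * D) + |B| + 1) * (1 + ‖y‖) ^ (-3 : ℝ) := by gcongr
    have : 0 ≤ C * (κ * D) := by positivity
    linarith
  · have h0 : 0 < ‖y‖ := by linarith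
    have h1 : rho t y ^ (-3 : ℝ) ≤ ‖y‖ ^ (-3 : ℝ) := rpow_neg_le h0 (norm_le_rho _ _) (by norm_num)
    have h2 : ‖y‖ ^ (-3 : ℝ) ≤ 8 * (1 + ‖y‖) ^ (-3 : ℝ) := by
      have := rpow_neg_pull h0 hpos (by linarith : 1 + ‖y‖ ≤ 2 * ‖y‖) (e := 3) (by norm_num) 3
      rw [sub_self, neg_zero, Real.rpow_zero, mul_one] at this
      refine this.trans (le_of_eq ?_)
      norm_num
    have h3 : C * (κ * D) * rho t y ^ (-3 : ℝ) ≤ C * (κ * D) * (8 * (1 + ‖y‖) ^ (-3 : ℝ)) := by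
      have := h1.trans h2
      gcongr
    have h4 : 0 ≤ (|B| + 1) * (8 * (1 + ‖y‖) ^ (-3 : ℝ)) := by positivity
    linarith

lemma integrable_prod_lin {ψ f : E3 → ℝ} (hψ : Continuous ψ) (hc : HasCompactSupport ψ)
    (hfm : AEStronglyMeasurable f volume)
    (hf : Integrable fun y => (1 + ‖y‖) ^ (-3 : ℝ) * f y) {t : ℝ} (ht : 0 < t) :
    Integrable (fun w : E3 × E3 => ψ w.1 * (heatKernel t (w.1 - w.2) * f w.2))
      ((volume : Measure E3).prod volume) := by
  obtain ⟨C, hC, H⟩ := integrable_lin_slice hψ hc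
  have hm : AEStronglyMeasurable (fun w : E3 × E3 => ψ w.1 * (heatKernel t (w.1 - w.2) * f w.2))
      ((volume : Measure E3).prod volume) :=
    hψ.aestronglyMeasurable.comp_fst.mul
      ((Measurable.aestronglyMeasurable (by fun_prop)).mul hfm.comp_snd)
  have e : ∀ x y, ψ x * (heatKernel t (x - y) * f y) = (heatKernel t (x - y) * ψ x) * f y :=
    fun x y => by ring
  rw [integrable_prod_iff' hm]
  refine ⟨ae_of_all _ fun y => ?_, (hf.norm.const_mul C).mono' ?_ (ae_of_all _ fun y => ?_)⟩
  · simp only [e]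
    exact (H t ht y).1.mul_const _
  · exact hm.norm.prod_swap.integral_prod_right'
  · simp only [e, norm_mul _ (f y), integral_mul_const]
    rw [norm_mul, norm_norm, Real.norm_of_nonneg (integral_nonneg fun _ => norm_nonneg _), ← mul_assoc,
      Real.norm_of_nonneg (by positivity : (0 : ℝ) ≤ (1 + ‖y‖) ^ (-3 : ℝ))]
    exact mul_le_mul_of_nonneg_right (H t ht y).2 (norm_nonneg _)

lemma integral_mul_lin {ψ f : E3 → ℝ} {t : ℝ}
    (h : Integrable (fun w : E3 × E3 => ψ w.1 * (heatKernel t (w.1 - w.2) * f w.2))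
      ((volume : Measure E3).prod volume)) :
    Integrable (fun x => ψ x * lin f t x) ∧
      ∫ x, ψ x * lin f t x = ∫ y, (∫ x, heatKernel t (x - y) * ψ x) * f y := by
  unfold lin
  simp_rw [← integral_const_mul]
  refine ⟨h.integral_prod_left, ?_⟩
  rw [integral_integral_swap h]
  congr 1
  ext y
  rw [← integral_mul_const]
  congr 1
  ext x
  ring

lemma exists_test_le {ψ : E3 → ℝ} (hψ : Continuous ψ) (hc : HasCompactSupport ψ) :
    ∃ C > 0, ∀ y, |ψ y| ≤ C * (1 + ‖y‖) ^ (-3 : ℝ) := by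
  obtain ⟨D, hD⟩ := (hψ.mul ((continuous_const.add continuous_norm).pow 3 :
    Continuous fun y : E3 => (1 + ‖y‖) ^ 3)).bounded_above_of_compact_support hc.mul_right
  refine ⟨|D| + 1, by positivity, fun y => ?_⟩
  have h1 : ‖ψ y * (1 + ‖y‖) ^ 3‖ ≤ D := hD y
  have h0 : 0 < 1 + ‖y‖ := by positivity
  rw [norm_mul, Real.norm_of_nonneg (pow_nonneg h0.le 3), Real.norm_eq_abs] at h1
  have := le_mul_rpow_neg h0 3 (b := |ψ y|) (c := |D| + 1) (by linarith [le_abs_self D])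
  simpa only [Nat.cast_ofNat] using this

lemma integrable_test_mul {F : Type*} [NormedAddCommGroup F] [NormedSpace ℝ F] {ψ : E3 → ℝ}
    (hψ : Continuous ψ) (hc : HasCompactSupport ψ) {f : E3 → F} (hfm : AEStronglyMeasurable f volume)
    (hf : Integrable fun y => (1 + ‖y‖) ^ (-3 : ℝ) • f y) : Integrable fun y => ψ y • f y := by
  obtain ⟨C, hC, H⟩ := exists_test_le hψ hc
  refine (hf.norm.const_mul C).mono' (hψ.aestronglyMeasurable.smul hfm) (ae_of_all _ fun y => ?_)
  rw [norm_smul, norm_smul, Real.norm_of_nonneg (by positivity : (0 : ℝ) ≤ (1 + ‖y‖) ^ (-3 : ℝ)),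
    ← mul_assoc]
  exact mul_le_mul_of_nonneg_right (H y) (norm_nonneg _)

lemma aesm_weight : AEStronglyMeasurable (fun y : E3 => (1 + ‖y‖) ^ (-3 : ℝ)) volume :=
  Measurable.aestronglyMeasurable (by fun_prop)

lemma integrable_test_rpow {ψ : E3 → ℝ} (hψ : Continuous ψ) (hc : HasCompactSupport ψ) :
    Integrable fun y => |ψ y| * ‖y‖ ^ (-(3 / 2) : ℝ) := by
  have hm : AEStronglyMeasurable (fun y : E3 => ‖y‖ ^ (-(3 / 2) : ℝ)) volume :=
    Measurable.aestronglyMeasurable (by fun_prop)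
  refine integrable_test_mul hψ.abs (by simpa using hc.norm) hm ?_
  refine (integrable_one_add_rpow_mul_rpow (a := 3 / 2) (by norm_num)).mono'
    (aesm_weight.smul hm) (ae_of_all _ fun y => ?_)
  rw [norm_smul, Real.norm_of_nonneg (by positivity), Real.norm_of_nonneg (by positivity)]
  refine mul_le_mul_of_nonneg_right ?_ (by positivity)
  exact Real.rpow_le_rpow_of_exponent_le (by linarith [norm_nonneg y]) (by norm_num)

section Data

variable {ε : ℝ} {u₀ : E3 → E3} {θ₀ : E3 → ℝ}

lemma Data.integrable_velocity (h : Data ε u₀ θ₀) :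
    Integrable fun y => (1 + ‖y‖) ^ (-3 : ℝ) • u₀ y := by
  have := (integrable_one_add_rpow_mul_rpow (a := 1) (by norm_num)).const_mul ε
  refine this.mono' (aesm_weight.smul h.mu) ?_
  filter_upwards [h.bu] with y hy
  rw [norm_smul, Real.norm_of_nonneg (by positivity), show -((4 : ℝ) - 1) = -3 by norm_num,
    mul_left_comm]
  exact mul_le_mul_of_nonneg_left hy (by positivity)

lemma Data.integrable_temperature (h : Data ε u₀ θ₀) :
    Integrable fun y => (1 + ‖y‖) ^ (-3 : ℝ) * θ₀ y := by
  refine h.iθ.norm.mono' ((Measurable.aestronglyMeasurable (by fun_prop)).mul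
    h.iθ.aestronglyMeasurable) (ae_of_all _ fun y => ?_)
  rw [norm_mul, Real.norm_of_nonneg (by positivity)]
  refine mul_le_of_le_one_left (norm_nonneg _) ?_
  exact Real.rpow_le_one_of_one_le_of_nonpos (by linarith [norm_nonneg y]) (by norm_num)

lemma Data.integrable_coord (h : Data ε u₀ θ₀) (j : Fin 3) :
    Integrable fun y => (1 + ‖y‖) ^ (-3 : ℝ) * u₀ y j := by
  refine h.integrable_velocity.norm.mono' ((Measurable.aestronglyMeasurable (by fun_prop)).mul
    (aesm_coord h.mu j)) (ae_of_all _ fun y => ?_)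
  rw [norm_mul, norm_smul]
  exact mul_le_mul_of_nonneg_left (abs_coord_le _ j) (norm_nonneg _)

end Data

/-- The heat flow preserves the divergence-free condition. -/
lemma sum_integral_pd_mul_lin {v : E3 → E3} (hv : IsDivFree v) (hvm : AEStronglyMeasurable v volume)
    (hi : ∀ j, Integrable fun y => (1 + ‖y‖) ^ (-3 : ℝ) * v y j) {t : ℝ} (ht : 0 < t) {φ : E3 → ℝ}
    (hφ : ContDiff ℝ ∞ φ) (hc : HasCompactSupport φ) :
    ∑ j, ∫ x, pd j φ x * lin (fun y => v y j) t x = 0 := by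
  have hF := fun j => integrable_prod_lin (contDiff_pd hφ j).continuous (hasCompactSupport_pd hc j)
    (aesm_coord hvm j) (hi j) ht
  have hG : ∀ j, Integrable (fun w : E3 × E3 =>
      heatKernel t w.1 * (v w.2 j * pd j φ (w.1 + w.2))) ((volume : Measure E3).prod volume) := by
    intro j
    have := ((measurePreserving_add_prod (volume : Measure E3) (volume : Measure E3)
      ).integrable_comp_of_integrable (hF j))
    refine this.congr (ae_of_all _ fun w => ?_)
    simp only [Function.comp, add_sub_cancel_right]
    ring
  have e : ∀ j, ∫ x, pd j φ x * lin (fun y => v y j) t x =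
      ∫ w : E3 × E3, heatKernel t w.1 * (v w.2 j * pd j φ (w.1 + w.2))
        ∂((volume : Measure E3).prod volume) := by
    intro j
    rw [(integral_mul_lin (hF j)).2, integral_prod_symm _ (hG j)]
    congr 1
    ext y
    rw [← integral_mul_const, ← integral_add_right_eq_self _ y]
    congr 1
    ext x
    rw [add_sub_cancel_right]
    ring
  simp_rw [e]
  rw [← integral_finsetSum _ fun j _ => hG j, integral_prod _ (integrable_finsetSum _ fun j _ => hG j)]
  refine integral_eq_zero_of_ae (ae_of_all _ fun z => ?_)
  -- After the substitution x = z + y the kernel depends on z alone. For fixed z the inner integral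
  -- tests v against the gradient of a translate of φ, so it vanishes.
  have h0 := hv (fun y => φ (z + y)) (hφ.comp (contDiff_const.add contDiff_id))
    (hc.comp_homeomorph (Homeomorph.addLeft z))
  have hp : ∀ j y, pd j (fun y => φ (z + y)) y = pd j φ (z + y) := fun j y => by
    unfold pd
    rw [fderiv_comp_add_left]
  simp_rw [hp] at h0
  simp only [← Finset.mul_sum]
  rw [integral_const_mul, h0, mul_zero, Pi.zero_apply]

/-- The kernel has mass one, so ψ y can be subtracted under the integral; the Lipschitz bound then
gives the rate √t. -/
lemma tendsto_average {ψ : E3 → ℝ} (hψ : Continuous ψ) (hc : HasCompactSupport ψ) {L : ℝ}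
    (hL : 0 ≤ L) (hl : ∀ x y, |ψ x - ψ y| ≤ L * ‖x - y‖) (y : E3) :
    Tendsto (fun t => ∫ x, heatKernel t (x - y) * ψ x) (𝓝[>] 0) (𝓝 (ψ y)) := by
  obtain ⟨C, hC, H⟩ := heatKernel_le (M := 5) (by norm_num)
  obtain ⟨_, _, Hs⟩ := integrable_lin_slice hψ hc
  set I := ∫ y : E3, (1 + ‖y‖) ^ (-4 : ℝ) with hI
  have hb : ∀ t, 0 < t → |(∫ x, heatKernel t (x - y) * ψ x) - ψ y| ≤
      L * C * I * t ^ (1 / 2 : ℝ) := by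
    intro t ht
    have hg := (integrable_heatKernel ht).comp_sub_right y
    have e : (∫ x, heatKernel t (x - y) * ψ x) - ψ y =
        ∫ x, heatKernel t (x - y) * (ψ x - ψ y) := by
      simp_rw [mul_sub]
      rw [integral_sub (Hs t ht y).1 (hg.mul_const _), integral_mul_const,
        integral_sub_right_eq_self (heatKernel t) y, integral_heatKernel ht, one_mul]
    have hρ : Integrable (fun x : E3 => rho t (x - y) ^ (-4 : ℝ)) :=
      (integrable_rho_rpow (N := 4) (by norm_num) ht).comp_sub_right y
    rw [e, ← Real.norm_eq_abs]
    refine (norm_integral_le_of_norm_le (hρ.const_mul (L * C * t ^ (1 : ℝ)))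
      (ae_of_all _ fun x => ?_)).trans (le_of_eq ?_)
    · rw [norm_mul, Real.norm_of_nonneg (heatKernel_nonneg ht _), Real.norm_eq_abs]
      have h1 := H t ht (x - y)
      rw [show ((5 : ℝ) - 3) / 2 = 1 by norm_num] at h1
      have h2 : |ψ x - ψ y| ≤ L * rho t (x - y) ^ (1 : ℝ) := by
        rw [Real.rpow_one]
        exact (hl x y).trans (mul_le_mul_of_nonneg_left (norm_le_rho _ _) hL)
      refine (mul_le_mul h1 h2 (abs_nonneg _) ((heatKernel_nonneg ht _).trans h1)).trans
        (le_of_eq ?_)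
      rw [show (-4 : ℝ) = -5 + 1 by norm_num, ← rho_rpow_mul t ht]
      ring
    · rw [integral_const_mul, integral_sub_right_eq_self (fun x : E3 => rho t x ^ (-4 : ℝ)) y,
        integral_rho_rpow ht, ← hI]
      rw [show (1 / 2 : ℝ) = 1 + (3 - 4) / 2 by norm_num, Real.rpow_add ht]
      ring
  refine tendsto_iff_norm_sub_tendsto_zero.2 (squeeze_zero' (Eventually.of_forall fun _ =>
    norm_nonneg _) (eventually_nhdsWithin_of_forall fun t ht => hb t ht) ?_)
  have : Tendsto (fun t : ℝ => t ^ (1 / 2 : ℝ)) (𝓝[>] 0) (𝓝 0) := by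
    have := (Real.continuous_rpow_const (q := 1 / 2) (by norm_num)).tendsto 0
    rw [Real.zero_rpow (by norm_num)] at this
    exact this.mono_left nhdsWithin_le_nhds
  simpa using this.const_mul (L * C * I)

lemma tendsto_integral_mul_lin {ψ f : E3 → ℝ} (hψ : Continuous ψ) (hc : HasCompactSupport ψ)
    {L : ℝ} (hL : 0 ≤ L) (hl : ∀ x y, |ψ x - ψ y| ≤ L * ‖x - y‖)
    (hfm : AEStronglyMeasurable f volume)
    (hf : Integrable fun y => (1 + ‖y‖) ^ (-3 : ℝ) * f y) :
    Tendsto (fun t => ∫ x, ψ x * lin f t x) (𝓝[>] 0) (𝓝 (∫ x, ψ x * f x)) := by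
  obtain ⟨C, hC, H⟩ := integrable_lin_slice hψ hc
  have h1 : Tendsto (fun t => ∫ y, (∫ x, heatKernel t (x - y) * ψ x) * f y) (𝓝[>] 0)
      (𝓝 (∫ x, ψ x * f x)) := by
    refine tendsto_integral_filter_of_dominated_convergence
      (fun y => ‖C * ((1 + ‖y‖) ^ (-3 : ℝ) * f y)‖) ?_ ?_ (hf.const_mul C).norm ?_
    · filter_upwards [self_mem_nhdsWithin] with t ht
      have hm : AEStronglyMeasurable (fun w : E3 × E3 => heatKernel t (w.2 - w.1) * ψ w.2)
          ((volume : Measure E3).prod volume) :=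
        (Measurable.aestronglyMeasurable (by fun_prop)).mul hψ.aestronglyMeasurable.comp_snd
      exact hm.integral_prod_right'.mul hfm
    · filter_upwards [self_mem_nhdsWithin] with t ht
      refine ae_of_all _ fun y => ?_
      rw [← mul_assoc, norm_mul, norm_mul]
      refine mul_le_mul_of_nonneg_right ?_ (norm_nonneg _)
      exact ((norm_integral_le_integral_norm _).trans (H t ht y).2).trans (le_abs_self _)
    · exact ae_of_all _ fun y => (tendsto_average hψ hc hL hl y).mul_const _
  refine h1.congr' ?_
  filter_upwards [self_mem_nhdsWithin] with t ht
  exact (integral_mul_lin (integrable_prod_lin hψ hc hfm hf ht)).2.symm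

lemma tendsto_rpow_zero {a : ℝ} (ha : 0 < a) (c : ℝ) :
    Tendsto (fun t : ℝ => c * t ^ a) (𝓝[>] 0) (𝓝 0) := by
  have h := (Real.continuous_rpow_const (q := a) ha.le).tendsto 0
  rw [Real.zero_rpow ha.ne'] at h
  simpa using (h.mono_left nhdsWithin_le_nhds).const_mul c

/-- Instead of the critical power ρ^(-1), pull out only ρ^(-3/2) of the total 6: the remaining total
9/2 is less than 5 and leaves t^(1/4), while |x|^(-3/2) is locally integrable. The velocity terms
(4,2) and (3,3) both have total 6. -/
lemma tendsto_integral_mul_duh {p C q A : ℝ} {k : ℝ → E3 → ℝ} (hk : Ker p C k) (hC : 0 ≤ C)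
    (hA : 0 ≤ A) (hp : 3 / 2 ≤ p) (hq : 3 / 2 ≤ q) (hpq : p + q = 6)
    {f : ℝ × E3 → ℝ} (hfm : AEStronglyMeasurable f spaceTime)
    (hf : ∀ᵐ z ∂spaceTime, |f z| ≤ A * rho z.1 z.2 ^ (-q))
    {ψ : E3 → ℝ} (hψ : Continuous ψ) (hc : HasCompactSupport ψ) :
    Tendsto (fun t => ∫ x, ψ x * duh k f t x) (𝓝[>] 0) (𝓝 0) := by
  obtain ⟨C₀, h₀, H⟩ := dom_sub (p := p) (q := q) (e := 3 / 2) (by norm_num) hp hq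
    (by linarith) (by linarith)
  refine squeeze_zero_norm' ?_ (tendsto_rpow_zero (a := 1 / 4) (by norm_num)
    (C * (A * C₀) * ∫ x, |ψ x| * ‖x‖ ^ (-(3 / 2) : ℝ)))
  filter_upwards [self_mem_nhdsWithin] with t ht
  have ht : 0 < t := ht
  refine (norm_integral_le_of_norm_le ((integrable_test_rpow hψ hc).const_mul
    (C * (A * C₀) * t ^ (1 / 4 : ℝ))) ?_).trans (le_of_eq ?_)
  · filter_upwards [ae_ne_zero] with x hx
    have h1 := (hk.integrand_integrable hC (aestronglyMeasurable_nu hfm t)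
      (ae_nu_of_spaceTime hf) (x := x) (c := A * (C₀ * (t ^ ((5 - (p + q - 3 / 2)) / 2) *
        rho t x ^ (-(3 / 2) : ℝ)))) (by
      convert! (H t ht x).const_mul hA using 2
      ring)).2
    rw [hpq, show ((5 : ℝ) - (6 - 3 / 2)) / 2 = 1 / 4 by norm_num] at h1
    have h2 : rho t x ^ (-(3 / 2) : ℝ) ≤ ‖x‖ ^ (-(3 / 2) : ℝ) :=
      rpow_neg_le (norm_pos_iff.2 hx) (norm_le_rho _ _) (by norm_num)
    rw [norm_mul, Real.norm_eq_abs, Real.norm_eq_abs]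
    have h3 : |duh k f t x| ≤ C * (A * C₀) * t ^ (1 / 4 : ℝ) * ‖x‖ ^ (-(3 / 2) : ℝ) := by
      refine h1.trans ?_
      have : 0 ≤ C * (A * C₀) * t ^ (1 / 4 : ℝ) := by positivity
      have := mul_le_mul_of_nonneg_left h2 this
      linarith
    have := mul_le_mul_of_nonneg_left h3 (abs_nonneg (ψ x))
    linarith
  · rw [integral_const_mul]
    ring

/-- The scale-invariant bound here is ρ^(-3), which does not give smallness as t → 0. Instead the
kernel is moved onto the Lipschitz function ψ, where its averages stay bounded; what remains is the
integral of ρ^(-4) over (0,t) × ℝ³, of order √t. -/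
lemma tendsto_integral_mul_duh_heat1 {A : ℝ} (hA : 0 ≤ A) (l : Fin 3)
    {f : ℝ × E3 → ℝ} (hfm : AEStronglyMeasurable f spaceTime)
    (hf : ∀ᵐ z ∂spaceTime, |f z| ≤ A * rho z.1 z.2 ^ (-4 : ℝ))
    {ψ : E3 → ℝ} (hψ : Continuous ψ) (hc : HasCompactSupport ψ) {L : ℝ} (hL : 0 ≤ L)
    (hl : ∀ x y, |ψ x - ψ y| ≤ L * ‖x - y‖) :
    Tendsto (fun t => ∫ x, ψ x * duh (heat1 l) f t x) (𝓝[>] 0) (𝓝 0) := by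
  obtain ⟨K, _, hk⟩ := ker_heat1
  obtain ⟨C₁, c₁, H₁⟩ := abs_integral_heat1_mul_test_le
  obtain ⟨C₀, h₀, H⟩ := dom_right (N := 4) (a := 0) (b := 0) (by norm_num) (by norm_num)
    (by norm_num)
  refine squeeze_zero_norm' ?_ (tendsto_rpow_zero (a := 1 / 2) (by norm_num)
    (C₁ * L * A * C₀))
  filter_upwards [self_mem_nhdsWithin] with t ht
  have ht : 0 < t := ht
  rw [integral_mul_duh ((hk l).integrable_prod_test (by norm_num) (by norm_num) (by norm_num)
    (by norm_num) (by norm_num) hfm hf ht hψ hc)]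
  have hd := (H t ht).const_mul (by positivity : 0 ≤ C₁ * L * A)
  refine (hd.norm_integral_le ?_).trans (le_of_eq ?_)
  · filter_upwards [ae_nu_of_spaceTime hf, ae_nu_mem t] with z hz hs
    have h1 := H₁ ψ L hL hl hψ.measurable (hψ.bounded_above_of_compact_support hc) l (t - z.1)
      (by linarith [hs.2]) z.2
    rw [abs_mul, neg_zero, Real.rpow_zero, Real.rpow_zero, one_mul, one_mul]
    refine (mul_le_mul h1 hz (abs_nonneg _) (by positivity)).trans (le_of_eq (by ring))
  · rw [show ((5 : ℝ) - 4) / 2 - 0 - 0 = 1 / 2 by norm_num]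
    ring

/-! ### Properties of the solution -/

section

variable {M N ε : ℝ} {u : ℝ → E3 → E3} {θ : ℝ → E3 → ℝ} {u₀ : E3 → E3} {θ₀ : E3 → ℝ}

lemma integral_mul_nextU (hD : Data ε u₀ θ₀) (h : Adm M N u θ) {t : ℝ} (ht : 0 < t) {ψ : E3 → ℝ}
    (hψ : Continuous ψ) (hc : HasCompactSupport ψ) (j : Fin 3) :
    Integrable (fun x => ψ x * nextU u₀ u θ t x j) ∧
    ∫ x, ψ x * nextU u₀ u θ t x j = (∫ x, ψ x * lin (fun y => u₀ y j) t x) -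
      (∑ k, ∑ l, ∫ x, ψ x * duh (fun σ => oseenGradKernel σ j k l)
        (fun z => u z.1 z.2 k * u z.1 z.2 l) t x) +
      ∫ x, ψ x * duh (fun σ => oseenKernel σ j 2) (fun z => θ z.1 z.2) t x := by
  obtain ⟨K₂, _, L₂⟩ := ker_oseenGradKernel
  obtain ⟨K₃, _, L₃⟩ := ker_oseenKernel
  have i1 := (integral_mul_lin (ψ := ψ) (f := fun y => u₀ y j) (integrable_prod_lin hψ hc (aesm_coord hD.mu j)
    (hD.integrable_coord j) ht)).1
  have i2 := fun k l => integrable_mul_duh (k := fun σ => oseenGradKernel σ j k l) (ψ := ψ) (t := t)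
    (f := fun z => u z.1 z.2 k * u z.1 z.2 l) ((L₂ j k l).integrable_prod_test (by norm_num) (by norm_num)
    (by norm_num) (by norm_num) (by norm_num) (h.muu k l) (h.buu k l) ht hψ hc)
  have i3 := integrable_mul_duh (k := fun σ => oseenKernel σ j 2) (ψ := ψ) (t := t)
    (f := fun z => θ z.1 z.2) ((L₃ j 2).integrable_prod_test (by norm_num) (by norm_num)
    (by norm_num) (by norm_num) (by norm_num) h.mθ h.bθ ht hψ hc)
  have i4 : Integrable fun x => ∑ k, ∑ l, ψ x * duh (fun σ => oseenGradKernel σ j k l)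
      (fun z => u z.1 z.2 k * u z.1 z.2 l) t x :=
    integrable_finsetSum _ fun k _ => integrable_finsetSum _ fun l _ => i2 k l
  have e : (fun x => ψ x * nextU u₀ u θ t x j) = fun x => ψ x * lin (fun y => u₀ y j) t x -
      (∑ k, ∑ l, ψ x * duh (fun σ => oseenGradKernel σ j k l)
        (fun z => u z.1 z.2 k * u z.1 z.2 l) t x) +
      ψ x * duh (fun σ => oseenKernel σ j 2) (fun z => θ z.1 z.2) t x := by
    ext x
    simp only [nextU, mul_add, mul_sub, Finset.mul_sum]
  rw [e]
  refine ⟨(i1.sub i4).add i3, ?_⟩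
  have e5 := integral_add (i1.sub i4) i3
  simp only [Pi.sub_apply] at e5
  rw [e5, integral_sub i1 i4, integral_finsetSum _ fun k _ => integrable_finsetSum _ fun l _ => i2 k l]
  simp_rw [integral_finsetSum _ fun l _ => i2 _ l]

lemma integral_mul_nextT (hD : Data ε u₀ θ₀) (h : Adm M N u θ) {t : ℝ} (ht : 0 < t) {ψ : E3 → ℝ}
    (hψ : Continuous ψ) (hc : HasCompactSupport ψ) :
    ∫ x, ψ x * nextT θ₀ u θ t x = (∫ x, ψ x * lin θ₀ t x) -
      ∑ l, ∫ x, ψ x * duh (heat1 l) (fun z => θ z.1 z.2 * u z.1 z.2 l) t x := by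
  obtain ⟨K₂, _, L₂⟩ := ker_heat1
  have i1 := (integral_mul_lin (integrable_prod_lin hψ hc hD.iθ.aestronglyMeasurable
    hD.integrable_temperature ht)).1
  have i2 := fun l => integrable_mul_duh (k := heat1 l) (ψ := ψ) (t := t)
    (f := fun z => θ z.1 z.2 * u z.1 z.2 l) ((L₂ l).integrable_prod_test (by norm_num) (by norm_num)
    (by norm_num) (by norm_num) (by norm_num) (h.mθu l) (h.bθu l) ht hψ hc)
  have e : (fun x => ψ x * nextT θ₀ u θ t x) = fun x => ψ x * lin θ₀ t x -
      ∑ l, ψ x * duh (heat1 l) (fun z => θ z.1 z.2 * u z.1 z.2 l) t x := by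
    ext x
    simp only [nextT, mul_sub, Finset.mul_sum]
  rw [e, integral_sub i1 (integrable_finsetSum _ fun l _ => i2 l), integral_finsetSum _ fun l _ => i2 l]

lemma Sol.divFree (hD : Data ε u₀ θ₀) (hv : IsDivFree u₀) (h : Sol M N u₀ θ₀ u θ) {t : ℝ}
    (ht : 0 < t) : IsDivFree (u t) := by
  intro φ hφ hc
  have hψ := fun j => (contDiff_pd hφ j).continuous
  have hcψ := fun j => hasCompactSupport_pd hc j
  have hU := fun j => integral_mul_nextU hD h.adm ht (hψ j) (hcψ j) j
  obtain ⟨K₂, _, L₂⟩ := ker_oseenGradKernel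
  obtain ⟨K₃, _, L₃⟩ := ker_oseenKernel
  have e : ∀ x j, u t x j * pd j φ x = pd j φ x * nextU u₀ u θ t x j := fun x j => by
    rw [h.eu t ht x, mul_comm]
  simp_rw [e]
  rw [integral_finsetSum _ fun j _ => (hU j).1]
  simp_rw [fun j => (hU j).2]
  rw [Finset.sum_add_distrib, Finset.sum_sub_distrib,
    sum_integral_pd_mul_lin hv hD.mu hD.integrable_coord ht hφ hc, Finset.sum_comm]
  have z1 : ∀ k, ∑ j, ∑ l, ∫ x, pd j φ x * duh (fun σ => oseenGradKernel σ j k l)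
        (fun z => u z.1 z.2 k * u z.1 z.2 l) t x = 0 := fun k => by
    rw [Finset.sum_comm]
    refine Finset.sum_eq_zero fun l _ => ?_
    refine sum_integral_mul_duh_eq_zero (k := fun j σ => oseenGradKernel σ j k l)
      (ψ := fun j => pd j φ) (fun j => (L₂ j k l).integrable_prod_test (by norm_num) (by norm_num)
        (by norm_num) (by norm_num) (by norm_num) (h.adm.muu k l) (h.adm.buu k l) ht (hψ j) (hcψ j))
      fun s hs y => ?_
    exact sum_integral_oseenGradKernel_mul_pd k l (by linarith [hs.2]) hφ hc y
  have z2 : ∑ j, ∫ x, pd j φ x * duh (fun σ => oseenKernel σ j 2) (fun z => θ z.1 z.2) t x = 0 := by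
    refine sum_integral_mul_duh_eq_zero (k := fun j σ => oseenKernel σ j 2)
      (ψ := fun j => pd j φ) (fun j => (L₃ j 2).integrable_prod_test (by norm_num) (by norm_num)
        (by norm_num) (by norm_num) (by norm_num) h.adm.mθ h.adm.bθ ht (hψ j) (hcψ j))
      fun s hs y => ?_
    exact sum_integral_oseenKernel_mul_pd 2 (by linarith [hs.2]) hφ hc y
  rw [z2, Finset.sum_eq_zero fun k _ => z1 k]
  norm_num

lemma Sol.tendsto_velocity (hM : 0 ≤ M) (hN : 0 ≤ N) (hD : Data ε u₀ θ₀) (h : Sol M N u₀ θ₀ u θ)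
    {φ : E3 → ℝ} (hφ : ContDiff ℝ ∞ φ) (hc : HasCompactSupport φ) :
    Tendsto (fun t => ∫ x, φ x • u t x) (𝓝[>] 0) (𝓝 (∫ x, φ x • u 0 x)) := by
  obtain ⟨K₂, k₂, L₂⟩ := ker_oseenGradKernel
  obtain ⟨K₃, k₃, L₃⟩ := ker_oseenKernel
  obtain ⟨L, hL, hl⟩ := exists_lipschitz_test hφ hc
  have hψ := hφ.continuous
  have h1 : ∀ j, Tendsto (fun t => ∫ x, φ x * nextU u₀ u θ t x j) (𝓝[>] 0)
      (𝓝 (∫ x, φ x * u₀ x j)) := by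
    intro j
    have a1 := tendsto_integral_mul_lin hψ hc hL hl (aesm_coord hD.mu j) (hD.integrable_coord j)
    have a2 := fun k l => tendsto_integral_mul_duh (L₂ j k l) k₂.le (by positivity : 0 ≤ M * M)
      (by norm_num) (by norm_num) (by norm_num) (h.adm.muu k l) (h.adm.buu k l) hψ hc
    have a3 := tendsto_integral_mul_duh (L₃ j 2) k₃.le hN
      (by norm_num) (by norm_num) (by norm_num) h.adm.mθ h.adm.bθ hψ hc
    have := (a1.sub (tendsto_finsetSum Finset.univ fun k _ =>
      tendsto_finsetSum Finset.univ fun l _ => a2 k l)).add a3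
    simp only [Finset.sum_const_zero, sub_zero, add_zero] at this
    refine this.congr' ?_
    filter_upwards [self_mem_nhdsWithin] with t ht
    exact ((integral_mul_nextU hD h.adm ht hψ hc j).2).symm
  have c0 : ∀ j, (∫ x, φ x • u 0 x) j = ∫ x, φ x * u₀ x j := fun j => by
    rw [h.zu]
    exact ((EuclideanSpace.proj j : E3 →L[ℝ] ℝ).integral_comp_comm
      (integrable_test_mul hψ hc hD.mu hD.integrable_velocity)).symm
  have ct : ∀ t, 0 < t → ∀ j, (∫ x, φ x • u t x) j = ∫ x, φ x * nextU u₀ u θ t x j := by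
    intro t ht j
    have hi : Integrable fun x => φ x • u t x := by
      have hm : AEStronglyMeasurable (u t) volume := by
        have := (stronglyMeasurable_nextU h.adm hD.mu).comp_measurable
          (measurable_prodMk_left (x := t) (β := E3))
        refine this.aestronglyMeasurable.congr (ae_of_all _ fun x => ?_)
        exact (h.eu t ht x).symm
      refine Integrable.smul_bdd (hψ.integrable_of_hasCompactSupport hc) (M * t ^ (-(1 / 2) : ℝ))
        hm (ae_of_all _ fun x => ?_)
      exact (h.bu t ht x).trans (mul_le_mul_of_nonneg_left
        (rho_rpow_le_sqrt ht x (e := 1) (by norm_num)) hM)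
    refine ((EuclideanSpace.proj j : E3 →L[ℝ] ℝ).integral_comp_comm hi).symm.trans ?_
    congr 1
    ext x
    rw [← h.eu t ht x]
    rfl
  refine tendsto_iff_norm_sub_tendsto_zero.2 (squeeze_zero' (Eventually.of_forall fun _ =>
    norm_nonneg _) (Eventually.of_forall fun t => norm_le_sum_coord _) ?_)
  have : Tendsto (fun t => ∑ j, |(∫ x, φ x * nextU u₀ u θ t x j) - ∫ x, φ x * u₀ x j|) (𝓝[>] 0)
      (𝓝 (∑ _j : Fin 3, 0)) := tendsto_finsetSum _ fun j _ =>
    tendsto_iff_norm_sub_tendsto_zero.1 (h1 j)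
  rw [Finset.sum_const_zero] at this
  refine this.congr' ?_
  filter_upwards [self_mem_nhdsWithin] with t ht
  refine Finset.sum_congr rfl fun j _ => ?_
  rw [← ct t ht j, ← c0 j]
  rfl

lemma Sol.tendsto_temperature (hM : 0 ≤ M) (hN : 0 ≤ N) (hD : Data ε u₀ θ₀)
    (h : Sol M N u₀ θ₀ u θ) {φ : E3 → ℝ} (hφ : ContDiff ℝ ∞ φ) (hc : HasCompactSupport φ) :
    Tendsto (fun t => ∫ x, φ x * θ t x) (𝓝[>] 0) (𝓝 (∫ x, φ x * θ 0 x)) := by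
  obtain ⟨L, hL, hl⟩ := exists_lipschitz_test hφ hc
  have hψ := hφ.continuous
  have a1 := tendsto_integral_mul_lin hψ hc hL hl hD.iθ.aestronglyMeasurable hD.integrable_temperature
  have a2 := fun l => tendsto_integral_mul_duh_heat1 (by positivity : 0 ≤ N * M) l
    (h.adm.mθu l) (h.adm.bθu l) hψ hc hL hl
  have := a1.sub (tendsto_finsetSum Finset.univ fun l _ => a2 l)
  simp only [Finset.sum_const_zero, sub_zero] at this
  rw [h.zθ]
  refine this.congr' ?_
  filter_upwards [self_mem_nhdsWithin] with t ht
  rw [← integral_mul_nextT hD h.adm ht hψ hc]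
  congr 1
  ext x
  rw [h.eθ t ht x]

end

/-! ### Continuity in time -/

lemma duh_time_le {p q : ℝ} (hp : 0 < p) (hq : 1 / 2 < q) (hp5 : p < 9 / 2) (hq5 : q < 5)
    (hpq : 5 ≤ p + q) : ∃ C₀ > 0, ∀ (C A : ℝ) (k : ℝ → E3 → ℝ) (f : ℝ × E3 → ℝ), Ker p C k →
    0 ≤ C → 0 ≤ A → AEStronglyMeasurable f spaceTime →
    (∀ᵐ z ∂spaceTime, |f z| ≤ A * rho z.1 z.2 ^ (-q)) → ∀ s t, 0 < s → s ≤ t → ∀ x,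
    |duh k f t x - duh k f s x| ≤
      C₀ * (C * A) * ((t - s) ^ (1 / 20 : ℝ) * s ^ (-(1 / 20) : ℝ)) *
        rho s x ^ (-(p + q - 5)) := by
  obtain ⟨C₀, h₀, H⟩ := powInt_le (g := 1 / 20) hp (by linarith) (by linarith) hq5 hpq (by linarith)
    (by linarith)
  refine ⟨2 * C₀, by positivity, fun C A k f hk hC hA hfm hf s t hs hst x => ?_⟩
  have ht := hs.trans_le hst
  refine (hk.abs_duh_sub_le hC hA hp (by linarith) (by linarith) hq5 hpq (by linarith) (by linarith)
    hfm hf hs hst x).trans ?_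
  have h1 : t ^ (-(1 / 20) : ℝ) ≤ s ^ (-(1 / 20) : ℝ) := rpow_neg_le hs hst (by norm_num)
  have h2 : rho t x ^ (-(p + q - 5)) ≤ rho s x ^ (-(p + q - 5)) :=
    rpow_neg_le (rho_pos hs x) (rho_mono hst x) (by linarith)
  have h3 := H t ht x
  have h4 := H s hs x
  have h5 : t ^ (-(1 / 20) : ℝ) * rho t x ^ (-(p + q - 5)) ≤
      s ^ (-(1 / 20) : ℝ) * rho s x ^ (-(p + q - 5)) :=
    mul_le_mul h1 h2 (Real.rpow_nonneg (rho_nonneg _ _) _) (Real.rpow_nonneg hs.le _)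
  have h6 := mul_le_mul_of_nonneg_left h5 h₀.le
  have h7 : 0 ≤ C * A * (t - s) ^ (1 / 20 : ℝ) :=
    mul_nonneg (mul_nonneg hC hA) (Real.rpow_nonneg (by linarith) _)
  refine (mul_le_mul_of_nonneg_left (add_le_add (h3.trans h6) h4) h7).trans (le_of_eq ?_)
  ring

lemma eLpNorm_conv_le {k f : E3 → ℝ} (hk : Measurable k) (hki : Integrable k) (hf : Integrable f) :
    eLpNorm (fun x => ∫ y, k (x - y) * f y) 1 volume ≤
      ENNReal.ofReal ((∫ z, |k z|) * ∫ y, |f y|) := by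
  rw [eLpNorm_one_eq_lintegral_enorm]
  calc ∫⁻ x, ‖∫ y, k (x - y) * f y‖ₑ ≤ ∫⁻ x, ∫⁻ y, ‖k (x - y)‖ₑ * ‖f y‖ₑ := by
        refine lintegral_mono fun x => (enorm_integral_le_lintegral_enorm _).trans_eq ?_
        simp_rw [enorm_mul]
    _ = ∫⁻ y, ∫⁻ x, ‖k (x - y)‖ₑ * ‖f y‖ₑ := by
        refine lintegral_lintegral_swap ?_
        exact (Measurable.aemeasurable (by fun_prop)).mul
          hf.aestronglyMeasurable.enorm.comp_snd
    _ = ∫⁻ y, ENNReal.ofReal (∫ z, |k z|) * ‖f y‖ₑ := by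
        refine lintegral_congr fun y => ?_
        rw [lintegral_mul_const _ (by fun_prop), lintegral_sub_right_eq_self (fun x => ‖k x‖ₑ) y,
          ← ofReal_integral_norm_eq_lintegral_enorm hki]
        rfl
    _ = _ := by
        rw [lintegral_const_mul' _ _ ENNReal.ofReal_ne_top,
          ← ofReal_integral_norm_eq_lintegral_enorm hf, ENNReal.ofReal_mul
            (integral_nonneg fun _ => abs_nonneg _)]
        rfl

lemma eLpNorm_duh_heat1_le : ∃ C > 0, ∀ (l : Fin 3) (A : ℝ) (f : ℝ × E3 → ℝ), 0 ≤ A →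
    AEStronglyMeasurable f spaceTime → (∀ᵐ z ∂spaceTime, |f z| ≤ A * rho z.1 z.2 ^ (-4 : ℝ)) →
    (∀ t, 0 < t → eLpNorm (duh (heat1 l) f t) 1 volume ≤ ENNReal.ofReal (C * A)) ∧
    ∀ s t, 0 < s → s ≤ t → eLpNorm (fun x => duh (heat1 l) f t x - duh (heat1 l) f s x) 1 volume ≤
      ENNReal.ofReal (C * A * ((t - s) ^ (1 / 20 : ℝ) * s ^ (-(1 / 20) : ℝ))) := by
  obtain ⟨K, hK, L⟩ := ker_heat1
  obtain ⟨C₀, h₀, H₀⟩ := lintegral_powInt_le (g := 0) (by norm_num)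
  obtain ⟨C₁, h₁, H₁⟩ := lintegral_powInt_le (g := 1 / 20) (by norm_num)
  have mono : ∀ {X c : ℝ}, X ≤ K * (C₀ + 2 * C₁) * c → ∀ {y : ℝ≥0∞}, y ≤ ENNReal.ofReal X →
    y ≤ ENNReal.ofReal (K * (C₀ + 2 * C₁) * c) := fun h _ hy => hy.trans (ENNReal.ofReal_le_ofReal h)
  refine ⟨K * (C₀ + 2 * C₁), by positivity, fun l A f hA hfm hf => ⟨fun t ht => ?_,
    fun s t hs hst => ?_⟩⟩
  · refine mono (X := K * A * C₀) ?_ ?_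
    · have : 0 ≤ K * A * C₁ := by positivity
      linarith
    rw [eLpNorm_one_eq_lintegral_enorm]
    calc ∫⁻ x, ‖duh (heat1 l) f t x‖ₑ ≤
        ∫⁻ x, ENNReal.ofReal (K * A) * ENNReal.ofReal (powInt 0 4 4 t x) := by
          refine lintegral_mono fun x => ?_
          rw [← ENNReal.ofReal_mul (by positivity), ← ofReal_norm]
          refine ENNReal.ofReal_le_ofReal ((norm_integral_le_integral_norm _).trans ?_)
          exact ((L l).integral_abs_le (by norm_num) (by norm_num) (by norm_num) (by norm_num)
            (by norm_num) hfm hf ht x).2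
      _ ≤ _ := by
          rw [lintegral_const_mul' _ _ ENNReal.ofReal_ne_top]
          have := H₀ t ht
          rw [neg_zero, Real.rpow_zero, mul_one] at this
          exact (mul_le_mul_right this _).trans_eq (ENNReal.ofReal_mul (by positivity)).symm
  · have ht := hs.trans_le hst
    have hd : 0 ≤ (t - s) ^ (1 / 20 : ℝ) := Real.rpow_nonneg (by linarith) _
    have hs' : 0 ≤ s ^ (-(1 / 20) : ℝ) := Real.rpow_nonneg hs.le _
    rw [mul_assoc]
    refine mono (X := K * A * (t - s) ^ (1 / 20 : ℝ) * (2 * C₁ * s ^ (-(1 / 20) : ℝ))) ?_ ?_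
    · have : 0 ≤ K * A * C₀ * ((t - s) ^ (1 / 20 : ℝ) * s ^ (-(1 / 20) : ℝ)) := by positivity
      linarith
    rw [eLpNorm_one_eq_lintegral_enorm]
    calc ∫⁻ x, ‖duh (heat1 l) f t x - duh (heat1 l) f s x‖ₑ ≤
        ∫⁻ x, ENNReal.ofReal (K * A * (t - s) ^ (1 / 20 : ℝ)) *
          (ENNReal.ofReal (powInt (1 / 20) 4 4 t x) + ENNReal.ofReal (powInt (1 / 20) 4 4 s x)) := by
          refine lintegral_mono fun x => ?_
          rw [← ENNReal.ofReal_add (powInt_nonneg _ _ _ _ _) (powInt_nonneg _ _ _ _ _),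
            ← ENNReal.ofReal_mul (by positivity), ← ofReal_norm]
          refine ENNReal.ofReal_le_ofReal ?_
          exact (L l).abs_duh_sub_le hK.le hA (by norm_num) (by norm_num) (by norm_num)
            (by norm_num) (by norm_num) (by norm_num) (by norm_num) hfm hf hs hst x
      _ ≤ _ := by
          have h1 : t ^ (-(1 / 20) : ℝ) ≤ s ^ (-(1 / 20) : ℝ) := rpow_neg_le hs hst (by norm_num)
          rw [lintegral_const_mul' _ _ ENNReal.ofReal_ne_top,
            lintegral_add_left ((measurable_powInt _ _ _ _).ennreal_ofReal)]
          refine (mul_le_mul_right ((add_le_add (H₁ t ht) (H₁ s hs)).trans ?_) _).trans_eq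
            (ENNReal.ofReal_mul (by positivity)).symm
          rw [← ENNReal.ofReal_add (by positivity) (by positivity)]
          refine ENNReal.ofReal_le_ofReal ?_
          have := mul_le_mul_of_nonneg_left h1 h₁.le
          linarith

/-- The time increment of the heat kernel has the same majorant s^(1/2) ρ(s,·)^(-4) as the kernel
itself, multiplied by (t-s)/s. The convolution lemmas for the linear flow therefore apply to it
directly. -/
lemma lin_time_le : ∃ C > 0, ∀ (ε : ℝ) (u₀ : E3 → E3) (θ₀ : E3 → ℝ), 0 ≤ ε → Data ε u₀ θ₀ →
    ∀ s t, 0 < s → s ≤ t →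
      (∀ x j, |lin (fun y => u₀ y j) t x - lin (fun y => u₀ y j) s x| ≤
        C * ε * ((t - s) / s) * rho s x ^ (-1 : ℝ)) ∧
      (∀ x, |lin θ₀ t x - lin θ₀ s x| ≤ C * ε * ((t - s) / s) * rho s x ^ (-3 : ℝ)) ∧
      eLpNorm (fun x => lin θ₀ t x - lin θ₀ s x) 1 volume ≤
        ENNReal.ofReal (C * ε * ((t - s) / s)) := by
  obtain ⟨C₁, c₁, H₁⟩ := conv_le_of_rpow (a := 1) (by norm_num) (by norm_num)
  obtain ⟨C₂, c₂, H₂⟩ := conv_le_of_integrable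
  obtain ⟨C₃, c₃, H₃⟩ := heatKernel_bound
  obtain ⟨C₄, c₄, H₄⟩ := abs_heatKernel_sub_le
  set I := ∫ y : E3, (1 + ‖y‖) ^ (-4 : ℝ) with hI
  have hI0 : 0 ≤ I := integral_nonneg fun y => by positivity
  refine ⟨(C₁ + C₂ + I) * C₄, by positivity, fun ε u₀ θ₀ hε hD s t hs hst => ?_⟩
  have ht := hs.trans_le hst
  have hts : 0 ≤ (t - s) / s := div_nonneg (by linarith) hs.le
  set κ := C₄ * ((t - s) / s) with hκ
  have hκ0 : 0 ≤ κ := by positivity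
  have hk := H₄ s t hs hst
  have hkm : Measurable fun z => heatKernel t z - heatKernel s z := by fun_prop
  have hki : Integrable fun z => heatKernel t z - heatKernel s z :=
    (integrable_heatKernel ht).sub (integrable_heatKernel hs)
  have hb : ∀ j, ∀ᵐ y, |u₀ y j| ≤ ε * ‖y‖ ^ (-1 : ℝ) := fun j => by
    filter_upwards [hD.bu] with y hy using (abs_coord_le _ _).trans hy
  have iu : ∀ r, 0 < r → ∀ x j, Integrable fun y => heatKernel r (x - y) * u₀ y j := fun r hr x j =>
    (H₁ r C₃ ε _ _ hr c₃.le hε (H₃ r hr) (hb j) (by fun_prop) (aesm_coord hD.mu j) x).1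
  have iθ : ∀ r, 0 < r → ∀ x, Integrable fun y => heatKernel r (x - y) * θ₀ y := fun r hr x =>
    (H₂ r C₃ ε _ _ hr c₃.le hε (H₃ r hr) hD.bθ (by fun_prop) hD.iθ hD.nθ x).1
  have eu : ∀ x j, lin (fun y => u₀ y j) t x - lin (fun y => u₀ y j) s x =
      ∫ y, (heatKernel t (x - y) - heatKernel s (x - y)) * u₀ y j := fun x j => by
    unfold lin
    rw [← integral_sub (iu t ht x j) (iu s hs x j)]
    simp_rw [sub_mul]
  have eθ : ∀ x, lin θ₀ t x - lin θ₀ s x =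
      ∫ y, (heatKernel t (x - y) - heatKernel s (x - y)) * θ₀ y := fun x => by
    unfold lin
    rw [← integral_sub (iθ t ht x) (iθ s hs x)]
    simp_rw [sub_mul]
  refine ⟨fun x j => ?_, fun x => ?_, ?_⟩
  · rw [eu]
    refine (H₁ s κ ε _ _ hs hκ0 hε hk (hb j) hkm (aesm_coord hD.mu j) x).2.trans
      (mul_le_mul_of_nonneg_right ?_ (Real.rpow_nonneg (rho_nonneg _ _) _))
    have : 0 ≤ (C₂ + I) * κ * ε := by positivity
    rw [hκ] at *
    linarith
  · rw [eθ]
    refine (H₂ s κ ε _ _ hs hκ0 hε hk hD.bθ hkm hD.iθ hD.nθ x).2.trans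
      (mul_le_mul_of_nonneg_right ?_ (Real.rpow_nonneg (rho_nonneg _ _) _))
    have : 0 ≤ (C₁ + I) * κ * ε := by positivity
    rw [hκ] at *
    linarith
  · simp_rw [eθ]
    refine (eLpNorm_conv_le hkm hki hD.iθ).trans (ENNReal.ofReal_le_ofReal ?_)
    have h1 : ∫ z, |heatKernel t z - heatKernel s z| ≤ κ * I := by
      refine (integral_mono hki.abs (((integrable_rho_rpow (N := 4) (by norm_num) hs).const_mul
        (s ^ (1 / 2 : ℝ))).const_mul κ) hk).trans (le_of_eq ?_)
      rw [integral_const_mul, integral_const_mul, integral_rho_rpow hs, ← hI, mul_left_comm _ I,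
        ← Real.rpow_add hs]
      norm_num
    refine (mul_le_mul h1 hD.nθ (integral_nonneg fun _ => abs_nonneg _) (by positivity)).trans ?_
    have : 0 ≤ (C₁ + C₂) * κ * ε := by positivity
    rw [hκ] at *
    linarith

/-- A modulus of continuity in time. -/
def timeMod (s t : ℝ) : ℝ := (t - s) / s + (t - s) ^ (1 / 20 : ℝ) * s ^ (-(1 / 20) : ℝ)

lemma timeMod_left {s t : ℝ} (hs : 0 < s) (hst : s ≤ t) : (t - s) / s ≤ timeMod s t :=
  le_add_of_nonneg_right (mul_nonneg (Real.rpow_nonneg (by linarith) _) (Real.rpow_nonneg hs.le _))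

lemma timeMod_right {s t : ℝ} (hs : 0 < s) (hst : s ≤ t) :
    (t - s) ^ (1 / 20 : ℝ) * s ^ (-(1 / 20) : ℝ) ≤ timeMod s t :=
  le_add_of_nonneg_left (div_nonneg (by linarith) hs.le)

lemma timeMod_nonneg {s t : ℝ} (hs : 0 < s) (hst : s ≤ t) : 0 ≤ timeMod s t :=
  (div_nonneg (by linarith) hs.le).trans (timeMod_left hs hst)

lemma tendsto_timeMod {t' : ℝ} (ht' : 0 < t') (C : ℝ) :
    Tendsto (fun t => ENNReal.ofReal (C * timeMod (min t t') (max t t'))) (𝓝 t') (𝓝 0) := by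
  have h : ContinuousAt (fun t => C * timeMod (min t t') (max t t')) t' := by
    unfold timeMod
    have h1 : ContinuousAt (fun t => min t t') t' := by fun_prop
    have h2 : ContinuousAt (fun t => max t t') t' := by fun_prop
    have h0 : min t' t' ≠ 0 := by rw [min_self]; exact ht'.ne'
    refine continuousAt_const.mul (((h2.sub h1).div h1 h0).add
      (((h2.sub h1).rpow_const (Or.inr (by norm_num))).mul (h1.rpow_const (Or.inl h0))))
  have h' : Tendsto (fun t => C * timeMod (min t t') (max t t')) (𝓝 t') (𝓝 0) := by
    have : C * timeMod (min t' t') (max t' t') = 0 := by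
      rw [min_self, max_self, timeMod, sub_self, zero_div, Real.zero_rpow (by norm_num), zero_mul,
        add_zero, mul_zero]
    simpa only [ContinuousAt, this] using h
  simpa using ENNReal.tendsto_ofReal h'

section

variable {M N ε : ℝ} {u : ℝ → E3 → E3} {θ : ℝ → E3 → ℝ} {u₀ : E3 → E3} {θ₀ : E3 → ℝ}

lemma Sol.time_sub_le (hM : 0 ≤ M) (hN : 0 ≤ N) (hε : 0 ≤ ε) (hD : Data ε u₀ θ₀)
    (h : Sol M N u₀ θ₀ u θ) : ∃ C ≥ 0, ∀ s t, 0 < s → s ≤ t →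
      (∀ x, ‖u t x - u s x‖ ≤ C * timeMod s t * rho s x ^ (-1 : ℝ)) ∧
      (∀ x, |θ t x - θ s x| ≤ C * timeMod s t * rho s x ^ (-3 : ℝ)) ∧
      eLpNorm (fun x => θ t x - θ s x) 1 volume ≤ ENNReal.ofReal (C * timeMod s t) := by
  obtain ⟨K₁, k₁, L₁⟩ := ker_heat1
  obtain ⟨K₂, k₂, L₂⟩ := ker_oseenGradKernel
  obtain ⟨K₃, k₃, L₃⟩ := ker_oseenKernel
  obtain ⟨C₁, c₁, H₁⟩ := duh_time_le (p := 4) (q := 4) (by norm_num) (by norm_num) (by norm_num)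
    (by norm_num) (by norm_num)
  obtain ⟨C₂, c₂, H₂⟩ := duh_time_le (p := 4) (q := 2) (by norm_num) (by norm_num) (by norm_num)
    (by norm_num) (by norm_num)
  obtain ⟨C₃, c₃, H₃⟩ := duh_time_le (p := 3) (q := 3) (by norm_num) (by norm_num) (by norm_num)
    (by norm_num) (by norm_num)
  obtain ⟨C₄, c₄, H₄⟩ := lin_time_le
  obtain ⟨C₅, c₅, H₅⟩ := eLpNorm_duh_heat1_le
  have hNM : 0 ≤ N * M := by positivity
  have hMM : 0 ≤ M * M := by positivity
  set S := C₄ * ε + 9 * (C₂ * (K₂ * (M * M))) + C₃ * (K₃ * N) + 3 * (C₁ * (K₁ * (N * M))) +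
    3 * (C₅ * (N * M)) with hS
  have p1 : 0 ≤ C₄ * ε := by positivity
  have p2 : 0 ≤ C₂ * (K₂ * (M * M)) := by positivity
  have p3 : 0 ≤ C₃ * (K₃ * N) := by positivity
  have p4 : 0 ≤ C₁ * (K₁ * (N * M)) := by positivity
  have p5 : 0 ≤ C₅ * (N * M) := by positivity
  refine ⟨3 * S, by positivity, fun s t hs hst => ?_⟩
  have ht := hs.trans_le hst
  obtain ⟨l1, l2, l3⟩ := H₄ ε u₀ θ₀ hε hD s t hs hst
  set m := timeMod s t with hm
  have m0 : 0 ≤ m := timeMod_nonneg hs hst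
  have ma : (t - s) / s ≤ m := timeMod_left hs hst
  have mb : (t - s) ^ (1 / 20 : ℝ) * s ^ (-(1 / 20) : ℝ) ≤ m := timeMod_right hs hst
  have up : ∀ {c a r X : ℝ}, 0 ≤ c → a ≤ m → 0 ≤ r → X ≤ c * a * r → X ≤ c * (m * r) :=
    fun hc ha hr h => h.trans ((mul_le_mul_of_nonneg_right (mul_le_mul_of_nonneg_left ha hc) hr).trans
      (le_of_eq (by ring)))
  have n : ∀ (x : E3) (e : ℝ), 0 ≤ rho s x ^ e := fun x e => Real.rpow_nonneg (rho_nonneg _ _) _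
  refine ⟨fun x => ?_, fun x => ?_, ?_⟩
  · refine (norm_le_sum_coord _).trans ?_
    rw [mul_assoc, mul_assoc]
    refine sum_le_of_le fun j => ?_
    have e : (u t x - u s x) j = (lin (fun y => u₀ y j) t x - lin (fun y => u₀ y j) s x) -
        (∑ k, ∑ l, (duh (fun σ => oseenGradKernel σ j k l)
          (fun z => u z.1 z.2 k * u z.1 z.2 l) t x - duh (fun σ => oseenGradKernel σ j k l)
          (fun z => u z.1 z.2 k * u z.1 z.2 l) s x)) +
        (duh (fun σ => oseenKernel σ j 2) (fun z => θ z.1 z.2) t x -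
          duh (fun σ => oseenKernel σ j 2) (fun z => θ z.1 z.2) s x) := by
      simp_rw [Finset.sum_sub_distrib]
      rw [h.eu t ht x, h.eu s hs x]
      simp only [nextU, PiLp.sub_apply]
      ring
    rw [e]
    refine (abs_add_le _ _).trans ?_
    have a0 := abs_sub (lin (fun y => u₀ y j) t x - lin (fun y => u₀ y j) s x)
      (∑ k, ∑ l, (duh (fun σ => oseenGradKernel σ j k l)
          (fun z => u z.1 z.2 k * u z.1 z.2 l) t x - duh (fun σ => oseenGradKernel σ j k l)
          (fun z => u z.1 z.2 k * u z.1 z.2 l) s x))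
    have a1 := up p1 ma (n x _) (l1 x j)
    have a2 := abs_sum_le_of_le fun k => abs_sum_le_of_le fun l => up p2 mb (n x _)
      (H₂ K₂ (M * M) _ _ (L₂ j k l) k₂.le hMM (h.adm.muu k l) (h.adm.buu k l) s t hs hst x)
    have a3 := up p3 mb (n x _) (H₃ K₃ N _ _ (L₃ j 2) k₃.le hN h.adm.mθ h.adm.bθ s t hs hst x)
    rw [show -((4 : ℝ) + 2 - 5) = -1 by norm_num] at a2
    rw [show -((3 : ℝ) + 3 - 5) = -1 by norm_num] at a3
    have a4 : 0 ≤ (3 * (C₁ * (K₁ * (N * M))) + 3 * (C₅ * (N * M))) * (m * rho s x ^ (-1 : ℝ)) :=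
      mul_nonneg (by positivity) (mul_nonneg m0 (n x _))
    rw [hS]
    linarith
  · have e : θ t x - θ s x = (lin θ₀ t x - lin θ₀ s x) -
        ∑ l, (duh (heat1 l) (fun z => θ z.1 z.2 * u z.1 z.2 l) t x -
          duh (heat1 l) (fun z => θ z.1 z.2 * u z.1 z.2 l) s x) := by
      simp_rw [Finset.sum_sub_distrib]
      rw [h.eθ t ht x, h.eθ s hs x]
      simp only [nextT]
      ring
    rw [e]
    refine (abs_sub _ _).trans ?_
    have a1 := up p1 ma (n x _) (l2 x)
    have a2 := abs_sum_le_of_le fun l => up p4 mb (n x _)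
      (H₁ K₁ (N * M) _ _ (L₁ l) k₁.le hNM (h.adm.mθu l) (h.adm.bθu l) s t hs hst x)
    rw [show -((4 : ℝ) + 4 - 5) = -3 by norm_num] at a2
    have a4 : 0 ≤ (2 * (C₄ * ε) + 27 * (C₂ * (K₂ * (M * M))) + 3 * (C₃ * (K₃ * N)) +
        6 * (C₁ * (K₁ * (N * M))) + 9 * (C₅ * (N * M))) * (m * rho s x ^ (-3 : ℝ)) :=
      mul_nonneg (by positivity) (mul_nonneg m0 (n x _))
    rw [hS]
    linarith
  · have e : (fun x => θ t x - θ s x) = (fun x => lin θ₀ t x - lin θ₀ s x) -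
        ∑ l, fun x => (duh (heat1 l) (fun z => θ z.1 z.2 * u z.1 z.2 l) t x -
          duh (heat1 l) (fun z => θ z.1 z.2 * u z.1 z.2 l) s x) := by
      ext x
      rw [Pi.sub_apply, Finset.sum_apply]
      simp_rw [Finset.sum_sub_distrib]
      rw [h.eθ t ht x, h.eθ s hs x]
      simp only [nextT]
      ring
    have ml : ∀ r, StronglyMeasurable (lin θ₀ r) := fun r =>
      (stronglyMeasurable_lin hD.iθ.aestronglyMeasurable).comp_measurable
        (measurable_prodMk_left (x := r) (β := E3))
    have md : ∀ l r, StronglyMeasurable (duh (heat1 l) (fun z => θ z.1 z.2 * u z.1 z.2 l) r) :=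
      fun l r => (stronglyMeasurable_duh (by fun_prop) (h.adm.mθu l)).comp_measurable
        (measurable_prodMk_left (x := r) (β := E3))
    rw [e]
    refine (eLpNorm_sub_le ((ml t).sub (ml s)).aestronglyMeasurable
      (Finset.aestronglyMeasurable_sum _ fun l _ => ((md l t).sub (md l s)).aestronglyMeasurable)
      le_rfl).trans ?_
    have b1 : eLpNorm (fun x => lin θ₀ t x - lin θ₀ s x) 1 volume ≤ ENNReal.ofReal (S * m) := by
      refine l3.trans (ENNReal.ofReal_le_ofReal ?_)
      have := mul_le_mul_of_nonneg_left ma p1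
      have : 0 ≤ (9 * (C₂ * (K₂ * (M * M))) + C₃ * (K₃ * N) + 3 * (C₁ * (K₁ * (N * M))) +
        3 * (C₅ * (N * M))) * m := by positivity
      rw [hS]
      linarith
    have b2 : ∀ l, eLpNorm (fun x => (duh (heat1 l) (fun z => θ z.1 z.2 * u z.1 z.2 l) t x -
        duh (heat1 l) (fun z => θ z.1 z.2 * u z.1 z.2 l) s x)) 1 volume ≤
        ENNReal.ofReal (C₅ * (N * M) * m) := fun l => by
      refine ((H₅ l (N * M) _ hNM (h.adm.mθu l) (h.adm.bθu l)).2 s t hs hst).trans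
        (ENNReal.ofReal_le_ofReal ?_)
      exact mul_le_mul_of_nonneg_left mb p5
    have b3 : eLpNorm (∑ l, fun x => (duh (heat1 l) (fun z => θ z.1 z.2 * u z.1 z.2 l) t x -
        duh (heat1 l) (fun z => θ z.1 z.2 * u z.1 z.2 l) s x)) 1 volume ≤
        ENNReal.ofReal (S * m) := by
      refine (eLpNorm_sum_le (fun l _ => ((md l t).sub (md l s)).aestronglyMeasurable) le_rfl).trans
        ((Finset.sum_le_sum fun l _ => b2 l).trans ?_)
      rw [Finset.sum_const, Finset.card_univ, Fintype.card_fin, nsmul_eq_mul, Nat.cast_ofNat,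
        show (3 : ℝ≥0∞) = ENNReal.ofReal 3 by simp, ← ENNReal.ofReal_mul (by norm_num)]
      refine ENNReal.ofReal_le_ofReal ?_
      have : 0 ≤ (C₄ * ε + 9 * (C₂ * (K₂ * (M * M))) + C₃ * (K₃ * N) +
        3 * (C₁ * (K₁ * (N * M)))) * m := by positivity
      rw [hS]
      linarith
    refine (add_le_add b1 b3).trans ?_
    rw [← ENNReal.ofReal_add (by positivity) (by positivity)]
    refine ENNReal.ofReal_le_ofReal ?_
    have : 0 ≤ S * m := by positivity
    linarith

lemma Sol.aestronglyMeasurable_velocity (hD : Data ε u₀ θ₀) (h : Sol M N u₀ θ₀ u θ) {t : ℝ}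
    (ht : 0 ≤ t) : AEStronglyMeasurable (u t) volume := by
  rcases ht.eq_or_lt with rfl | ht
  · rw [h.zu]; exact hD.mu
  · have := (stronglyMeasurable_nextU h.adm hD.mu).comp_measurable
      (measurable_prodMk_left (x := t) (β := E3))
    exact this.aestronglyMeasurable.congr (ae_of_all _ fun x => (h.eu t ht x).symm)

lemma Sol.aestronglyMeasurable_temperature (hD : Data ε u₀ θ₀) (h : Sol M N u₀ θ₀ u θ) {t : ℝ}
    (ht : 0 ≤ t) : AEStronglyMeasurable (θ t) volume := by
  rcases ht.eq_or_lt with rfl | ht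
  · rw [h.zθ]; exact hD.iθ.aestronglyMeasurable
  · have := (stronglyMeasurable_nextT h.adm hD.iθ.aestronglyMeasurable).comp_measurable
      (measurable_prodMk_left (x := t) (β := E3))
    exact this.aestronglyMeasurable.congr (ae_of_all _ fun x => (h.eθ t ht x).symm)

/-- Weighted differences over time are controlled by those between ordered times. -/
lemma tendsto_essSup_of_timeMod {F : Type*} [NormedAddCommGroup F] {v : ℝ → E3 → F} {C : ℝ} (m : ℕ)
    (H : ∀ s t, 0 < s → s ≤ t → ∀ x, ‖v t x - v s x‖ ≤ C * timeMod s t * rho s x ^ (-(m : ℝ)))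
    {t' : ℝ} (ht' : 0 < t') :
    Tendsto (fun t => essSup (fun x => ‖x‖ₑ ^ m * ‖v t x - v t' x‖ₑ) volume) (𝓝 t') (𝓝 0) := by
  refine tendsto_of_tendsto_of_tendsto_of_le_of_le' tendsto_const_nhds (tendsto_timeMod ht' C)
    (Eventually.of_forall fun _ => zero_le) ?_
  filter_upwards [lt_mem_nhds ht'] with t ht
  have hmin : 0 < min t t' := lt_min ht ht'
  refine essSup_le_of_ae_le _ (ae_of_all _ fun x => ?_)
  have e := ofReal_pow_mul_enorm (norm_nonneg x) m (v t x - v t' x)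
  rw [ofReal_norm] at e
  refine e.trans_le (ENNReal.ofReal_le_ofReal ?_)
  have h1 : ‖v t x - v t' x‖ ≤ C * timeMod (min t t') (max t t') *
      rho (min t t') x ^ (-(m : ℝ)) := by
    rcases le_total t t' with h | h
    · rw [min_eq_left h, max_eq_right h, norm_sub_rev]
      exact H t t' ht h x
    · rw [min_eq_right h, max_eq_left h]
      exact H t' t ht' h x
  have h2 := mul_le_of_le_rpow_neg (rho_pos hmin x) m h1
  refine le_trans ?_ h2
  gcongr
  exact norm_le_rho _ _

lemma Sol.memX (hM : 0 ≤ M) (hN : 0 ≤ N) (hε : 0 ≤ ε) (hD : Data ε u₀ θ₀) (hv : IsDivFree u₀)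
    (h : Sol M N u₀ θ₀ u θ) : MemX u where
  aestronglyMeasurable := h.adm.mu
  aestronglyMeasurable_slice t ht := h.aestronglyMeasurable_velocity hD ht
  norm_lt_top := (normX_le h.bu).trans_lt ENNReal.ofReal_lt_top
  divFree t ht := h.divFree hD hv ht
  tendsto_zero φ hφ hc := h.tendsto_velocity hM hN hD hφ hc
  continuous t' ht' := by
    obtain ⟨C, hC, H⟩ := h.time_sub_le hM hN hε hD
    have := tendsto_essSup_of_timeMod (v := u) 1 (fun s t hs hst x => by
      simpa only [Nat.cast_one] using (H s t hs hst).1 x) ht'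
    simpa only [pow_one] using this

lemma Sol.memY (hM : 0 ≤ M) (hN : 0 ≤ N) (hε : 0 ≤ ε) (hD : Data ε u₀ θ₀)
    (h : Sol M N u₀ θ₀ u θ) {r : ℝ} (hY : normY θ ≤ ENNReal.ofReal r) : MemY θ where
  aestronglyMeasurable := h.adm.mθ
  aestronglyMeasurable_slice t ht := h.aestronglyMeasurable_temperature hD ht
  norm_lt_top := hY.trans_lt ENNReal.ofReal_lt_top
  tendsto_zero φ hφ hc := h.tendsto_temperature hM hN hD hφ hc
  continuous t' ht' := by
    obtain ⟨C, hC, H⟩ := h.time_sub_le hM hN hε hD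
    exact tendsto_essSup_of_timeMod (v := θ) 3 (fun s t hs hst x => by
      simpa only [Nat.cast_ofNat, Real.norm_eq_abs] using (H s t hs hst).2.1 x) ht'
  continuous_L1 t' ht' := by
    obtain ⟨C, hC, H⟩ := h.time_sub_le hM hN hε hD
    refine tendsto_of_tendsto_of_tendsto_of_le_of_le' tendsto_const_nhds (tendsto_timeMod ht' C)
      (Eventually.of_forall fun _ => zero_le) ?_
    filter_upwards [lt_mem_nhds ht'] with t ht
    rcases le_total t t' with h | h
    · rw [min_eq_left h, max_eq_right h]
      have e : (fun x => θ t x - θ t' x) = -fun x => θ t' x - θ t x := by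
        ext x
        simp
      rw [e, eLpNorm_neg]
      exact (H t t' ht h).2.2
    · rw [min_eq_right h, max_eq_left h]
      exact (H t' t ht' h).2.2

end

/-! ### Mass of the temperature -/

lemma integral_lin {f : E3 → ℝ} (hf : Integrable f) {t : ℝ} (ht : 0 < t) :
    ∫ x, lin f t x = ∫ y, f y := by
  have hF : Integrable (fun w : E3 × E3 => heatKernel t (w.1 - w.2) * f w.2)
      ((volume : Measure E3).prod volume) :=
    (measurePreserving_sub_prod (volume : Measure E3) (volume : Measure E3)
      ).integrable_comp_of_integrable ((integrable_heatKernel ht).mul_prod hf)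
  unfold lin
  rw [integral_integral_swap hF]
  congr 1
  ext y
  rw [integral_mul_const, integral_sub_right_eq_self (heatKernel t) y, integral_heatKernel ht, one_mul]

lemma integrable_lin {f : E3 → ℝ} (hf : Integrable f) {t : ℝ} (ht : 0 < t) :
    Integrable (lin f t) := by
  have hF : Integrable (fun w : E3 × E3 => heatKernel t (w.1 - w.2) * f w.2)
      ((volume : Measure E3).prod volume) :=
    (measurePreserving_sub_prod (volume : Measure E3) (volume : Measure E3)
      ).integrable_comp_of_integrable ((integrable_heatKernel ht).mul_prod hf)
  exact hF.integral_prod_left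

lemma eLpNorm_lin_le {f : E3 → ℝ} (hf : Integrable f) {t : ℝ} (ht : 0 < t) :
    eLpNorm (lin f t) 1 volume ≤ ENNReal.ofReal (∫ y, |f y|) := by
  refine (eLpNorm_conv_le (by fun_prop) (integrable_heatKernel ht) hf).trans (le_of_eq ?_)
  simp_rw [abs_of_nonneg (heatKernel_nonneg ht _)]
  rw [integral_heatKernel ht, one_mul]

/-- By Fubini the mass is carried by the integral of the kernel in x, which is zero. The nonlinear
term thus neither creates nor destroys heat, and the mean of the temperature is conserved. -/
lemma integral_duh_heat1 {A : ℝ} (l : Fin 3) {f : ℝ × E3 → ℝ}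
    (hfm : AEStronglyMeasurable f spaceTime)
    (hf : ∀ᵐ z ∂spaceTime, |f z| ≤ A * rho z.1 z.2 ^ (-4 : ℝ)) {t : ℝ} (ht : 0 < t) :
    Integrable (duh (heat1 l) f t) ∧ ∫ x, duh (heat1 l) f t x = 0 := by
  obtain ⟨K, hK, L⟩ := ker_heat1
  obtain ⟨C₀, h₀, H₀⟩ := lintegral_powInt_le (g := 0) (by norm_num)
  have hp : Integrable (powInt 0 4 4 t) := by
    refine ⟨(measurable_powInt _ _ _ _).aestronglyMeasurable, ?_⟩
    rw [hasFiniteIntegral_iff_ofReal (ae_of_all _ fun x => powInt_nonneg _ _ _ _ _)]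
    exact (H₀ t ht).trans_lt ENNReal.ofReal_lt_top
  have hl := fun x => (L l).integral_abs_le (by norm_num) (by norm_num) (by norm_num) (by norm_num)
    (by norm_num) hfm hf ht x
  have hi := integrable_prod_of_left (ψ := fun _ => 1) (b := fun x => K * A * powInt 0 4 4 t x)
    (L l).measurable (aestronglyMeasurable_nu hfm t) aestronglyMeasurable_const
    (ae_of_all _ fun x => (hl x).1) (ae_of_all _ fun x => (hl x).2)
    (by simpa only [one_mul] using hp.const_mul (K * A))
  refine ⟨by simpa only [one_mul] using integrable_mul_duh (k := heat1 l) (f := f) (ψ := fun _ => 1) hi, ?_⟩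
  have e := integral_mul_duh (k := heat1 l) (f := f) (ψ := fun _ => 1) hi
  simp only [one_mul, mul_one] at e
  rw [e]
  refine integral_eq_zero_of_ae (ae_of_all _ fun z => ?_)
  dsimp only
  rw [integral_sub_right_eq_self (heat1 l (t - z.1)) z.2, integral_heat1, zero_mul, Pi.zero_apply]

section

variable {M N ε : ℝ} {u : ℝ → E3 → E3} {θ : ℝ → E3 → ℝ} {u₀ : E3 → E3} {θ₀ : E3 → ℝ}

lemma Sol.integral_temperature (hD : Data ε u₀ θ₀)
    (h : Sol M N u₀ θ₀ u θ) {t : ℝ} (ht : 0 < t) :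
    Integrable (θ t) ∧ ∫ x, θ t x = ∫ x, θ₀ x := by
  have hd := fun l => integral_duh_heat1 l (h.adm.mθu l) (h.adm.bθu l) ht
  have e : θ t = fun x => lin θ₀ t x - ∑ l, duh (heat1 l) (fun z => θ z.1 z.2 * u z.1 z.2 l) t x := by
    ext x
    rw [h.eθ t ht x, nextT]
  have hs : Integrable fun x => ∑ l, duh (heat1 l) (fun z => θ z.1 z.2 * u z.1 z.2 l) t x :=
    integrable_finsetSum _ fun l _ => (hd l).1
  constructor
  · rw [e]
    exact (integrable_lin hD.iθ ht).sub hs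
  · conv_lhs => rw [e]
    rw [integral_sub (integrable_lin hD.iθ ht) hs, integral_lin hD.iθ ht,
      integral_finsetSum _ fun l _ => (hd l).1, Finset.sum_eq_zero fun l _ => (hd l).2, sub_zero]

end

/-- The solution of the integral equations for small data, and its elementary properties. -/
structure GoodSol (M : ℝ) (u₀ : E3 → E3) (θ₀ : E3 → ℝ) (u : ℝ → E3 → E3) (θ : ℝ → E3 → ℝ) :
    Prop where
  sol : Sol M M u₀ θ₀ u θ
  integrable : ∀ t, 0 < t → Integrable (θ t)
  integral_abs_le : ∀ t, 0 < t → ∫ x, |θ t x| ≤ M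
  integral : ∀ t, 0 < t → ∫ x, θ t x = ∫ x, θ₀ x
  data : ∃ ε, Data ε u₀ θ₀

lemma Sol.mono {M N N' : ℝ} {u : ℝ → E3 → E3} {θ : ℝ → E3 → ℝ} {u₀ : E3 → E3} {θ₀ : E3 → ℝ}
    (h : Sol M N u₀ θ₀ u θ) (hN : N ≤ N') : Sol M N' u₀ θ₀ u θ :=
  ⟨h.adm.mono le_rfl hN, h.bu, fun t ht x => (h.bθ t ht x).trans
    (mul_le_mul_of_nonneg_right hN (Real.rpow_nonneg (rho_nonneg _ _) _)), h.eu, h.eθ, h.zu, h.zθ⟩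

lemma exists_goodSol : ∃ C ≥ 1, ∀ ε, 0 < ε → 216 * C ^ 2 * (18 * C ^ 2 * ε) ≤ 1 →
    ∀ (u₀ : E3 → E3) (θ₀ : E3 → ℝ), SmallData ε u₀ θ₀ → ∃ u θ,
      GoodSol (18 * C ^ 2 * ε) u₀ θ₀ u θ ∧ IsStrongSolution (18 * C ^ 2 * ε) u₀ θ₀ u θ ∧
      ∀ u' θ', IsStrongSolution (18 * C ^ 2 * ε) u₀ θ₀ u' θ' →
        ∀ t, 0 ≤ t → u' t =ᵐ[volume] u t ∧ θ' t =ᵐ[volume] θ t := by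
  obtain ⟨C₁, c₁, H₁⟩ := exists_duhBound
  obtain ⟨C₂, c₂, H₂⟩ := lin_le
  obtain ⟨C₃, c₃, H₃⟩ := eLpNorm_duh_heat1_le
  refine ⟨C₁ + C₂ + C₃ + 1, by linarith, fun ε hε hs u₀ θ₀ hd => ?_⟩
  set C := C₁ + C₂ + C₃ + 1 with hC
  have hC1 : 1 ≤ C := by linarith
  have hDB : DuhBound C := H₁.mono (by linarith)
  have hD := hd.data hε
  set M := 18 * C ^ 2 * ε with hM
  have hM0 : 0 ≤ M := by positivity
  have hCε : ε ≤ C * ε := le_mul_of_one_le_left hε.le hC1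
  have hCε2 : C * ε ≤ C ^ 2 * ε := mul_le_mul_of_nonneg_right (by nlinarith) hε.le
  -- The norm of θ is a sum of two parts: the L¹ part and the weighted supremum will each be at most
  -- 2Cε, and together they must fit below M.
  have hNM : 2 * C * ε + 2 * C * ε ≤ M := by rw [hM]; linarith
  have hN0 : 0 ≤ 2 * C * ε := by positivity
  have hl : LinBound C ε u₀ θ₀ := fun t ht x => by
    have hle : C₂ * ε ≤ C * ε := mul_le_mul_of_nonneg_right (by linarith) hε.le
    obtain ⟨h1, h2⟩ := H₂ ε u₀ θ₀ hε.le hD t ht x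
    exact ⟨fun j => (h1 j).trans (mul_le_mul_of_nonneg_right hle (Real.rpow_nonneg (rho_nonneg _ _) _)),
      h2.trans (mul_le_mul_of_nonneg_right hle (Real.rpow_nonneg (rho_nonneg _ _) _))⟩
  obtain ⟨u, θ, hS⟩ := exists_sol hDB hC1 hε.le hM rfl hs hl hD
  have hL1 : ∀ t, 0 < t → eLpNorm (θ t) 1 volume ≤ ENNReal.ofReal (2 * C * ε) := by
    intro t ht
    have e : θ t = lin θ₀ t - ∑ l, duh (heat1 l) (fun z => θ z.1 z.2 * u z.1 z.2 l) t := by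
      ext x
      rw [hS.eθ t ht x, nextT, Pi.sub_apply, Finset.sum_apply]
    have hd1 := fun l => integral_duh_heat1 l (hS.adm.mθu l)
      (hS.adm.bθu l) ht
    have hd2 := fun l => (H₃ l (2 * C * ε * M) _ (by positivity) (hS.adm.mθu l) (hS.adm.bθu l)).1 t ht
    rw [e]
    refine (eLpNorm_sub_le (integrable_lin hD.iθ ht).aestronglyMeasurable
      (Finset.aestronglyMeasurable_sum _ fun l _ => (hd1 l).1.aestronglyMeasurable) le_rfl).trans ?_
    have b2 := (eLpNorm_sum_le (fun l (_ : l ∈ Finset.univ) => (hd1 l).1.aestronglyMeasurable)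
      le_rfl).trans (Finset.sum_le_sum fun l _ => hd2 l)
    rw [Finset.sum_const, Finset.card_univ, Fintype.card_fin, nsmul_eq_mul, Nat.cast_ofNat,
      show (3 : ℝ≥0∞) = ENNReal.ofReal 3 by simp, ← ENNReal.ofReal_mul (by norm_num)] at b2
    refine (add_le_add ((eLpNorm_lin_le hD.iθ ht).trans (ENNReal.ofReal_le_ofReal hD.nθ)) b2).trans ?_
    rw [← ENNReal.ofReal_add hε.le (by positivity)]
    refine ENNReal.ofReal_le_ofReal ?_
    have hCM : C * M ≤ C ^ 2 * M := mul_le_mul_of_nonneg_right (by nlinarith) hM0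
    have h1 : C₃ * M ≤ C * M := mul_le_mul_of_nonneg_right (by linarith) hM0
    have h2 : C₃ * M * (2 * C * ε) ≤ 1 / 216 * (2 * C * ε) :=
      mul_le_mul_of_nonneg_right (by linarith) hN0
    linarith
  have hY : normY θ ≤ ENNReal.ofReal M :=
    (normY_le hN0 hN0 hS.bθ hL1).trans (ENNReal.ofReal_le_ofReal hNM)
  have hI := fun t ht => hS.integral_temperature hD (t := t) ht
  refine ⟨u, θ, ⟨hS.mono (by linarith), fun t ht => (hI t ht).1, fun t ht => ?_,
    fun t ht => (hI t ht).2, ε, hD⟩,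
    ⟨hS.memX hM0 hN0 hε.le hD hd.divFree, hS.memY hM0 hN0 hε.le hD hY,
      hS.isMildSolution hDB hM0 hN0, normX_le hS.bu, hY⟩, fun u' θ' h' t ht =>
    hS.unique hDB hC1 hM0 (by linarith) hs hD.mu hD.iθ.aestronglyMeasurable h' ht⟩
  have h1 := hL1 t ht
  rw [eLpNorm_one_eq_lintegral_enorm, ← ofReal_integral_norm_eq_lintegral_enorm (hI t ht).1,
    ENNReal.ofReal_le_ofReal_iff hN0] at h1
  simp only [Real.norm_eq_abs] at h1
  linarith

/-! ### Weights -/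

/-- The weights `(1 + t) ^ c (√(1 + t) + |x|) ^ (-e)`. -/
def wt (c e t : ℝ) (x : E3) : ℝ := (1 + t) ^ c * rho (1 + t) x ^ (-e)

lemma rho_succ_pos {t : ℝ} (ht : 0 ≤ t) (x : E3) : 0 < rho (1 + t) x := rho_pos (by linarith) x

lemma one_le_rho_succ {t : ℝ} (ht : 0 ≤ t) (x : E3) : 1 ≤ rho (1 + t) x :=
  (Real.one_le_sqrt.2 (by linarith)).trans (sqrt_le_rho _ _)

lemma rho_le_succ (t : ℝ) (x : E3) : rho t x ≤ rho (1 + t) x := rho_mono (by linarith) x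

lemma rho_succ_le {t : ℝ} (x : E3) : rho (1 + t) x ≤ 1 + rho t x := by
  have := sqrt_add_le 1 t
  rw [Real.sqrt_one] at this
  unfold rho
  linarith

lemma rho_succ_le_sub (s t : ℝ) (x y : E3) :
    rho (1 + t) x ≤ rho (t - s) (x - y) + rho (1 + s) y := by
  have := rho_le_sub (1 + s) (1 + t) x y
  rwa [add_sub_add_left_eq_sub] at this

lemma wt_nonneg {t : ℝ} (ht : 0 ≤ t) (c e : ℝ) (x : E3) : 0 ≤ wt c e t x :=
  mul_nonneg (Real.rpow_nonneg (by linarith) _) (Real.rpow_nonneg (rho_nonneg _ _) _)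

lemma wt_mul {t : ℝ} (ht : 0 ≤ t) (c e c' e' : ℝ) (x : E3) :
    wt c e t x * wt c' e' t x = wt (c + c') (e + e') t x := by
  unfold wt
  rw [neg_add, Real.rpow_add (by linarith), Real.rpow_add (rho_succ_pos ht x)]
  ring

/-- Since √(1+t) + |x| ≥ √(1+t), spatial decay of order e - e' can be exchanged for
(1+t)^(-(e-e')/2). Raising the power of 1 + t is free. -/
lemma wt_le {t : ℝ} (ht : 0 ≤ t) {c e c' e' : ℝ} (he : e' ≤ e) (hc : c - (e - e') / 2 ≤ c')
    (x : E3) : wt c e t x ≤ wt c' e' t x := by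
  have h1 : (0 : ℝ) < 1 + t := by linarith
  have h2 := rho_rpow_le_sqrt h1 x (e := e - e') (by linarith)
  unfold wt
  calc (1 + t) ^ c * rho (1 + t) x ^ (-e) =
      (1 + t) ^ c * (rho (1 + t) x ^ (-(e - e')) * rho (1 + t) x ^ (-e')) := by
        rw [← Real.rpow_add (rho_succ_pos ht x)]
        ring_nf
    _ ≤ (1 + t) ^ c * ((1 + t) ^ (-((e - e') / 2)) * rho (1 + t) x ^ (-e')) := by
        have := Real.rpow_nonneg (rho_nonneg (1 + t) x) (-e')
        gcongr
    _ = (1 + t) ^ (c - (e - e') / 2) * rho (1 + t) x ^ (-e') := by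
        rw [sub_eq_add_neg c, Real.rpow_add h1, mul_assoc]
    _ ≤ (1 + t) ^ c' * rho (1 + t) x ^ (-e') := by
        have := Real.rpow_nonneg (rho_nonneg (1 + t) x) (-e')
        have := Real.rpow_le_rpow_of_exponent_le (by linarith : 1 ≤ 1 + t) hc
        gcongr

/-- Where ρ(t,x) ≤ 1 the weight is bounded below, so a bounded function satisfies any decay estimate
there. In the complementary region ρ(t,x) and ρ(1+t,x) are comparable (`rho_rpow_le_wt`). -/
lemma one_le_wt {t : ℝ} (ht : 0 ≤ t) {x : E3} (hx : rho t x ≤ 1) {c e : ℝ} (hc : 0 ≤ c)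
    (he : 0 ≤ e) : 1 ≤ 2 ^ e * wt c e t x := by
  have h1 : (1 : ℝ) ≤ (1 + t) ^ c := Real.one_le_rpow (by linarith) hc
  have h2 : (2 : ℝ) ^ (-e) ≤ rho (1 + t) x ^ (-e) :=
    rpow_neg_le (rho_succ_pos ht x) ((rho_succ_le x).trans (by linarith)) he
  have h3 : (2 : ℝ) ^ e * 2 ^ (-e) = 1 := by rw [← Real.rpow_add two_pos, add_neg_cancel, Real.rpow_zero]
  calc (1 : ℝ) = 2 ^ e * (1 * 2 ^ (-e)) := by rw [one_mul, h3]
    _ ≤ _ := by unfold wt; gcongr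

lemma rho_rpow_le_wt {t : ℝ} (ht : 0 ≤ t) {x : E3} (hx : 1 ≤ rho t x) (c : ℝ) {e : ℝ} (he : 0 ≤ e) :
    (1 + t) ^ c * rho t x ^ (-e) ≤ 2 ^ e * wt c e t x := by
  have h := rpow_neg_pull (by linarith : 0 < rho t x) (rho_succ_pos ht x)
    ((rho_succ_le x).trans (by linarith)) he e
  rw [sub_self, neg_zero, Real.rpow_zero, mul_one] at h
  unfold wt
  rw [mul_left_comm]
  exact mul_le_mul_of_nonneg_left h (Real.rpow_nonneg (by linarith) _)

/-! ### Decay of the linear flow -/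

lemma abs_lin_le {D : ℝ} {f : E3 → ℝ} (hf : ∀ᵐ y, |f y| ≤ D) {t : ℝ} (ht : 0 < t) (x : E3) :
    |lin f t x| ≤ D := by
  have hi := (integrable_heatKernel ht).comp_sub_left x
  have : |lin f t x| ≤ ∫ y, heatKernel t (x - y) * D := by
    unfold lin
    rw [← Real.norm_eq_abs]
    refine norm_integral_le_of_norm_le (hi.mul_const D) ?_
    filter_upwards [hf] with y hy
    rw [norm_mul, Real.norm_of_nonneg (heatKernel_nonneg ht _)]
    exact mul_le_mul_of_nonneg_left hy (heatKernel_nonneg ht _)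
  rwa [integral_mul_const, integral_sub_left_eq_self (heatKernel t) volume x, integral_heatKernel ht,
    one_mul] at this

lemma one_add_rpow_le_one {a : ℝ} (ha : 0 ≤ a) (y : E3) : (1 + ‖y‖) ^ (-a) ≤ 1 :=
  Real.rpow_le_one_of_one_le_of_nonpos (by linarith [norm_nonneg y]) (by linarith)

lemma ae_le_of_one_add {a D : ℝ} (ha : 0 ≤ a) (hD : 0 ≤ D) {f : E3 → ℝ}
    (hf : ∀ᵐ y, |f y| ≤ D * (1 + ‖y‖) ^ (-a)) : ∀ᵐ y, |f y| ≤ D := by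
  filter_upwards [hf] with y hy
  exact hy.trans (mul_le_of_le_one_right hD (one_add_rpow_le_one ha y))

lemma lin_wt_of_rpow {a : ℝ} (ha0 : 0 < a) (ha : a < 3) : ∃ C > 0, ∀ (D : ℝ) (f : E3 → ℝ), 0 ≤ D →
    AEStronglyMeasurable f volume → (∀ᵐ y, |f y| ≤ D * (1 + ‖y‖) ^ (-a)) → ∀ t, 0 < t → ∀ x,
    |lin f t x| ≤ C * D * wt 0 a t x := by
  obtain ⟨C₁, c₁, H₁⟩ := conv_le_of_rpow ha0 ha
  obtain ⟨C₃, c₃, H₃⟩ := heatKernel_bound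
  refine ⟨2 ^ a * (C₁ * C₃ + 1), by positivity, fun D f hD hfm hf t ht x => ?_⟩
  have hw := wt_nonneg ht.le 0 a x
  rcases le_total (rho t x) 1 with hx | hx
  · have h1 := abs_lin_le (ae_le_of_one_add ha0.le hD hf) ht x
    have h2 := mul_le_mul_of_nonneg_left (one_le_wt ht.le hx le_rfl ha0.le (c := 0)) hD
    have h3 : 0 ≤ 2 ^ a * (C₁ * C₃) * D * wt 0 a t x := by positivity
    linarith
  · have hf' : ∀ᵐ y, |f y| ≤ D * ‖y‖ ^ (-a) := by
      filter_upwards [hf, ae_ne_zero] with y hy h0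
      exact hy.trans (mul_le_mul_of_nonneg_left (rpow_neg_le (norm_pos_iff.2 h0) (by linarith)
        ha0.le) hD)
    have h1 := (H₁ t C₃ D _ _ ht c₃.le hD (H₃ t ht) hf' (by fun_prop) hfm x).2
    have h2 := rho_rpow_le_wt ht.le hx 0 ha0.le
    rw [Real.rpow_zero, one_mul] at h2
    have h3 := mul_le_mul_of_nonneg_left h2 (by positivity : 0 ≤ C₁ * (C₃ * D))
    have h4 : 0 ≤ 2 ^ a * D * wt 0 a t x := by positivity
    unfold lin
    linarith

lemma half_rho_le {t : ℝ} {x y : E3} (hy : ‖y‖ ≤ rho t x / 2) : rho t x / 2 ≤ rho t (x - y) := by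
  have := norm_le_add_rho t x y
  linarith

lemma half_rpow_neg {A : ℝ} (hA : 0 < A) (b : ℝ) : (A / 2) ^ (-b) = 2 ^ b * A ^ (-b) := by
  rw [Real.div_rpow hA.le two_pos.le, Real.rpow_neg two_pos.le, div_inv_eq_mul, mul_comm]

/-- Split at |y| = ρ(t,x)/2. For smaller y the kernel decays with exponent b, at the cost
t^((b-3)/2), against the mass of f; for larger y the pointwise decay of f is used against the unit
mass of the kernel. -/
lemma lin_wt_of_integrable {b : ℝ} (hb : 3 ≤ b) : ∃ C > 0, ∀ (D : ℝ) (f : E3 → ℝ), 0 ≤ D →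
    Integrable f → (∀ᵐ y, |f y| ≤ D * (1 + ‖y‖) ^ (-b)) → ∫ y, |f y| ≤ D → ∀ t, 0 < t → ∀ x,
    |lin f t x| ≤ C * D * wt ((b - 3) / 2) b t x := by
  obtain ⟨C₁, c₁, H₁⟩ := heatKernel_le (M := b) (by linarith)
  refine ⟨2 ^ b * (2 ^ b * (C₁ + 1) + 1), by positivity, fun D f hD hfi hf hL t ht x => ?_⟩
  have hw := wt_nonneg ht.le ((b - 3) / 2) b x
  have hf1 := ae_le_of_one_add (by linarith) hD hf
  rcases le_total (rho t x) 1 with hx | hx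
  · have h1 := abs_lin_le hf1 ht x
    have h2 := mul_le_mul_of_nonneg_left (one_le_wt ht.le hx (by linarith : 0 ≤ (b - 3) / 2)
      (by linarith : 0 ≤ b)) hD
    have h3 : 0 ≤ 2 ^ b * (2 ^ b * (C₁ + 1)) * D * wt ((b - 3) / 2) b t x := by positivity
    linarith
  · have hA : 0 < rho t x := by linarith
    have hA2 : 0 < rho t x / 2 := by linarith
    set P := (rho t x / 2) ^ (-b) with hP
    have hP0 : 0 ≤ P := Real.rpow_nonneg hA2.le _
    have ht1 : t ^ ((b - 3) / 2) ≤ (1 + t) ^ ((b - 3) / 2) :=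
      Real.rpow_le_rpow ht.le (by linarith) (by linarith)
    have h1t : 1 ≤ (1 + t) ^ ((b - 3) / 2) := Real.one_le_rpow (by linarith) (by linarith)
    have hle : |lin f t x| ≤ ∫ y, (C₁ * (t ^ ((b - 3) / 2) * P) * |f y| +
        D * P * heatKernel t (x - y)) := by
      unfold lin
      rw [← Real.norm_eq_abs]
      refine norm_integral_le_of_norm_le ((hfi.abs.const_mul _).add
        (((integrable_heatKernel ht).comp_sub_left x).const_mul _)) ?_
      filter_upwards [hf] with y hy
      have hg := heatKernel_nonneg ht (x - y)
      rw [norm_mul, Real.norm_of_nonneg hg, Real.norm_eq_abs]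
      rcases le_total ‖y‖ (rho t x / 2) with h | h
      · have h1 : heatKernel t (x - y) ≤ C₁ * (t ^ ((b - 3) / 2) * P) := by
          refine (H₁ t ht (x - y)).trans ?_
          have := rpow_neg_le hA2 (half_rho_le h) (by linarith : 0 ≤ b)
          gcongr
        have := mul_le_mul_of_nonneg_right h1 (abs_nonneg (f y))
        have : 0 ≤ D * P * heatKernel t (x - y) := by positivity
        linarith
      · have h1 : |f y| ≤ D * P := hy.trans (mul_le_mul_of_nonneg_left
          (rpow_neg_le hA2 (by linarith) (by linarith)) hD)
        have := mul_le_mul_of_nonneg_left h1 hg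
        have : 0 ≤ C₁ * (t ^ ((b - 3) / 2) * P) * |f y| := by positivity
        linarith
    rw [integral_add (hfi.abs.const_mul _) (((integrable_heatKernel ht).comp_sub_left x).const_mul _),
      integral_const_mul, integral_const_mul, integral_sub_left_eq_self (heatKernel t) volume x,
      integral_heatKernel ht, mul_one] at hle
    have e1 : C₁ * (t ^ ((b - 3) / 2) * P) * ∫ y, |f y| ≤ C₁ * ((1 + t) ^ ((b - 3) / 2) * P) * D := by
      gcongr
    have e2 : D * P ≤ D * ((1 + t) ^ ((b - 3) / 2) * P) := by
      have := mul_le_mul_of_nonneg_right h1t hP0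
      rw [one_mul] at this
      gcongr
    have e3 := mul_le_mul_of_nonneg_left (rho_rpow_le_wt ht.le hx ((b - 3) / 2)
      (by linarith : 0 ≤ b)) (by positivity : 0 ≤ 2 ^ b * (C₁ + 1) * D)
    have e4 : (1 + t) ^ ((b - 3) / 2) * P = 2 ^ b * ((1 + t) ^ ((b - 3) / 2) * rho t x ^ (-b)) := by
      rw [hP, half_rpow_neg hA]
      ring
    rw [e4] at e1 e2
    have h4 : 0 ≤ 2 ^ b * D * wt ((b - 3) / 2) b t x := by positivity
    linarith

/-- The mean being zero, the kernel at x may be subtracted. For |y| ≤ ρ/2 the increment supplies a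
factor |y|, to be integrated against f. For |y| ≥ ρ/2 the subtracted value is estimated with
exponent b - 1 only, and ρ ≤ 2|y| provides the first moment. This improves the time exponent by 1/2.
-/
lemma lin_wt_of_mean_zero {b : ℝ} (hb : 4 ≤ b) : ∃ C > 0, ∀ (D : ℝ) (f : E3 → ℝ), 0 ≤ D →
    Integrable f → (∀ᵐ y, |f y| ≤ D * (1 + ‖y‖) ^ (-b)) → ∫ y, f y = 0 →
    Integrable (fun y => ‖y‖ * |f y|) → ∫ y, ‖y‖ * |f y| ≤ D → ∀ t, 0 < t → ∀ x,
    |lin f t x| ≤ C * D * wt ((b - 4) / 2) b t x := by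
  obtain ⟨C₁, c₁, H₁⟩ := heatKernel_le (M := b - 1) (by linarith)
  obtain ⟨C₂, c₂, H₂⟩ := abs_heatKernel_sub_space_le (m := b) (by linarith)
  refine ⟨2 ^ b * (2 * C₁ + C₂ + 2 ^ b + 1), by positivity, fun D f hD hfi hf hz hfy hL t ht x => ?_⟩
  have hw := wt_nonneg ht.le ((b - 4) / 2) b x
  have hf1 := ae_le_of_one_add (by linarith) hD hf
  rcases le_total (rho t x) 1 with hx | hx
  · have h1 := abs_lin_le hf1 ht x
    have h2 := mul_le_mul_of_nonneg_left (one_le_wt ht.le hx (by linarith : 0 ≤ (b - 4) / 2)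
      (by linarith : 0 ≤ b)) hD
    have h3 : 0 ≤ 2 ^ b * (2 * C₁ + C₂ + 2 ^ b) * D * wt ((b - 4) / 2) b t x := by positivity
    linarith
  · have hA : 0 < rho t x := by linarith
    have hA2 : 0 < rho t x / 2 := by linarith
    set P := rho t x ^ (-b) with hP
    have hP0 : 0 ≤ P := Real.rpow_nonneg hA.le _
    have hPA : rho t x ^ (-(b - 1)) = rho t x * P := by
      rw [hP, ← Real.rpow_one_add' hA.le (by linarith)]
      ring_nf
    set T := t ^ ((b - 4) / 2) with hT
    have hT0 : 0 ≤ T := Real.rpow_nonneg ht.le _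
    have ht1 : T ≤ (1 + t) ^ ((b - 4) / 2) := Real.rpow_le_rpow ht.le (by linarith) (by linarith)
    have h1t : 1 ≤ (1 + t) ^ ((b - 4) / 2) := Real.one_le_rpow (by linarith) (by linarith)
    have hgi := (integrable_heatKernel ht).comp_sub_left x
    have hint : Integrable fun y => heatKernel t (x - y) * f y := by
      refine (hgi.mul_const D).mono' ((Measurable.aestronglyMeasurable (by fun_prop)).mul
        hfi.aestronglyMeasurable) ?_
      filter_upwards [hf1] with y hy
      rw [norm_mul, Real.norm_of_nonneg (heatKernel_nonneg ht _)]
      exact mul_le_mul_of_nonneg_left hy (heatKernel_nonneg ht _)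
    have e : lin f t x = ∫ y, (heatKernel t (x - y) - heatKernel t x) * f y := by
      simp_rw [sub_mul]
      rw [integral_sub hint (hfi.const_mul _), integral_const_mul, hz, mul_zero, sub_zero, lin]
    have hg0 : heatKernel t x ≤ C₁ * (T * (rho t x * P)) := by
      have := H₁ t ht x
      rwa [hPA, show (b - 1 - 3) / 2 = (b - 4) / 2 by ring] at this
    have hle : |lin f t x| ≤ ∫ y, ((2 * C₁ + C₂) * (T * P) * (‖y‖ * |f y|) +
        D * (2 ^ b * P) * heatKernel t (x - y)) := by
      rw [e, ← Real.norm_eq_abs]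
      refine norm_integral_le_of_norm_le ((hfy.const_mul _).add (hgi.const_mul _)) ?_
      filter_upwards [hf] with y hy
      have hg := heatKernel_nonneg ht (x - y)
      rw [norm_mul, Real.norm_eq_abs, Real.norm_eq_abs]
      rcases le_total ‖y‖ (rho t x / 2) with h | h
      · have h1 := mul_le_mul_of_nonneg_right (H₂ t ht x y h) (abs_nonneg (f y))
        have : 0 ≤ D * (2 ^ b * P) * heatKernel t (x - y) := by positivity
        have : 0 ≤ 2 * C₁ * (T * P) * (‖y‖ * |f y|) := by positivity
        linarith
      · have h1 : |f y| ≤ D * (2 ^ b * P) := by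
          rw [hP, ← half_rpow_neg hA]
          exact hy.trans (mul_le_mul_of_nonneg_left
            (rpow_neg_le hA2 (by linarith) (by linarith)) hD)
        have h2 := mul_le_mul_of_nonneg_left h1 hg
        have h3 : heatKernel t x ≤ 2 * C₁ * (T * P) * ‖y‖ := by
          have : C₁ * T * P * rho t x ≤ C₁ * T * P * (2 * ‖y‖) := by
            have : rho t x ≤ 2 * ‖y‖ := by linarith
            gcongr
          linarith
        have h4 := mul_le_mul_of_nonneg_right h3 (abs_nonneg (f y))
        have h5 : |heatKernel t (x - y) - heatKernel t x| ≤ heatKernel t (x - y) + heatKernel t x := by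
          refine (abs_sub _ _).trans (le_of_eq ?_)
          rw [abs_of_nonneg hg, abs_of_nonneg (heatKernel_nonneg ht x)]
        have h6 := mul_le_mul_of_nonneg_right h5 (abs_nonneg (f y))
        have : 0 ≤ C₂ * (T * P) * (‖y‖ * |f y|) := by positivity
        linarith
    rw [integral_add (hfy.const_mul _) (hgi.const_mul _), integral_const_mul, integral_const_mul,
      integral_sub_left_eq_self (heatKernel t) volume x, integral_heatKernel ht, mul_one] at hle
    set T' := (1 + t) ^ ((b - 4) / 2) with hT'
    have e1 : (2 * C₁ + C₂) * (T * P) * ∫ y, ‖y‖ * |f y| ≤ (2 * C₁ + C₂) * (T' * P) * D := by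
      gcongr
    have e2 : D * (2 ^ b * P) ≤ D * (2 ^ b * (T' * P)) := by
      have := mul_le_mul_of_nonneg_right h1t hP0
      rw [one_mul] at this
      gcongr
    have e3 := mul_le_mul_of_nonneg_left (rho_rpow_le_wt ht.le hx ((b - 4) / 2)
      (by linarith : 0 ≤ b)) (by positivity : 0 ≤ (2 * C₁ + C₂ + 2 ^ b) * D)
    have h4 : 0 ≤ 2 ^ b * D * wt ((b - 4) / 2) b t x := by positivity
    linarith

/-! ### Weighted estimates of small bilinear terms -/

@[fun_prop]
lemma measurable_wt {α : Type*} [MeasurableSpace α] {f : α → ℝ} {g : α → E3} (c e : ℝ)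
    (hf : Measurable f) (hg : Measurable g) : Measurable (fun a => wt c e (f a) (g a)) := by
  unfold wt
  fun_prop

/-- As a function of r, A^(-r) B^(-(n-r)) is a constant times (B/A)^r, hence monotone, so it is
bounded by its value at one of the two ends. No constant depending on p enters. -/
lemma rpow_neg_interpolate {A B : ℝ} (hA : 0 < A) (hB : 0 < B) {p₀ p₁ p q n : ℝ} (h0 : p₀ ≤ p)
    (h1 : p ≤ p₁) (hn : p + q = n) :
    A ^ (-p) * B ^ (-q) ≤ A ^ (-p₀) * B ^ (-(n - p₀)) + A ^ (-p₁) * B ^ (-(n - p₁)) := by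
  have key : ∀ r, A ^ (-r) * B ^ (-(n - r)) = B ^ (-n) * (B / A) ^ r := fun r => by
    rw [Real.div_rpow hB.le hA.le, Real.rpow_neg hA.le, neg_sub, Real.rpow_sub hB,
      Real.rpow_neg hB.le]
    field_simp
  have hq : q = n - p := by linarith
  rw [hq, key, key, key, ← mul_add]
  refine mul_le_mul_of_nonneg_left ?_ (Real.rpow_nonneg hB.le _)
  have hBA : 0 < B / A := div_pos hB hA
  rcases le_total 1 (B / A) with h | h
  · have := Real.rpow_le_rpow_of_exponent_le h h1
    have := Real.rpow_nonneg hBA.le p₀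
    linarith
  · have := Real.rpow_le_rpow_of_exponent_ge hBA h h0
    have := Real.rpow_nonneg hBA.le p₁
    linarith

lemma dom_five {p q : ℝ} (hp : 0 < p) (hq : 0 < q) (h5 : p + q = 5) :
    ∃ C > 0, ∀ t : ℝ, 0 < t → ∀ x : E3,
      Dom t (fun z => rho (t - z.1) (x - z.2) ^ (-p) * rho z.1 z.2 ^ (-q)) C := by
  obtain ⟨C, hC, H⟩ := dom_power_five (g := 0) hp hq h5 (by linarith)
  refine ⟨C, hC, fun t ht x => ?_⟩
  have := H t ht x
  simpa only [neg_zero, Real.rpow_zero, one_mul, mul_one] using this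

lemma dom_le_five {p q : ℝ} (hp : 0 < p) (hq : 0 < q) (h3 : 3 < p + q) (h5 : p + q ≤ 5) :
    ∃ C > 0, ∀ t : ℝ, 0 < t → ∀ x : E3,
      Dom t (fun z => rho (t - z.1) (x - z.2) ^ (-p) * rho z.1 z.2 ^ (-q))
        (C * t ^ ((5 - (p + q)) / 2)) := by
  rcases h5.eq_or_lt with h | h
  · obtain ⟨C, hC, H⟩ := dom_five hp hq h
    refine ⟨C, hC, fun t ht x => ?_⟩
    rw [h, sub_self, zero_div, Real.rpow_zero, mul_one]
    exact H t ht x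
  · exact dom_power_lt hp.le hq.le h3 h

/-- Pulling a weight out of a bilinear integral, uniformly in the weight. -/
lemma dom_contract : ∃ C > 0, ∀ e c : ℝ, 1 ≤ e → e ≤ 15 / 4 → 0 ≤ c → ∀ t : ℝ, 0 < t → ∀ x : E3,
    Dom t (fun z => rho (t - z.1) (x - z.2) ^ (-4 : ℝ) * (rho z.1 z.2 ^ (-1 : ℝ) * wt c e z.1 z.2))
      (C * wt c e t x) := by
  obtain ⟨C₁, c₁, H₁⟩ := dom_five (p := 1 / 4) (q := 19 / 4) (by norm_num) (by norm_num) (by norm_num)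
  obtain ⟨C₂, c₂, H₂⟩ := dom_five (p := 3) (q := 2) (by norm_num) (by norm_num) (by norm_num)
  obtain ⟨C₃, c₃, H₃⟩ := dom_five (p := 4) (q := 1) (by norm_num) (by norm_num) (by norm_num)
  refine ⟨16 * (C₁ + C₂ + C₃), by positivity, fun e c he he' hc t ht x => ?_⟩
  have hw := wt_nonneg ht.le c e x
  refine ((((H₁ t ht x).add (H₂ t ht x)).add (H₃ t ht x)).const_mul
    (by positivity : 0 ≤ 16 * wt c e t x)).mono (Measurable.aestronglyMeasurable (by fun_prop))
    (fun s hs y => ?_) (fun s hs y => ?_) (le_of_eq (by ring))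
  · have := wt_nonneg hs.1.le c e y
    have := Real.rpow_nonneg (rho_nonneg (t - s) (x - y)) (-4)
    have := Real.rpow_nonneg (rho_nonneg s y) (-1)
    dsimp only
    positivity
  · have hs0 : 0 < s := hs.1
    have hA : 0 < rho (t - s) (x - y) := rho_pos (by linarith [hs.2]) _
    have hB : 0 < rho s y := rho_pos hs0 y
    have hR : 0 < rho (1 + t) x := rho_succ_pos ht.le x
    have hRs : 0 < rho (1 + s) y := rho_succ_pos hs0.le y
    have h1 := rpow_neg_split hA hRs hR (rho_succ_le_sub s t x y) (by linarith : 0 ≤ e) 4 e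
    rw [sub_self, neg_zero, Real.rpow_zero, mul_one] at h1
    have h2 : rho (1 + s) y ^ (-e) ≤ rho s y ^ (-e) := rpow_neg_le hB (rho_le_succ s y) (by linarith)
    -- For 1 ≤ e ≤ 15/4 the exponent 4 - e stays in [1/4, 3]. Bounding by the two end pairs (1/4,
    -- 19/4) and (3, 2), both of total 5, makes the constant independent of e.
    have h3 := rpow_neg_interpolate hA hB (p₀ := 1 / 4) (p₁ := 3) (p := 4 - e) (q := 1 + e) (n := 5)
      (by linarith) (by linarith) (by ring)
    rw [show (5 : ℝ) - 1 / 4 = 19 / 4 by norm_num, show (5 : ℝ) - 3 = 2 by norm_num] at h3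
    have h4 : (1 + s) ^ c ≤ (1 + t) ^ c := Real.rpow_le_rpow (by linarith) (by linarith [hs.2]) hc
    have h5 : (2 : ℝ) ^ e ≤ 16 := by
      rw [show (16 : ℝ) = 2 ^ (4 : ℝ) by norm_num]
      exact Real.rpow_le_rpow_of_exponent_le (by norm_num) (by linarith)
    have h6 : rho s y ^ (-(1 + e)) = rho s y ^ (-1 : ℝ) * rho s y ^ (-e) := by
      rw [rho_rpow_mul s hs0]
      ring_nf
    set A := rho (t - s) (x - y) with hAd
    set B := rho s y with hBd
    have n : ∀ {X : ℝ}, 0 < X → ∀ r : ℝ, 0 ≤ X ^ r := fun h r => Real.rpow_nonneg h.le r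
    have n1 := n hA (-4)
    have n2 := n hA (-(4 - e))
    have n3 := n hB (-1)
    have n4 := n hR (-e)
    have n5 := n hRs (-e)
    have n6 : 0 ≤ (1 + t) ^ c := Real.rpow_nonneg (by linarith) _
    calc A ^ (-4 : ℝ) * (B ^ (-1 : ℝ) * wt c e s y)
        = (1 + s) ^ c * (B ^ (-1 : ℝ) * (A ^ (-4 : ℝ) * rho (1 + s) y ^ (-e))) := by
          unfold wt; ring
      _ ≤ (1 + t) ^ c * (B ^ (-1 : ℝ) * (16 * (rho (1 + t) x ^ (-e) *
          (A ^ (-(4 - e)) * B ^ (-e) + A ^ (-4 : ℝ))))) := by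
          have : A ^ (-4 : ℝ) * rho (1 + s) y ^ (-e) ≤ 16 * (rho (1 + t) x ^ (-e) *
            (A ^ (-(4 - e)) * B ^ (-e) + A ^ (-4 : ℝ))) := h1.trans (by gcongr)
          gcongr
      _ = 16 * wt c e t x * (A ^ (-(4 - e)) * B ^ (-(1 + e)) + A ^ (-4 : ℝ) * B ^ (-1 : ℝ)) := by
          rw [h6]; unfold wt; ring
      _ ≤ _ := by gcongr

/-- If one factor of the product is M ρ^(-1) and the other is at most α ρ^(-(q-1)) + β `wt c e`, the
Duhamel integral reproduces the bound on the second factor with a small constant. That C₀ precedes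
e, c, α, β is the point: smallness of M is decided once and for all. -/
lemma duh_contract {q : ℝ} (hq : 1 ≤ q) (hq5 : q < 5) : ∃ C₀ > 0, ∀ (K M α β e c : ℝ)
    (k : ℝ → E3 → ℝ) (f : ℝ × E3 → ℝ), Ker 4 K k → 0 ≤ K → 0 ≤ M → 0 ≤ α → 0 ≤ β → 1 ≤ e →
    e ≤ 15 / 4 → 0 ≤ c → AEStronglyMeasurable f spaceTime →
    (∀ᵐ z ∂spaceTime, |f z| ≤ M * (α * rho z.1 z.2 ^ (-q) +
      β * (rho z.1 z.2 ^ (-1 : ℝ) * wt c e z.1 z.2))) → ∀ t, 0 < t → ∀ x,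
    |duh k f t x| ≤ C₀ * (K * M) * (α * rho t x ^ (-(q - 1)) + β * wt c e t x) := by
  obtain ⟨C₁, c₁, H₁⟩ := dom_crit (p := 4) (q := q) (g := 0) (by norm_num) (by linarith) (by norm_num)
    hq5 (by linarith) (by linarith) (by norm_num)
  obtain ⟨C₂, c₂, H₂⟩ := dom_contract
  refine ⟨C₁ + C₂, by positivity, fun K M α β e c k f hk hK hM hα hβ he he' hc hfm hf t ht x => ?_⟩
  have d := (((H₁ t ht x).const_mul hα).add ((H₂ e c he he' hc t ht x).const_mul hβ)).const_mul hM
  simp only [neg_zero, Real.rpow_zero, one_mul] at d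
  have h := (hk.integrand_integrable hK (w := fun z => M * (α * rho z.1 z.2 ^ (-q) +
      β * (rho z.1 z.2 ^ (-1 : ℝ) * wt c e z.1 z.2))) (aestronglyMeasurable_nu hfm t)
      (ae_nu_of_spaceTime hf) (x := x) (by convert! d using 2; ring)).2
  refine h.trans ?_
  rw [show (4 : ℝ) + q - 5 = q - 1 by ring]
  have n1 : 0 ≤ rho t x ^ (-(q - 1)) := Real.rpow_nonneg (rho_nonneg _ _) _
  have n2 := wt_nonneg ht.le c e x
  have : 0 ≤ K * M * (C₂ * (α * rho t x ^ (-(q - 1))) + C₁ * (β * wt c e t x)) := by positivity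
  linarith

/-- The unweighted a priori bound is halved at each step, while the coefficient of w follows β ↦ A +
β/2, whose fixed point is 2A. In the limit only the weighted bound survives, although no weighted
norm was assumed finite at the start. -/
lemma le_of_halving {v w₁ w : ℝ → E3 → ℝ} {M A : ℝ} (hM : 0 ≤ M) (hA : 0 ≤ A)
    (hw : ∀ t, 0 < t → ∀ x, 0 ≤ w t x)
    (h0 : ∀ t, 0 < t → ∀ x, v t x ≤ M * w₁ t x)
    (step : ∀ α β, 0 ≤ α → 0 ≤ β → (∀ t, 0 < t → ∀ x, v t x ≤ α * w₁ t x + β * w t x) →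
      ∀ t, 0 < t → ∀ x, v t x ≤ α / 2 * w₁ t x + (A + β / 2) * w t x) :
    ∀ t, 0 < t → ∀ x, v t x ≤ 2 * A * w t x := by
  have key : ∀ n : ℕ, ∀ t, 0 < t → ∀ x, v t x ≤ M * (1 / 2) ^ n * w₁ t x + 2 * A * w t x := by
    intro n
    induction n with
    | zero =>
      intro t ht x
      have := h0 t ht x
      have : 0 ≤ 2 * A * w t x := mul_nonneg (by positivity) (hw t ht x)
      rw [pow_zero, mul_one]
      linarith
    | succ n ih =>
      intro t ht x
      refine (step _ _ (by positivity) (by positivity) ih t ht x).trans (le_of_eq ?_)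
      ring
  intro t ht x
  have hz : Tendsto (fun n : ℕ => (1 / 2 : ℝ) ^ n) atTop (𝓝 0) :=
    tendsto_pow_atTop_nhds_zero_of_lt_one (by norm_num) (by norm_num)
  have hl : Tendsto (fun n : ℕ => M * (1 / 2) ^ n * w₁ t x + 2 * A * w t x) atTop
      (𝓝 (2 * A * w t x)) := by
    have := ((hz.const_mul M).mul_const (w₁ t x)).add_const (2 * A * w t x)
    simpa only [mul_zero, zero_mul, zero_add] using this
  exact ge_of_tendsto' hl fun n => key n t ht x

/-- The contribution of the temperature to the velocity. -/
def source (θ : ℝ → E3 → ℝ) (j : Fin 3) (t : ℝ) (x : E3) : ℝ :=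
  duh (fun σ => oseenKernel σ j 2) (fun z => θ z.1 z.2) t x

section

variable {u : ℝ → E3 → E3} {θ : ℝ → E3 → ℝ} {u₀ : E3 → E3} {θ₀ : E3 → ℝ}

lemma ae_abs_mul_le {v w : ℝ × E3 → ℝ} {M : ℝ} {W : ℝ × E3 → ℝ}
    (hv : ∀ᵐ z ∂spaceTime, |v z| ≤ M * rho z.1 z.2 ^ (-1 : ℝ))
    (hw : ∀ᵐ z ∂spaceTime, |w z| ≤ W z) :
    ∀ᵐ z ∂spaceTime, |w z * v z| ≤ M * (rho z.1 z.2 ^ (-1 : ℝ) * W z) := by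
  filter_upwards [hv, hw] with z h1 h2
  rw [abs_mul]
  refine (mul_le_mul h2 h1 (abs_nonneg _) ((abs_nonneg _).trans h2)).trans (le_of_eq (by ring))

/-- Decay of the temperature is inherited from its linear flow, since θu is linear in θ with the
small coefficient u. The smallness threshold precedes e, c and A. -/
lemma exists_temperature_contract : ∃ m > 0, ∀ M ≤ m, 0 ≤ M → ∀ u₀ θ₀ u θ, Sol M M u₀ θ₀ u θ →
    ∀ e c A : ℝ, 1 ≤ e → e ≤ 15 / 4 → 0 ≤ c → 0 ≤ A →
    (∀ t, 0 < t → ∀ x, |lin θ₀ t x| ≤ A * wt c e t x) →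
    ∀ t, 0 < t → ∀ x, |θ t x| ≤ 2 * A * wt c e t x := by
  obtain ⟨K, hK, L⟩ := ker_heat1
  obtain ⟨C, hC, H⟩ := duh_contract (q := 4) (by norm_num) (by norm_num)
  refine ⟨1 / (6 * (C * K)), by positivity, fun M hMm hM u₀ θ₀ u θ h e c A he he' hc hA hl => ?_⟩
  have hm : 3 * (C * (K * M)) ≤ 1 / 2 := by
    rw [le_div_iff₀ (by positivity)] at hMm
    linarith
  refine le_of_halving (v := fun t x => |θ t x|) (w₁ := fun t x => rho t x ^ (-3 : ℝ)) hM hA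
    (fun t ht x => wt_nonneg ht.le c e x) h.bθ fun α β hα hβ hb t ht x => ?_
  have hn : 0 ≤ α * rho t x ^ (-3 : ℝ) + β * wt c e t x :=
    add_nonneg (mul_nonneg hα (Real.rpow_nonneg (rho_nonneg _ _) _))
      (mul_nonneg hβ (wt_nonneg ht.le c e x))
  have key : ∀ l, |duh (heat1 l) (fun z => θ z.1 z.2 * u z.1 z.2 l) t x| ≤
      C * (K * M) * (α * rho t x ^ (-3 : ℝ) + β * wt c e t x) := fun l => by
    have := H K M α β e c _ _ (L l) hK.le hM hα hβ he he' hc (h.adm.mθu l) (by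
      filter_upwards [ae_abs_mul_le (v := fun z => u z.1 z.2 l) (w := fun z => θ z.1 z.2)
        (W := fun z => α * rho z.1 z.2 ^ (-3 : ℝ) + β * wt c e z.1 z.2)
        (h.adm.bu.mono fun z hz => (abs_coord_le _ l).trans hz) (ae_spaceTime_of_forall hb),
        ae_spaceTime_pos] with z hz hp
      refine hz.trans (le_of_eq ?_)
      rw [show (-4 : ℝ) = -1 + -3 by norm_num, ← rho_rpow_mul _ hp]
      ring) t ht x
    rwa [show (4 : ℝ) - 1 = 3 by norm_num] at this
  show |θ t x| ≤ _
  rw [h.eθ t ht x, nextT]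
  refine (abs_sub _ _).trans ?_
  have h1 := abs_sum_le_of_le key
  have h2 := hl t ht x
  have h3 := mul_le_mul_of_nonneg_right hm hn
  linarith

/-- The same for u ⊗ u, with one factor kept at M ρ^(-1). The buoyancy term is not small and is
grouped with the linear flow. The constant 6 is 2 from the halving times 3 from the sum over
coordinates. -/
lemma exists_velocity_contract : ∃ m > 0, ∀ M ≤ m, 0 ≤ M → ∀ u₀ θ₀ u θ, Sol M M u₀ θ₀ u θ →
    ∀ e c A : ℝ, 1 ≤ e → e ≤ 15 / 4 → 0 ≤ c → 0 ≤ A →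
    (∀ t, 0 < t → ∀ x j, |lin (fun y => u₀ y j) t x| + |source θ j t x| ≤ A * wt c e t x) →
    ∀ t, 0 < t → ∀ x, ‖u t x‖ ≤ 6 * A * wt c e t x := by
  obtain ⟨K, hK, L⟩ := ker_oseenGradKernel
  obtain ⟨C, hC, H⟩ := duh_contract (q := 2) (by norm_num) (by norm_num)
  refine ⟨1 / (54 * (C * K)), by positivity, fun M hMm hM u₀ θ₀ u θ h e c A he he' hc hA hl => ?_⟩
  have hm : 27 * (C * (K * M)) ≤ 1 / 2 := by
    rw [le_div_iff₀ (by positivity)] at hMm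
    linarith
  have := le_of_halving (v := fun t x => ‖u t x‖) (w₁ := fun t x => rho t x ^ (-1 : ℝ))
    (A := 3 * A) (w := wt c e) hM (by positivity)
    (fun t ht x => wt_nonneg ht.le c e x) h.bu fun α β hα hβ hb t ht x => ?_
  · intro t ht x
    refine (this t ht x).trans (le_of_eq (by ring))
  have hn : 0 ≤ α * rho t x ^ (-1 : ℝ) + β * wt c e t x :=
    add_nonneg (mul_nonneg hα (Real.rpow_nonneg (rho_nonneg _ _) _))
      (mul_nonneg hβ (wt_nonneg ht.le c e x))
  have key : ∀ j k l, |duh (fun σ => oseenGradKernel σ j k l)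
      (fun z => u z.1 z.2 k * u z.1 z.2 l) t x| ≤
      C * (K * M) * (α * rho t x ^ (-1 : ℝ) + β * wt c e t x) := fun j k l => by
    have := H K M α β e c _ _ (L j k l) hK.le hM hα hβ he he' hc (h.adm.muu k l) (by
      filter_upwards [ae_abs_mul_le (v := fun z => u z.1 z.2 l) (w := fun z => u z.1 z.2 k)
        (W := fun z => α * rho z.1 z.2 ^ (-1 : ℝ) + β * wt c e z.1 z.2)
        (h.adm.bu.mono fun z hz => (abs_coord_le _ l).trans hz)
        (ae_spaceTime_of_forall fun s hs y => (abs_coord_le _ k).trans (hb s hs y)),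
        ae_spaceTime_pos] with z hz hp
      refine hz.trans (le_of_eq ?_)
      rw [show (-2 : ℝ) = -1 + -1 by norm_num, ← rho_rpow_mul _ hp]
      ring) t ht x
    rwa [show (2 : ℝ) - 1 = 1 by norm_num] at this
  show ‖u t x‖ ≤ _
  rw [h.eu t ht x]
  have hj : ∀ j, |nextU u₀ u θ t x j| ≤ A * wt c e t x +
      9 * (C * (K * M) * (α * rho t x ^ (-1 : ℝ) + β * wt c e t x)) := fun j => by
    refine (abs_add_le _ _).trans ?_
    have h0 := abs_sub (lin (fun y => u₀ y j) t x) (∑ k, ∑ l, duh (fun σ => oseenGradKernel σ j k l)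
        (fun z => u z.1 z.2 k * u z.1 z.2 l) t x)
    have h1 := abs_sum_le_of_le fun k => abs_sum_le_of_le fun l => key j k l
    have h2 := hl t ht x j
    unfold source at h2
    linarith
  refine (norm_le_sum_coord _).trans ((sum_le_of_le hj).trans ?_)
  have h3 := mul_le_mul_of_nonneg_right hm hn
  linarith

end

/-! ### Decay of Duhamel integrals of decaying functions -/

lemma rpow_neg_pull_of_le {A R c : ℝ} (hc : 0 < c) (hA : 0 < A) (hR : 0 < R) (h : R ≤ c * A) {e : ℝ}
    (he : 0 ≤ e) (p : ℝ) : A ^ (-p) ≤ c ^ e * (R ^ (-e) * A ^ (-(p - e))) := by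
  have h1 : A ^ (-p) = A ^ (-e) * A ^ (-(p - e)) := by
    rw [← Real.rpow_add hA]; congr 1; ring
  have h2 : A ^ (-e) ≤ c ^ e * R ^ (-e) := by
    have := rpow_neg_le hR h he
    rw [Real.mul_rpow hc.le hA.le] at this
    have := mul_le_mul_of_nonneg_left this (Real.rpow_nonneg hc.le e)
    rw [← mul_assoc, ← Real.rpow_add hc, add_neg_cancel, Real.rpow_zero, one_mul] at this
    linarith [(rpow_neg_le hR h he)]
  rw [h1, ← mul_assoc]
  exact mul_le_mul_of_nonneg_right h2 (Real.rpow_nonneg hA.le _)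

lemma dom_mass {f : ℝ × E3 → ℝ} (hfm : AEStronglyMeasurable f spaceTime) {D t : ℝ} (ht : 0 < t)
    (hi : ∀ s, 0 < s → Integrable (fun y => f (s, y))) (hb : ∀ s, 0 < s → ∫ y, |f (s, y)| ≤ D) :
    Dom t (fun z => |f z|) (t * D) := by
  have hm := aestronglyMeasurable_nu hfm t
  have hm2 : AEStronglyMeasurable (fun s => ∫ y, |f (s, y)|) (volume.restrict (Ioo 0 t)) :=
    hm.norm.integral_prod_right'
  have hI : Integrable (fun s => ∫ y, |f (s, y)|) (volume.restrict (Ioo 0 t)) := by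
    refine (integrable_const D).mono' hm2 ?_
    filter_upwards [ae_restrict_mem measurableSet_Ioo] with s hs
    rw [Real.norm_of_nonneg (integral_nonneg fun _ => abs_nonneg _)]
    exact hb s hs.1
  have hint : Integrable (fun z => |f z|) (nu t) := by
    refine (integrable_prod_iff hm.norm).2 ⟨?_, ?_⟩
    · filter_upwards [ae_restrict_mem measurableSet_Ioo] with s hs using (hi s hs.1).abs
    · simpa only [Real.norm_eq_abs, abs_abs] using hI
  refine ⟨hint, ?_⟩
  have e : ∫ z, |f z| ∂nu t = ∫ s in Ioo 0 t, ∫ y, |f (s, y)| := integral_prod _ hint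
  rw [e]
  refine (setIntegral_mono_on hI (by simp) measurableSet_Ioo fun s hs => hb s hs.1).trans
    (le_of_eq ?_)
  rw [setIntegral_const, Real.volume_real_Ioo_of_le ht.le, sub_zero, smul_eq_mul]

lemma mul_rpow_le_wt {t : ℝ} (ht : 0 < t) {r : ℝ} (hr : 0 ≤ r) (a : ℝ) (x : E3) :
    t ^ r * rho (1 + t) x ^ (-a) ≤ wt r a t x :=
  mul_le_mul_of_nonneg_right (Real.rpow_le_rpow ht.le (by linarith) hr)
    (Real.rpow_nonneg (rho_nonneg _ _) _)

/-- The buoyancy term for a temperature of finite mass. -/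
lemma source_le_of_mass {a : ℝ} (ha1 : 1 ≤ a) (ha3 : a < 3) : ∃ C > 0, ∀ (D : ℝ) (θ : ℝ → E3 → ℝ),
    0 ≤ D → AEStronglyMeasurable (fun z : ℝ × E3 => θ z.1 z.2) spaceTime →
    (∀ t, 0 < t → ∀ x, |θ t x| ≤ D * wt 0 3 t x) → (∀ t, 0 < t → Integrable (θ t)) →
    (∀ t, 0 < t → ∫ x, |θ t x| ≤ D) → ∀ j t, 0 < t → ∀ x,
    |source θ j t x| ≤ C * D * wt ((a - 1) / 2) a t x := by
  obtain ⟨K, hK, L⟩ := ker_oseenKernel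
  obtain ⟨C, hC, H⟩ := dom_le_five (p := 3) (q := 3 - a) (by norm_num) (by linarith) (by linarith)
    (by linarith)
  refine ⟨K * (8 + 2 ^ a * C), by positivity, fun D θ hD hfm hb hi hm j t ht x => ?_⟩
  have hR := rho_succ_pos ht.le x
  have n : ∀ {X : ℝ}, 0 < X → ∀ r : ℝ, 0 ≤ X ^ r := fun h r => Real.rpow_nonneg h.le r
  have nR := n hR
  have d := (((dom_mass hfm ht hi hm).const_mul (by positivity :
      0 ≤ K * (8 * rho (1 + t) x ^ (-3 : ℝ)))).add ((H t ht x).const_mul (by positivity :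
      0 ≤ K * (D * (2 ^ a * rho (1 + t) x ^ (-a))))))
  refine (d.norm_integral_le ?_).trans ?_
  · filter_upwards [ae_nu_mem t] with z hz
    have hz1 : 0 < z.1 := hz.1
    have hzt : 0 < t - z.1 := by linarith [hz.2]
    have hA : 0 < rho (t - z.1) (x - z.2) := rho_pos hzt _
    have hB : 0 < rho z.1 z.2 := rho_pos hz1 _
    have hRs := rho_succ_pos hz1.le z.2
    have hk := (L j 2).bound _ hzt (x - z.2)
    set A := rho (t - z.1) (x - z.2)
    set B := rho z.1 z.2
    set R := rho (1 + t) x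
    have nA := n hA
    have nB := n hB
    rw [abs_mul]
    refine (mul_le_mul_of_nonneg_right hk (abs_nonneg _)).trans ?_
    have key : A ^ (-3 : ℝ) * |θ z.1 z.2| ≤ 8 * R ^ (-3 : ℝ) * |θ z.1 z.2| +
        D * (2 ^ a * R ^ (-a)) * (A ^ (-3 : ℝ) * B ^ (-(3 - a))) := by
      -- Either the kernel is evaluated at parabolic distance at least R/2, so that it is O(R^(-3))
      -- and the mass of θ is integrated over (0,t), or θ itself is evaluated at such a distance,
      -- and R^(-a) is pulled out of its decay of order 3.
      rcases le_total R (2 * A) with h | h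
      · have h1 := rpow_neg_pull_of_le two_pos hA hR h (e := 3) (by norm_num) 3
        rw [sub_self, neg_zero, Real.rpow_zero, mul_one] at h1
        have h2 := mul_le_mul_of_nonneg_right h1 (abs_nonneg (θ z.1 z.2))
        have h3 : (2 : ℝ) ^ (3 : ℝ) = 8 := by norm_num
        rw [h3] at h2
        have := nR (-a)
        have := nA (-3)
        have := nB (-(3 - a))
        have : 0 ≤ D * (2 ^ a * R ^ (-a)) * (A ^ (-3 : ℝ) * B ^ (-(3 - a))) := by positivity
        linarith
      · have hRR : R ≤ 2 * rho (1 + z.1) z.2 := by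
          have : R ≤ A + rho (1 + z.1) z.2 := rho_succ_le_sub z.1 t x z.2
          linarith
        have h1 := rpow_neg_pull_of_le two_pos hRs hR hRR (e := a) (by linarith) 3
        have h2 : rho (1 + z.1) z.2 ^ (-(3 - a)) ≤ B ^ (-(3 - a)) :=
          rpow_neg_le hB (rho_le_succ _ _) (by linarith)
        have h3 : |θ z.1 z.2| ≤ D * (2 ^ a * (R ^ (-a) * B ^ (-(3 - a)))) := by
          refine (hb z.1 hz1 z.2).trans (mul_le_mul_of_nonneg_left ?_ hD)
          rw [wt, Real.rpow_zero, one_mul]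
          have := nR (-a)
          exact h1.trans (by gcongr)
        have h4 := mul_le_mul_of_nonneg_left h3 (nA (-3))
        have : 0 ≤ 8 * R ^ (-3 : ℝ) * |θ z.1 z.2| :=
          mul_nonneg (mul_nonneg (by norm_num) (nR _)) (abs_nonneg _)
        linarith
    have := mul_le_mul_of_nonneg_left key hK.le
    linarith
  · have h1 : t * rho (1 + t) x ^ (-3 : ℝ) ≤ wt ((a - 1) / 2) a t x := by
      have := mul_rpow_le_wt ht zero_le_one 3 x
      rw [Real.rpow_one] at this
      exact this.trans (wt_le ht.le (by linarith) (by linarith) x)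
    have h2 : t ^ ((a - 1) / 2) * rho (1 + t) x ^ (-a) ≤ wt ((a - 1) / 2) a t x :=
      mul_rpow_le_wt ht (by linarith) a x
    rw [show (5 - ((3 : ℝ) + (3 - a))) / 2 = (a - 1) / 2 by ring]
    have e1 := mul_le_mul_of_nonneg_left h1 (by positivity : 0 ≤ K * 8 * D)
    have e2 := mul_le_mul_of_nonneg_left h2 (by positivity : 0 ≤ K * (D * 2 ^ a) * C)
    linarith

/-- By the triangle inequality R^(-m), with R = ρ(1+t,x), can be pulled either out of the kernel,
which has decay of any order m at the price (t-s)^((m-4)/2), or out of f. The hypotheses `J₁` and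
`J₂` are the integrals left in the two cases. -/
lemma heat_decay {m h r : ℝ} (hm : 0 ≤ m)
    (J₁ : ∃ C > 0, ∀ t : ℝ, 0 < t →
      Dom t (fun z => (t - z.1) ^ ((m - 4) / 2) * wt h m z.1 z.2) (C * (1 + t) ^ r))
    (J₂ : ∃ C > 0, ∀ t : ℝ, 0 < t → ∀ x : E3,
      Dom t (fun z => (1 + z.1) ^ h * rho (t - z.1) (x - z.2) ^ (-4 : ℝ)) (C * (1 + t) ^ r)) :
    ∃ C > 0, ∀ (D : ℝ) (f : ℝ × E3 → ℝ), 0 ≤ D → (∀ᵐ z ∂spaceTime, |f z| ≤ D * wt h m z.1 z.2) →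
      ∀ l t, 0 < t → ∀ x, |duh (heat1 l) f t x| ≤ C * D * wt r m t x := by
  obtain ⟨K₁, k₁, L₁⟩ := abs_heat1_le hm
  obtain ⟨K₂, k₂, L₂⟩ := ker_heat1
  obtain ⟨C₁, c₁, H₁⟩ := J₁
  obtain ⟨C₂, c₂, H₂⟩ := J₂
  refine ⟨2 ^ m * (K₁ * C₁ + K₂ * C₂), by positivity, fun D f hD hf l t ht x => ?_⟩
  have hR := rho_succ_pos ht.le x
  have n : ∀ {X : ℝ}, 0 < X → ∀ r : ℝ, 0 ≤ X ^ r := fun h r => Real.rpow_nonneg h.le r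
  have nR := n hR
  have nRm := nR (-m)
  have d := ((H₁ t ht).const_mul (by positivity : 0 ≤ 2 ^ m * rho (1 + t) x ^ (-m) * K₁ * D)).add
    ((H₂ t ht x).const_mul (by positivity : 0 ≤ 2 ^ m * rho (1 + t) x ^ (-m) * K₂ * D))
  refine (d.norm_integral_le ?_).trans (le_of_eq ?_)
  · filter_upwards [ae_nu_mem t, ae_nu_of_spaceTime hf] with z hz hfz
    have hz1 : 0 < z.1 := hz.1
    have hzt : 0 < t - z.1 := by linarith [hz.2]
    have hA : 0 < rho (t - z.1) (x - z.2) := rho_pos hzt _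
    have hRs := rho_succ_pos hz1.le z.2
    have hw := wt_nonneg hz1.le h m z.2
    have hk₁ := L₁ l _ hzt (x - z.2)
    have hk₂ := (L₂ l).bound _ hzt (x - z.2)
    have hA4 := n hA (-4)
    have hT := n hzt ((m - 4) / 2)
    have h1s : 0 ≤ (1 + z.1) ^ h := Real.rpow_nonneg (by linarith) _
    rw [abs_mul]
    rcases le_total (rho (1 + t) x) (2 * rho (t - z.1) (x - z.2)) with hc | hc
    · have h1 := rpow_neg_pull_of_le two_pos hA hR hc hm m
      rw [sub_self, neg_zero, Real.rpow_zero, mul_one] at h1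
      have h2 := mul_le_mul (hk₁.trans (mul_le_mul_of_nonneg_left
        (mul_le_mul_of_nonneg_left h1 hT) k₁.le)) hfz (abs_nonneg _) (by positivity)
      have : 0 ≤ 2 ^ m * rho (1 + t) x ^ (-m) * K₂ * D * ((1 + z.1) ^ h *
        rho (t - z.1) (x - z.2) ^ (-4 : ℝ)) := by positivity
      linarith
    · have hRR : rho (1 + t) x ≤ 2 * rho (1 + z.1) z.2 := by
        have := rho_succ_le_sub z.1 t x z.2
        linarith
      have h1 := rpow_neg_pull_of_le two_pos hRs hR hRR hm m
      rw [sub_self, neg_zero, Real.rpow_zero, mul_one] at h1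
      have h3 : wt h m z.1 z.2 ≤ (1 + z.1) ^ h * (2 ^ m * rho (1 + t) x ^ (-m)) :=
        mul_le_mul_of_nonneg_left h1 h1s
      have h2 := mul_le_mul hk₂ (hfz.trans (mul_le_mul_of_nonneg_left h3 hD)) (abs_nonneg _)
        (by positivity)
      have : 0 ≤ 2 ^ m * rho (1 + t) x ^ (-m) * K₁ * D * ((t - z.1) ^ ((m - 4) / 2) *
        wt h m z.1 z.2) := by positivity
      linarith
  · unfold wt
    ring

lemma dom_heat_near {h r : ℝ} (hr : 0 ≤ r) (hh : h ≤ r - 1 / 2) : ∃ C > 0, ∀ t : ℝ, 0 < t → ∀ x : E3,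
    Dom t (fun z => (1 + z.1) ^ h * rho (t - z.1) (x - z.2) ^ (-4 : ℝ)) (C * (1 + t) ^ r) := by
  obtain ⟨C, hC, H⟩ := dom_left (N := 4) (a := 0) (b := 1 / 2) (by norm_num) (by norm_num) (by norm_num)
  refine ⟨C, hC, fun t ht x => ?_⟩
  have h1t : 0 ≤ (1 + t) ^ r := Real.rpow_nonneg (by linarith) _
  refine ((H t ht x).const_mul h1t).mono (Measurable.aestronglyMeasurable (by fun_prop))
    (fun s hs y => ?_) (fun s hs y => ?_) (le_of_eq ?_)
  · exact mul_nonneg (Real.rpow_nonneg (by linarith [hs.1]) _) (Real.rpow_nonneg (rho_nonneg _ _) _)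
  · have hs0 : 0 < s := hs.1
    have h1s : 0 < 1 + s := by linarith
    have e1 : (1 + s) ^ h ≤ (1 + s) ^ r * (1 + s) ^ (-(1 / 2) : ℝ) := by
      rw [← Real.rpow_add h1s]
      exact Real.rpow_le_rpow_of_exponent_le (by linarith) (by linarith)
    have e2 : (1 + s) ^ r ≤ (1 + t) ^ r := Real.rpow_le_rpow h1s.le (by linarith [hs.2]) hr
    have e3 : (1 + s) ^ (-(1 / 2) : ℝ) ≤ s ^ (-(1 / 2) : ℝ) :=
      rpow_neg_le hs0 (by linarith) (by norm_num)
    have e4 : 0 ≤ rho (t - s) (x - y) ^ (-4 : ℝ) := Real.rpow_nonneg (rho_nonneg _ _) _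
    dsimp only
    rw [neg_zero, Real.rpow_zero, one_mul, ← mul_assoc]
    refine mul_le_mul_of_nonneg_right (e1.trans ?_) e4
    exact mul_le_mul e2 e3 (Real.rpow_nonneg h1s.le _) h1t
  · norm_num
    ring

lemma lintegral_wt {m : ℝ} (hm : 3 < m) (h : ℝ) : ∃ C > 0, ∀ s : ℝ, 0 < s →
    ∫⁻ y, ENNReal.ofReal (wt h m s y) ≤ ENNReal.ofReal (C * (1 + s) ^ (h + (3 - m) / 2)) := by
  obtain ⟨C, hC, H⟩ := lintegral_rho_rpow m hm
  refine ⟨C, hC, fun s hs => ?_⟩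
  have h1s : 0 < 1 + s := by linarith
  have h0 : 0 ≤ (1 + s) ^ h := Real.rpow_nonneg h1s.le _
  have h1 := H (1 + s) h1s 0
  have e : ∀ y : E3, rho (1 + s) (0 - y) = rho (1 + s) y := fun y => by
    unfold rho
    rw [zero_sub, norm_neg]
  simp_rw [e] at h1
  unfold wt
  simp_rw [ENNReal.ofReal_mul h0]
  rw [lintegral_const_mul' _ _ ENNReal.ofReal_ne_top, Real.rpow_add h1s, mul_left_comm,
    ENNReal.ofReal_mul h0]
  exact mul_le_mul_right h1 _

lemma lintegral_one_add_rpow (t : ℝ) (ht : 0 < t) :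
    ∫⁻ s in Ioo 0 t, ENNReal.ofReal ((1 + s) ^ (-(5 / 4) : ℝ)) ≤ ENNReal.ofReal 4 := by
  have hc : ContinuousOn (fun s : ℝ => (1 + s) ^ (-(5 / 4) : ℝ)) (Icc 0 t) := fun s hs =>
    ((continuousAt_const.add continuousAt_id).rpow_const
      (Or.inl (by have := hs.1; show 1 + s ≠ 0; linarith))).continuousWithinAt
  have hi : IntegrableOn (fun s : ℝ => (1 + s) ^ (-(5 / 4) : ℝ)) (Ioo 0 t) :=
    (hc.integrableOn_Icc).mono_set Ioo_subset_Icc_self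
  rw [← ofReal_integral_eq_lintegral_ofReal hi]
  · refine ENNReal.ofReal_le_ofReal ?_
    rw [← integral_Ioc_eq_integral_Ioo, ← intervalIntegral.integral_of_le ht.le,
      intervalIntegral.integral_comp_add_left (fun s : ℝ => s ^ (-(5 / 4) : ℝ)) 1,
      integral_rpow (Or.inr ⟨by norm_num, fun h => by
        rw [uIcc_of_le (by linarith)] at h; linarith [h.1]⟩)]
    have : 0 ≤ (1 + t) ^ (-(5 / 4) + 1 : ℝ) := Real.rpow_nonneg (by linarith) _
    rw [add_zero, Real.one_rpow, div_le_iff_of_neg (by norm_num)]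
    linarith
  · filter_upwards [ae_restrict_mem measurableSet_Ioo] with s hs
    exact Real.rpow_nonneg (by linarith [hs.1]) _

/-- Duhamel integrals with the gradient of the heat kernel, without cancellations. -/
lemma heat_decay_of_mass {m : ℝ} (hm : 3 < m) :
    ∃ C > 0, ∀ (D : ℝ) (f : ℝ × E3 → ℝ), 0 ≤ D →
      (∀ᵐ z ∂spaceTime, |f z| ≤ D * wt ((m - 4) / 2) m z.1 z.2) →
      ∀ l t, 0 < t → ∀ x, |duh (heat1 l) f t x| ≤ C * D * wt ((m - 3) / 2) m t x := by
  refine heat_decay (by linarith) ?_ (dom_heat_near (by linarith) (by linarith))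
  obtain ⟨C₁, c₁, H₁⟩ := lintegral_wt hm ((m - 4) / 2)
  obtain ⟨C₂, c₂, H₂⟩ := lintegral_beta (a := 1 / 2) (b := 1 / 2) (by norm_num) (by norm_num)
  refine ⟨C₁ * C₂, by positivity, fun t ht => ?_⟩
  have d : Dom t (fun z => (t - z.1) ^ (-(1 / 2) : ℝ) * wt ((m - 4) / 2) m z.1 z.2) (C₁ * C₂) := by
    refine dom_mul (a := fun s => (t - s) ^ (-(1 / 2) : ℝ)) (e := fun s => C₁ * s ^ (-(1 / 2) : ℝ))
      (by positivity) (by fun_prop) (by fun_prop)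
      (fun s hs => Real.rpow_nonneg (by linarith [hs.2]) _) (fun s hs y => wt_nonneg hs.1.le _ _ _)
      (fun s hs => (H₁ s hs.1).trans (ENNReal.ofReal_le_ofReal ?_)) ?_
    · rw [show (m - 4) / 2 + (3 - m) / 2 = -(1 / 2) by ring]
      exact mul_le_mul_of_nonneg_left (rpow_neg_le hs.1 (by linarith [hs.1]) (by norm_num)) c₁.le
    · simp_rw [mul_left_comm _ C₁, ENNReal.ofReal_mul c₁.le]
      rw [lintegral_const_mul' _ _ ENNReal.ofReal_ne_top]
      have := H₂ t ht
      rw [show (1 : ℝ) - 1 / 2 - 1 / 2 = 0 by norm_num, Real.rpow_zero, mul_one] at this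
      exact mul_le_mul_right this _
  have h1t : 0 ≤ (1 + t) ^ ((m - 3) / 2) := Real.rpow_nonneg (by linarith) _
  refine (d.const_mul h1t).mono (Measurable.aestronglyMeasurable (by fun_prop))
    (fun s hs y => mul_nonneg (Real.rpow_nonneg (by linarith [hs.2]) _) (wt_nonneg hs.1.le _ _ _))
    (fun s hs y => ?_) (le_of_eq (by ring))
  have hts : 0 < t - s := by linarith [hs.2]
  have e : (t - s) ^ ((m - 4) / 2) ≤ (1 + t) ^ ((m - 3) / 2) * (t - s) ^ (-(1 / 2) : ℝ) := by
    rw [show (m - 4) / 2 = (m - 3) / 2 + -(1 / 2) by ring, Real.rpow_add hts]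
    exact mul_le_mul_of_nonneg_right (Real.rpow_le_rpow hts.le (by linarith [hs.1]) (by linarith))
      (Real.rpow_nonneg hts.le _)
  dsimp only
  rw [← mul_assoc]
  exact mul_le_mul_of_nonneg_right e (wt_nonneg hs.1.le _ _ _)

/-- The extra factor (1+s)^(-3/4) makes the mass of f at time s of order (1+s)^(-5/4), integrable up
to infinity, so no growth in time is lost. The value 3/4 is what exponents 15/4 for θ and 7/4 for u
provide at m = 4. -/
lemma heat_decay_of_fast {m : ℝ} (hm : 4 ≤ m) :
    ∃ C > 0, ∀ (D : ℝ) (f : ℝ × E3 → ℝ), 0 ≤ D →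
      (∀ᵐ z ∂spaceTime, |f z| ≤ D * wt ((m - 4) / 2 - 3 / 4) m z.1 z.2) →
      ∀ l t, 0 < t → ∀ x, |duh (heat1 l) f t x| ≤ C * D * wt ((m - 4) / 2) m t x := by
  refine heat_decay (by linarith) ?_ (dom_heat_near (by linarith) (by linarith))
  obtain ⟨C₁, c₁, H₁⟩ := lintegral_wt (by linarith : 3 < m) ((m - 4) / 2 - 3 / 4)
  refine ⟨C₁ * 4, by positivity, fun t ht => ?_⟩
  have d : Dom t (fun z => 1 * wt ((m - 4) / 2 - 3 / 4) m z.1 z.2) (C₁ * 4) := by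
    refine dom_mul (a := fun s => 1) (e := fun s => C₁ * (1 + s) ^ (-(5 / 4) : ℝ))
      (by positivity) (by fun_prop) (by fun_prop)
      (fun s hs => zero_le_one) (fun s hs y => wt_nonneg hs.1.le _ _ _)
      (fun s hs => (H₁ s hs.1).trans_eq ?_) ?_
    · rw [show (m - 4) / 2 - 3 / 4 + (3 - m) / 2 = -(5 / 4) by ring]
    · simp_rw [one_mul, ENNReal.ofReal_mul c₁.le]
      rw [lintegral_const_mul' _ _ ENNReal.ofReal_ne_top]
      exact mul_le_mul_right (lintegral_one_add_rpow t ht) _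
  have h1t : 0 ≤ (1 + t) ^ ((m - 4) / 2) := Real.rpow_nonneg (by linarith) _
  refine (d.const_mul h1t).mono (Measurable.aestronglyMeasurable (by fun_prop))
    (fun s hs y => mul_nonneg (Real.rpow_nonneg (by linarith [hs.2]) _) (wt_nonneg hs.1.le _ _ _))
    (fun s hs y => ?_) (le_of_eq (by ring))
  dsimp only
  rw [one_mul]
  exact mul_le_mul_of_nonneg_right (Real.rpow_le_rpow (by linarith [hs.2]) (by linarith [hs.1])
    (by linarith)) (wt_nonneg hs.1.le _ _ _)

/-! ### The buoyancy term for temperatures of mean zero -/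

lemma rho_succ_zero_le (s : ℝ) (y : E3) : rho (1 + s) 0 ≤ rho (1 + s) y := by
  unfold rho
  rw [norm_zero]
  linarith [norm_nonneg y]

/-- The pointwise bound behind the decay of the buoyancy term: the kernel is compared with its
value at `x` where the latter is not too large. -/
lemma oseenKernel_truncation_le {γ δ a : ℝ} (hγ : 0 ≤ γ) (hγ1 : γ ≤ 1) (ha0 : 0 ≤ a) (ha : a ≤ 3 + δ) :
    ∃ C > 0, ∀ (j k : Fin 3) (s t : ℝ), 0 < s → s < t → ∀ x y : E3,
      |oseenKernel (t - s) j k (x - y) -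
          (if rho (1 + t) x ≤ 2 * rho (t - s) x then oseenKernel (t - s) j k x else 0)| *
        rho (1 + s) y ^ (-(3 + δ)) ≤
      C * (rho (1 + t) x ^ (-(3 + γ)) * rho s y ^ (-(3 + δ - γ))) +
      C * (rho (1 + t) x ^ (-a) * (rho (t - s) (x - y) ^ (-3 : ℝ) * rho s y ^ (-(3 + δ - a)))) := by
  obtain ⟨K, hK, H⟩ := ker_oseenKernel
  obtain ⟨L, hL, G⟩ := abs_oseenKernel_sub_space_le
  have h4 : (1 : ℝ) ≤ 4 ^ a := Real.one_le_rpow (by norm_num) ha0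
  have h2 : (1 : ℝ) ≤ 2 ^ (3 + γ) := Real.one_le_rpow (by norm_num) (by linarith)
  refine ⟨K * 4 ^ a + (L + 2 * K) * 2 ^ (3 + γ), by positivity, fun j k s t hs hst x y => ?_⟩
  have hts : 0 < t - s := by linarith
  have hA : 0 < rho (t - s) (x - y) := rho_pos hts _
  have hA0 : 0 < rho (t - s) x := rho_pos hts _
  have hB : 0 < rho s y := rho_pos hs _
  have hR : 0 < rho (1 + t) x := rho_succ_pos (by linarith) _
  have hRs : 0 < rho (1 + s) y := rho_succ_pos hs.le _
  have hBR : rho s y ≤ rho (1 + s) y := rho_le_succ s y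
  have hRA : rho (1 + t) x ≤ rho (t - s) x + rho (1 + s) y := by
    have h := rho_succ_le_sub s t x 0
    rw [sub_zero] at h
    exact h.trans (by gcongr; exact rho_succ_zero_le s y)
  have hyB := norm_le_rho s y
  have hk := (H j k).bound _ hts (x - y)
  have hk0 := (H j k).bound _ hts x
  have hG := G j k _ hts x y
  set A := rho (t - s) (x - y)
  set A₀ := rho (t - s) x
  set B := rho s y
  set R := rho (1 + t) x
  set S := rho (1 + s) y
  have n : ∀ {X : ℝ}, 0 < X → ∀ r : ℝ, 0 ≤ X ^ r := fun h r => Real.rpow_nonneg h.le r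
  have nS := n hRs
  have nA := n hA (-3)
  have nR := n hR
  have nB := n hB
  have nR1 := nR (-a)
  have nR2 := nR (-(3 + γ))
  have nB1 := nB (-(3 + δ - γ))
  have nB2 := nB (-(3 + δ - a))
  have hSB : S ^ (-(3 + δ)) ≤ B ^ (-(3 + δ)) := rpow_neg_le hB hBR (by linarith)
  -- When (s,y) itself is far from the origin the untruncated kernel needs no cancellation: R^(-a)
  -- comes from the weight in y.
  have far : R ≤ 4 * S → |oseenKernel (t - s) j k (x - y)| * S ^ (-(3 + δ)) ≤
      K * 4 ^ a * (R ^ (-a) * (A ^ (-3 : ℝ) * B ^ (-(3 + δ - a)))) := fun h => by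
    have h1 := rpow_neg_pull_of_le (by norm_num) hRs hR h ha0 (3 + δ)
    have h2 : S ^ (-(3 + δ - a)) ≤ B ^ (-(3 + δ - a)) := rpow_neg_le hB hBR (by linarith)
    have h3 : S ^ (-(3 + δ)) ≤ 4 ^ a * (R ^ (-a) * B ^ (-(3 + δ - a))) := h1.trans (by gcongr)
    exact (mul_le_mul hk h3 (nS _) (by positivity)).trans (le_of_eq (by ring))
  have p1 : 0 ≤ R ^ (-(3 + γ)) * B ^ (-(3 + δ - γ)) := by positivity
  have p2 : 0 ≤ R ^ (-a) * (A ^ (-3 : ℝ) * B ^ (-(3 + δ - a))) := by positivity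
  have q1 : 0 ≤ (L + 2 * K) * 2 ^ (3 + γ) := by positivity
  have q2 : 0 ≤ K * 4 ^ a := by positivity
  have pull : R ≤ 2 * A₀ → A₀ ^ (-(3 + γ)) ≤ 2 ^ (3 + γ) * R ^ (-(3 + γ)) := fun h => by
    have := rpow_neg_pull_of_le two_pos hA0 hR h (e := 3 + γ) (by linarith) (3 + γ)
    rwa [sub_self, neg_zero, Real.rpow_zero, mul_one] at this
  have hBγ : B ^ γ * S ^ (-(3 + δ)) ≤ B ^ (-(3 + δ - γ)) := by
    rw [show -(3 + δ - γ) = γ + -(3 + δ) by ring, Real.rpow_add hB]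
    exact mul_le_mul_of_nonneg_left hSB (nB _)
  split_ifs with hc
  · rcases le_total ‖y‖ (A₀ / 2) with hy | hy
    · have h1 : ‖y‖ ≤ B ^ γ * A₀ ^ (1 - γ) := by
        calc ‖y‖ = ‖y‖ ^ γ * ‖y‖ ^ (1 - γ) := by
              rw [← Real.rpow_add_of_nonneg (norm_nonneg y) hγ (by linarith)]
              simp
          _ ≤ _ := by
              have : ‖y‖ ≤ A₀ := by linarith
              gcongr
      have h2 : ‖y‖ * A₀ ^ (-4 : ℝ) ≤ B ^ γ * A₀ ^ (-(3 + γ)) := by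
        refine (mul_le_mul_of_nonneg_right h1 (n hA0 _)).trans (le_of_eq ?_)
        rw [mul_assoc, ← Real.rpow_add hA0]
        congr 2
        ring
      have h3 : |oseenKernel (t - s) j k (x - y) - oseenKernel (t - s) j k x| ≤
          L * 2 ^ (3 + γ) * R ^ (-(3 + γ)) * B ^ γ := by
        refine (hG hy).trans ?_
        have := mul_le_mul_of_nonneg_left (h2.trans (mul_le_mul_of_nonneg_left (pull hc) (nB γ))) hL.le
        linarith
      have h4 := mul_le_mul_of_nonneg_right h3 (nS (-(3 + δ)))
      have h5 := mul_le_mul_of_nonneg_left hBγ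
        (by positivity : 0 ≤ L * 2 ^ (3 + γ) * R ^ (-(3 + γ)))
      have e1 := mul_nonneg q2 p1
      have e2 := mul_nonneg q2 p2
      have e3 := mul_nonneg q1 p2
      have e4 : 0 ≤ K * 2 ^ (3 + γ) * (R ^ (-(3 + γ)) * B ^ (-(3 + δ - γ))) := by positivity
      linarith
    · have h0 : A₀ ≤ 2 * B := by linarith
      have h1 := far (by linarith)
      have h2 : A₀ ^ (-3 : ℝ) ≤ 2 ^ (3 + γ) * R ^ (-(3 + γ)) * (2 * B ^ γ) := by
        have e : A₀ ^ (-3 : ℝ) = A₀ ^ (-(3 + γ)) * A₀ ^ γ := by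
          rw [← Real.rpow_add hA0]; congr 1; ring
        have e' : A₀ ^ γ ≤ 2 * B ^ γ := by
          refine (Real.rpow_le_rpow hA0.le h0 hγ).trans ?_
          rw [Real.mul_rpow two_pos.le hB.le]
          refine mul_le_mul_of_nonneg_right ?_ (nB _)
          calc (2 : ℝ) ^ γ ≤ 2 ^ (1 : ℝ) := Real.rpow_le_rpow_of_exponent_le one_le_two hγ1
            _ = 2 := Real.rpow_one 2
        rw [e]
        exact mul_le_mul (pull hc) e' (n hA0 _) (by positivity)
      have h3 : |oseenKernel (t - s) j k x| * S ^ (-(3 + δ)) ≤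
          2 * K * 2 ^ (3 + γ) * (R ^ (-(3 + γ)) * B ^ (-(3 + δ - γ))) := by
        have e := mul_le_mul_of_nonneg_right (hk0.trans (mul_le_mul_of_nonneg_left h2 hK.le))
          (nS (-(3 + δ)))
        have e' := mul_le_mul_of_nonneg_left hBγ
          (by positivity : 0 ≤ 2 * K * 2 ^ (3 + γ) * R ^ (-(3 + γ)))
        linarith
      have h4 := mul_le_mul_of_nonneg_right
        (abs_sub (oseenKernel (t - s) j k (x - y)) (oseenKernel (t - s) j k x)) (nS (-(3 + δ)))
      have e1 := mul_nonneg q2 p1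
      have e3 := mul_nonneg q1 p2
      have e4 : 0 ≤ L * 2 ^ (3 + γ) * (R ^ (-(3 + γ)) * B ^ (-(3 + δ - γ))) := by positivity
      linarith
  · have h1 := far (by linarith)
    rw [sub_zero]
    have e1 := mul_nonneg q2 p1
    have e2 := mul_nonneg q1 p1
    have e3 := mul_nonneg q1 p2
    linarith

/-- The buoyancy term for a temperature of mean zero. -/
lemma source_le_of_mean_zero {δ a : ℝ} (hδ : 0 < δ) (hδ1 : δ ≤ 1) (ha : 1 + δ ≤ a) (ha3 : a < 3 + δ) :
    ∃ C > 0, ∀ (D : ℝ) (θ : ℝ → E3 → ℝ),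
    0 ≤ D → AEStronglyMeasurable (fun z : ℝ × E3 => θ z.1 z.2) spaceTime →
    (∀ t, 0 < t → ∀ x, |θ t x| ≤ D * wt 0 (3 + δ) t x) →
    (∀ t, 0 < t → ∫ x, θ t x = 0) → ∀ j t, 0 < t → ∀ x,
    |source θ j t x| ≤ C * D * wt ((a - 1 - δ) / 2) a t x := by
  -- The gain γ must satisfy a ≤ 3 + γ, for the exponent of R, and γ < δ, so that the remaining
  -- power 3 + δ - γ is integrable in y. Both are possible because a < 3 + δ.
  set γ := max 0 (a - 3) with hγd
  have hγ : 0 ≤ γ := le_max_left _ _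
  have hγa : a ≤ 3 + γ := by linarith [le_max_right 0 (a - 3)]
  have hγδ : γ < δ := max_lt hδ (by linarith)
  obtain ⟨K, hK, L⟩ := ker_oseenKernel
  obtain ⟨C₀, c₀, H₀⟩ := oseenKernel_truncation_le (γ := γ) (δ := δ) (a := a) hγ (by linarith)
    (by linarith) ha3.le
  obtain ⟨C₁, c₁, H₁⟩ := dom_right (N := 3 + δ - γ) (a := 0) (b := 0) (by linarith) (by norm_num)
    (by linarith)
  obtain ⟨C₂, c₂, H₂⟩ := dom_le_five (p := 3) (q := 3 + δ - a) (by norm_num) (by linarith)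
    (by linarith) (by linarith)
  obtain ⟨C₃, c₃, H₃⟩ := dom_right (N := 3 + δ) (a := 0) (b := 0) (by linarith) (by norm_num)
    (by linarith)
  refine ⟨C₀ * (C₁ + C₂), by positivity, fun D θ hD hfm hb hm j t ht x => ?_⟩
  have hR := rho_succ_pos ht.le x
  have n : ∀ {X : ℝ}, 0 < X → ∀ r : ℝ, 0 ≤ X ^ r := fun h r => Real.rpow_nonneg h.le r
  have nR := n hR
  have hfm' := aestronglyMeasurable_nu hfm t
  -- The subtracted kernel value does not depend on y, so its contribution vanishes with the mean of
  -- θ at each time. The truncation keeps it bounded by a multiple of R^(-3), which is needed for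
  -- integrability as s → t when x is near 0.
  set G : ℝ → ℝ := fun s =>
    if rho (1 + t) x ≤ 2 * rho (t - s) x then oseenKernel (t - s) j 2 x else 0 with hG
  have hGm : Measurable G := Measurable.ite (measurableSet_le measurable_const (by fun_prop))
    (measurable_kernel_comp (k := fun σ => oseenKernel σ j 2) (f := fun s : ℝ => t - s)
      (g := fun _ => x) (measurable_oseenKernel j 2) (by fun_prop) (by fun_prop)) measurable_const
  have hGb : ∀ s ∈ Ioo 0 t, |G s| ≤ K * (8 * rho (1 + t) x ^ (-3 : ℝ)) := fun s hs => by
    have hts : 0 < t - s := by linarith [hs.2]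
    have hA := rho_pos hts x
    simp only [hG]
    split_ifs with hc
    · refine ((L j 2).bound _ hts x).trans (mul_le_mul_of_nonneg_left ?_ hK.le)
      have h1 := rpow_neg_pull_of_le two_pos hA hR hc (e := 3) (by norm_num) 3
      rw [sub_self, neg_zero, Real.rpow_zero, mul_one] at h1
      refine h1.trans (le_of_eq ?_)
      norm_num
    · rw [abs_zero]
      have := nR (-3)
      positivity
  have hθi : Integrable (fun z => θ z.1 z.2) (nu t) := by
    refine ((H₃ t ht).const_mul hD).integrable.mono' hfm' ?_
    filter_upwards [ae_nu_mem t] with z hz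
    refine (hb z.1 hz.1 z.2).trans (mul_le_mul_of_nonneg_left ?_ hD)
    simp only [neg_zero, Real.rpow_zero, one_mul, wt]
    exact rpow_neg_le (rho_pos hz.1 _) (rho_le_succ _ _) (by linarith)
  have hGi : Integrable (fun z => G z.1 * θ z.1 z.2) (nu t) :=
    hθi.bdd_mul (hGm.comp measurable_fst).aestronglyMeasurable
      (by filter_upwards [ae_nu_mem t] with z hz using hGb z.1 hz)
  have hG0 : ∫ z, G z.1 * θ z.1 z.2 ∂nu t = 0 := by
    have e : ∫ z, G z.1 * θ z.1 z.2 ∂nu t = ∫ s in Ioo 0 t, ∫ y, G s * θ s y := integral_prod _ hGi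
    rw [e]
    refine setIntegral_eq_zero_of_forall_eq_zero fun s hs => ?_
    rw [integral_const_mul, hm s hs.1, mul_zero]
  have d := ((H₁ t ht).const_mul (by have := nR (-(3 + γ)); positivity :
      0 ≤ D * C₀ * rho (1 + t) x ^ (-(3 + γ)))).add
    ((H₂ t ht x).const_mul (by have := nR (-a); positivity : 0 ≤ D * C₀ * rho (1 + t) x ^ (-a)))
  have hle : ∀ᵐ z ∂nu t, |oseenKernel (t - z.1) j 2 (x - z.2) * θ z.1 z.2 - G z.1 * θ z.1 z.2| ≤
      D * C₀ * rho (1 + t) x ^ (-(3 + γ)) *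
        ((t - z.1) ^ (-0 : ℝ) * z.1 ^ (-0 : ℝ) * rho z.1 z.2 ^ (-(3 + δ - γ))) +
      D * C₀ * rho (1 + t) x ^ (-a) *
        (rho (t - z.1) (x - z.2) ^ (-3 : ℝ) * rho z.1 z.2 ^ (-(3 + δ - a))) := by
    filter_upwards [ae_nu_mem t] with z hz
    have h1 := H₀ j 2 z.1 t hz.1 hz.2 x z.2
    have h2 := hb z.1 hz.1 z.2
    rw [wt, Real.rpow_zero, one_mul] at h2
    rw [← sub_mul, abs_mul, neg_zero, Real.rpow_zero, Real.rpow_zero, one_mul, one_mul]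
    have h3 := mul_le_mul_of_nonneg_left h2 (abs_nonneg (oseenKernel (t - z.1) j 2 (x - z.2) - G z.1))
    have h4 := mul_le_mul_of_nonneg_left h1 hD
    linarith
  have hFm : AEStronglyMeasurable (fun z : ℝ × E3 => oseenKernel (t - z.1) j 2 (x - z.2) * θ z.1 z.2)
      (nu t) := (measurable_kernel_comp (k := fun σ => oseenKernel σ j 2)
        (f := fun z : ℝ × E3 => t - z.1) (g := fun z : ℝ × E3 => x - z.2)
        (measurable_oseenKernel j 2) (by fun_prop) (by fun_prop)).aestronglyMeasurable.mul hfm'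
  have hsub := d.integrable.mono' (hFm.sub hGi.aestronglyMeasurable) hle
  have e : source θ j t x = ∫ z, (oseenKernel (t - z.1) j 2 (x - z.2) * θ z.1 z.2
      - G z.1 * θ z.1 z.2) ∂nu t := by
    rw [integral_sub (by simpa using hsub.add hGi) hGi, hG0, sub_zero]
    rfl
  rw [e]
  refine (d.norm_integral_le hle).trans ?_
  have h1 : t ^ ((2 - δ + γ) / 2) * rho (1 + t) x ^ (-(3 + γ)) ≤ wt ((a - 1 - δ) / 2) a t x :=
    (mul_rpow_le_wt ht (by linarith) _ x).trans (wt_le ht.le hγa (by linarith) x)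
  have h2 : t ^ ((a - 1 - δ) / 2) * rho (1 + t) x ^ (-a) ≤ wt ((a - 1 - δ) / 2) a t x :=
    mul_rpow_le_wt ht (by linarith) a x
  rw [show (5 - (3 + (3 + δ - a))) / 2 = (a - 1 - δ) / 2 by ring,
    show (5 - (3 + δ - γ)) / 2 - 0 - 0 = (2 - δ + γ) / 2 by ring]
  have e1 := mul_le_mul_of_nonneg_left h1 (by positivity : 0 ≤ C₀ * D * C₁)
  have e2 := mul_le_mul_of_nonneg_left h2 (by positivity : 0 ≤ C₀ * D * C₂)
  linarith

/-! ### Quadratic terms for rapidly decaying velocities -/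

/-- R^(-e) is pulled out of whichever factor sits at parabolic distance at least R/2; `J₁` and `J₂`
are the remaining integrals. -/
lemma dom_split {e r : ℝ} (he : 0 ≤ e) (q : ℝ)
    (J₁ : ∃ C > 0, ∀ t : ℝ, 0 < t → ∀ x : E3,
      Dom t (fun z => rho (t - z.1) (x - z.2) ^ (-(4 - e)) * rho (1 + z.1) z.2 ^ (-q)) (C * t ^ r))
    (J₂ : ∃ C > 0, ∀ t : ℝ, 0 < t → ∀ x : E3,
      Dom t (fun z => rho (t - z.1) (x - z.2) ^ (-4 : ℝ) * rho (1 + z.1) z.2 ^ (-(q - e))) (C * t ^ r)) :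
    ∃ C > 0, ∀ t : ℝ, 0 < t → ∀ x : E3,
      Dom t (fun z => rho (t - z.1) (x - z.2) ^ (-4 : ℝ) * rho (1 + z.1) z.2 ^ (-q))
        (C * (t ^ r * rho (1 + t) x ^ (-e))) := by
  obtain ⟨C₁, c₁, H₁⟩ := J₁
  obtain ⟨C₂, c₂, H₂⟩ := J₂
  refine ⟨2 ^ e * (C₁ + C₂), by positivity, fun t ht x => ?_⟩
  have hR := rho_succ_pos ht.le x
  have n : ∀ {X : ℝ}, 0 < X → ∀ r : ℝ, 0 ≤ X ^ r := fun h r => Real.rpow_nonneg h.le r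
  have nR := n hR (-e)
  refine (((H₁ t ht x).add (H₂ t ht x)).const_mul
    (by positivity : 0 ≤ 2 ^ e * rho (1 + t) x ^ (-e))).mono
    (Measurable.aestronglyMeasurable (by fun_prop)) (fun s hs y => ?_) (fun s hs y => ?_)
    (le_of_eq (by ring))
  · exact mul_rpow_nonneg (rho_nonneg _ _) (rho_nonneg _ _)
  have hA : 0 < rho (t - s) (x - y) := rho_pos (by linarith [hs.2]) _
  have hS := rho_succ_pos hs.1.le y
  have hRR := rho_succ_le_sub s t x y
  have nA := n hA
  have nS := n hS
  dsimp only
  have p1 := nA (-4)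
  have p2 := nA (-(4 - e))
  have p3 := nS (-q)
  have p4 := nS (-(q - e))
  rcases le_total (rho (1 + t) x) (2 * rho (t - s) (x - y)) with h | h
  · have h1 := mul_le_mul_of_nonneg_right (rpow_neg_pull_of_le two_pos hA hR h he 4) p3
    have : 0 ≤ 2 ^ e * rho (1 + t) x ^ (-e) *
      (rho (t - s) (x - y) ^ (-4 : ℝ) * rho (1 + s) y ^ (-(q - e))) := by positivity
    linarith
  · have h1 := mul_le_mul_of_nonneg_left (rpow_neg_pull_of_le two_pos hS hR (by linarith) he q) p1
    have : 0 ≤ 2 ^ e * rho (1 + t) x ^ (-e) *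
      (rho (t - s) (x - y) ^ (-(4 - e)) * rho (1 + s) y ^ (-q)) := by positivity
    linarith

lemma dom_succ {p q q' t c : ℝ} {x : E3} (hq' : 0 ≤ q') (hq : q' ≤ q)
    (H : Dom t (fun z => rho (t - z.1) (x - z.2) ^ (-p) * rho z.1 z.2 ^ (-q')) c) :
    Dom t (fun z => rho (t - z.1) (x - z.2) ^ (-p) * rho (1 + z.1) z.2 ^ (-q)) c := by
  refine H.mono (Measurable.aestronglyMeasurable (by fun_prop)) (fun s hs y => ?_)
    (fun s hs y => ?_) le_rfl
  · exact mul_rpow_nonneg (rho_nonneg _ _) (rho_nonneg _ _)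
  · refine mul_le_mul_of_nonneg_left ?_ (Real.rpow_nonneg (rho_nonneg _ _) _)
    exact (Real.rpow_le_rpow_of_exponent_le (one_le_rho_succ hs.1.le y) (by linarith)).trans
      (rpow_neg_le (rho_pos hs.1 y) (rho_le_succ _ _) hq')

lemma duh_le_of_dom {q r e : ℝ}
    (J : ∃ C > 0, ∀ t : ℝ, 0 < t → ∀ x : E3,
      Dom t (fun z => rho (t - z.1) (x - z.2) ^ (-4 : ℝ) * rho (1 + z.1) z.2 ^ (-q))
        (C * (t ^ r * rho (1 + t) x ^ (-e)))) (hr : 0 ≤ r) :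
    ∃ C > 0, ∀ (K D : ℝ) (k : ℝ → E3 → ℝ) (f : ℝ × E3 → ℝ), Ker 4 K k → 0 ≤ K → 0 ≤ D →
      (∀ᵐ z ∂spaceTime, |f z| ≤ D * wt 0 q z.1 z.2) →
      ∀ t, 0 < t → ∀ x, |duh k f t x| ≤ C * (K * D) * wt r e t x := by
  obtain ⟨C, hC, H⟩ := J
  refine ⟨C, hC, fun K D k f hk hK hD hf t ht x => ?_⟩
  refine (((H t ht x).const_mul (mul_nonneg hK hD)).norm_integral_le ?_).trans ?_
  · filter_upwards [ae_nu_mem t, ae_nu_of_spaceTime hf] with z hz hfz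
    have h1 := hk.bound _ (by linarith [hz.2] : 0 < t - z.1) (x - z.2)
    rw [wt, Real.rpow_zero, one_mul] at hfz
    rw [abs_mul]
    refine (mul_le_mul h1 hfz (abs_nonneg _)
      (mul_nonneg hK (Real.rpow_nonneg (rho_nonneg _ _) _))).trans (le_of_eq (by ring))
  · have := mul_le_mul_of_nonneg_left (mul_rpow_le_wt ht hr e x)
      (by positivity : 0 ≤ C * (K * D))
    linarith

/-- Pulling out R^(-2) leaves (2, 7/2) and (4, 3/2). As ρ(1+s,y) ≥ 1, the second exponents may be
lowered to reach the critical pairs (2, 3) and (4, 1), which cost no power of t. -/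
lemma duh_quadratic_two : ∃ C > 0, ∀ (K D : ℝ) (k : ℝ → E3 → ℝ) (f : ℝ × E3 → ℝ), Ker 4 K k →
    0 ≤ K → 0 ≤ D → (∀ᵐ z ∂spaceTime, |f z| ≤ D * wt 0 (7 / 2) z.1 z.2) →
      ∀ t, 0 < t → ∀ x, |duh k f t x| ≤ C * (K * D) * wt 0 2 t x := by
  refine duh_le_of_dom (dom_split (by norm_num) _ ?_ ?_) le_rfl
  · obtain ⟨C, hC, H⟩ := dom_five (p := 4 - 2) (q := 3) (by norm_num) (by norm_num) (by norm_num)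
    refine ⟨C, hC, fun t ht x => ?_⟩
    rw [Real.rpow_zero, mul_one]
    exact dom_succ (by norm_num) (by norm_num) (H t ht x)
  · obtain ⟨C, hC, H⟩ := dom_five (p := 4) (q := 1) (by norm_num) (by norm_num) (by norm_num)
    refine ⟨C, hC, fun t ht x => ?_⟩
    rw [Real.rpow_zero, mul_one]
    exact dom_succ (by norm_num) (by norm_num) (H t ht x)

/-- Pulling out R^(-4) leaves ρ^(-4) alone, in one variable or the other, with integral of order √t.
-/
lemma duh_quadratic_four : ∃ C > 0, ∀ (K D : ℝ) (k : ℝ → E3 → ℝ) (f : ℝ × E3 → ℝ), Ker 4 K k →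
    0 ≤ K → 0 ≤ D → (∀ᵐ z ∂spaceTime, |f z| ≤ D * wt 0 4 z.1 z.2) →
      ∀ t, 0 < t → ∀ x, |duh k f t x| ≤ C * (K * D) * wt (1 / 2) 4 t x := by
  refine duh_le_of_dom (dom_split (by norm_num) _ ?_ ?_) (by norm_num)
  · obtain ⟨C, hC, H⟩ := dom_right (N := 4) (a := 0) (b := 0) (by norm_num) (by norm_num)
      (by norm_num)
    refine ⟨C, hC, fun t ht x => dom_succ (q' := 4) (by norm_num) le_rfl ?_⟩
    have := H t ht
    norm_num at this ⊢
    exact this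
  · obtain ⟨C, hC, H⟩ := dom_left (N := 4) (a := 0) (b := 0) (by norm_num) (by norm_num)
      (by norm_num)
    refine ⟨C, hC, fun t ht x => dom_succ (q' := 0) le_rfl (by norm_num) ?_⟩
    have := H t ht x
    norm_num at this ⊢
    exact this

/-! ### Decay of the solution -/

/-- Decay of a function at the rate of a weight. -/
def Dec (v : ℝ → E3 → ℝ) (c e : ℝ) : Prop :=
  ∃ A, 0 ≤ A ∧ ∀ t, 0 < t → ∀ x, |v t x| ≤ A * wt c e t x

section

variable {v w : ℝ → E3 → ℝ} {c e c' e' : ℝ}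

lemma Dec.mono (h : Dec v c e) (he : e' ≤ e) (hc : c - (e - e') / 2 ≤ c') : Dec v c' e' := by
  obtain ⟨A, hA, H⟩ := h
  exact ⟨A, hA, fun t ht x => (H t ht x).trans (mul_le_mul_of_nonneg_left (wt_le ht.le he hc x) hA)⟩

lemma Dec.of_abs_le (h : Dec v c e) (hw : ∀ t, 0 < t → ∀ x, |w t x| ≤ |v t x|) : Dec w c e := by
  obtain ⟨A, hA, H⟩ := h
  exact ⟨A, hA, fun t ht x => (hw t ht x).trans (H t ht x)⟩

lemma Dec.mul (h : Dec v c e) (h' : Dec w c' e') :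
    Dec (fun t x => v t x * w t x) (c + c') (e + e') := by
  obtain ⟨A, hA, H⟩ := h
  obtain ⟨B, hB, H'⟩ := h'
  refine ⟨A * B, mul_nonneg hA hB, fun t ht x => ?_⟩
  rw [abs_mul, ← wt_mul ht.le]
  have := wt_nonneg ht.le c e x
  exact (mul_le_mul (H t ht x) (H' t ht x) (abs_nonneg _) (by positivity)).trans
    (le_of_eq (by ring))

lemma Dec.add (h : Dec v c e) (h' : Dec w c e) : Dec (fun t x => v t x + w t x) c e := by
  obtain ⟨A, hA, H⟩ := h
  obtain ⟨B, hB, H'⟩ := h'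
  refine ⟨A + B, add_nonneg hA hB, fun t ht x => (abs_add_le _ _).trans ?_⟩
  rw [add_mul]
  exact add_le_add (H t ht x) (H' t ht x)

lemma Dec.sub (h : Dec v c e) (h' : Dec w c e) : Dec (fun t x => v t x - w t x) c e := by
  simpa only [sub_eq_add_neg] using
    h.add (h'.of_abs_le (w := fun t x => -w t x) fun _ _ _ => (abs_neg _).le)

lemma Dec.sum {v : Fin 3 → ℝ → E3 → ℝ} (h : ∀ j, Dec (v j) c e) :
    Dec (fun t x => ∑ j, v j t x) c e := by
  simp only [Fin.sum_univ_three]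
  exact ((h 0).add (h 1)).add (h 2)

lemma exists_uniform_bound {v : Fin 3 → ℝ → E3 → ℝ} (h : ∀ j, Dec (v j) c e) :
    ∃ A, 0 ≤ A ∧ ∀ j t, 0 < t → ∀ x, |v j t x| ≤ A * wt c e t x := by
  choose A hA H using h
  refine ⟨∑ j, A j, Finset.sum_nonneg fun j _ => hA j, fun j t ht x => (H j t ht x).trans ?_⟩
  exact mul_le_mul_of_nonneg_right
    (Finset.single_le_sum (fun i _ => hA i) (Finset.mem_univ j)) (wt_nonneg ht.le _ _ _)

lemma Dec.lin_of_rpow {a C : ℝ} {f : E3 → ℝ} (ha0 : 0 < a) (ha : a < 3) (hC : 0 ≤ C)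
    (hm : AEStronglyMeasurable f volume) (hf : ∀ᵐ y, |f y| ≤ C * (1 + ‖y‖) ^ (-a)) :
    Dec (lin f) 0 a := by
  obtain ⟨K, hK, H⟩ := lin_wt_of_rpow ha0 ha
  exact ⟨K * C, by positivity, H C f hC hm hf⟩

lemma Dec.lin_of_integrable {b C : ℝ} {f : E3 → ℝ} (hb : 3 ≤ b) (hC : 0 ≤ C)
    (hi : Integrable f) (hf : ∀ᵐ y, |f y| ≤ C * (1 + ‖y‖) ^ (-b)) :
    Dec (lin f) ((b - 3) / 2) b := by
  obtain ⟨K, hK, H⟩ := lin_wt_of_integrable hb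
  have h0 : 0 ≤ ∫ y, |f y| := integral_nonneg fun _ => abs_nonneg _
  refine ⟨K * (C + ∫ y, |f y|), by positivity, H _ f (by positivity) hi ?_ (by linarith)⟩
  filter_upwards [hf] with y hy
  exact hy.trans (mul_le_mul_of_nonneg_right (by linarith) (by positivity))

lemma Dec.lin_of_mean_zero {b C : ℝ} {f : E3 → ℝ} (hb : 4 ≤ b) (hC : 0 ≤ C)
    (hi : Integrable f) (hf : ∀ᵐ y, |f y| ≤ C * (1 + ‖y‖) ^ (-b)) (hz : ∫ y, f y = 0)
    (h1 : Integrable (fun y => ‖y‖ * |f y|)) :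
    Dec (lin f) ((b - 4) / 2) b := by
  obtain ⟨K, hK, H⟩ := lin_wt_of_mean_zero hb
  have h0 : 0 ≤ ∫ y, ‖y‖ * |f y| := integral_nonneg fun _ => by positivity
  refine ⟨K * (C + ∫ y, ‖y‖ * |f y|), by positivity,
    H _ f (by positivity) hi ?_ hz h1 (by linarith)⟩
  filter_upwards [hf] with y hy
  exact hy.trans (mul_le_mul_of_nonneg_right (by linarith) (by positivity))

lemma Dec.ae {A : ℝ} (h : ∀ t, 0 < t → ∀ x, |v t x| ≤ A * wt c e t x) :
    ∀ᵐ z ∂spaceTime, |v z.1 z.2| ≤ A * wt c e z.1 z.2 := ae_spaceTime_of_forall h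

lemma Dec.duh_heat_of_mass {m : ℝ} (hm : 3 < m) (h : Dec v ((m - 4) / 2) m) (l : Fin 3) :
    Dec (duh (heat1 l) (fun z => v z.1 z.2)) ((m - 3) / 2) m := by
  obtain ⟨K, hK, H⟩ := heat_decay_of_mass hm
  obtain ⟨A, hA, h⟩ := h
  exact ⟨K * A, by positivity, H A _ hA (Dec.ae h) l⟩

lemma Dec.duh_heat_of_fast {m : ℝ} (hm : 4 ≤ m) (h : Dec v ((m - 4) / 2 - 3 / 4) m) (l : Fin 3) :
    Dec (duh (heat1 l) (fun z => v z.1 z.2)) ((m - 4) / 2) m := by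
  obtain ⟨K, hK, H⟩ := heat_decay_of_fast hm
  obtain ⟨A, hA, h⟩ := h
  exact ⟨K * A, by positivity, H A _ hA (Dec.ae h) l⟩

lemma Dec.duh_oseen_two (h : Dec v 0 (7 / 2)) (j k l : Fin 3) :
    Dec (duh (fun σ => oseenGradKernel σ j k l) (fun z => v z.1 z.2)) 0 2 := by
  obtain ⟨K, hK, L⟩ := ker_oseenGradKernel
  obtain ⟨C, hC, H⟩ := duh_quadratic_two
  obtain ⟨A, hA, h⟩ := h
  exact ⟨C * (K * A), by positivity, H K A _ _ (L j k l) hK.le hA (Dec.ae h)⟩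

lemma Dec.duh_oseen_four (h : Dec v 0 4) (j k l : Fin 3) :
    Dec (duh (fun σ => oseenGradKernel σ j k l) (fun z => v z.1 z.2)) (1 / 2) 4 := by
  obtain ⟨K, hK, L⟩ := ker_oseenGradKernel
  obtain ⟨C, hC, H⟩ := duh_quadratic_four
  obtain ⟨A, hA, h⟩ := h
  exact ⟨C * (K * A), by positivity, H K A _ _ (L j k l) hK.le hA (Dec.ae h)⟩

end

/-- A good solution which is small enough for decay to propagate from the linear evolution. -/
structure DecSol (M : ℝ) (u₀ : E3 → E3) (θ₀ : E3 → ℝ) (u : ℝ → E3 → E3) (θ : ℝ → E3 → ℝ) :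
    Prop extends GoodSol M u₀ θ₀ u θ where
  temperature : ∀ e c, 1 ≤ e → e ≤ 15 / 4 → 0 ≤ c → Dec (lin θ₀) c e → Dec θ c e
  velocity : ∀ e c, 1 ≤ e → e ≤ 15 / 4 → 0 ≤ c → (∀ j, Dec (lin fun y => u₀ y j) c e) →
    (∀ j, Dec (source θ j) c e) → Dec (fun t x => ‖u t x‖) c e

lemma exists_decSol : ∃ m > 0, ∀ M ≤ m, 0 ≤ M → ∀ u₀ θ₀ u θ, GoodSol M u₀ θ₀ u θ →
    DecSol M u₀ θ₀ u θ := by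
  obtain ⟨m₁, h₁, H₁⟩ := exists_temperature_contract
  obtain ⟨m₂, h₂, H₂⟩ := exists_velocity_contract
  refine ⟨min m₁ m₂, lt_min h₁ h₂, fun M hM hM0 u₀ θ₀ u θ h => ⟨h, ?_, ?_⟩⟩
  · rintro e c he he' hc ⟨A, hA, hl⟩
    exact ⟨2 * A, by positivity, H₁ M (hM.trans (min_le_left _ _)) hM0 u₀ θ₀ u θ h.sol e c A he he'
      hc hA hl⟩
  · intro e c he he' hc hl hs
    obtain ⟨A, hA, hl⟩ := exists_uniform_bound hl
    obtain ⟨B, hB, hs⟩ := exists_uniform_bound hs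
    refine ⟨6 * (A + B), by positivity, fun t ht x => ?_⟩
    rw [abs_norm]
    refine H₂ M (hM.trans (min_le_right _ _)) hM0 u₀ θ₀ u θ h.sol e c (A + B) he he' hc
      (by positivity) (fun t ht x j => ?_) t ht x
    rw [add_mul]
    exact add_le_add (hl j t ht x) (hs j t ht x)

/-- Induction on the decay exponent in steps of length one. -/
lemma decay_induction {P : ℝ → Prop} {m b : ℝ} (hmb : m ≤ b) (h0 : P m)
    (step : ∀ r s, m ≤ r → r < s → s ≤ r + 1 → s ≤ b → P r → P s) : P b := by
  have key : ∀ n : ℕ, P (min b (m + n)) := fun n => by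
    induction n with
    | zero => simpa [hmb] using h0
    | succ n ih =>
      rcases le_or_gt b (m + n) with h | h
      · rw [min_eq_left h] at ih
        rwa [min_eq_left (by push_cast; linarith)]
      · rw [min_eq_right h.le] at ih
        refine step (m + n) _ (by linarith [n.cast_nonneg (α := ℝ)]) ?_ ?_ (min_le_left _ _) ih
        · push_cast
          exact lt_min h (by linarith)
        · push_cast
          exact (min_le_right _ _).trans (by linarith)
  have := key ⌈b - m⌉₊
  rwa [min_eq_left (by linarith [Nat.le_ceil (b - m)])] at this

section

variable {M : ℝ} {u : ℝ → E3 → E3} {θ : ℝ → E3 → ℝ} {u₀ : E3 → E3} {θ₀ : E3 → ℝ}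

lemma GoodSol.nonneg (h : GoodSol M u₀ θ₀ u θ) : 0 ≤ M :=
  (integral_nonneg fun _ => abs_nonneg _).trans (h.integral_abs_le 1 one_pos)

lemma GoodSol.dec_temperature {c e : ℝ} (h : GoodSol M u₀ θ₀ u θ) (hl : Dec (lin θ₀) c e)
    (hd : ∀ l, Dec (duh (heat1 l) (fun z => θ z.1 z.2 * u z.1 z.2 l)) c e) : Dec θ c e :=
  (hl.sub (Dec.sum hd)).of_abs_le fun t ht x => by rw [h.sol.eθ t ht x, nextT]

lemma GoodSol.dec_velocity {c e : ℝ} (h : GoodSol M u₀ θ₀ u θ)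
    (hl : ∀ j, Dec (lin fun y => u₀ y j) c e) (hs : ∀ j, Dec (source θ j) c e)
    (hd : ∀ j k l, Dec (duh (fun σ => oseenGradKernel σ j k l)
      (fun z => u z.1 z.2 k * u z.1 z.2 l)) c e) : Dec (fun t x => ‖u t x‖) c e := by
  have hj : ∀ j, Dec (fun t x => |u t x j|) c e := fun j =>
    (((hl j).sub (Dec.sum fun k => Dec.sum fun l => hd j k l)).add (hs j)).of_abs_le
      fun t ht x => by
        rw [abs_abs, h.sol.eu t ht x]
        exact le_rfl
  refine (Dec.sum hj).of_abs_le fun t ht x => ?_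
  rw [abs_norm]
  exact (norm_le_sum_coord _).trans (le_abs_self _)

lemma Dec.coord {c e : ℝ} (h : Dec (fun t x => ‖u t x‖) c e) (l : Fin 3) :
    Dec (fun t x => u t x l) c e :=
  h.of_abs_le fun _ _ _ => (abs_coord_le _ l).trans (le_abs_self _)

lemma GoodSol.dec_source_of_mass {a : ℝ} (h : GoodSol M u₀ θ₀ u θ) (ha : 1 ≤ a) (ha3 : a < 3)
    (hθ : Dec θ 0 3) (j : Fin 3) : Dec (source θ j) ((a - 1) / 2) a := by
  obtain ⟨C, hC, H⟩ := source_le_of_mass ha ha3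
  obtain ⟨A, hA, hθ⟩ := hθ
  have hM := h.nonneg
  refine ⟨C * (A + M), by positivity, H _ θ (by positivity) h.sol.adm.mθ (fun t ht x => ?_)
    h.integrable (fun t ht => (h.integral_abs_le t ht).trans (by linarith)) j⟩
  exact (hθ t ht x).trans (mul_le_mul_of_nonneg_right (by linarith) (wt_nonneg ht.le _ _ _))

lemma GoodSol.dec_source_of_mean_zero {δ a : ℝ} (h : GoodSol M u₀ θ₀ u θ) (hz : ∫ x, θ₀ x = 0)
    (hδ : 0 < δ) (hδ1 : δ ≤ 1) (ha : 1 + δ ≤ a) (ha3 : a < 3 + δ) (hθ : Dec θ 0 (3 + δ))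
    (j : Fin 3) : Dec (source θ j) ((a - 1 - δ) / 2) a := by
  obtain ⟨C, hC, H⟩ := source_le_of_mean_zero hδ hδ1 ha ha3
  obtain ⟨A, hA, hθ⟩ := hθ
  exact ⟨C * A, by positivity, H A θ hA h.sol.adm.mθ hθ (fun t ht => (h.integral t ht).trans hz) j⟩

/-- Decay of small solutions. -/
theorem DecSol.decay {a b : ℝ} (h : DecSol M u₀ θ₀ u θ) (ha : 1 ≤ a) (ha3 : a < 3) (hb : 3 ≤ b)
    (hd : DataDecay a b u₀ θ₀) :
    Dec (fun t x => ‖u t x‖) ((a - 1) / 2) a ∧ Dec θ ((b - 3) / 2) b := by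
  obtain ⟨C, hC, hd⟩ := hd
  obtain ⟨ε, D⟩ := h.data
  have lu : ∀ j, Dec (lin fun y => u₀ y j) 0 a := fun j =>
    Dec.lin_of_rpow (by linarith) ha3 hC.le (aesm_coord D.mu j)
      (hd.mono fun x hx => (abs_coord_le _ j).trans hx.1)
  have lθ : Dec (lin θ₀) ((b - 3) / 2) b :=
    Dec.lin_of_integrable hb hC.le D.iθ (hd.mono fun x hx => hx.2)
  have θ3 : Dec θ 0 3 := h.temperature 3 0 (by norm_num) (by norm_num) le_rfl
    (lθ.mono hb (by linarith))
  have ua : Dec (fun t x => ‖u t x‖) ((a - 1) / 2) a :=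
    h.velocity a ((a - 1) / 2) ha (by linarith) (by linarith)
      (fun j => (lu j).mono le_rfl (by linarith)) (h.dec_source_of_mass ha ha3 θ3)
  refine ⟨ua, decay_induction (P := fun m => Dec θ ((m - 3) / 2) m) hb
    (θ3.mono le_rfl (by norm_num)) fun r s hr hrs hs hsb hθ => ?_⟩
  have u1 : Dec (fun t x => ‖u t x‖) 0 1 := ua.mono ha (by linarith)
  -- From θ at exponent r and u at exponent 1 with no growth, θu has exponent r + 1. For s ≤ r + 1
  -- the spare decay is exchanged for time, giving exactly the rate (s-4)/2 that the Duhamel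
  -- estimate requires.
  exact h.dec_temperature (lθ.mono hsb (by linarith)) fun l =>
    Dec.duh_heat_of_mass (by linarith) ((hθ.mul (u1.coord l)).mono (by linarith) (by linarith)) l

lemma integrable_of_one_add_rpow {a C : ℝ} (ha : 3 < a) {f : E3 → ℝ}
    (hm : AEStronglyMeasurable f volume) (hf : ∀ᵐ y, |f y| ≤ C * (1 + ‖y‖) ^ (-a)) :
    Integrable f :=
  ((integrable_one_add_norm (E := E3) (μ := volume) (r := a) (by simpa using ha)).const_mul C).mono'
    hm hf

/-- Faster decay of small solutions for temperatures of mean zero. -/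
theorem DecSol.decay_of_mean_zero {a b : ℝ} (h : DecSol M u₀ θ₀ u θ) (ha : 2 ≤ a) (ha4 : a < 4)
    (ha3 : a ≠ 3) (hb : 4 ≤ b) (hd : DataDecay a b u₀ θ₀) (hz : ∫ x, θ₀ x = 0)
    (h1 : Integrable (fun x => ‖x‖ * |θ₀ x|)) :
    Dec (fun t x => ‖u t x‖) ((a - 2) / 2) a ∧ Dec θ ((b - 4) / 2) b := by
  obtain ⟨C, hC, hd⟩ := hd
  obtain ⟨ε, D⟩ := h.data
  have bu : ∀ j, ∀ᵐ y, |u₀ y j| ≤ C * (1 + ‖y‖) ^ (-a) := fun j =>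
    hd.mono fun x hx => (abs_coord_le _ j).trans hx.1
  have lu2 : ∀ j, Dec (lin fun y => u₀ y j) 0 2 := fun j =>
    Dec.lin_of_rpow two_pos (by norm_num) hC.le (aesm_coord D.mu j)
      ((bu j).mono fun x hx => hx.trans (mul_le_mul_of_nonneg_left
        (Real.rpow_le_rpow_of_exponent_le (by linarith [norm_nonneg x]) (by linarith)) hC.le))
  have lua : ∀ j, Dec (lin fun y => u₀ y j) ((a - 2) / 2) a := fun j => by
    -- Below 3 the datum is dominated by a locally integrable homogeneous function; above 3 it is
    -- integrable. At a = 3 neither linear estimate applies, which is why this exponent is excluded.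
    rcases ha3.lt_or_gt with ha3 | ha3
    · exact (Dec.lin_of_rpow (by linarith) ha3 hC.le (aesm_coord D.mu j) (bu j)).mono le_rfl
        (by linarith)
    · exact (Dec.lin_of_integrable ha3.le hC.le
        (integrable_of_one_add_rpow ha3 (aesm_coord D.mu j) (bu j)) (bu j)).mono le_rfl (by linarith)
  have lθ : Dec (lin θ₀) ((b - 4) / 2) b :=
    Dec.lin_of_mean_zero hb hC.le D.iθ (hd.mono fun x hx => hx.2) hz h1
  -- 15/4 is the largest exponent reached by contraction. It beats 3, so cancellation in the
  -- buoyancy term becomes available with δ = 3/4, and gives u at 1 + δ = 7/4 without growth.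
  have θ' : Dec θ 0 (15 / 4) := h.temperature _ 0 (by norm_num) le_rfl le_rfl
    (lθ.mono (by linarith) (by linarith))
  have u' : Dec (fun t x => ‖u t x‖) 0 (7 / 4) :=
    h.velocity _ 0 (by norm_num) (by norm_num) le_rfl
      (fun j => (lu2 j).mono (by norm_num) (by norm_num)) fun j =>
      (h.dec_source_of_mean_zero (δ := 3 / 4) (a := 7 / 4) hz (by norm_num) (by norm_num)
        (by norm_num) (by norm_num) (θ'.mono (by norm_num) (by norm_num)) j).mono le_rfl
        (by norm_num)
  -- θu now has exponent 15/4 + 7/4 = 11/2, which is exponent 4 with the surplus (1+t)^(-3/4).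
  have θ4 : Dec θ 0 4 := h.dec_temperature (lθ.mono hb (by linarith)) fun l =>
    (Dec.duh_heat_of_fast le_rfl ((θ'.mul (u'.coord l)).mono (by norm_num) (by norm_num)) l).mono
      le_rfl (by norm_num)
  -- With θ at exponent 4 the choice δ = 1 is allowed, and the buoyancy term attains every exponent
  -- below 3 + δ = 4; this is the restriction a < 4.
  have src : ∀ r, 2 ≤ r → r < 4 → ∀ j, Dec (source θ j) ((r - 2) / 2) r := fun r hr hr4 j =>
    (h.dec_source_of_mean_zero (δ := 1) (a := r) hz one_pos le_rfl (by linarith) (by linarith)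
      (θ4.mono (by norm_num) (by norm_num)) j).mono le_rfl (by linarith)
  -- u ⊗ u at exponent 7/4 + 7/4 = 7/2 yields u at exponent 2. Below, u ⊗ u at exponent 4 yields the
  -- final exponent a.
  have u2 : Dec (fun t x => ‖u t x‖) 0 2 :=
    h.dec_velocity lu2 (fun j => (src 2 le_rfl (by norm_num) j).mono le_rfl (by norm_num))
      fun j k l => Dec.duh_oseen_two (((u'.coord k).mul (u'.coord l)).mono (by norm_num)
        (by norm_num)) j k l
  refine ⟨h.dec_velocity lua (src a ha ha4) fun j k l =>
    (Dec.duh_oseen_four (((u2.coord k).mul (u2.coord l)).mono (by norm_num)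
        (by norm_num)) j k l).mono ha4.le (by linarith),
    decay_induction (P := fun m => Dec θ ((m - 4) / 2) m) hb
    (θ4.mono le_rfl (by norm_num)) fun r s hr hrs hs hsb hθ => ?_⟩
  exact h.dec_temperature (lθ.mono hsb (by linarith)) fun l =>
    Dec.duh_heat_of_fast (by linarith) ((hθ.mul (u2.coord l)).mono (by linarith) (by linarith)) l

end

/-! ### Interpolated form of the decay estimates -/

/-- The weight at the extreme exponent a dominates all intermediate rates: exchange a - η powers of
the parabolic distance for time. One estimate at η = a thus gives the whole infimum. -/
lemma wt_le_one_add {t : ℝ} (ht : 0 ≤ t) {a η p : ℝ} (hη : 0 ≤ η) (hηa : η ≤ a) (x : E3) :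
    wt ((a - p) / 2) a t x ≤ (1 + ‖x‖) ^ (-η) * (1 + t) ^ ((η - p) / 2) := by
  refine (wt_le (e' := η) (c' := (η - p) / 2) ht hηa (by linarith) x).trans ?_
  rw [wt, mul_comm]
  refine mul_le_mul_of_nonneg_right (rpow_neg_le (by positivity) ?_ hη)
    (Real.rpow_nonneg (by linarith) _)
  unfold rho
  have := Real.one_le_sqrt.2 (by linarith : 1 ≤ 1 + t)
  linarith

lemma le_mul_ciInf {ι : Type*} [Nonempty ι] {f : ι → ℝ} {C y : ℝ} (hC : 0 < C)
    (h : ∀ i, y ≤ C * f i) : y ≤ C * ⨅ i, f i :=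
  (div_le_iff₀' hC).1 (le_ciInf fun i => (div_le_iff₀' hC).2 (h i))

lemma Dec.le_iInf {v : ℝ → E3 → ℝ} {a p : ℝ} (ha : 0 ≤ a) (h : Dec v ((a - p) / 2) a)
    (h0 : ∃ C > 0, ∀ᵐ x, |v 0 x| ≤ C * (1 + ‖x‖) ^ (-a)) :
    ∃ C : ℝ, 0 < C ∧ ∀ t, 0 ≤ t → ∀ᵐ x : E3, |v t x| ≤ C * ⨅ η : Icc (0 : ℝ) a,
      (1 + ‖x‖) ^ (-(η : ℝ)) * (1 + t) ^ (((η : ℝ) - p) / 2) := by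
  obtain ⟨A, hA, H⟩ := h
  obtain ⟨C, hC, h0⟩ := h0
  have : Nonempty (Icc (0 : ℝ) a) := ⟨⟨0, le_rfl, ha⟩⟩
  refine ⟨A + C, by positivity, fun t ht => ?_⟩
  -- Decay in the weight is known for t > 0 only; at t = 0 the hypothesis on the data is used
  -- instead.
  have key : ∀ᵐ x, |v t x| ≤ (A + C) * wt ((a - p) / 2) a t x ∨
      t = 0 ∧ |v t x| ≤ (A + C) * (1 + ‖x‖) ^ (-a) := by
    rcases ht.eq_or_lt with rfl | ht
    · filter_upwards [h0] with x hx
      exact Or.inr ⟨rfl, hx.trans (mul_le_mul_of_nonneg_right (by linarith) (by positivity))⟩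
    · exact ae_of_all _ fun x => Or.inl ((H t ht x).trans
        (mul_le_mul_of_nonneg_right (by linarith) (wt_nonneg ht.le _ _ _)))
  filter_upwards [key] with x hx
  refine le_mul_ciInf (by positivity) fun η => ?_
  rcases hx with hx | ⟨rfl, hx⟩
  · exact hx.trans (mul_le_mul_of_nonneg_left (wt_le_one_add ht η.2.1 η.2.2 x) (by positivity))
  · refine hx.trans (mul_le_mul_of_nonneg_left ?_ (by positivity))
    rw [add_zero, Real.one_rpow, mul_one]
    exact Real.rpow_le_rpow_of_exponent_le (by linarith [norm_nonneg x]) (by linarith [η.2.2])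

/-- The point x = 0 must be left out: there 0 ^ (-η) = 0 for η > 0 by convention, and the right-hand
side loses its meaning. -/
lemma iInf_one_add_le {t a p : ℝ} (ht : 0 ≤ t) {x : E3} (hx : x ≠ 0) :
    (⨅ η : Icc (0 : ℝ) a, (1 + ‖x‖) ^ (-(η : ℝ)) * (1 + t) ^ (((η : ℝ) - p) / 2)) ≤
      ⨅ η : Icc (0 : ℝ) a, ‖x‖ ^ (-(η : ℝ)) * (1 + t) ^ (((η : ℝ) - p) / 2) := by
  refine ciInf_mono ⟨0, ?_⟩ fun η => ?_
  · rintro _ ⟨η, rfl⟩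
    positivity
  · exact mul_le_mul_of_nonneg_right
      (rpow_neg_le (norm_pos_iff.2 hx) (by linarith) η.2.1) (by positivity)

lemma iInf_one_add_nonneg {t : ℝ} (ht : 0 ≤ t) (a p : ℝ) (x : E3) :
    0 ≤ ⨅ η : Icc (0 : ℝ) a, (1 + ‖x‖) ^ (-(η : ℝ)) * (1 + t) ^ (((η : ℝ) - p) / 2) :=
  Real.iInf_nonneg fun η => by positivity

lemma exists_common_bound {v w : ℝ → E3 → ℝ} {a b p q : ℝ} (ha : 0 ≤ a) (hb : 0 ≤ b)
    (hv : Dec v ((a - p) / 2) a) (hw : Dec w ((b - q) / 2) b)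
    (h0 : ∃ C > 0, ∀ᵐ x, |v 0 x| ≤ C * (1 + ‖x‖) ^ (-a) ∧ |w 0 x| ≤ C * (1 + ‖x‖) ^ (-b)) :
    ∃ C : ℝ, 0 < C ∧ ∀ t, 0 ≤ t → ∀ᵐ x : E3,
      |v t x| ≤ C * (⨅ η : Icc (0 : ℝ) a,
        (1 + ‖x‖) ^ (-(η : ℝ)) * (1 + t) ^ (((η : ℝ) - p) / 2)) ∧
      |w t x| ≤ C * (⨅ η : Icc (0 : ℝ) b,
        (1 + ‖x‖) ^ (-(η : ℝ)) * (1 + t) ^ (((η : ℝ) - q) / 2)) := by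
  obtain ⟨C, hC, h0⟩ := h0
  obtain ⟨A, hA, H⟩ := hv.le_iInf ha ⟨C, hC, h0.mono fun x hx => hx.1⟩
  obtain ⟨B, hB, H'⟩ := hw.le_iInf hb ⟨C, hC, h0.mono fun x hx => hx.2⟩
  refine ⟨A + B, by positivity, fun t ht => ?_⟩
  filter_upwards [H t ht, H' t ht] with x hx hx'
  exact ⟨hx.trans (mul_le_mul_of_nonneg_right (by linarith) (iInf_one_add_nonneg ht _ _ x)),
    hx'.trans (mul_le_mul_of_nonneg_right (by linarith) (iInf_one_add_nonneg ht _ _ x))⟩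

end

end Boussinesq

/-! ### The theorem -/

theorem proposition2p4 :
    ∃ ε : ℝ, 0 < ε ∧ ∃ K : ℝ, 0 < K ∧ ∀ (u₀ : E3 → E3) (θ₀ : E3 → ℝ), SmallData ε u₀ θ₀ →
      ∃ (u : ℝ → E3 → E3) (θ : ℝ → E3 → ℝ),
        IsStrongSolution (K * ε) u₀ θ₀ u θ ∧
        (∀ (u' : ℝ → E3 → E3) (θ' : ℝ → E3 → ℝ), IsStrongSolution (K * ε) u₀ θ₀ u' θ' →
          ∀ t, 0 ≤ t → u' t =ᵐ[volume] u t ∧ θ' t =ᵐ[volume] θ t) ∧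
        (∀ a b : ℝ, 1 ≤ a → a < 3 → 3 ≤ b → DataDecay a b u₀ θ₀ →
          ∃ C : ℝ, 0 < C ∧ ∀ t, 0 ≤ t → ∀ᵐ x : E3,
            ‖u t x‖ ≤ C * (⨅ η : Icc (0 : ℝ) a,
              ‖x‖ ^ (-(η : ℝ)) * (1 + t) ^ (((η : ℝ) - 1) / 2)) ∧
            |θ t x| ≤ C * (⨅ η : Icc (0 : ℝ) b,
              ‖x‖ ^ (-(η : ℝ)) * (1 + t) ^ (((η : ℝ) - 3) / 2))) ∧
        (∀ a b : ℝ, 2 ≤ a → a < 4 → a ≠ 3 → 4 ≤ b → DataDecay a b u₀ θ₀ →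
          (∫ x, θ₀ x) = 0 → Integrable (fun x => (1 + ‖x‖) * θ₀ x) volume →
          ∃ C : ℝ, 0 < C ∧ ∀ t, 0 ≤ t → ∀ᵐ x : E3,
            ‖u t x‖ ≤ C * (⨅ η : Icc (0 : ℝ) a,
              (1 + ‖x‖) ^ (-(η : ℝ)) * (1 + t) ^ (((η : ℝ) - 2) / 2)) ∧
            |θ t x| ≤ C * (⨅ η : Icc (0 : ℝ) b,
              (1 + ‖x‖) ^ (-(η : ℝ)) * (1 + t) ^ (((η : ℝ) - 4) / 2))) := by
  obtain ⟨C, hC, H⟩ := exists_goodSol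
  obtain ⟨m, hm, G⟩ := exists_decSol
  have hC0 : 0 < C := by linarith
  have hK : 0 < 18 * C ^ 2 := by positivity
  obtain ⟨ε, hε, h1, h2⟩ : ∃ ε : ℝ, 0 < ε ∧ 216 * C ^ 2 * (18 * C ^ 2 * ε) ≤ 1 ∧
      18 * C ^ 2 * ε ≤ m := by
    -- The radius Kε, with K = 18C², is made equal to the smaller of the threshold for the fixed
    -- point argument and the threshold m for the propagation of decay.
    refine ⟨min (1 / (216 * C ^ 2)) m / (18 * C ^ 2), by positivity, ?_, ?_⟩
    · rw [mul_div_cancel₀ _ hK.ne', ← le_div_iff₀' (by positivity)]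
      exact min_le_left _ _
    · rw [mul_div_cancel₀ _ hK.ne']
      exact min_le_right _ _
  refine ⟨ε, hε, 18 * C ^ 2, hK, fun u₀ θ₀ hd => ?_⟩
  obtain ⟨u, θ, hg, hs, hu⟩ := H ε hε h1 u₀ θ₀ hd
  have hdec := G _ h2 (by positivity) u₀ θ₀ u θ hg
  have initial : ∀ {a b : ℝ}, DataDecay a b u₀ θ₀ → ∃ C > 0, ∀ᵐ x,
      |‖u 0 x‖| ≤ C * (1 + ‖x‖) ^ (-a) ∧ |θ 0 x| ≤ C * (1 + ‖x‖) ^ (-b) := by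
    rintro a b ⟨C, hC, h⟩
    refine ⟨C, hC, ?_⟩
    simpa only [abs_norm, hg.sol.zu, hg.sol.zθ] using h
  refine ⟨u, θ, hs, hu, fun a b ha ha3 hb hab => ?_, fun a b ha ha4 ha3 hb hab hz hi => ?_⟩
  · obtain ⟨du, dθ⟩ := hdec.decay ha ha3 hb hab
    obtain ⟨A, hA, h⟩ := exists_common_bound (by linarith) (by linarith) du dθ (initial hab)
    refine ⟨A, hA, fun t ht => ?_⟩
    filter_upwards [h t ht, Measure.ae_ne volume (0 : E3)] with x hx hx0
    rw [abs_norm] at hx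
    exact ⟨hx.1.trans (mul_le_mul_of_nonneg_left (iInf_one_add_le ht hx0) hA.le),
      hx.2.trans (mul_le_mul_of_nonneg_left (iInf_one_add_le ht hx0) hA.le)⟩
  · have hi' : Integrable (fun x => ‖x‖ * |θ₀ x|) := by
      obtain ⟨_, D⟩ := hg.data
      refine hi.mono (continuous_norm.aestronglyMeasurable.mul D.iθ.aestronglyMeasurable.norm)
        (ae_of_all _ fun x => ?_)
      rw [norm_mul, norm_mul, norm_norm, Real.norm_eq_abs |θ₀ x|, abs_abs, Real.norm_eq_abs (θ₀ x),
        Real.norm_of_nonneg (by positivity : 0 ≤ 1 + ‖x‖)]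
      exact mul_le_mul_of_nonneg_right (by linarith) (abs_nonneg _)
    obtain ⟨du, dθ⟩ := hdec.decay_of_mean_zero ha ha4 ha3 hb hab hz hi'
    obtain ⟨A, hA, h⟩ := exists_common_bound (by linarith) (by linarith) du dθ (initial hab)
    simp only [abs_norm] at h
    exact ⟨A, hA, h⟩
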